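/- Fix integers $N\ge 1$, $m\ge 0$ and $d_1,\dots,d_m\ge 0$. Let $B_N$ be the algebra over $\mathbb C[\gamma,\nu]$, $\gamma=(\gamma_{kj})_{1\le k\le m,\,1\le j\le d_k}$, generated by $Y_{i,k}$ ($1\le i\le N$, $1\le k\le m$) and the symmetric group $S_N$ with relations (for $i\ne j$, and $s_{ij}$ the transposition) $$s_{ij}Y_{i,k}=Y_{j,k}s_{ij},\quad s_{ij}Y_{h,k}=Y_{h,k}s_{ij}\ (h\ne i,j),\quad \prod_{j=1}^{d_k}(Y_{i,k}-\gamma_{kj})=0,\quad \sum_k Y_{i,k}=\nu\sum_{j\ne i}s_{ij},$$ $$[Y_{i,k},Y_{j,k}]=\nu(Y_{i,k}-Y_{j,k})s_{ij},\qquad [Y_{i,k},Y_{j,l}]=0\ (k\ne l).$$ Let $H_N$ be the algebra over $\mathbb C[u_{kj}^{\pm1},t^{\pm1}]$ generated by invertible $U_1,\dots,U_m,T_1,\dots,T_{N-1}$ with relations $$U_1\cdots U_m\,T_1\cdots T_{N-1}T_{N-1}\cdots T_1=1,\quad T_iT_{i+1}T_i=T_{i+1}T_iT_{i+1},\quad [T_i,T_j]=0\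 (|i-j|>1),\quad [U_j,T_i]=0\ (i\ge2),$$ $$[U_j,T_1U_jT_1]=0,\quad [U_k,T_1^{-1}U_jT_1]=0\ (k<j),\quad \prod_{j=1}^{d_k}(U_k-u_{kj})=0,\quad T_i-T_i^{-1}=t-t^{-1}.$$ 1. Let $\alpha_1,\dots,\alpha_m\in\mathbb C$ be distinct. The connection $\nabla$, with poles, on the trivial bundle over $(\mathbb{CP}^1)^N$ with fibre $B_N$ given by $\partial F/\partial z_i=A_iF$, $$A_i=\sum_k\frac{Y_{i,k}}{z_i-\alpha_k}-\sum_{p\ne i}\frac{\nu s_{ip}}{z_i-z_p},$$ extends holomorphically to the space $X$ of all $N$-tuples of distinct points of $\mathbb{CP}^1\setminus\{\alpha_1,\dots,\alpha_m\}$ (including configurations with a point at $\infty$) and is flat there. 2. Let $M$ be a $B_N$-module, finite dimensional over $\mathbb C$, and let $\mathbf z_0\in X$. For every path in $X$ starting at $\mathbf z_0$, every $v\in M$ is the initial value of a unique analytic continuation along the path of solutions of the equations $\partial F/\partial z_i=A_iF$ with values in $M$. There is a unique representation $\rho$ on $M$ of the braid group $Br_{N,m}=\pi_1(X/S_N,[\mathbf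 z_0])$ (in a product $\sigma\sigma'$ the loop $\sigma'$ is traced first) given by monodromy: if a loop lifts to a path in $X$ from $\mathbf z_0$ to $\sigma\mathbf z_0$, $\sigma\in S_N$, then $\rho$ of its class sends the initial value of a continuation along the path to $\sigma^{-1}$ applied to its final value. 3. Let $\alpha_p$ and $\mathbf z_0=(z_{01},\dots,z_{0N})$ be real with $\alpha_1<\dots<\alpha_m<z_{01}<\dots<z_{0N}$. Let $T_i\in Br_{N,m}$ be the class in which $z_i,z_{i+1}$ move counterclockwise to exchange positions, and $U_k\in Br_{N,m}$ the class in which $z_1$ moves counterclockwise around $\alpha_k$, passing $\alpha_{k+1},\dots,\alpha_m$ from below; the other points are fixed. Then the monodromy defines a functor $$\mathcal F:\mathrm{Rep}_f B_N\to\mathrm{Rep}_f H_N$$ between the categories of $B_N$-modules and $H_N$-modules that are finite dimensional over $\mathbb C$: $\mathcal F(M)$ is (naturally isomorphic to) the vector space $M$, $\mathcal F$ is the identity on underlying linear maps, the generators $T_i$ and $U_k$ of $H_N$ act by $\rho(T_i)$ and $\rho(U_k)$, and the parameters act by the operators $u_{kj}=e^{2\pi i\gamma_{kj}}$ and $t=e^{-\pi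 i\nu}$. In particular, the operators $\rho(T_i),\rho(U_k)$ satisfy the braid relations, the Hecke relations and the polynomial relations of $H_N$. -/

import Mathlib

open scoped ModuleCat

universe w

noncomputable section

namespace GDAHA

/-! ### The two algebras -/

/-- Index set of the parameters: `none` is the single parameter (`ν`, resp. `t`),
`some ⟨k, j⟩` is the parameter attached to the `j`-th vertex of the `k`-th leg
(`γ k j`, resp. `u k j`). -/
abbrev Param {m : ℕ} (d : Fin m → ℕ) : Type := Option (Σ k : Fin m, Fin (d k))

/-- The polynomial ring `ℂ[γ, ν]`. -/
abbrev PolyParam {m : ℕ} (d : Fin m → ℕ) : Type := MvPolynomial (Param d) ℂ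

/-- The Laurent polynomial ring `ℂ[u^{±1}, t^{±1}]`. -/
abbrev LaurentParam {m : ℕ} (d : Fin m → ℕ) : Type := AddMonoidAlgebra ℂ (Param d →₀ ℤ)

/-- Generators of the rational algebra: the `Y i k` and the elements of the symmetric group. -/
inductive BGen (n m : ℕ) : Type
  | Y (i : Fin n) (k : Fin m) : BGen n m
  | perm (σ : Equiv.Perm (Fin n)) : BGen n m

/-- The free `ℂ[γ, ν]`-algebra on the generators of the rational algebra. -/
abbrev BFree (n : ℕ) {m : ℕ} (d : Fin m → ℕ) : Type := FreeAlgebra (PolyParam d) (BGen n m)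

namespace BFree

variable {n m : ℕ} {d : Fin m → ℕ}

def Y (d : Fin m → ℕ) (i : Fin n) (k : Fin m) : BFree n d :=
  FreeAlgebra.ι (PolyParam d) (BGen.Y i k)

def perm (d : Fin m → ℕ) (σ : Equiv.Perm (Fin n)) : BFree n d :=
  FreeAlgebra.ι (PolyParam d) (BGen.perm σ)

/-- The transposition `s_{ij}`. -/
def s (d : Fin m → ℕ) (i j : Fin n) : BFree n d := perm d (Equiv.swap i j)

def gam (n : ℕ) (d : Fin m → ℕ) (k : Fin m) (j : Fin (d k)) : BFree n d :=
  algebraMap (PolyParam d) (BFree n d) (MvPolynomial.X (some ⟨k, j⟩))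

def nu (n : ℕ) (d : Fin m → ℕ) : BFree n d :=
  algebraMap (PolyParam d) (BFree n d) (MvPolynomial.X none)

end BFree

open BFree in
/-- The defining relations of the rational generalized double affine Hecke algebra. -/
inductive BRel (n : ℕ) {m : ℕ} (d : Fin m → ℕ) : BFree n d → BFree n d → Prop
  | perm_one : BRel n d (perm d 1) 1
  | perm_mul (σ τ : Equiv.Perm (Fin n)) : BRel n d (perm d (σ * τ)) (perm d σ * perm d τ)
  | swap_Y (i j : Fin n) (k : Fin m) (hij : i ≠ j) :
      BRel n d (s d i j * Y d i k) (Y d j k * s d i j)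
  | swap_Y_of_ne (i j h : Fin n) (k : Fin m) (hij : i ≠ j) (hi : h ≠ i) (hj : h ≠ j) :
      BRel n d (s d i j * Y d h k) (Y d h k * s d i j)
  | poly (i : Fin n) (k : Fin m) :
      BRel n d (List.ofFn fun j : Fin (d k) => Y d i k - gam n d k j).prod 0
  | sum_Y (i : Fin n) :
      BRel n d (∑ k : Fin m, Y d i k) (nu n d * ∑ j ∈ Finset.univ.erase i, s d i j)
  | comm_Y (i j : Fin n) (k : Fin m) (hij : i ≠ j) :
      BRel n d (Y d i k * Y d j k - Y d j k * Y d i k)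
        (nu n d * (Y d i k - Y d j k) * s d i j)
  | comm_Y_of_ne (i j : Fin n) (k l : Fin m) (hij : i ≠ j) (hkl : k ≠ l) :
      BRel n d (Y d i k * Y d j l) (Y d j l * Y d i k)

/-- The rational (degenerate) generalized double affine Hecke algebra `B_n`, an algebra over
`ℂ[γ, ν]` (and hence over `ℂ`). -/
abbrev B (n : ℕ) {m : ℕ} (d : Fin m → ℕ) : Type := RingQuot (BRel n d)

namespace B

variable {n m : ℕ} {d : Fin m → ℕ}

/-- The projection of the free algebra onto `B_n`. -/
def proj (n : ℕ) (d : Fin m → ℕ) : BFree n d →ₐ[PolyParam d] B n d :=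
  RingQuot.mkAlgHom (PolyParam d) (BRel n d)

def Y (d : Fin m → ℕ) (i : Fin n) (k : Fin m) : B n d := proj n d (BFree.Y d i k)

def perm (d : Fin m → ℕ) (σ : Equiv.Perm (Fin n)) : B n d := proj n d (BFree.perm d σ)

/-- The transposition `s_{ij}`. -/
def s (d : Fin m → ℕ) (i j : Fin n) : B n d := perm d (Equiv.swap i j)

/-- The central element `γ_{kj}`. -/
def gam (n : ℕ) (d : Fin m → ℕ) (k : Fin m) (j : Fin (d k)) : B n d :=
  algebraMap (PolyParam d) (B n d) (MvPolynomial.X (some ⟨k, j⟩))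

/-- The central element `ν`. -/
def nu (n : ℕ) (d : Fin m → ℕ) : B n d :=
  algebraMap (PolyParam d) (B n d) (MvPolynomial.X none)

end B

/-- Generators of the generalized double affine Hecke algebra of rank `n + 1`:
`U 1, …, U m`, `T 1, …, T n` and their inverses. -/
inductive HGen (n m : ℕ) : Type
  | U (k : Fin m) : HGen n m
  | Uinv (k : Fin m) : HGen n m
  | T (i : Fin n) : HGen n m
  | Tinv (i : Fin n) : HGen n m

/-- The free `ℂ[u^{±1}, t^{±1}]`-algebra on these generators. -/
abbrev HFree (n : ℕ) {m : ℕ} (d : Fin m → ℕ) : Type := FreeAlgebra (LaurentParam d) (HGen n m)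

namespace HFree

variable {n m : ℕ}

def U (n : ℕ) (d : Fin m → ℕ) (k : Fin m) : HFree n d := FreeAlgebra.ι (LaurentParam d) (HGen.U k)

def Uinv (n : ℕ) (d : Fin m → ℕ) (k : Fin m) : HFree n d :=
  FreeAlgebra.ι (LaurentParam d) (HGen.Uinv k)

def T (d : Fin m → ℕ) (i : Fin n) : HFree n d := FreeAlgebra.ι (LaurentParam d) (HGen.T i)

def Tinv (d : Fin m → ℕ) (i : Fin n) : HFree n d := FreeAlgebra.ι (LaurentParam d) (HGen.Tinv i)

/-- The Laurent monomial `x_p ^ e` as an element of the free algebra. -/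
def par (n : ℕ) (d : Fin m → ℕ) (p : Param d) (e : ℤ) : HFree n d :=
  algebraMap (LaurentParam d) (HFree n d) (AddMonoidAlgebra.single (Finsupp.single p e) 1)

end HFree

open HFree in
/-- The defining relations of the generalized double affine Hecke algebra of rank `n + 1`.
The generator `T_i` of the literature is `T` at the index `i - 1`. -/
inductive HRel (n : ℕ) {m : ℕ} (d : Fin m → ℕ) : HFree n d → HFree n d → Prop
  | U_mul_inv (k : Fin m) : HRel n d (U n d k * Uinv n d k) 1
  | U_inv_mul (k : Fin m) : HRel n d (Uinv n d k * U n d k) 1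
  | T_mul_inv (i : Fin n) : HRel n d (T d i * Tinv d i) 1
  | T_inv_mul (i : Fin n) : HRel n d (Tinv d i * T d i) 1
  /-- `(U_1 ⋯ U_m) (T_1 ⋯ T_n T_n ⋯ T_1) = 1` -/
  | total : HRel n d
      ((List.ofFn fun k : Fin m => U n d k).prod *
        ((List.ofFn fun i : Fin n => T d i).prod *
          (List.ofFn fun i : Fin n => T d i).reverse.prod)) 1
  | braid (i j : Fin n) (hij : i.val + 1 = j.val) :
      HRel n d (T d i * T d j * T d i) (T d j * T d i * T d j)
  | comm_T (i j : Fin n) (hij : i.val + 1 < j.val) : HRel n d (T d i * T d j) (T d j * T d i)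
  | comm_U_T (k : Fin m) (i : Fin n) (hi : 1 ≤ i.val) :
      HRel n d (U n d k * T d i) (T d i * U n d k)
  | comm_U_TUT (k : Fin m) (i : Fin n) (hi : i.val = 0) :
      HRel n d (U n d k * (T d i * U n d k * T d i)) ((T d i * U n d k * T d i) * U n d k)
  | comm_U_TinvUT (k j : Fin m) (i : Fin n) (hi : i.val = 0) (hkj : k < j) :
      HRel n d (U n d k * (Tinv d i * U n d j * T d i)) ((Tinv d i * U n d j * T d i) * U n d k)
  | poly (k : Fin m) :
      HRel n d (List.ofFn fun j : Fin (d k) => U n d k - par n d (some ⟨k, j⟩) 1).prod 0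
  | hecke (i : Fin n) :
      HRel n d (T d i - Tinv d i) (par n d none 1 - par n d none (-1))

/-- The generalized double affine Hecke algebra of rank `n + 1`, an algebra over
`ℂ[u^{±1}, t^{±1}]` (and hence over `ℂ`). -/
abbrev H (n : ℕ) {m : ℕ} (d : Fin m → ℕ) : Type := RingQuot (HRel n d)

namespace H

variable {n m : ℕ}

/-- The projection of the free algebra onto the quotient. -/
def proj (n : ℕ) (d : Fin m → ℕ) : HFree n d →ₐ[LaurentParam d] H n d :=
  RingQuot.mkAlgHom (LaurentParam d) (HRel n d)

def U (n : ℕ) (d : Fin m → ℕ) (k : Fin m) : H n d := proj n d (HFree.U n d k)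

def T (d : Fin m → ℕ) (i : Fin n) : H n d := proj n d (HFree.T d i)

/-- The central element `u_{kj}`. -/
def u (n : ℕ) (d : Fin m → ℕ) (k : Fin m) (j : Fin (d k)) : H n d :=
  proj n d (HFree.par n d (some ⟨k, j⟩) 1)

/-- The central element `t`. -/
def t (n : ℕ) (d : Fin m → ℕ) : H n d := proj n d (HFree.par n d none 1)

end H

/-- The category of `A`-modules that are finite dimensional over `ℂ`. -/
abbrev RepF (A : Type) [Ring A] [Algebra ℂ A] : Type _ :=
  CategoryTheory.ObjectProperty.FullSubcategory
    (fun M : ModuleCat.{w} A => FiniteDimensional ℂ M)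

/-! ### Derivatives and exponentials in complex vector spaces without a topology -/

/-- `f` has derivative `v` at `x`, tested on all linear functionals. For a function whose values
lie in a fixed finite dimensional subspace this is the usual complex derivative. -/
def HasWeakDerivAt {V : Type*} [AddCommGroup V] [Module ℂ V] (f : ℂ → V) (v : V) (x : ℂ) : Prop :=
  ∀ φ : Module.Dual ℂ V, HasDerivAt (fun y => φ (f y)) (φ v) x

/-- `w = exp(c b) v`, where `b` acts on the (finite dimensional) module `M`; the convergence of
the exponential series is tested on all linear functionals. -/
def IsExpSMul {A : Type*} [Ring A] {M : Type*} [AddCommGroup M] [Module ℂ M] [Module A M]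
    (c : ℂ) (b : A) (v w : M) : Prop :=
  ∀ φ : Module.Dual ℂ M,
    HasSum (fun r : ℕ => (r.factorial : ℂ)⁻¹ * c ^ r * φ (b ^ r • v)) (φ w)

/-! ### Configurations on the Riemann sphere -/

/-- Ordered configurations of `n` distinct points on `ℂℙ¹ = ℂ ∪ {∞}` avoiding the points `α k`. -/
def configSet {m : ℕ} (α : Fin m → ℂ) (n : ℕ) : Set (Fin n → OnePoint ℂ) :=
  {ζ | Function.Injective ζ ∧ ∀ i k, ζ i ≠ (α k : OnePoint ℂ)}

/-- The ordered configuration space. -/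
abbrev Config {m : ℕ} (α : Fin m → ℂ) (n : ℕ) : Type := configSet α n

/-- The symmetric group permutes the points: `(σ • ζ) (σ i) = ζ i`. -/
instance {m : ℕ} (α : Fin m → ℂ) (n : ℕ) : MulAction (Equiv.Perm (Fin n)) (Config α n) where
  smul σ ζ := ⟨fun i => ζ.1 (σ⁻¹ i), ζ.2.1.comp (σ⁻¹).injective, fun _ k => ζ.2.2 _ k⟩
  one_smul _ := rfl
  mul_smul _ _ _ := rfl

/-- The unordered configuration space, with the quotient topology. -/
abbrev UConfig {m : ℕ} (α : Fin m → ℂ) (n : ℕ) : Type :=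
  MulAction.orbitRel.Quotient (Equiv.Perm (Fin n)) (Config α n)

/-- The unordered configuration underlying an ordered one. -/
def toUConfig {m : ℕ} (α : Fin m → ℂ) (n : ℕ) : C(Config α n, UConfig α n) :=
  ⟨Quotient.mk _, continuous_quotient_mk'⟩

/-- The braid group of `n` points on `ℂℙ¹ ∖ {α k}`, with base point the configuration
underlying `x`. In Mathlib's convention the product `g * h` traces `h` first and then `g`. -/
abbrev BraidGroup {m : ℕ} (α : Fin m → ℂ) {n : ℕ} (x : Config α n) : Type :=
  FundamentalGroup (UConfig α n) (toUConfig α n x)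

/-- The class of the loop of unordered configurations given by a path of ordered configurations
whose end points agree up to the order of the points. -/
def braidClass {m : ℕ} {α : Fin m → ℂ} {n : ℕ} {x y : Config α n} (p : Path x y)
    (h : ∃ σ : Equiv.Perm (Fin n), y = σ • x) : BraidGroup α x :=
  FundamentalGroup.fromPath (Path.Homotopic.Quotient.mk
    ((p.map (toUConfig α n).continuous).cast rfl (by
      obtain ⟨σ, rfl⟩ := h
      exact (Quotient.sound (MulAction.orbitRel_apply.mpr ⟨σ, rfl⟩)).symm)))

/-- The point of `ℂℙ¹` with affine coordinate `x` in the chart `z` (`b = false`) or in the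
chart `1 / z` (`b = true`). -/
def toSphere (b : Bool) (x : ℂ) : OnePoint ℂ :=
  if b then (if x = 0 then OnePoint.infty else ((x⁻¹ : ℂ) : OnePoint ℂ)) else (x : OnePoint ℂ)

/-- The coordinate charts of `(ℂℙ¹)^n` indexed by `ε : Fin n → Bool`. -/
def chart {n : ℕ} (ε : Fin n → Bool) (x : Fin n → ℂ) : Fin n → OnePoint ℂ :=
  fun i => toSphere (ε i) (x i)

/-- Homogeneous coordinates of `toSphere b x`. -/
def homog (b : Bool) (x : ℂ) : ℂ × ℂ := if b then (1, x) else (x, 1)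

/-- With `(a : c)` the homogeneous coordinates of the point with coordinate `x` in the chart `b`
and `v = (a' : c')` a second point, the coefficient of the logarithmic differential
`d log (a c' - a' c)` with respect to `dx`, for fixed `v`. For `b = false` and `v = (α, 1)`
this is `1 / (x - α)`. -/
def dlogCoeff (b : Bool) (x : ℂ) (v : ℂ × ℂ) : ℂ :=
  if b then -v.1 / (v.2 - v.1 * x) else v.2 / (x * v.2 - v.1)

/-! ### The Knizhnik-Zamolodchikov connection -/

/-- The Knizhnik-Zamolodchikov coefficients
`A_i = ∑_k Y_{ik} / (z_i - α_k) - ∑_{p ≠ i} ν s_{ip} / (z_i - z_p)` on the affine part. -/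
def kzAffine {m : ℕ} (d : Fin m → ℕ) (α : Fin m → ℂ) {n : ℕ} (z : Fin n → ℂ) (i : Fin n) :
    B n d :=
  ∑ k : Fin m, (z i - α k)⁻¹ • B.Y d i k
    - ∑ p ∈ Finset.univ.erase i, (z i - z p)⁻¹ • (B.nu n d * B.s d i p)

/-- The coefficient of `dx_i` of the connection form in the chart `ε` of `(ℂℙ¹)^n`. -/
def kzCoeff {m : ℕ} (d : Fin m → ℕ) (α : Fin m → ℂ) {n : ℕ} (ε : Fin n → Bool) (x : Fin n → ℂ)
    (i : Fin n) : B n d :=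
  ∑ k : Fin m, dlogCoeff (ε i) (x i) (α k, 1) • B.Y d i k
    - ∑ p ∈ Finset.univ.erase i,
        dlogCoeff (ε i) (x i) (homog (ε p) (x p)) • (B.nu n d * B.s d i p)

/-- In every chart, the form `∑ kzCoeff i dx_i` is the form `∑ A_i dz_i` wherever all points are
finite: the latter extends to all configurations on the sphere. -/
def KZExtends {m : ℕ} (d : Fin m → ℕ) (α : Fin m → ℂ) (n : ℕ) : Prop :=
  ∀ (ε : Fin n → Bool) (x : Fin n → ℂ), chart ε x ∈ configSet α n →
    (∀ i, ε i = true → x i ≠ 0) → ∀ i,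
      kzCoeff d α ε x i =
        (if ε i then -(x i ^ 2)⁻¹ else (1 : ℂ)) •
          kzAffine d α (fun p => if ε p then (x p)⁻¹ else x p) i

/-- The curvature of the connection `∇_i = ∂_i - A_i` with coefficients in `B_n` vanishes
in all charts. -/
def KZFlat {m : ℕ} (d : Fin m → ℕ) (α : Fin m → ℂ) (n : ℕ) : Prop :=
  ∀ (ε : Fin n → Bool) (x : Fin n → ℂ), chart ε x ∈ configSet α n → ∀ i j : Fin n,
    ∃ a b : B n d,
      HasWeakDerivAt (fun y => kzCoeff d α ε (Function.update x i y) j) a (x i) ∧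
      HasWeakDerivAt (fun y => kzCoeff d α ε (Function.update x j y) i) b (x j) ∧
      a - b - (kzCoeff d α ε x i * kzCoeff d α ε x j - kzCoeff d α ε x j * kzCoeff d α ε x i) = 0

section Monodromy

variable {n m : ℕ} {d : Fin m → ℕ} {M : Type*} [AddCommGroup M] [Module ℂ M] [Module (B n d) M]

/-- `F` is a solution of the equations `∂F/∂x_i = A_i F` on the open set `V`. -/
structure IsKZSolution (d : Fin m → ℕ) [Module (B n d) M] (α : Fin m → ℂ)
    (V : Set (Fin n → OnePoint ℂ)) (F : (Fin n → OnePoint ℂ) → M) : Prop where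
  isOpen : IsOpen V
  subset : V ⊆ configSet α n
  deriv : ∀ (ε : Fin n → Bool) (x : Fin n → ℂ), chart ε x ∈ V → ∀ i,
    HasWeakDerivAt (fun y => F (chart ε (Function.update x i y)))
      (kzCoeff d α ε x i • F (chart ε x)) (x i)

/-- `f` is the family of values of an analytic continuation of a solution along the path `p`:
locally, `f t` is the value at `p t` of a single solution. -/
def IsKZContinuation (d : Fin m → ℕ) [Module (B n d) M] {α : Fin m → ℂ} {x y : Config α n}
    (p : Path x y) (f : unitInterval → M) : Prop :=
  ∀ t₀ : unitInterval, ∃ (V : Set (Fin n → OnePoint ℂ)) (F : (Fin n → OnePoint ℂ) → M),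
    IsKZSolution d α V F ∧ (p t₀).1 ∈ V ∧ ∀ᶠ t in nhds t₀, f t = F (p t).1

/-- `ρ` is the monodromy representation of the connection on the quotient of the trivial bundle
with fibre `M` by the diagonal action of the symmetric group: if the loop of unordered
configurations lifts to a path from `x` to `σ • x`, continue along the path and identify the fibre
at `σ • x` with the fibre at `x` through the action of `σ`. -/
def IsKZMonodromy (d : Fin m → ℕ) [Module (B n d) M] {α : Fin m → ℂ} (x : Config α n)
    (ρ : BraidGroup α x →* (M ≃ₗ[ℂ] M)) : Prop :=
  ∀ (σ : Equiv.Perm (Fin n)) (p : Path x (σ • x)) (f : unitInterval → M),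
    IsKZContinuation d p f → ρ (braidClass p ⟨σ, rfl⟩) (f 0) = B.perm d σ⁻¹ • f 1

end Monodromy

/-! ### The standard generators of the braid group -/

/-- Real positions `α_1 < ⋯ < α_m < z_1 < ⋯ < z_{n+1}`. -/
structure RealPosition (n m : ℕ) where
  α : Fin m → ℝ
  z : Fin (n + 1) → ℝ
  α_mono : StrictMono α
  z_mono : StrictMono z
  lt : ∀ k j, α k < z j

/-- The counterclockwise half circle with diameter from `x` to `y`. -/
def halfTurn (x y : ℝ) (t : ℝ) : ℂ :=
  ((x + y) / 2 : ℝ) + ((x - y) / 2 : ℝ) * Complex.exp ((Real.pi * t : ℝ) * Complex.I)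

theorem halfTurn_zero (x y : ℝ) : halfTurn x y 0 = x := by
  simp only [halfTurn, mul_zero, Complex.ofReal_zero, zero_mul, Complex.exp_zero, mul_one]
  push_cast; ring

theorem halfTurn_one (x y : ℝ) : halfTurn x y 1 = y := by
  simp only [halfTurn, mul_one, Complex.exp_pi_mul_I]
  push_cast; ring

theorem continuous_halfTurn (x y : ℝ) : Continuous (halfTurn x y) := by
  unfold halfTurn; fun_prop

theorem halfTurn_eq_real {x y t : ℝ} (h0 : 0 ≤ t) (h1 : t ≤ 1) {q : ℝ}
    (h : halfTurn x y t = q) : q = x ∨ q = y := by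
  have him := congrArg Complex.im h
  simp only [halfTurn, Complex.exp_mul_I, ← Complex.ofReal_cos, ← Complex.ofReal_sin,
    Complex.add_im, Complex.ofReal_im, Complex.mul_im, Complex.ofReal_re, Complex.I_im,
    Complex.I_re] at him
  rcases eq_or_lt_of_le h0 with rfl | h0'
  · left; rw [halfTurn_zero] at h; exact_mod_cast h.symm
  rcases eq_or_lt_of_le h1 with rfl | h1'
  · right; rw [halfTurn_one] at h; exact_mod_cast h.symm
  have hs : 0 < Real.sin (Real.pi * t) :=
    Real.sin_pos_of_pos_of_lt_pi (by positivity) (by nlinarith [Real.pi_pos])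
  have hxy : x = y := by
    have : (x - y) / 2 * Real.sin (Real.pi * t) = 0 := by linarith
    rcases mul_eq_zero.mp this with h' | h'
    · linarith
    · exact absurd h' hs.ne'
  subst hxy
  left
  simp only [halfTurn, sub_self, zero_div, Complex.ofReal_zero, zero_mul, add_zero] at h
  have := Complex.ofReal_injective h
  linarith

namespace RealPosition

variable {n m : ℕ} (P : RealPosition n m)

/-- The points `α_k` as complex numbers. -/
def cα : Fin m → ℂ := fun k => P.α k

theorem cα_injective : Function.Injective P.cα := fun _ _ h =>
  P.α_mono.injective (Complex.ofReal_injective h)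

/-- The configuration of finite points `w`. -/
def ofFinite (w : Fin (n + 1) → ℂ) (h : Function.Injective w) (h' : ∀ i k, w i ≠ P.α k) :
    Config P.cα (n + 1) :=
  ⟨fun i => (w i : OnePoint ℂ), fun _ _ e => h (OnePoint.coe_injective e),
    fun i k e => h' i k (OnePoint.coe_injective e)⟩

/-- The base point `(z_1, …, z_{n+1})`. -/
def base : Config P.cα (n + 1) :=
  P.ofFinite (fun i => (P.z i : ℂ))
    (fun _ _ h => P.z_mono.injective (Complex.ofReal_injective h))
    (fun i k h => (P.lt k i).ne' (Complex.ofReal_injective h))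

/-- `z_{i+1}` and `z_i` move counterclockwise to exchange positions. -/
def exchange (i : Fin n) (t : ℝ) : Fin (n + 1) → ℂ := fun j =>
  if j = i.castSucc then halfTurn (P.z i.castSucc) (P.z i.succ) t
  else if j = i.succ then halfTurn (P.z i.succ) (P.z i.castSucc) t
  else P.z j

theorem exchange_injective (i : Fin n) (t : unitInterval) :
    Function.Injective (P.exchange i t) := by
  have hne : i.castSucc ≠ i.succ := (Fin.castSucc_lt_succ).ne
  have hz : P.z i.castSucc ≠ P.z i.succ := fun h => hne (P.z_mono.injective h)
  have h1 : ∀ j, j ≠ i.castSucc → j ≠ i.succ →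
      halfTurn (P.z i.castSucc) (P.z i.succ) t ≠ P.z j := by
    intro j ha hb h
    rcases halfTurn_eq_real t.2.1 t.2.2 h with h | h
    · exact ha (P.z_mono.injective h)
    · exact hb (P.z_mono.injective h)
  have h2 : ∀ j, j ≠ i.castSucc → j ≠ i.succ →
      halfTurn (P.z i.succ) (P.z i.castSucc) t ≠ P.z j := by
    intro j ha hb h
    rcases halfTurn_eq_real t.2.1 t.2.2 h with h | h
    · exact hb (P.z_mono.injective h)
    · exact ha (P.z_mono.injective h)
  have h3 : halfTurn (P.z i.castSucc) (P.z i.succ) t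
      ≠ halfTurn (P.z i.succ) (P.z i.castSucc) t := by
    intro h
    have h' : ((P.z i.castSucc : ℂ) - P.z i.succ) *
        Complex.exp ((Real.pi * (t : ℝ) : ℝ) * Complex.I) = 0 := by
      unfold halfTurn at h
      push_cast at h ⊢
      linear_combination h
    rcases mul_eq_zero.mp h' with h' | h'
    · exact hz (Complex.ofReal_injective (sub_eq_zero.mp h'))
    · exact Complex.exp_ne_zero _ h'
  intro a b hab
  unfold exchange at hab
  split_ifs at hab with ha hb hb' ha' hb hb' hb hb'
  · rw [ha, hb]
  · exact absurd hab h3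
  · exact absurd hab (h1 b hb hb')
  · exact absurd hab.symm h3
  · rw [ha', hb']
  · exact absurd hab (h2 b hb hb')
  · exact absurd hab.symm (h1 a ha ha')
  · exact absurd hab.symm (h2 a ha ha')
  · exact P.z_mono.injective (Complex.ofReal_injective hab)

theorem exchange_ne (i : Fin n) (t : unitInterval) (j : Fin (n + 1)) (k : Fin m) :
    P.exchange i t j ≠ P.α k := by
  intro h
  unfold exchange at h
  split_ifs at h with h1 h2
  · rcases halfTurn_eq_real t.2.1 t.2.2 h with h | h <;> exact (P.lt k _).ne h
  · rcases halfTurn_eq_real t.2.1 t.2.2 h with h | h <;> exact (P.lt k _).ne h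
  · exact (P.lt k j).ne' (Complex.ofReal_injective h)

/-- The path in which the points number `i` and `i + 1` move counterclockwise to exchange
positions, the other points being fixed. -/
def pathT (i : Fin n) : Path P.base (Equiv.swap i.castSucc i.succ • P.base) where
  toFun t := P.ofFinite (P.exchange i t) (P.exchange_injective i t) (P.exchange_ne i t)
  continuous_toFun := by
    refine Continuous.subtype_mk (continuous_pi fun j => ?_) _
    refine OnePoint.continuous_coe.comp ?_
    unfold exchange
    split_ifs
    · exact (continuous_halfTurn _ _).comp continuous_subtype_val
    · exact (continuous_halfTurn _ _).comp continuous_subtype_val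
    · exact continuous_const
  source' := by
    apply Subtype.ext
    funext j
    change ((P.exchange i 0 j : ℂ) : OnePoint ℂ) = ((P.z j : ℂ) : OnePoint ℂ)
    unfold exchange
    split_ifs with h1 h2
    · rw [halfTurn_zero, h1]
    · rw [halfTurn_zero, h2]
    · rfl
  target' := by
    apply Subtype.ext
    funext j
    change ((P.exchange i 1 j : ℂ) : OnePoint ℂ)
      = ((P.z ((Equiv.swap i.castSucc i.succ)⁻¹ j) : ℂ) : OnePoint ℂ)
    rw [Equiv.swap_inv]
    unfold exchange
    split_ifs with h1 h2
    · rw [halfTurn_one, h1, Equiv.swap_apply_left]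
    · rw [halfTurn_one, h2, Equiv.swap_apply_right]
    · rw [Equiv.swap_apply_of_ne_of_ne h1 h2]

/-- The real number `x` is a possible position of the first point. -/
def Free (x : ℝ) : Prop := (∀ k, x ≠ P.α k) ∧ ∀ j, j ≠ 0 → x ≠ P.z j

theorem update_injective (w : ℂ) (h : ∀ j, j ≠ 0 → w ≠ P.z j) :
    Function.Injective (Function.update (fun j => (P.z j : ℂ)) 0 w) := by
  intro a b hab
  by_cases ha : a = 0 <;> by_cases hb : b = 0
  · rw [ha, hb]
  · subst ha; rw [Function.update_self, Function.update_of_ne hb] at hab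
    exact absurd hab (h b hb)
  · subst hb; rw [Function.update_self, Function.update_of_ne ha] at hab
    exact absurd hab.symm (h a ha)
  · rw [Function.update_of_ne ha, Function.update_of_ne hb] at hab
    exact P.z_mono.injective (Complex.ofReal_injective hab)

theorem update_ne (w : ℂ) (h : ∀ k, w ≠ P.α k) (i : Fin (n + 1)) (k : Fin m) :
    Function.update (fun j => (P.z j : ℂ)) 0 w i ≠ P.α k := by
  by_cases hi : i = 0
  · subst hi; rw [Function.update_self]; exact h k
  · rw [Function.update_of_ne hi]
    exact fun e => (P.lt k i).ne' (Complex.ofReal_injective e)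

/-- The configuration obtained from the base point by moving the first point to `w`. -/
def withFirst (w : ℂ) (h : ∀ k, w ≠ P.α k) (h' : ∀ j, j ≠ 0 → w ≠ P.z j) :
    Config P.cα (n + 1) :=
  P.ofFinite (Function.update (fun j => (P.z j : ℂ)) 0 w) (P.update_injective w h')
    (P.update_ne w h)

/-- The configuration obtained from the base point by moving the first point to the real
number `x`. -/
def withFirstReal (x : ℝ) (h : P.Free x) : Config P.cα (n + 1) :=
  P.withFirst x (fun k e => h.1 k (Complex.ofReal_injective e))
    (fun j hj e => h.2 j hj (Complex.ofReal_injective e))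

/-- The first point moves along the counterclockwise half circle from `x` to `y`. -/
def pathFirst (x y : ℝ) (hx : P.Free x) (hy : P.Free y) :
    Path (P.withFirstReal x hx) (P.withFirstReal y hy) where
  toFun t := P.withFirst (halfTurn x y t)
    (fun k e => by
      rcases halfTurn_eq_real t.2.1 t.2.2 e with h | h
      · exact hx.1 k h.symm
      · exact hy.1 k h.symm)
    (fun j hj e => by
      rcases halfTurn_eq_real t.2.1 t.2.2 e with h | h
      · exact hx.2 j hj h.symm
      · exact hy.2 j hj h.symm)
  continuous_toFun := by
    refine Continuous.subtype_mk (continuous_pi fun j => ?_) _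
    refine OnePoint.continuous_coe.comp ?_
    have : Continuous fun t : unitInterval =>
        Function.update (fun j => (P.z j : ℂ)) 0 (halfTurn x y t) :=
      continuous_const.update 0 ((continuous_halfTurn x y).comp continuous_subtype_val)
    exact (continuous_apply j).comp this
  source' := by
    apply Subtype.ext
    funext j
    change ((Function.update (fun j => (P.z j : ℂ)) 0 (halfTurn x y 0) j : ℂ) : OnePoint ℂ) = _
    rw [halfTurn_zero]
    rfl
  target' := by
    apply Subtype.ext
    funext j
    change ((Function.update (fun j => (P.z j : ℂ)) 0 (halfTurn x y 1) j : ℂ) : OnePoint ℂ) = _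
    rw [halfTurn_one]
    rfl

/-- A real number between `α_{k-1}` and `α_k` (to the left of `α_1` if `k = 1`). -/
def left (k : Fin m) : ℝ :=
  ((if h : 0 < k.val then P.α ⟨k.val - 1, by omega⟩ else P.α k - 1) + P.α k) / 2

/-- A real number between `α_k` and `α_{k+1}` (between `α_m` and `z_1` if `k = m`). -/
def right (k : Fin m) : ℝ :=
  (P.α k + (if h : k.val + 1 < m then P.α ⟨k.val + 1, h⟩ else P.z 0)) / 2

theorem z_zero_le (j : Fin (n + 1)) : P.z 0 ≤ P.z j := P.z_mono.monotone (Fin.zero_le j)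

theorem free_base : P.Free (P.z 0) :=
  ⟨fun k => (P.lt k 0).ne', fun _ hj h => hj (P.z_mono.injective h).symm⟩

theorem free_left (k : Fin m) : P.Free (P.left k) := by
  have hlt : P.left k < P.α k := by
    unfold left
    split_ifs with h
    · have : P.α ⟨k.val - 1, by omega⟩ < P.α k := P.α_mono (by simp [Fin.lt_def]; omega)
      linarith
    · linarith
  refine ⟨fun l hl => ?_, fun j _ hj => ?_⟩
  · rcases lt_or_ge l k with hlk | hlk
    · have hk : 0 < k.val := lt_of_le_of_lt (Nat.zero_le _) (Fin.lt_def.mp hlk)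
      have h1 : P.α l ≤ P.α ⟨k.val - 1, by omega⟩ :=
        P.α_mono.monotone (by rw [Fin.le_def]; have := Fin.lt_def.mp hlk; simp; omega)
      have h2 : P.α ⟨k.val - 1, by omega⟩ < P.α k := P.α_mono (by simp [Fin.lt_def]; omega)
      have h3 : P.left k = (P.α ⟨k.val - 1, by omega⟩ + P.α k) / 2 := by
        unfold left; rw [dif_pos hk]
      linarith
    · have := P.α_mono.monotone hlk
      linarith
  · have := P.lt k j
    linarith

theorem free_right (k : Fin m) : P.Free (P.right k) := by
  have hlt : P.α k < P.right k ∧ P.right k < P.z 0 := by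
    unfold right
    split_ifs with h
    · have h1 : P.α k < P.α ⟨k.val + 1, h⟩ := P.α_mono (by simp [Fin.lt_def])
      have h2 := P.lt ⟨k.val + 1, h⟩ 0
      constructor <;> linarith
    · have h2 := P.lt k 0
      constructor <;> linarith
  refine ⟨fun l hl => ?_, fun j _ hj => ?_⟩
  · rcases le_or_gt l k with hlk | hlk
    · have := P.α_mono.monotone hlk
      linarith [hlt.1]
    · have hk : k.val + 1 < m := by have := Fin.lt_def.mp hlk; have := l.2; omega
      have h1 : P.α ⟨k.val + 1, hk⟩ ≤ P.α l :=
        P.α_mono.monotone (by rw [Fin.le_def]; have := Fin.lt_def.mp hlk; simp; omega)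
      have h2 : P.α k < P.α ⟨k.val + 1, hk⟩ := P.α_mono (by simp [Fin.lt_def])
      have h3 : P.right k = (P.α k + P.α ⟨k.val + 1, hk⟩) / 2 := by
        unfold right; rw [dif_pos hk]
      linarith
  · have := P.z_zero_le j
    linarith [hlt.2]

theorem base_eq : P.base = P.withFirstReal (P.z 0) P.free_base := by
  apply Subtype.ext
  funext j
  change ((P.z j : ℂ) : OnePoint ℂ)
    = ((Function.update (fun j => (P.z j : ℂ)) 0 (P.z 0 : ℂ) j : ℂ) : OnePoint ℂ)
  rw [Function.update_eq_self 0 (fun j => (P.z j : ℂ))]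

/-- The loop in which the first point moves counterclockwise around `α_k`, passing
`α_{k+1}, …, α_m` from below: below the real axis from `z_1` to a point between `α_k` and
`α_{k+1}`, above `α_k` to a point between `α_{k-1}` and `α_k`, and below the real axis back
to `z_1`. -/
def pathU (k : Fin m) : Path P.base P.base :=
  (((P.pathFirst (P.right k) (P.z 0) (P.free_right k) P.free_base).symm.trans
    (P.pathFirst (P.right k) (P.left k) (P.free_right k) (P.free_left k))).trans
    (P.pathFirst (P.left k) (P.z 0) (P.free_left k) P.free_base)).cast P.base_eq P.base_eq

/-- The element `T_i` of the braid group. -/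
def braidT (i : Fin n) : BraidGroup P.cα P.base :=
  braidClass (P.pathT i) ⟨_, rfl⟩

/-- The element `U_k` of the braid group. -/
def braidU (k : Fin m) : BraidGroup P.cα P.base :=
  braidClass (P.pathU k) ⟨1, (one_smul _ _).symm⟩

end RealPosition

end GDAHA

end

noncomputable section

namespace GDAHA

open Topology Filter Set Asymptotics

namespace B

variable {n m : ℕ} {d : Fin m → ℕ}

theorem proj_eq_of_rel {x y : BFree n d} (h : BRel n d x y) : proj n d x = proj n d y :=
  RingQuot.mkAlgHom_rel _ h

theorem perm_one : perm d (1 : Equiv.Perm (Fin n)) = 1 := by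
  simpa [perm] using proj_eq_of_rel (BRel.perm_one (n := n) (d := d))

theorem perm_mul (σ τ : Equiv.Perm (Fin n)) : perm d (σ * τ) = perm d σ * perm d τ := by
  simpa [perm] using proj_eq_of_rel (BRel.perm_mul (d := d) σ τ)

theorem perm_inv_mul (σ : Equiv.Perm (Fin n)) : perm d σ⁻¹ * perm d σ = 1 := by
  rw [← perm_mul, inv_mul_cancel, perm_one]

theorem perm_mul_inv (σ : Equiv.Perm (Fin n)) : perm d σ * perm d σ⁻¹ = 1 := by
  rw [← perm_mul, mul_inv_cancel, perm_one]

theorem s_mul_Y {i j : Fin n} (hij : i ≠ j) (k : Fin m) : s d i j * Y d i k = Y d j k * s d i j := by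
  simpa [s, perm, Y, BFree.s] using proj_eq_of_rel (BRel.swap_Y (d := d) i j k hij)

theorem s_comm (i j : Fin n) : s d i j = s d j i := by
  rw [s, s, Equiv.swap_comm]

theorem s_mul_Y' {i j : Fin n} (hij : i ≠ j) (k : Fin m) :
    s d i j * Y d j k = Y d i k * s d i j := by
  rw [s_comm]; exact s_mul_Y hij.symm k

theorem s_mul_Y_of_ne {i j h : Fin n} (hij : i ≠ j) (hi : h ≠ i) (hj : h ≠ j) (k : Fin m) :
    s d i j * Y d h k = Y d h k * s d i j := by
  simpa [s, perm, Y, BFree.s] using proj_eq_of_rel (BRel.swap_Y_of_ne (d := d) i j h k hij hi hj)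

theorem poly (i : Fin n) (k : Fin m) :
    (List.ofFn fun j : Fin (d k) => Y d i k - gam n d k j).prod = 0 := by
  have := proj_eq_of_rel (BRel.poly (d := d) i k)
  rw [map_list_prod, List.map_ofFn, map_zero] at this
  rw [← this]
  congr 2
  funext j
  rw [Function.comp_apply, map_sub]
  simp [Y, gam, BFree.gam]

theorem sum_Y (i : Fin n) : ∑ k : Fin m, Y d i k = nu n d * ∑ j ∈ Finset.univ.erase i, s d i j := by
  simpa only [s, perm, Y, BFree.s, nu, BFree.nu, map_sum, map_mul, AlgHom.commutes] using
    proj_eq_of_rel (BRel.sum_Y (d := d) i)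

theorem comm_Y {i j : Fin n} (hij : i ≠ j) (k : Fin m) :
    Y d i k * Y d j k - Y d j k * Y d i k = nu n d * (Y d i k - Y d j k) * s d i j := by
  simpa [s, perm, Y, BFree.s, nu, BFree.nu] using proj_eq_of_rel (BRel.comm_Y (d := d) i j k hij)

theorem comm_Y_of_ne {i j : Fin n} (hij : i ≠ j) {k l : Fin m} (hkl : k ≠ l) :
    Y d i k * Y d j l = Y d j l * Y d i k := by
  simpa [Y] using proj_eq_of_rel (BRel.comm_Y_of_ne (d := d) i j k l hij hkl)

theorem nu_comm (b : B n d) : nu n d * b = b * nu n d := Algebra.commutes _ _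

theorem gam_comm (k : Fin m) (j : Fin (d k)) (b : B n d) : gam n d k j * b = b * gam n d k j :=
  Algebra.commutes _ _

theorem s_mul_s (i j : Fin n) : s d i j * s d i j = 1 := by
  rw [s, ← perm_mul, Equiv.swap_mul_self, perm_one]

theorem perm_mul_Y (σ : Equiv.Perm (Fin n)) (i : Fin n) (k : Fin m) :
    perm d σ * Y d i k = Y d (σ i) k * perm d σ := by
  induction σ using Equiv.Perm.swap_induction_on generalizing i with
  | one => simp [perm_one]
  | swap_mul f x y hxy ih =>
    rw [perm_mul, mul_assoc, ih, ← mul_assoc, ← mul_assoc, Equiv.Perm.mul_apply]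
    congr 1
    change s d x y * _ = _ * s d x y
    by_cases h1 : f i = x
    · rw [h1, Equiv.swap_apply_left, s_mul_Y hxy]
    by_cases h2 : f i = y
    · rw [h2, Equiv.swap_apply_right, s_mul_Y' hxy]
    · rw [Equiv.swap_apply_of_ne_of_ne h1 h2, s_mul_Y_of_ne hxy h1 h2]

end B

/-! Bilinearity of the commutator of an associative algebra. -/

section Commutator

variable {R : Type*} [Ring R]

theorem commutator_add (x y z : R) : ⁅x, y + z⁆ = ⁅x, y⁆ + ⁅x, z⁆ := by
  simp only [Ring.lie_def]; noncomm_ring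

theorem add_commutator (x y z : R) : ⁅x + y, z⁆ = ⁅x, z⁆ + ⁅y, z⁆ := by
  simp only [Ring.lie_def]; noncomm_ring

theorem commutator_sub (x y z : R) : ⁅x, y - z⁆ = ⁅x, y⁆ - ⁅x, z⁆ := by
  simp only [Ring.lie_def]; noncomm_ring

theorem sub_commutator (x y z : R) : ⁅x - y, z⁆ = ⁅x, z⁆ - ⁅y, z⁆ := by
  simp only [Ring.lie_def]; noncomm_ring

theorem commutator_sum {ι : Type*} (t : Finset ι) (f : ι → R) (x : R) :
    ⁅x, ∑ i ∈ t, f i⁆ = ∑ i ∈ t, ⁅x, f i⁆ := by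
  simp only [Ring.lie_def, Finset.mul_sum, Finset.sum_mul, Finset.sum_sub_distrib]

theorem sum_commutator {ι : Type*} (t : Finset ι) (f : ι → R) (x : R) :
    ⁅∑ i ∈ t, f i, x⁆ = ∑ i ∈ t, ⁅f i, x⁆ := by
  simp only [Ring.lie_def, Finset.mul_sum, Finset.sum_mul, Finset.sum_sub_distrib]

theorem commutator_smul [Algebra ℂ R] (c : ℂ) (x y : R) : ⁅x, c • y⁆ = c • ⁅x, y⁆ := by
  simp only [Ring.lie_def, mul_smul_comm, smul_mul_assoc, smul_sub]

theorem smul_commutator [Algebra ℂ R] (c : ℂ) (x y : R) : ⁅c • x, y⁆ = c • ⁅x, y⁆ := by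
  simp only [Ring.lie_def, mul_smul_comm, smul_mul_assoc, smul_sub]

theorem commutator_self (x : R) : ⁅x, x⁆ = 0 := by rw [Ring.lie_def, sub_self]

end Commutator

/-- Elements of an algebra satisfying the homogeneous relations of the rational algebra. -/
structure KZData (R : Type*) [Ring R] [Algebra ℂ R] (n m : ℕ) where
  perm : Equiv.Perm (Fin n) →* R
  Y : Fin n → Fin m → R
  nu : R
  nu_comm : ∀ x, nu * x = x * nu
  perm_mul_Y : ∀ σ i k, perm σ * Y i k = Y (σ i) k * perm σ
  sum_Y : ∀ i, ∑ k : Fin m, Y i k = nu * ∑ j ∈ Finset.univ.erase i, perm (Equiv.swap i j)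
  comm_Y : ∀ {i j}, i ≠ j → ∀ k,
    Y i k * Y j k - Y j k * Y i k = nu * (Y i k - Y j k) * perm (Equiv.swap i j)
  comm_Y_of_ne : ∀ {i j}, i ≠ j → ∀ {k l}, k ≠ l → Y i k * Y j l = Y j l * Y i k

namespace KZData

variable {R : Type*} [Ring R] [Algebra ℂ R] {n m : ℕ} (D : KZData R n m)

/-- The transposition `s_{ij}`. -/
def s (i j : Fin n) : R := D.perm (Equiv.swap i j)

theorem sum_Y' (i : Fin n) : ∑ k : Fin m, D.Y i k = D.nu * ∑ j ∈ Finset.univ.erase i, D.s i j :=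
  D.sum_Y i

theorem s_comm (i j : Fin n) : D.s i j = D.s j i := by
  rw [s, s, Equiv.swap_comm]

theorem s_mul_Y (i j : Fin n) (k : Fin m) : D.s i j * D.Y i k = D.Y j k * D.s i j := by
  rw [s, D.perm_mul_Y, Equiv.swap_apply_left]

theorem s_mul_Y' (i j : Fin n) (k : Fin m) : D.s i j * D.Y j k = D.Y i k * D.s i j := by
  rw [s_comm]; exact D.s_mul_Y _ _ k

theorem s_mul_Y_of_ne {i j h : Fin n} (hi : h ≠ i) (hj : h ≠ j) (k : Fin m) :
    D.s i j * D.Y h k = D.Y h k * D.s i j := by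
  rw [s, D.perm_mul_Y, Equiv.swap_apply_of_ne_of_ne hi hj]

theorem perm_mul_s (σ : Equiv.Perm (Fin n)) (i j : Fin n) :
    D.perm σ * D.s i j = D.s (σ i) (σ j) * D.perm σ := by
  rw [s, s, ← map_mul, ← map_mul, Equiv.mul_swap_eq_swap_mul]

/-- The cyclic relation between products of two transpositions among `i, j, p`. -/
theorem s_mul_s_cycle {i j p : Fin n} (hij : i ≠ j) (hp : p ≠ i) (hp' : p ≠ j) :
    D.s i j * D.s i p = D.s i p * D.s j p ∧ D.s j p * D.s i j = D.s i p * D.s j p ∧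
    D.s i p * D.s i j = D.s j p * D.s i p ∧ D.s i j * D.s j p = D.s j p * D.s i p := by
  refine ⟨?_, ?_, ?_, ?_⟩
  · have := D.perm_mul_s (Equiv.swap i p) j p
    rw [Equiv.swap_apply_of_ne_of_ne hij.symm hp'.symm, Equiv.swap_apply_right] at this
    rw [D.s_comm i j]; exact this.symm
  · have := D.perm_mul_s (Equiv.swap j p) i j
    rw [Equiv.swap_apply_of_ne_of_ne hij hp.symm, Equiv.swap_apply_left] at this
    exact this
  · have := D.perm_mul_s (Equiv.swap i p) i j
    rw [Equiv.swap_apply_left, Equiv.swap_apply_of_ne_of_ne hij.symm hp'.symm] at this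
    rw [D.s_comm j p]; exact this
  · have := D.perm_mul_s (Equiv.swap j p) i p
    rw [Equiv.swap_apply_of_ne_of_ne hij hp.symm, Equiv.swap_apply_right] at this
    exact this.symm

theorem s_lie_s {i j p : Fin n} (hij : i ≠ j) (hp : p ≠ i) (hp' : p ≠ j) :
    ⁅D.s i p, D.s i j⁆ = D.s j p * D.s i p - D.s i p * D.s j p ∧
    ⁅D.s i j, D.s j p⁆ = D.s j p * D.s i p - D.s i p * D.s j p := by
  obtain ⟨h1, h2, h3, h4⟩ := D.s_mul_s_cycle hij hp hp'
  rw [Ring.lie_def, Ring.lie_def, h1, h2, h3, h4]; simp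

theorem s_lie_s_of_ne {i j p q : Fin n} (hij : i ≠ j) (hp' : p ≠ j)
    (hq : q ≠ i) (hpq : p ≠ q) : ⁅D.s i p, D.s j q⁆ = 0 := by
  have := D.perm_mul_s (Equiv.swap i p) j q
  rw [Equiv.swap_apply_of_ne_of_ne hij.symm hp'.symm,
    Equiv.swap_apply_of_ne_of_ne hq hpq.symm] at this
  rw [Ring.lie_def, sub_eq_zero]; exact this

theorem Y_lie_s (i j : Fin n) (k : Fin m) :
    ⁅D.Y i k, D.s i j⁆ = (D.Y i k - D.Y j k) * D.s i j := by
  rw [Ring.lie_def, D.s_mul_Y i j, sub_mul]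

theorem s_lie_Y (i j : Fin n) (k : Fin m) :
    ⁅D.s i j, D.Y j k⁆ = (D.Y i k - D.Y j k) * D.s i j := by
  rw [Ring.lie_def, D.s_mul_Y' i j, sub_mul]

theorem Y_lie_s_of_ne {i j h : Fin n} (hi : h ≠ i) (hj : h ≠ j) (k : Fin m) :
    ⁅D.Y h k, D.s i j⁆ = 0 := by
  rw [Ring.lie_def, D.s_mul_Y_of_ne hi hj, sub_self]

theorem s_lie_Y_of_ne {i j h : Fin n} (hi : h ≠ i) (hj : h ≠ j) (k : Fin m) :
    ⁅D.s i j, D.Y h k⁆ = 0 := by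
  rw [Ring.lie_def, D.s_mul_Y_of_ne hi hj, sub_self]

theorem lie_nu_mul (x y : R) : ⁅x, D.nu * y⁆ = D.nu * ⁅x, y⁆ := by
  simp only [Ring.lie_def, mul_sub, ← mul_assoc, D.nu_comm x]

theorem nu_mul_lie (x y : R) : ⁅D.nu * x, y⁆ = D.nu * ⁅x, y⁆ := by
  simp only [Ring.lie_def, mul_sub, ← mul_assoc, D.nu_comm (y * x)]
  simp only [mul_assoc, D.nu_comm x, D.nu_comm]

theorem sum_Y_sub_mul_s {i j : Fin n} (hij : i ≠ j) :
    (∑ k : Fin m, (D.Y i k - D.Y j k)) * D.s i j =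
      D.nu * ∑ p ∈ (Finset.univ.erase i).erase j, (D.s j p * D.s i p - D.s i p * D.s j p) := by
  have hj : j ∈ Finset.univ.erase i := Finset.mem_erase.mpr ⟨hij.symm, Finset.mem_univ _⟩
  have hi : i ∈ Finset.univ.erase j := Finset.mem_erase.mpr ⟨hij, Finset.mem_univ _⟩
  rw [Finset.sum_sub_distrib, D.sum_Y', D.sum_Y', ← mul_sub, mul_assoc,
    ← Finset.add_sum_erase _ _ hj, ← Finset.add_sum_erase _ _ hi, D.s_comm j i,
    Finset.erase_right_comm (a := j), add_sub_add_left_eq_sub, ← Finset.sum_sub_distrib,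
    Finset.sum_mul]
  congr 1
  refine Finset.sum_congr rfl fun p hp => ?_
  simp only [Finset.mem_erase, Finset.mem_univ, and_true] at hp
  obtain ⟨_, h2, h3, _⟩ := D.s_mul_s_cycle hij hp.2 hp.1
  rw [sub_mul, h2, h3]

/-- A linear combination of `D.Y i k` and `ν D.s i p` of the shape of a connection coefficient. -/
def comb (i : Fin n) (a : Fin m → ℂ) (c : Fin n → ℂ) : R :=
  ∑ k : Fin m, a k • D.Y i k - ∑ p ∈ Finset.univ.erase i, c p • (D.nu * D.s i p)

theorem comb_lie_comb {i j : Fin n} (hij : i ≠ j) {a b : Fin m → ℂ} {c c' : Fin n → ℂ} {E : ℂ}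
    (hE : ∀ k, a k * b k - a k * c' i - c j * b k = E)
    (hE' : ∀ p, p ≠ i → p ≠ j → c p * c' p - c p * c' i - c j * c' p = E) :
    ⁅D.comb i a c, D.comb j b c'⁆ = 0 := by
  have hj : j ∈ Finset.univ.erase i := Finset.mem_erase.mpr ⟨hij.symm, Finset.mem_univ _⟩
  have hi : i ∈ Finset.univ.erase j := Finset.mem_erase.mpr ⟨hij, Finset.mem_univ _⟩
  set S := (Finset.univ.erase i).erase j with hS
  have hSm : ∀ p ∈ S, p ≠ j ∧ p ≠ i := fun p hp => by simpa [hS] using hp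
  have e1 : ⁅∑ k : Fin m, a k • D.Y i k, ∑ k : Fin m, b k • D.Y j k⁆ =
      ∑ k, (a k * b k) • (D.nu * (D.Y i k - D.Y j k) * D.s i j) := by
    rw [sum_commutator]
    refine Finset.sum_congr rfl fun k _ => ?_
    rw [commutator_sum, Finset.sum_eq_single k]
    · rw [smul_commutator, commutator_smul, Ring.lie_def, D.comm_Y hij, smul_smul, s]
    · intro l _ hl
      rw [smul_commutator, commutator_smul, Ring.lie_def, D.comm_Y_of_ne hij hl.symm, sub_self,
        smul_zero, smul_zero]
    · simp
  have e2 : ⁅∑ k : Fin m, a k • D.Y i k, c' i • (D.nu * D.s i j)⁆ =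
      ∑ k, (a k * c' i) • (D.nu * (D.Y i k - D.Y j k) * D.s i j) := by
    rw [sum_commutator]
    refine Finset.sum_congr rfl fun k _ => ?_
    rw [smul_commutator, commutator_smul, D.lie_nu_mul, D.Y_lie_s, smul_smul, mul_assoc D.nu]
  have e3 : ⁅∑ k : Fin m, a k • D.Y i k, ∑ p ∈ S, c' p • (D.nu * D.s j p)⁆ = 0 := by
    rw [sum_commutator]
    refine Finset.sum_eq_zero fun k _ => ?_
    rw [commutator_sum]
    refine Finset.sum_eq_zero fun p hp => ?_
    rw [smul_commutator, commutator_smul, D.lie_nu_mul,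
      D.Y_lie_s_of_ne hij (hSm p hp).2.symm, mul_zero, smul_zero, smul_zero]
  have e4 : ⁅c j • (D.nu * D.s i j), ∑ k : Fin m, b k • D.Y j k⁆ =
      ∑ k, (c j * b k) • (D.nu * (D.Y i k - D.Y j k) * D.s i j) := by
    rw [commutator_sum]
    refine Finset.sum_congr rfl fun k _ => ?_
    rw [smul_commutator, commutator_smul, D.nu_mul_lie, D.s_lie_Y, smul_smul, mul_assoc D.nu]
  have e5 : ⁅∑ p ∈ S, c p • (D.nu * D.s i p), ∑ k : Fin m, b k • D.Y j k⁆ = 0 := by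
    rw [sum_commutator]
    refine Finset.sum_eq_zero fun p hp => ?_
    rw [commutator_sum]
    refine Finset.sum_eq_zero fun k _ => ?_
    rw [smul_commutator, commutator_smul, D.nu_mul_lie,
      D.s_lie_Y_of_ne hij.symm (hSm p hp).1.symm, mul_zero, smul_zero, smul_zero]
  have e6 : ⁅c j • (D.nu * D.s i j), c' i • (D.nu * D.s i j)⁆ = 0 := by
    rw [smul_commutator, commutator_smul, commutator_self, smul_zero, smul_zero]
  have e7 : ⁅c j • (D.nu * D.s i j), ∑ p ∈ S, c' p • (D.nu * D.s j p)⁆ =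
      ∑ p ∈ S, (c j * c' p) • (D.nu * (D.nu * (D.s j p * D.s i p - D.s i p * D.s j p))) := by
    rw [commutator_sum]
    refine Finset.sum_congr rfl fun p hp => ?_
    rw [smul_commutator, commutator_smul, D.nu_mul_lie, D.lie_nu_mul, smul_smul,
      (D.s_lie_s hij (hSm p hp).2 (hSm p hp).1).2]
  have e8 : ⁅∑ p ∈ S, c p • (D.nu * D.s i p), c' i • (D.nu * D.s i j)⁆ =
      ∑ p ∈ S, (c p * c' i) • (D.nu * (D.nu * (D.s j p * D.s i p - D.s i p * D.s j p))) := by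
    rw [sum_commutator]
    refine Finset.sum_congr rfl fun p hp => ?_
    rw [smul_commutator, commutator_smul, D.nu_mul_lie, D.lie_nu_mul, smul_smul,
      (D.s_lie_s hij (hSm p hp).2 (hSm p hp).1).1]
  have e9 : ⁅∑ p ∈ S, c p • (D.nu * D.s i p), ∑ p ∈ S, c' p • (D.nu * D.s j p)⁆ =
      -∑ p ∈ S, (c p * c' p) • (D.nu * (D.nu * (D.s j p * D.s i p - D.s i p * D.s j p))) := by
    rw [sum_commutator, ← Finset.sum_neg_distrib]
    refine Finset.sum_congr rfl fun p hp => ?_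
    rw [commutator_sum, Finset.sum_eq_single p]
    · rw [smul_commutator, commutator_smul, D.nu_mul_lie, D.lie_nu_mul, smul_smul, Ring.lie_def,
        ← smul_neg, ← mul_neg, ← mul_neg, neg_sub]
    · intro q hq hqp
      rw [smul_commutator, commutator_smul, D.nu_mul_lie, D.lie_nu_mul,
        D.s_lie_s_of_ne hij (hSm p hp).1 (hSm q hq).2 hqp.symm]
      simp
    · exact fun h => absurd hp h
  have e10 : ∑ k : Fin m, E • (D.nu * (D.Y i k - D.Y j k) * D.s i j) =
      ∑ p ∈ S, E • (D.nu * (D.nu * (D.s j p * D.s i p - D.s i p * D.s j p))) := by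
    rw [← Finset.smul_sum, ← Finset.smul_sum, ← Finset.mul_sum, ← Finset.mul_sum,
      ← D.sum_Y_sub_mul_s hij, ← mul_assoc, ← Finset.sum_mul, ← Finset.mul_sum]
  rw [comb, comb, ← Finset.add_sum_erase _ _ hj, ← Finset.add_sum_erase _ _ hi,
    Finset.erase_right_comm (a := j), ← hS, D.s_comm j i]
  simp only [sub_commutator, commutator_sub, add_commutator, commutator_add, e1, e2, e3, e4, e5, e6, e7, e8, e9]
  have f1 : ∑ k, (a k * b k) • (D.nu * (D.Y i k - D.Y j k) * D.s i j) -
      ∑ k, (a k * c' i) • (D.nu * (D.Y i k - D.Y j k) * D.s i j) -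
      ∑ k, (c j * b k) • (D.nu * (D.Y i k - D.Y j k) * D.s i j) =
      ∑ k : Fin m, E • (D.nu * (D.Y i k - D.Y j k) * D.s i j) := by
    rw [← Finset.sum_sub_distrib, ← Finset.sum_sub_distrib]
    refine Finset.sum_congr rfl fun k _ => ?_
    rw [← sub_smul, ← sub_smul, hE]
  have f2 : ∑ p ∈ S, (c p * c' p) • (D.nu * (D.nu * (D.s j p * D.s i p - D.s i p * D.s j p))) -
      ∑ p ∈ S, (c p * c' i) • (D.nu * (D.nu * (D.s j p * D.s i p - D.s i p * D.s j p))) -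
      ∑ p ∈ S, (c j * c' p) • (D.nu * (D.nu * (D.s j p * D.s i p - D.s i p * D.s j p))) =
      ∑ p ∈ S, E • (D.nu * (D.nu * (D.s j p * D.s i p - D.s i p * D.s j p))) := by
    rw [← Finset.sum_sub_distrib, ← Finset.sum_sub_distrib]
    refine Finset.sum_congr rfl fun p hp => ?_
    rw [← sub_smul, ← sub_smul, hE' p (hSm p hp).2 (hSm p hp).1]
  rw [← e10, ← f1] at f2
  rw [← sub_eq_zero] at f2
  refine Eq.trans ?_ (neg_eq_zero.mpr f2)
  abel

end KZData

namespace KZData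

variable {R : Type*} [Ring R] [Algebra ℂ R] {n m : ℕ} (D : KZData R n m)

theorem comb_affine (i : Fin n) (a : Fin m → ℂ) (c : Fin n → ℂ) (l κ : ℂ) :
    D.comb i (fun k => l * a k + κ) (fun p => l * c p + κ) = l • D.comb i a c := by
  have h : ∑ k : Fin m, κ • D.Y i k = ∑ p ∈ Finset.univ.erase i, κ • (D.nu * D.s i p) := by
    rw [← Finset.smul_sum, ← Finset.smul_sum, D.sum_Y', Finset.mul_sum]
  simp only [comb, add_smul, Finset.sum_add_distrib, h, smul_sub, Finset.smul_sum, smul_smul]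
  abel

theorem comb_congr (i : Fin n) {a a' : Fin m → ℂ} {c c' : Fin n → ℂ} (ha : ∀ k, a k = a' k)
    (hc : ∀ p, p ≠ i → c p = c' p) : D.comb i a c = D.comb i a' c' := by
  rw [comb, comb]
  congr 1
  · exact Finset.sum_congr rfl fun k _ => by rw [ha]
  · exact Finset.sum_congr rfl fun p hp => by rw [hc p (Finset.ne_of_mem_erase hp)]

theorem perm_mul_comb (σ : Equiv.Perm (Fin n)) (i : Fin n) (a : Fin m → ℂ) (c : Fin n → ℂ) :
    D.perm σ * D.comb i a c = D.comb (σ i) a (fun p => c (σ⁻¹ p)) * D.perm σ := by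
  rw [comb, comb, mul_sub, sub_mul, Finset.mul_sum, Finset.sum_mul, Finset.mul_sum, Finset.sum_mul]
  congr 1
  · refine Finset.sum_congr rfl fun k _ => ?_
    rw [mul_smul_comm, smul_mul_assoc, D.perm_mul_Y]
  · refine Finset.sum_bij (fun p _ => σ p) (fun p hp => ?_) (fun p _ q _ h => σ.injective h)
      (fun q hq => ⟨σ⁻¹ q, ?_, by simp⟩) fun p hp => ?_
    · simpa using hp
    · simpa [Equiv.symm_apply_eq] using hq
    · rw [mul_smul_comm, smul_mul_assoc, ← mul_assoc, ← D.nu_comm, mul_assoc, D.perm_mul_s,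
        mul_assoc]
      simp

theorem comb_single {i j : Fin n} (hij : i ≠ j) (c : ℂ) :
    D.comb i (fun _ => 0) (fun p => if p = j then c else 0) = -(c • (D.nu * D.s i j)) := by
  rw [comb, Finset.sum_eq_zero (fun _ _ => zero_smul _ _), Finset.sum_eq_single j, if_pos rfl,
    zero_sub]
  · intro p _ hp; rw [if_neg hp, zero_smul]
  · intro hj; exact absurd (Finset.mem_erase.mpr ⟨hij.symm, Finset.mem_univ _⟩) hj

theorem sub_self_sub_eq_zero (a : R) {x y : R} (h : x * y = y * x) :
    a - a - (x * y - y * x) = 0 := by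
  rw [h, sub_self, sub_self, sub_self]

theorem hasWeakDerivAt_comb (i : Fin n) {a : ℂ → Fin m → ℂ} {c : ℂ → Fin n → ℂ}
    {a' : Fin m → ℂ} {c' : Fin n → ℂ} {x : ℂ} (ha : ∀ k, HasDerivAt (fun y => a y k) (a' k) x)
    (hc : ∀ p, p ≠ i → HasDerivAt (fun y => c y p) (c' p) x) :
    HasWeakDerivAt (fun y => D.comb i (a y) (c y)) (D.comb i a' c') x := by
  intro φ
  simp only [comb, map_sub, map_sum, map_smul, smul_eq_mul]
  refine HasDerivAt.sub (HasDerivAt.fun_sum fun k _ => (ha k).mul_const _)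
    (HasDerivAt.fun_sum fun p hp => (hc p (Finset.ne_of_mem_erase hp)).mul_const _)

end KZData

/-- The generators of the rational algebra. -/
def B.data (n : ℕ) {m : ℕ} (d : Fin m → ℕ) : KZData (B n d) n m where
  perm := { toFun := B.perm d, map_one' := B.perm_one, map_mul' := B.perm_mul }
  Y := B.Y d
  nu := B.nu n d
  nu_comm := B.nu_comm
  perm_mul_Y := B.perm_mul_Y
  sum_Y := B.sum_Y
  comm_Y := B.comm_Y
  comm_Y_of_ne := B.comm_Y_of_ne

/-! ### The logarithmic differentials -/

/-- The denominator of `dlogCoeff`. -/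
def wedge (b : Bool) (x : ℂ) (v : ℂ × ℂ) : ℂ := if b then v.2 - v.1 * x else x * v.2 - v.1

theorem dlogCoeff_eq (b : Bool) (x : ℂ) (v : ℂ × ℂ) :
    dlogCoeff b x v = (if b then -v.1 else v.2) / wedge b x v := by
  cases b <;> rfl

theorem toSphere_false (x : ℂ) : toSphere false x = (x : OnePoint ℂ) := rfl

theorem toSphere_true_zero : toSphere true 0 = OnePoint.infty := by simp [toSphere]

theorem toSphere_true_of_ne {x : ℂ} (hx : x ≠ 0) : toSphere true x = ((x⁻¹ : ℂ) : OnePoint ℂ) := by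
  simp [toSphere, hx]

theorem toSphere_true_eq_coe {x y : ℂ} : toSphere true x = (y : OnePoint ℂ) ↔ x * y = 1 := by
  by_cases hx : x = 0
  · subst hx; simp [toSphere_true_zero, OnePoint.infty_ne_coe]
  · rw [toSphere_true_of_ne hx, OnePoint.coe_eq_coe]
    constructor
    · rintro rfl; exact mul_inv_cancel₀ hx
    · intro h; exact inv_eq_of_mul_eq_one_right h

theorem toSphere_eq_iff {b b' : Bool} {x y : ℂ} :
    toSphere b x = toSphere b' y ↔ if b = b' then x = y else x * y = 1 := by
  cases b <;> cases b'
  · simp [toSphere_false]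
  · rw [toSphere_false, eq_comm, toSphere_true_eq_coe, mul_comm]; simp
  · rw [toSphere_false, toSphere_true_eq_coe]; simp
  · simp only [if_true]
    by_cases hy : y = 0
    · subst hy
      by_cases hx : x = 0
      · simp [hx]
      · simp [toSphere_true_zero, toSphere_true_of_ne hx, OnePoint.coe_ne_infty, hx]
    · rw [toSphere_true_of_ne hy, toSphere_true_eq_coe, mul_inv_eq_one₀ hy]

theorem wedge_coe {b : Bool} {x a : ℂ} (h : toSphere b x ≠ (a : OnePoint ℂ)) :
    wedge b x (a, 1) ≠ 0 := by
  rw [← toSphere_false, Ne, toSphere_eq_iff] at h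
  cases b <;> simp [wedge, sub_eq_zero] at h ⊢
  · exact h
  · rw [mul_comm]; exact fun e => h e.symm

theorem wedge_homog {b b' : Bool} {x y : ℂ} (h : toSphere b x ≠ toSphere b' y) :
    wedge b x (homog b' y) ≠ 0 := by
  rw [Ne, toSphere_eq_iff] at h
  cases b <;> cases b' <;> simp [wedge, homog, sub_eq_zero] at h ⊢
  · exact h
  · exact h
  · rw [mul_comm]; exact fun e => h e.symm
  · exact fun e => h e.symm

theorem dlogCoeff_identity {b b' : Bool} {x y : ℂ} {v : ℂ × ℂ} (h : toSphere b x ≠ toSphere b' y)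
    (hx : wedge b x v ≠ 0) (hy : wedge b' y v ≠ 0) :
    dlogCoeff b x v * dlogCoeff b' y v - dlogCoeff b x v * dlogCoeff b' y (homog b x) -
      dlogCoeff b x (homog b' y) * dlogCoeff b' y v = if b = b' then 0 else (1 - x * y)⁻¹ := by
  have h1 := wedge_homog h
  have h2 := wedge_homog h.symm
  obtain ⟨p, q⟩ := v
  cases b <;> cases b' <;> simp [dlogCoeff, wedge, homog] at h1 h2 hx hy ⊢
  · rw [mul_comm] at hx hy
    field_simp; ring
  · rw [mul_comm] at hx
    have h3 : 1 - x * y ≠ 0 := fun e => h1 (by linear_combination -e)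
    field_simp; ring
  · rw [mul_comm] at hy
    have h3 : 1 - x * y ≠ 0 := fun e => h2 (by linear_combination -e)
    rw [mul_comm] at h2
    have h4 : x * y - 1 ≠ 0 := h2
    field_simp; ring
  · field_simp; ring

theorem hasDerivAt_dlogCoeff_left {b : Bool} {x : ℂ} {v : ℂ × ℂ} (hx : wedge b x v ≠ 0) :
    HasDerivAt (fun y => dlogCoeff b y v) (-dlogCoeff b x v ^ 2) x := by
  cases b
  · simp only [dlogCoeff, wedge, Bool.false_eq_true, if_false] at hx ⊢
    convert! (hasDerivAt_const x v.2).div (((hasDerivAt_id x).mul_const v.2).sub_const v.1) hx using 1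
    simp only [id]; field_simp; ring
  · simp only [dlogCoeff, wedge, if_true] at hx ⊢
    convert! (hasDerivAt_const x (-v.1)).div (((hasDerivAt_id x).const_mul v.1).const_sub v.2) hx
      using 1
    simp only [id]; field_simp; ring

/-- The mixed second derivative of `log (a c' - a' c)`, up to sign. -/
def mixedCoeff (b b' : Bool) (x y : ℂ) : ℂ := if b = b' then ((x - y) ^ 2)⁻¹ else -((1 - x * y) ^ 2)⁻¹

theorem mixedCoeff_comm (b b' : Bool) (x y : ℂ) : mixedCoeff b b' x y = mixedCoeff b' b y x := by
  rw [mixedCoeff, mixedCoeff, mul_comm y, ← neg_sub x y, neg_sq]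
  simp only [eq_comm]

theorem hasDerivAt_dlogCoeff_right {b b' : Bool} {x y : ℂ} (h : toSphere b x ≠ toSphere b' y) :
    HasDerivAt (fun y => dlogCoeff b x (homog b' y)) (mixedCoeff b b' x y) y := by
  have h1 := wedge_homog h
  cases b <;> cases b' <;>
    simp [dlogCoeff, wedge, homog, mixedCoeff, -one_div] at h1 ⊢
  · convert! (hasDerivAt_const y (1:ℂ)).div ((hasDerivAt_id y).const_sub x) h1 using 1
    simp only [id]; field_simp; ring
  · have h3 : 1 - x * y ≠ 0 := fun e => h1 (by linear_combination -e)
    convert! (hasDerivAt_id y).div (((hasDerivAt_id y).const_mul x).sub_const 1) h1 using 1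
    simp only [id]; field_simp; ring
  · have h3 : 1 - x * y ≠ 0 := fun e => h1 (by linear_combination e)
    convert! (hasDerivAt_id y).neg.div (((hasDerivAt_id y).mul_const x).const_sub 1) h1 using 1
    simp only [id, Pi.neg_apply]; field_simp; ring
  · have h3 : x - y ≠ 0 := fun e => h1 (by linear_combination -e)
    convert! (hasDerivAt_const y (-1:ℂ)).div ((hasDerivAt_id y).sub_const x) h1 using 1
    simp only [id]; field_simp; ring

theorem dlogCoeff_smul (b : Bool) (x : ℂ) {c : ℂ} (hc : c ≠ 0) (v : ℂ × ℂ) :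
    dlogCoeff b x (c • v) = dlogCoeff b x v := by
  have : wedge b x (c • v) = c * wedge b x v := by
    cases b <;> simp [wedge] <;> ring
  rw [dlogCoeff_eq, dlogCoeff_eq, this, ← mul_div_mul_left _ (wedge b x v) hc]
  cases b <;> simp

theorem dlogCoeff_inv {b : Bool} {x : ℂ} (hx : x ≠ 0) {v : ℂ × ℂ} (h : wedge b x v ≠ 0) :
    dlogCoeff (!b) x⁻¹ v = -x ^ 2 * dlogCoeff b x v + x := by
  obtain ⟨p, q⟩ := v
  cases b <;> simp [dlogCoeff, wedge] at h ⊢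
  · rw [mul_comm] at h
    have : q - p * x⁻¹ ≠ 0 := fun e => h (by field_simp at e; linear_combination e)
    field_simp; ring
  · rw [mul_comm] at h
    have : x⁻¹ * q - p ≠ 0 := fun e => h (by field_simp at e; linear_combination e)
    field_simp; ring

section Coefficients

variable {n m : ℕ} {d : Fin m → ℕ} {α : Fin m → ℂ}

theorem kzCoeff_eq (ε : Fin n → Bool) (x : Fin n → ℂ) (i : Fin n) :
    kzCoeff d α ε x i = (B.data n d).comb i (fun k => dlogCoeff (ε i) (x i) (α k, 1))
      (fun p => dlogCoeff (ε i) (x i) (homog (ε p) (x p))) := rfl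

theorem kzAffine_eq (z : Fin n → ℂ) (i : Fin n) :
    kzAffine d α z i = kzCoeff d α (fun _ => false) z i := by
  rw [kzCoeff_eq]
  change (B.data n d).comb i (fun k => (z i - α k)⁻¹) (fun p => (z i - z p)⁻¹) = _
  refine KZData.comb_congr _ i (fun k => ?_) fun p _ => ?_ <;> simp [dlogCoeff, homog]

theorem toSphere_ne_coe {ε : Fin n → Bool} {x : Fin n → ℂ} (h : chart ε x ∈ configSet α n)
    (i : Fin n) (k : Fin m) : toSphere (ε i) (x i) ≠ (α k : OnePoint ℂ) := h.2 i k

theorem toSphere_ne {ε : Fin n → Bool} {x : Fin n → ℂ} (h : chart ε x ∈ configSet α n)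
    {i j : Fin n} (hij : i ≠ j) : toSphere (ε i) (x i) ≠ toSphere (ε j) (x j) :=
  fun e => hij (h.1 e)

theorem kzCoeff_commute {ε : Fin n → Bool} {x : Fin n → ℂ} (h : chart ε x ∈ configSet α n)
    (i j : Fin n) : kzCoeff d α ε x i * kzCoeff d α ε x j = kzCoeff d α ε x j * kzCoeff d α ε x i := by
  rcases eq_or_ne i j with rfl | hij
  · rfl
  rw [← sub_eq_zero]
  refine KZData.comb_lie_comb (B.data n d) hij
    (E := if ε i = ε j then 0 else (1 - x i * x j)⁻¹) (fun k => ?_) fun p hp hp' => ?_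
  · exact dlogCoeff_identity (toSphere_ne h hij) (wedge_coe (toSphere_ne_coe h i k))
      (wedge_coe (toSphere_ne_coe h j k))
  · exact dlogCoeff_identity (toSphere_ne h hij) (wedge_homog (toSphere_ne h hp.symm))
      (wedge_homog (toSphere_ne h hp'.symm))

/-- The derivative of the `j`-th coefficient in the direction of the `i`-th coordinate. -/
def kzCoeffDeriv (d : Fin m → ℕ) (α : Fin m → ℂ) (ε : Fin n → Bool) (x : Fin n → ℂ)
    (i j : Fin n) : B n d :=
  if i = j then (B.data n d).comb i (fun k => -dlogCoeff (ε i) (x i) (α k, 1) ^ 2)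
      (fun p => -dlogCoeff (ε i) (x i) (homog (ε p) (x p)) ^ 2)
  else (B.data n d).comb j (fun _ => 0)
    (fun p => if p = i then mixedCoeff (ε j) (ε i) (x j) (x i) else 0)

theorem kzCoeffDeriv_comm (ε : Fin n → Bool) (x : Fin n → ℂ) (i j : Fin n) :
    kzCoeffDeriv d α ε x i j = kzCoeffDeriv d α ε x j i := by
  rcases eq_or_ne i j with rfl | hij
  · rfl
  · rw [kzCoeffDeriv, kzCoeffDeriv, if_neg hij, if_neg hij.symm, KZData.comb_single _ hij,
      KZData.comb_single _ hij.symm, mixedCoeff_comm, KZData.s_comm]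

theorem hasWeakDerivAt_kzCoeff {ε : Fin n → Bool} {x : Fin n → ℂ} (h : chart ε x ∈ configSet α n)
    (i j : Fin n) :
    HasWeakDerivAt (fun y => kzCoeff d α ε (Function.update x i y) j)
      (kzCoeffDeriv d α ε x i j) (x i) := by
  rcases eq_or_ne i j with rfl | hij
  · rw [kzCoeffDeriv, if_pos rfl]
    simp only [kzCoeff_eq, Function.update_self]
    refine KZData.hasWeakDerivAt_comb _ i (fun k => ?_) fun p hp => ?_
    · exact hasDerivAt_dlogCoeff_left (wedge_coe (toSphere_ne_coe h i k))
    · simp only [Function.update_of_ne hp]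
      exact hasDerivAt_dlogCoeff_left (wedge_homog (toSphere_ne h hp.symm))
  · rw [kzCoeffDeriv, if_neg hij]
    simp only [kzCoeff_eq, Function.update_of_ne hij.symm]
    refine KZData.hasWeakDerivAt_comb _ j (fun k => hasDerivAt_const _ _) fun p hp => ?_
    by_cases hpi : p = i
    · subst hpi
      simp only [Function.update_self, if_true]
      exact hasDerivAt_dlogCoeff_right (toSphere_ne h hij.symm)
    · simp only [Function.update_of_ne hpi, if_neg hpi]
      exact hasDerivAt_const _ _

theorem kzFlat (d : Fin m → ℕ) (α : Fin m → ℂ) (n : ℕ) : KZFlat d α n := fun ε x h i j =>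
  ⟨_, _, hasWeakDerivAt_kzCoeff h i j, hasWeakDerivAt_kzCoeff h j i, by
    rw [kzCoeffDeriv_comm]
    exact KZData.sub_self_sub_eq_zero (R := B n d) _ (kzCoeff_commute (d := d) h i j)⟩

theorem homog_eq_smul {b b' : Bool} {x y : ℂ} (h : toSphere b x = toSphere b' y) :
    ∃ c : ℂ, c ≠ 0 ∧ homog b' y = c • homog b x := by
  rw [toSphere_eq_iff] at h
  split_ifs at h with hb
  · subst hb; subst h; exact ⟨1, one_ne_zero, by simp⟩
  · have hx : x ≠ 0 := left_ne_zero_of_mul_eq_one h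
    have hy : y = x⁻¹ := (inv_eq_of_mul_eq_one_right h).symm
    subst hy
    have := inv_ne_zero hx
    cases b <;> cases b' <;> simp at hb
    · exact ⟨x⁻¹, this, by simp [homog, hx]⟩
    · exact ⟨x⁻¹, this, by simp [homog, hx]⟩

/-- The transformation of the coefficients under a change of charts. -/
theorem kzCoeff_change {ε ε' : Fin n → Bool} {x x' : Fin n → ℂ} (h : chart ε x ∈ configSet α n)
    (e : chart ε x = chart ε' x') (i : Fin n) :
    kzCoeff d α ε' x' i = (if ε i = ε' i then (1 : ℂ) else -x i ^ 2) • kzCoeff d α ε x i := by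
  have hv : ∀ p, dlogCoeff (ε' i) (x' i) (homog (ε' p) (x' p)) =
      dlogCoeff (ε' i) (x' i) (homog (ε p) (x p)) := fun p => by
    obtain ⟨c, hc, hh⟩ := homog_eq_smul (congrFun e p)
    rw [hh, dlogCoeff_smul _ _ hc]
  simp only [kzCoeff_eq, hv]
  have hi := congrFun e i
  simp only [chart, toSphere_eq_iff] at hi
  split_ifs at hi ⊢ with hb
  · rw [one_smul, hb, hi]
  · have hx : x i ≠ 0 := left_ne_zero_of_mul_eq_one hi
    have hy : x' i = (x i)⁻¹ := (inv_eq_of_mul_eq_one_right hi).symm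
    have hb' : ε' i = !(ε i) := by
      cases h1 : ε i <;> cases h2 : ε' i <;> simp_all
    rw [hy, hb', ← KZData.comb_affine _ _ _ _ _ (x i)]
    refine KZData.comb_congr _ i (fun k => ?_) fun p hp => ?_
    · exact dlogCoeff_inv hx (wedge_coe (toSphere_ne_coe h i k))
    · exact dlogCoeff_inv hx (wedge_homog (toSphere_ne h hp.symm))

theorem kzExtends (d : Fin m → ℕ) (α : Fin m → ℂ) (n : ℕ) : KZExtends d α n := by
  intro ε x h hx i
  have e : chart (fun _ => false) (fun p => if ε p then (x p)⁻¹ else x p) = chart ε x := by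
    funext p
    simp only [chart, toSphere_eq_iff]
    cases hp : ε p
    · simp
    · simp [inv_mul_cancel₀ (hx p hp)]
  rw [kzAffine_eq, kzCoeff_change (e ▸ h) e i]
  congr 1
  cases hp : ε i <;> simp

/-- The action of the symmetric group on the coefficients. -/
theorem perm_mul_kzCoeff (σ : Equiv.Perm (Fin n)) (ε : Fin n → Bool) (x : Fin n → ℂ) (i : Fin n) :
    B.perm d σ * kzCoeff d α ε x i =
      kzCoeff d α (fun p => ε (σ⁻¹ p)) (fun p => x (σ⁻¹ p)) (σ i) * B.perm d σ := by
  have := (B.data n d).perm_mul_comb σ i (fun k => dlogCoeff (ε i) (x i) (α k, 1))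
    (fun p => dlogCoeff (ε i) (x i) (homog (ε p) (x p)))
  have hi : σ⁻¹ (σ i) = i := by simp
  simp only [kzCoeff_eq, hi]
  exact this

end Coefficients

set_option maxHeartbeats 2000000 in
open Metric Set Filter Topology in
/-- Linear Frobenius theorem: a system `dF = ω F` with closed and commuting coefficients has
local solutions with arbitrary initial value, on a ball that does not depend on this value. -/
theorem exists_flat_section {E M : Type*} [NormedAddCommGroup E] [NormedSpace ℂ E]
    [FiniteDimensional ℂ E] [NormedAddCommGroup M] [NormedSpace ℂ M] [CompleteSpace M]
    {U : Set E} (hU : IsOpen U) {ω : E → E →L[ℂ] M →L[ℂ] M} {ω' : E → E →L[ℂ] E →L[ℂ] M →L[ℂ] M}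
    (hω : ∀ x ∈ U, HasFDerivAt ω (ω' x) x) (hω' : ContinuousOn ω' U)
    (symm : ∀ x ∈ U, ∀ h k, ω' x h k = ω' x k h)
    (comm : ∀ x ∈ U, ∀ h k v, ω x h (ω x k v) = ω x k (ω x h v)) {x₀ : E} (hx₀ : x₀ ∈ U) :
    ∃ r > 0, ball x₀ r ⊆ U ∧ ∀ v : M, ∃ F : E → M, F x₀ = v ∧
      ∀ x ∈ ball x₀ r, HasFDerivAt F ((ω x).flip (F x)) x := by
  have : ProperSpace E := FiniteDimensional.proper ℂ E
  have hωc : ContinuousOn ω U := fun x hx => (hω x hx).continuousAt.continuousWithinAt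
  obtain ⟨r₀, hr₀, hr₀U⟩ := nhds_basis_closedBall.mem_iff.mp (hU.mem_nhds hx₀)
  obtain ⟨C, hC⟩ := (isCompact_closedBall x₀ r₀).exists_bound_of_continuousOn (f := ω) (hωc.mono hr₀U)
  have hC0 : 0 ≤ C := (norm_nonneg _).trans (hC x₀ (mem_closedBall_self hr₀.le))
  set r := min r₀ (1 / (2 * (C + 1))) with hr
  have hrpos : 0 < r := lt_min hr₀ (by positivity)
  have hrC : C * r ≤ 1 / 2 := by
    calc C * r ≤ (C + 1) * (1 / (2 * (C + 1))) := by gcongr; · linarith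
                                                     · exact min_le_right _ _
      _ = 1 / 2 := by field_simp
  have hballU : closedBall x₀ r ⊆ U := (closedBall_subset_closedBall (min_le_left _ _)).trans hr₀U
  have hCr : ∀ x ∈ closedBall x₀ r, ‖ω x‖ ≤ C := fun x hx =>
    hC x (closedBall_subset_closedBall (min_le_left _ _) hx)
  -- the radial vector field
  set a : ℝ → E → M →L[ℂ] M := fun s x => ω (x₀ + s • (x - x₀)) (x - x₀) with ha
  have hmem : ∀ s ∈ Icc (0 : ℝ) 1, ∀ x ∈ closedBall x₀ r, x₀ + s • (x - x₀) ∈ closedBall x₀ r := by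
    intro s hs x hx
    rw [mem_closedBall_iff_norm] at hx ⊢
    rw [add_sub_cancel_left, norm_smul, Real.norm_of_nonneg hs.1]
    nlinarith [norm_nonneg (x - x₀), hs.1, hs.2]
  have hpc : Continuous fun p : ℝ × E => x₀ + p.1 • (p.2 - x₀) := by fun_prop
  have hK : IsCompact (Icc (0 : ℝ) 1 ×ˢ closedBall x₀ r) := isCompact_Icc.prod (isCompact_closedBall _ _)
  have hmaps : MapsTo (fun p : ℝ × E => x₀ + p.1 • (p.2 - x₀)) (Icc (0 : ℝ) 1 ×ˢ closedBall x₀ r) U :=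
    fun p hp => hballU (hmem p.1 hp.1 p.2 hp.2)
  have hac : ContinuousOn (fun p : ℝ × E => a p.1 p.2) (Icc (0 : ℝ) 1 ×ˢ closedBall x₀ r) :=
    (hωc.comp hpc.continuousOn hmaps).clm_apply (continuous_snd.sub continuous_const).continuousOn
  have hanorm : ∀ s ∈ Icc (0 : ℝ) 1, ∀ x ∈ closedBall x₀ r, ‖a s x‖ ≤ 1 / 2 := by
    intro s hs x hx
    refine (ContinuousLinearMap.le_opNorm _ _).trans ((mul_le_mul (hCr _ (hmem s hs x hx))
      (mem_closedBall_iff_norm.mp hx) (norm_nonneg _) hC0).trans hrC)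
  -- its derivative
  set a' : ℝ → E → E →L[ℂ] M →L[ℂ] M := fun s x =>
    ω (x₀ + s • (x - x₀)) + (s : ℂ) • (ω' (x₀ + s • (x - x₀))).flip (x - x₀) with ha'
  have ha'c : ContinuousOn (fun p : ℝ × E => a' p.1 p.2) (Icc (0 : ℝ) 1 ×ˢ closedBall x₀ r) := by
    have h1 : ContinuousOn (fun p : ℝ × E => ω (x₀ + p.1 • (p.2 - x₀)))
        (Icc (0 : ℝ) 1 ×ˢ closedBall x₀ r) := hωc.comp hpc.continuousOn hmaps
    have h2 : ContinuousOn (fun p : ℝ × E => ω' (x₀ + p.1 • (p.2 - x₀)))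
        (Icc (0 : ℝ) 1 ×ˢ closedBall x₀ r) := hω'.comp hpc.continuousOn hmaps
    have h3 : ContinuousOn (fun p : ℝ × E => (ω' (x₀ + p.1 • (p.2 - x₀))).flip)
        (Icc (0 : ℝ) 1 ×ˢ closedBall x₀ r) :=
      (ContinuousLinearMap.flipₗᵢ ℂ E E (M →L[ℂ] M)).continuous.comp_continuousOn h2
    have h4 : ContinuousOn (fun p : ℝ × E => p.2 - x₀) (Icc (0 : ℝ) 1 ×ˢ closedBall x₀ r) :=
      (continuous_snd.sub continuous_const).continuousOn
    have h5 : ContinuousOn (fun p : ℝ × E => (p.1 : ℂ)) (Icc (0 : ℝ) 1 ×ˢ closedBall x₀ r) :=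
      (Complex.continuous_ofReal.comp continuous_fst).continuousOn
    exact h1.add (h5.smul (h3.clm_apply h4))
  have hadiff : ∀ s ∈ Icc (0 : ℝ) 1, ∀ x ∈ closedBall x₀ r, HasFDerivAt (a s) (a' s x) x := by
    intro s hs x hx
    have h1 : HasFDerivAt (fun x : E => x₀ + s • (x - x₀)) ((s : ℂ) • ContinuousLinearMap.id ℂ E) x := by
      have := (((hasFDerivAt_id (𝕜 := ℂ) x).sub_const x₀).const_smul (s : ℂ)).const_add x₀
      exact this
    have h2 := HasFDerivAt.comp (𝕜 := ℂ) (E := E) (F := E) (G := E →L[ℂ] M →L[ℂ] M)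
      (g := ω) (f := fun x : E => x₀ + s • (x - x₀)) x
      (hω (x₀ + s • (x - x₀)) (hmaps (x := (s, x)) ⟨hs, hx⟩)) h1
    have h3 := h2.clm_apply ((hasFDerivAt_id (𝕜 := ℂ) x).sub_const x₀)
    refine h3.congr_fderiv ?_
    ext k v
    simp [ha', smul_sub]
  obtain ⟨C', hC'⟩ := hK.exists_bound_of_continuousOn (f := fun p : ℝ × E => a' p.1 p.2) ha'c
  have huc := hK.uniformContinuousOn_of_continuous (f := fun p : ℝ × E => a' p.1 p.2) ha'c
  refine ⟨r, hrpos, ball_subset_closedBall.trans hballU, fun v => ?_⟩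
  -- the radial solutions
  have hex : ∀ x : E, ∃ γ : ℝ → M, x ∈ closedBall x₀ r → γ 0 = v ∧
      ∀ t ∈ Icc (0 : ℝ) 1, HasDerivWithinAt γ (a t x (γ t)) (Icc 0 1) t := by
    intro x
    by_cases hx : x ∈ closedBall x₀ r
    swap
    · exact ⟨0, fun h => absurd h hx⟩
    have hPL : IsPicardLindelof (fun t y => a t x y) (tmin := 0) (tmax := 1)
        ⟨0, left_mem_Icc.mpr zero_le_one⟩ v ‖v‖₊ 0 ‖v‖₊ (1 / 2) := by
      refine ⟨fun t ht => ?_, fun y _ => ?_, fun t ht y hy => ?_, ?_⟩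
      · refine LipschitzOnWith.of_dist_le_mul fun y _ z _ => ?_
        rw [dist_eq_norm, ← map_sub, dist_eq_norm]
        refine (ContinuousLinearMap.le_opNorm _ _).trans ?_
        gcongr
        simpa using hanorm t ht x hx
      · exact (hac.comp (f := fun t : ℝ => (t, x)) (by fun_prop)
          (fun t ht => ⟨ht, hx⟩)).clm_apply continuousOn_const
      · refine (ContinuousLinearMap.le_opNorm _ _).trans ?_
        have h1 : ‖y‖ ≤ 2 * ‖v‖ := by
          have := norm_le_norm_add_norm_sub' y v
          rw [mem_closedBall_iff_norm] at hy
          simp at hy; linarith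
        have := hanorm t ht x hx
        simp only [coe_nnnorm]
        nlinarith [norm_nonneg y, norm_nonneg (a t x)]
      · simp
    obtain ⟨γ, h1, h2⟩ := hPL.exists_eq_forall_mem_Icc_hasDerivWithinAt₀
    exact ⟨γ, fun _ => ⟨h1, h2⟩⟩
  choose γ hγ using hex
  have hcont : ∀ x ∈ closedBall x₀ r, ContinuousOn (γ x) (Icc 0 1) := fun x hx t ht =>
    ((hγ x hx).2 t ht).continuousWithinAt
  have hright : ∀ x ∈ closedBall x₀ r, ∀ t ∈ Ico (0 : ℝ) 1,
      HasDerivWithinAt (γ x) (a t x (γ x t)) (Ici t) t := fun x hx t ht =>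
    ((hγ x hx).2 t (Ico_subset_Icc_self ht)).mono_of_mem_nhdsWithin
      (mem_nhdsWithin.mpr ⟨Iio 1, isOpen_Iio, ht.2, fun z hz => ⟨ht.1.trans hz.2, hz.1.le⟩⟩)
  have hlip : ∀ x ∈ closedBall x₀ r, ∀ t ∈ Ico (0 : ℝ) 1,
      LipschitzOnWith 1 (fun y => a t x y) univ := by
    intro x hx t ht
    refine LipschitzOnWith.of_dist_le_mul fun y _ z _ => ?_
    rw [dist_eq_norm, ← map_sub, dist_eq_norm]
    refine (ContinuousLinearMap.le_opNorm _ _).trans ?_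
    gcongr
    simpa using (hanorm t (Ico_subset_Icc_self ht) x hx).trans (by norm_num)
  refine ⟨fun x => γ x 1, ?_, fun x₁ hx₁ => ?_⟩
  · have hx := mem_closedBall_self (x := x₀) hrpos.le
    have := dist_le_of_trajectories_ODE_of_mem (f := γ x₀) (g := fun _ => v) (a := 0) (b := 1)
      (δ := 0) (hlip x₀ hx) (hcont _ hx) (hright _ hx) (fun _ _ => mem_univ _) continuousOn_const
      (fun t ht => by simpa [ha] using hasDerivWithinAt_const t (Ici t) v) (fun _ _ => mem_univ _)
      (by rw [(hγ x₀ hx).1, dist_self]) 1 (right_mem_Icc.mpr zero_le_one)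
    simpa using this
  have hx₁' := ball_subset_closedBall hx₁
  obtain ⟨G, hG⟩ := isCompact_Icc.exists_bound_of_continuousOn (hcont x₁ hx₁')
  have hG0 : 0 ≤ G := (norm_nonneg _).trans (hG 0 (left_mem_Icc.mpr zero_le_one))
  have hC'0 : 0 ≤ C' := (norm_nonneg _).trans
    (hC' (0, x₁) ⟨left_mem_Icc.mpr zero_le_one, hx₁'⟩)
  refine HasFDerivAt.of_isLittleO (Asymptotics.isLittleO_iff.mpr fun c hc => ?_)
  set η := min 1 (c / (4 * (G + 1))) with hη
  have hηpos : 0 < η := lt_min one_pos (by positivity)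
  obtain ⟨δ, hδ, hδ'⟩ := (Metric.uniformContinuousOn_iff (α := ℝ × E)
    (β := E →L[ℂ] M →L[ℂ] M)).mp huc η hηpos
  have hbr : ball x₀ r ∈ 𝓝 x₁ := isOpen_ball.mem_nhds hx₁
  obtain ⟨ρ, hρ, hρ'⟩ := Metric.mem_nhds_iff.mp hbr
  set κ := c / (4 * ((C' + 1) * C * G + 1)) with hκ
  have hκpos : 0 < κ := by positivity
  filter_upwards [ball_mem_nhds x₁ (lt_min (lt_min hδ hρ) hκpos)] with x hx
  rw [mem_ball, lt_min_iff, lt_min_iff, dist_eq_norm] at hx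
  obtain ⟨⟨hxδ, hxρ⟩, hxκ⟩ := hx
  set k := x - x₁ with hk
  have hxr : x ∈ closedBall x₀ r :=
    ball_subset_closedBall (hρ' (by rw [mem_ball, dist_eq_norm]; exact hxρ))
  -- uniform differentiability of the radial field
  have hest : ∀ s ∈ Icc (0 : ℝ) 1, ‖a s x - a s x₁ - a' s x₁ k‖ ≤ η * ‖k‖ := by
    intro s hs
    refine (convex_ball x₁ (min δ ρ)).norm_image_sub_le_of_norm_hasFDerivWithin_le'
      (𝕜 := ℂ) (f := a s) (f' := a' s)
      (fun y hy => (hadiff s hs y (ball_subset_closedBall (hρ' ?_))).hasFDerivWithinAt)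
      (fun y hy => ?_) (mem_ball_self (lt_min hδ hρ)) ?_
    · exact ball_subset_ball (min_le_right _ _) hy
    · rw [← dist_eq_norm]
      refine (hδ' (s, y) ⟨hs, ball_subset_closedBall (hρ' (ball_subset_ball (min_le_right _ _) hy))⟩
        (s, x₁) ⟨hs, hx₁'⟩ ?_).le
      rw [Prod.dist_eq, dist_self, max_eq_right dist_nonneg]
      exact lt_of_lt_of_le (mem_ball.mp hy) (min_le_left _ _)
    · rw [mem_ball, dist_eq_norm]; exact lt_min hxδ hxρ
  have hest2 : ∀ s ∈ Icc (0 : ℝ) 1, ‖a s x - a s x₁‖ ≤ (C' + 1) * ‖k‖ := by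
    intro s hs
    have h1 := hest s hs
    have h2 : ‖a' s x₁ k‖ ≤ C' * ‖k‖ := (ContinuousLinearMap.le_opNorm _ _).trans
      (mul_le_mul_of_nonneg_right (hC' (s, x₁) ⟨hs, hx₁'⟩) (norm_nonneg _))
    have h3 := norm_le_norm_sub_add (a s x - a s x₁) (a' s x₁ k)
    have h4 : η ≤ 1 := min_le_left _ _
    nlinarith [norm_nonneg k]
  -- the approximate solution
  set W : ℝ → M →L[ℂ] M := fun s => ω (x₀ + s • (x₁ - x₀)) k with hW
  set W' : ℝ → M →L[ℂ] M := fun s => ω' (x₀ + s • (x₁ - x₀)) (x₁ - x₀) k with hW'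
  set g : ℝ → M := fun s => γ x₁ s + (s : ℂ) • W s (γ x₁ s) with hg
  have hWnorm : ∀ s ∈ Icc (0 : ℝ) 1, ‖W s‖ ≤ C * ‖k‖ := fun s hs =>
    (ContinuousLinearMap.le_opNorm _ _).trans
      (mul_le_mul_of_nonneg_right (hCr _ (hmem s hs x₁ hx₁')) (norm_nonneg _))
  have hWd : ∀ s ∈ Icc (0 : ℝ) 1, HasDerivAt W (W' s) s := by
    intro s hs
    have h1 : HasDerivAt (fun s : ℝ => x₀ + s • (x₁ - x₀)) (x₁ - x₀) s := by
      simpa using ((hasDerivAt_id s).smul_const (x₁ - x₀)).const_add x₀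
    have h2 := (HasFDerivAt.restrictScalars (𝕜 := ℝ) (𝕜' := ℂ) (E := E)
      (F := E →L[ℂ] M →L[ℂ] M) (f := ω)
      (hω (x₀ + s • (x₁ - x₀)) (hmaps (x := (s, x₁)) ⟨hs, hx₁'⟩))).comp_hasDerivAt s h1
    have h3 := (((ContinuousLinearMap.apply ℂ (M →L[ℂ] M) k).restrictScalars ℝ).hasFDerivAt).comp_hasDerivAt s h2
    exact h3
  set g' : ℝ → M := fun s => a s x₁ (γ x₁ s) + (W s (γ x₁ s) +
    (s : ℂ) • (W' s (γ x₁ s) + W s (a s x₁ (γ x₁ s)))) with hg'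
  have hgd : ∀ t ∈ Icc (0 : ℝ) 1, HasDerivWithinAt g (g' t) (Icc 0 1) t := by
    intro t ht
    have h0 := (hγ x₁ hx₁').2 t ht
    have h1 : HasDerivWithinAt (fun s => W s (γ x₁ s)) (W' t (γ x₁ t) + W t (a t x₁ (γ x₁ t)))
        (Icc 0 1) t := by
      have e := (hWd t ht).hasDerivWithinAt (s := Icc 0 1)
      have e' : HasDerivWithinAt (fun s => (W s).restrictScalars ℝ) ((W' t).restrictScalars ℝ) (Icc 0 1) t := by
        have := ((ContinuousLinearMap.restrictScalarsL ℂ M M ℝ ℝ).hasFDerivAt (x := W t)).comp_hasDerivWithinAt t e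
        exact this
      exact e'.clm_apply h0
    have h2 : HasDerivWithinAt (fun s : ℝ => (s : ℂ)) 1 (Icc 0 1) t := by
      exact (HasDerivAt.ofReal_comp (hasDerivAt_id t)).hasDerivWithinAt.congr_deriv (by simp)
    have h3 := h0.add (h2.smul h1)
    refine h3.congr_deriv ?_
    simp only [hg', one_smul]
    abel
  have herr : ∀ t ∈ Ico (0 : ℝ) 1, dist (g' t) (a t x (g t)) ≤ c / 2 * ‖k‖ := by
    intro t ht'
    have ht := Ico_subset_Icc_self ht'
    have hy : x₀ + t • (x₁ - x₀) ∈ U := hmaps (x := (t, x₁)) ⟨ht, hx₁'⟩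
    have e : g' t - a t x (g t) = -((a t x - a t x₁ - a' t x₁ k) (γ x₁ t))
        - (t : ℂ) • (a t x - a t x₁) (W t (γ x₁ t)) := by
      have h1 : W t (a t x₁ (γ x₁ t)) = a t x₁ (W t (γ x₁ t)) := comm _ hy _ _ _
      have h2 : a' t x₁ k = W t + (t : ℂ) • W' t := by
        simp only [ha', hW, hW', add_apply, smul_apply,
          ContinuousLinearMap.flip_apply]
        rw [symm _ hy]
      simp only [hg', hg, h1, h2, map_add, map_smul, sub_apply,
        add_apply, smul_apply, smul_add, smul_sub]
      abel
    rw [dist_eq_norm, e]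
    have hGt := hG t ht
    have n1 : ‖(a t x - a t x₁ - a' t x₁ k) (γ x₁ t)‖ ≤ η * ‖k‖ * G :=
      (ContinuousLinearMap.le_opNorm _ _).trans
        (mul_le_mul (hest t ht) hGt (norm_nonneg _) (by positivity))
    have n2 : ‖(t : ℂ) • (a t x - a t x₁) (W t (γ x₁ t))‖ ≤ (C' + 1) * ‖k‖ * (C * ‖k‖ * G) := by
      rw [norm_smul, Complex.norm_real, Real.norm_of_nonneg ht.1]
      refine (mul_le_of_le_one_left (norm_nonneg _) ht.2).trans ?_
      refine (ContinuousLinearMap.le_opNorm _ _).trans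
        (mul_le_mul (hest2 t ht) ?_ (norm_nonneg _) (by positivity))
      exact (ContinuousLinearMap.le_opNorm _ _).trans
        (mul_le_mul (hWnorm t ht) hGt (norm_nonneg _) (by positivity))
    have n3 : η * G ≤ c / 4 := by
      calc η * G ≤ c / (4 * (G + 1)) * (G + 1) := by
            gcongr
            · exact min_le_right _ _
            · linarith
        _ = c / 4 := by field_simp
    have n4 : (C' + 1) * C * G * ‖k‖ ≤ c / 4 := by
      calc (C' + 1) * C * G * ‖k‖ ≤ ((C' + 1) * C * G + 1) * κ := by
            gcongr
            linarith
        _ = c / 4 := by rw [hκ]; field_simp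
    calc _ ≤ ‖(a t x - a t x₁ - a' t x₁ k) (γ x₁ t)‖ + ‖(t : ℂ) • (a t x - a t x₁) (W t (γ x₁ t))‖ := by
          refine (norm_sub_le _ _).trans (by rw [norm_neg])
      _ ≤ (η * G) * ‖k‖ + ((C' + 1) * C * G * ‖k‖) * ‖k‖ := by
          refine (add_le_add n1 n2).trans (le_of_eq (by ring))
      _ ≤ c / 4 * ‖k‖ + c / 4 * ‖k‖ := by gcongr
      _ = _ := by ring
  have hfin := dist_le_of_approx_trajectories_ODE_of_mem (f := γ x) (g := g) (a := 0) (b := 1)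
    (δ := 0) (εf := 0) (εg := c / 2 * ‖k‖) (g' := g') (hlip x hxr) (hcont _ hxr) (hright _ hxr)
    (fun t _ => by rw [dist_self]) (fun _ _ => mem_univ _)
    (fun t ht => (hgd t ht).continuousWithinAt)
    (fun t ht => (hgd t (Ico_subset_Icc_self ht)).mono_of_mem_nhdsWithin
      (mem_nhdsWithin.mpr ⟨Iio 1, isOpen_Iio, ht.2, fun z hz => ⟨ht.1.trans hz.2, hz.1.le⟩⟩))
    herr (fun _ _ => mem_univ _) (by simp [hg, (hγ x hxr).1, (hγ x₁ hx₁').1]) 1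
    (right_mem_Icc.mpr zero_le_one)
  rw [gronwallBound_of_K_ne_0 (by simp)] at hfin
  have he : Real.exp 1 - 1 ≤ 2 := by have := Real.exp_one_lt_d9; linarith
  rw [dist_eq_norm] at hfin
  have e2 : γ x 1 - γ x₁ 1 - ((ω x₁).flip (γ x₁ 1)) k = γ x 1 - g 1 := by
    simp [hg, hW, sub_sub]
  rw [e2]
  refine hfin.trans ?_
  simp
  nlinarith [norm_nonneg k, mul_nonneg hc.le (norm_nonneg k)]

theorem continuous_toSphere (b : Bool) : Continuous (toSphere b) := by
  cases b
  · exact OnePoint.continuous_coe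
  refine continuous_iff_continuousAt.mpr fun x => ?_
  by_cases hx : x = 0
  · subst hx
    rw [continuousAt_iff_punctured_nhds, toSphere_true_zero]
    have h : Tendsto (fun x : ℂ => ((x⁻¹ : ℂ) : OnePoint ℂ)) (𝓝[≠] 0) (𝓝 OnePoint.infty) := by
      refine OnePoint.tendsto_coe_infty.comp ?_
      rw [coclosedCompact_eq_cocompact, ← Metric.cobounded_eq_cocompact]
      exact tendsto_inv₀_nhdsNE_zero
    refine h.congr' ?_
    filter_upwards [self_mem_nhdsWithin] with y hy
    exact (toSphere_true_of_ne hy).symm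
  · have h : ContinuousAt (fun x : ℂ => ((x⁻¹ : ℂ) : OnePoint ℂ)) x :=
      OnePoint.continuous_coe.continuousAt.comp (continuousAt_inv₀ hx)
    refine h.congr ?_
    filter_upwards [isOpen_ne.mem_nhds hx] with y hy
    exact (toSphere_true_of_ne hy).symm

theorem toSphere_injective (b : Bool) : Function.Injective (toSphere b) := fun x y h => by
  simpa using toSphere_eq_iff.mp h

/-- The involution `z ↦ 1 / z` of the Riemann sphere. -/
def sphereInv (z : OnePoint ℂ) : OnePoint ℂ := z.elim ((0 : ℂ) : OnePoint ℂ) (toSphere true)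

theorem sphereInv_coe (x : ℂ) : sphereInv (x : OnePoint ℂ) = toSphere true x := rfl

theorem sphereInv_toSphere (b : Bool) (x : ℂ) : sphereInv (toSphere b x) = toSphere (!b) x := by
  cases b
  · rfl
  by_cases hx : x = 0
  · subst hx; rw [toSphere_true_zero]; rfl
  · rw [toSphere_true_of_ne hx, sphereInv_coe, toSphere_true_of_ne (inv_ne_zero hx), inv_inv]; rfl

theorem continuous_sphereInv : Continuous sphereInv := by
  refine continuous_iff_continuousAt.mpr fun z => ?_
  induction z using OnePoint.rec with
  | infty =>
    rw [OnePoint.continuousAt_infty']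
    have h : Tendsto (fun x : ℂ => ((x⁻¹ : ℂ) : OnePoint ℂ)) (coclosedCompact ℂ)
        (𝓝 ((0 : ℂ) : OnePoint ℂ)) := by
      refine (OnePoint.continuous_coe.tendsto _).comp ?_
      rw [coclosedCompact_eq_cocompact, ← Metric.cobounded_eq_cocompact]
      exact tendsto_inv₀_cobounded
    refine h.congr' ?_
    rw [coclosedCompact_eq_cocompact, ← Metric.cobounded_eq_cocompact]
    filter_upwards [Bornology.eventually_ne_cobounded (0 : ℂ)] with y hy
    exact (toSphere_true_of_ne hy).symm
  | coe x =>
    rw [OnePoint.continuousAt_coe]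
    exact (continuous_toSphere true).continuousAt

theorem sphereInv_sphereInv (z : OnePoint ℂ) : sphereInv (sphereInv z) = z := by
  induction z using OnePoint.rec with
  | infty => rw [← toSphere_true_zero, sphereInv_toSphere, sphereInv_toSphere]; rfl
  | coe x => rw [← toSphere_false, sphereInv_toSphere, sphereInv_toSphere]; rfl

/-- The involution `z ↦ 1 / z` of the Riemann sphere as a homeomorphism. -/
def sphereInvHomeo : OnePoint ℂ ≃ₜ OnePoint ℂ where
  toFun := sphereInv
  invFun := sphereInv
  left_inv := sphereInv_sphereInv
  right_inv := sphereInv_sphereInv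
  continuous_toFun := continuous_sphereInv
  continuous_invFun := continuous_sphereInv

theorem isOpenMap_toSphere (b : Bool) : IsOpenMap (toSphere b) := by
  cases b
  · exact OnePoint.isOpenMap_coe
  · exact sphereInvHomeo.isOpenMap.comp OnePoint.isOpenMap_coe

theorem exists_toSphere (z : OnePoint ℂ) : ∃ b x, toSphere b x = z := by
  induction z using OnePoint.rec with
  | infty => exact ⟨true, 0, toSphere_true_zero⟩
  | coe x => exact ⟨false, x, rfl⟩

section Chart

variable {n : ℕ}

theorem continuous_chart (ε : Fin n → Bool) : Continuous (chart ε) :=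
  continuous_pi fun i => (continuous_toSphere (ε i)).comp (continuous_apply i)

theorem chart_injective (ε : Fin n → Bool) : Function.Injective (chart ε) := fun _ _ h =>
  funext fun i => toSphere_injective (ε i) (congrFun h i)

theorem isOpenMap_chart (ε : Fin n → Bool) : IsOpenMap (chart ε) :=
  IsOpenMap.piMap (fun i => isOpenMap_toSphere (ε i)) (by simp)

theorem exists_chart (ζ : Fin n → OnePoint ℂ) : ∃ ε x, chart ε x = ζ := by
  choose b x h using fun i => exists_toSphere (ζ i)
  exact ⟨b, x, funext h⟩

theorem chart_update (ε : Fin n → Bool) (x : Fin n → ℂ) (i : Fin n) (y : ℂ) :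
    chart ε (Function.update x i y) = Function.update (chart ε x) i (toSphere (ε i) y) := by
  funext p
  by_cases hp : p = i
  · subst hp; simp [chart]
  · simp [chart, hp]

theorem isOpen_configSet {m : ℕ} (α : Fin m → ℂ) (n : ℕ) : IsOpen (configSet α n) := by
  have h : configSet α n = (⋂ i : Fin n, ⋂ j : Fin n, {ζ | ζ i = ζ j → i = j}) ∩
      ⋂ i : Fin n, ⋂ k : Fin m, {ζ | ζ i ≠ (α k : OnePoint ℂ)} := by
    ext ζ; simp [configSet, Function.Injective]
  rw [h]
  refine (isOpen_iInter_of_finite fun i => isOpen_iInter_of_finite fun j => ?_).inter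
    (isOpen_iInter_of_finite fun i => isOpen_iInter_of_finite fun k =>
      isOpen_ne_fun (continuous_apply i) continuous_const)
  by_cases hij : i = j
  · simp [hij]
  · simp only [hij, imp_false]
    exact isOpen_ne_fun (continuous_apply i) (continuous_apply j)

/-- If two charts describe the same configuration then near it one coordinate of the first chart
is a function of the same coordinate of the second. -/
theorem exists_transition {b b' : Bool} {x x' : ℂ} (h : toSphere b x = toSphere b' x') :
    ∃ τ : ℂ → ℂ, τ x' = x ∧ HasDerivAt τ (if b = b' then (1 : ℂ) else -x ^ 2) x' ∧
      ∀ᶠ y in 𝓝 x', toSphere b' y = toSphere b (τ y) := by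
  rw [toSphere_eq_iff] at h
  split_ifs at h ⊢ with hb
  · subst hb; subst h
    exact ⟨id, rfl, hasDerivAt_id _, .of_forall fun _ => rfl⟩
  · have hx' : x' ≠ 0 := right_ne_zero_of_mul_eq_one h
    have hx : x = x'⁻¹ := eq_inv_of_mul_eq_one_left h
    refine ⟨Inv.inv, hx.symm, ?_, ?_⟩
    · rw [hx, inv_pow]; exact hasDerivAt_inv hx'
    · filter_upwards [isOpen_ne.mem_nhds hx'] with y hy
      rw [toSphere_eq_iff, if_neg (Ne.symm hb), mul_inv_cancel₀ hy]

end Chart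

section Weak

variable {V W : Type*} [AddCommGroup V] [Module ℂ V] [AddCommGroup W] [Module ℂ W]

theorem HasWeakDerivAt.comp_linearMap {f : ℂ → V} {v : V} {x : ℂ} (h : HasWeakDerivAt f v x)
    (g : V →ₗ[ℂ] W) : HasWeakDerivAt (fun y => g (f y)) (g v) x := fun φ => h (φ ∘ₗ g)

theorem HasWeakDerivAt.add {f g : ℂ → V} {v w : V} {x : ℂ} (h : HasWeakDerivAt f v x)
    (h' : HasWeakDerivAt g w x) : HasWeakDerivAt (fun y => f y + g y) (v + w) x := fun φ => by
  simp only [map_add]; exact (h φ).add (h' φ)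

theorem HasWeakDerivAt.const_smul {f : ℂ → V} {v : V} {x : ℂ} (h : HasWeakDerivAt f v x) (c : ℂ) :
    HasWeakDerivAt (fun y => c • f y) (c • v) x := fun φ => by
  simp only [map_smul, smul_eq_mul]; exact (h φ).const_mul c

theorem HasWeakDerivAt.scomp {f : ℂ → V} {v : V} {x : ℂ} {τ : ℂ → ℂ} {c : ℂ}
    (h : HasWeakDerivAt f v (τ x)) (hτ : HasDerivAt τ c x) :
    HasWeakDerivAt (fun y => f (τ y)) (c • v) x := fun φ => by
  rw [map_smul, smul_eq_mul, mul_comm]; exact (h φ).comp x hτ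

theorem HasWeakDerivAt.congr {f g : ℂ → V} {v : V} {x : ℂ} (h : HasWeakDerivAt f v x)
    (e : ∀ᶠ y in 𝓝 x, g y = f y) : HasWeakDerivAt g v x := fun φ =>
  (h φ).congr_of_eventuallyEq (e.mono fun y hy => by simp only [hy])

theorem HasWeakDerivAt.unique {f : ℂ → V} {v w : V} {x : ℂ} (h : HasWeakDerivAt f v x)
    (h' : HasWeakDerivAt f w x) : v = w :=
  (Module.forall_dual_apply_eq_zero_iff ℂ (v - w)).mp (fun φ => by
    rw [map_sub, sub_eq_zero]; exact (h φ).unique (h' φ)) |> sub_eq_zero.mp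

end Weak

theorem hasWeakDerivAt_iff {V : Type*} [NormedAddCommGroup V] [NormedSpace ℂ V]
    [FiniteDimensional ℂ V] {f : ℂ → V} {v : V} {x : ℂ} :
    HasWeakDerivAt f v x ↔ HasDerivAt f v x := by
  refine ⟨fun h => ?_, fun h φ => ?_⟩
  · let e : V ≃L[ℂ] (Fin (Module.finrank ℂ V) → ℂ) :=
      (Module.finBasis ℂ V).equivFun.toContinuousLinearEquiv
    have h1 : HasDerivAt (fun y => e (f y)) (e v) x := hasDerivAt_pi.mpr fun i =>
      h ((Module.finBasis ℂ V).coord i)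
    have h2 := (e.symm : _ →L[ℂ] V).hasFDerivAt.comp_hasDerivAt x h1
    simpa [Function.comp_def] using h2
  · exact φ.toContinuousLinearMap.hasFDerivAt.comp_hasDerivAt x h

section Action

variable {n m : ℕ} {d : Fin m → ℕ}

theorem isScalarTower_symm_smul {M : Type*} [AddCommGroup M] [Module ℂ M] [Module (B n d) M]
    [IsScalarTower ℂ (B n d) M] (c : ℂ) (b : B n d) (v : M) : b • c • v = c • b • v := by
  rw [← smul_one_smul (B n d) c v, smul_smul, ← smul_one_smul (B n d) c (b • v), smul_smul,
    ← Algebra.algebraMap_eq_smul_one, Algebra.commutes]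

/-- The action of an element of `B_n` as a linear map. -/
def act (M : Type*) [AddCommGroup M] [Module ℂ M] [Module (B n d) M]
    [IsScalarTower ℂ (B n d) M] : B n d →ₗ[ℂ] M →ₗ[ℂ] M where
  toFun b :=
    { toFun := fun v => b • v
      map_add' := fun v w => smul_add b v w
      map_smul' := fun c v => isScalarTower_symm_smul c b v }
  map_add' a b := LinearMap.ext fun v => add_smul a b v
  map_smul' c b := LinearMap.ext fun v => smul_assoc c b v

@[simp] theorem act_apply {M : Type*} [AddCommGroup M] [Module ℂ M] [Module (B n d) M]
    [IsScalarTower ℂ (B n d) M] (b : B n d) (v : M) : act M b v = b • v := rfl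

end Action

theorem KZData.map_comb {R : Type*} [Ring R] [Algebra ℂ R] {n m : ℕ} (D : KZData R n m) {W : Type*}
    [AddCommGroup W] [Module ℂ W] (L : R →ₗ[ℂ] W) (i : Fin n) (a : Fin m → ℂ) (c : Fin n → ℂ) :
    L (D.comb i a c) = ∑ k, a k • L (D.Y i k)
      - ∑ p ∈ Finset.univ.erase i, c p • L (D.nu * D.s i p) := by
  simp only [KZData.comb, map_sum, map_smul, map_sub]

/-- The preimage of the configuration space in a chart. -/
def chartDomain {m : ℕ} (α : Fin m → ℂ) {n : ℕ} (ε : Fin n → Bool) : Set (Fin n → ℂ) :=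
  {x | chart ε x ∈ configSet α n}

theorem isOpen_chartDomain {m : ℕ} (α : Fin m → ℂ) {n : ℕ} (ε : Fin n → Bool) :
    IsOpen (chartDomain α ε) :=
  (isOpen_configSet α n).preimage (continuous_chart ε)

section Smooth

variable {n m : ℕ} {α : Fin m → ℂ}

theorem contDiffAt_dlogCoeff {E : Type*} [NormedAddCommGroup E] [NormedSpace ℂ E] {f : E → ℂ}
    {g : E → ℂ × ℂ} {x : E} {b : Bool} (hf : ContDiffAt ℂ 1 f x) (hg : ContDiffAt ℂ 1 g x)
    (h : wedge b (f x) (g x) ≠ 0) : ContDiffAt ℂ 1 (fun y => dlogCoeff b (f y) (g y)) x := by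
  cases b
  · simp only [wedge, Bool.false_eq_true, if_false] at h
    simp only [dlogCoeff, Bool.false_eq_true, if_false]
    exact hg.snd.div ((hf.mul hg.snd).sub hg.fst) h
  · simp only [wedge, if_true] at h
    simp only [dlogCoeff, if_true]
    exact hg.fst.neg.div (hg.snd.sub (hg.fst.mul hf)) h

theorem contDiffAt_coord (x : Fin n → ℂ) (i : Fin n) :
    ContDiffAt ℂ 1 (fun y : Fin n → ℂ => y i) x :=
  (ContinuousLinearMap.proj (R := ℂ) (φ := fun _ : Fin n => ℂ) i).contDiff.contDiffAt

theorem contDiffAt_homog {b : Bool} {x : Fin n → ℂ} (i : Fin n) :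
    ContDiffAt ℂ 1 (fun y : Fin n → ℂ => homog b (y i)) x := by
  cases b
  · exact (contDiffAt_coord x i).prodMk contDiffAt_const
  · exact contDiffAt_const.prodMk (contDiffAt_coord x i)

theorem contDiffAt_dlogCoeff_alpha {ε : Fin n → Bool} {x : Fin n → ℂ} (h : x ∈ chartDomain α ε)
    (i : Fin n) (k : Fin m) :
    ContDiffAt ℂ 1 (fun y : Fin n → ℂ => dlogCoeff (ε i) (y i) (α k, 1)) x :=
  contDiffAt_dlogCoeff (contDiffAt_coord x i) contDiffAt_const (wedge_coe (toSphere_ne_coe h i k))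

theorem contDiffAt_dlogCoeff_homog {ε : Fin n → Bool} {x : Fin n → ℂ} (h : x ∈ chartDomain α ε)
    {i p : Fin n} (hp : i ≠ p) :
    ContDiffAt ℂ 1 (fun y : Fin n → ℂ => dlogCoeff (ε i) (y i) (homog (ε p) (y p))) x :=
  contDiffAt_dlogCoeff (contDiffAt_coord x i) (contDiffAt_homog p) (wedge_homog (toSphere_ne h hp))

variable (d : Fin m → ℕ) (M : Type*) [NormedAddCommGroup M] [NormedSpace ℂ M]
  [FiniteDimensional ℂ M] [Module (B n d) M] [IsScalarTower ℂ (B n d) M]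

/-- The action of an element of `B_n` as a continuous linear map. -/
def actL : B n d →ₗ[ℂ] M →L[ℂ] M :=
  (LinearMap.toContinuousLinearMap : (M →ₗ[ℂ] M) ≃ₗ[ℂ] (M →L[ℂ] M)).toLinearMap ∘ₗ act M

@[simp] theorem actL_apply (b : B n d) (v : M) : actL d M b v = b • v := rfl

theorem contDiffAt_actL_kzCoeff {ε : Fin n → Bool} {x : Fin n → ℂ} (h : x ∈ chartDomain α ε)
    (i : Fin n) : ContDiffAt ℂ 1 (fun y => actL d M (kzCoeff d α ε y i)) x := by
  have e : (fun y => actL d M (kzCoeff d α ε y i)) = fun y =>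
      ∑ k : Fin m, dlogCoeff (ε i) (y i) (α k, 1) • actL d M (B.Y d i k)
    - ∑ p ∈ Finset.univ.erase i,
        dlogCoeff (ε i) (y i) (homog (ε p) (y p)) • actL d M (B.nu n d * B.s d i p) := by
    funext y
    exact (B.data n d).map_comb (actL d M) i _ _
  rw [e]
  refine (ContDiffAt.sum fun k _ => ?_).sub (ContDiffAt.sum fun p hp => ?_)
  · exact (contDiffAt_dlogCoeff_alpha h i k).smul contDiffAt_const
  · exact (contDiffAt_dlogCoeff_homog h (Finset.ne_of_mem_erase hp).symm).smul contDiffAt_const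

/-- The connection form in a chart. -/
def kzForm (α : Fin m → ℂ) (ε : Fin n → Bool) (x : Fin n → ℂ) : (Fin n → ℂ) →L[ℂ] M →L[ℂ] M :=
  ∑ i, (ContinuousLinearMap.proj (R := ℂ) (φ := fun _ : Fin n => ℂ) i).smulRight
    (actL d M (kzCoeff d α ε x i))

theorem kzForm_apply (ε : Fin n → Bool) (x h : Fin n → ℂ) :
    kzForm d M α ε x h = ∑ i, h i • actL d M (kzCoeff d α ε x i) := by
  simp [kzForm]

theorem kzForm_single (ε : Fin n → Bool) (x : Fin n → ℂ) (i : Fin n) :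
    kzForm d M α ε x (Pi.single i 1) = actL d M (kzCoeff d α ε x i) := by
  rw [kzForm_apply, Finset.sum_eq_single i]
  · simp
  · intro j _ hj; simp [hj]
  · simp

theorem contDiffAt_kzForm {ε : Fin n → Bool} {x : Fin n → ℂ} (h : x ∈ chartDomain α ε) :
    ContDiffAt ℂ 1 (kzForm d M α ε) x := by
  unfold kzForm
  refine ContDiffAt.sum fun i _ => ?_
  exact contDiffAt_const.smulRight (contDiffAt_actL_kzCoeff d M h i)

theorem kzForm_commute {ε : Fin n → Bool} {x : Fin n → ℂ} (h : x ∈ chartDomain α ε)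
    (a b : Fin n → ℂ) (v : M) :
    kzForm d M α ε x a (kzForm d M α ε x b v) = kzForm d M α ε x b (kzForm d M α ε x a v) := by
  simp only [kzForm_apply, sum_apply, smul_apply, actL_apply, map_sum, map_smul,
    Finset.smul_sum]
  rw [Finset.sum_comm]
  refine Finset.sum_congr rfl fun i _ => Finset.sum_congr rfl fun j _ => ?_
  have e : kzCoeff d α ε x i • kzCoeff d α ε x j • v = kzCoeff d α ε x j • kzCoeff d α ε x i • v := by
    rw [← mul_smul, kzCoeff_commute (d := d) h, mul_smul]
  rw [smul_comm, e]

theorem hasDerivAt_update_coord (x : Fin n → ℂ) (i : Fin n) :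
    HasDerivAt (fun y : ℂ => Function.update x i y) (Pi.single i 1) (x i) := by
  exact hasDerivAt_update x i (x i)

theorem fderiv_kzForm_symm {ε : Fin n → Bool} {x : Fin n → ℂ} (h : x ∈ chartDomain α ε)
    (a b : Fin n → ℂ) : fderiv ℂ (kzForm d M α ε) x a b = fderiv ℂ (kzForm d M α ε) x b a := by
  have hd := ((contDiffAt_kzForm d M h).differentiableAt one_ne_zero).hasFDerivAt
  have key : ∀ i j, fderiv ℂ (kzForm d M α ε) x (Pi.single i 1) (Pi.single j 1) =
      actL d M (kzCoeffDeriv d α ε x i j) := by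
    intro i j
    ext v
    have e : Function.update x i (x i) = x := Function.update_eq_self i x
    have h1 : HasDerivAt (fun y => kzForm d M α ε (Function.update x i y))
        (fderiv ℂ (kzForm d M α ε) x (Pi.single i 1)) (x i) :=
      HasFDerivAt.comp_hasDerivAt (E := (Fin n → ℂ) →L[ℂ] M →L[ℂ] M) (F := Fin n → ℂ)
        (l := kzForm d M α ε) (f := fun y : ℂ => Function.update x i y) (x i)
        (by rw [e]; exact hd) (hasDerivAt_update_coord x i)
    have h2 : HasDerivAt (fun y => kzForm d M α ε (Function.update x i y) (Pi.single j 1) v)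
        (fderiv ℂ (kzForm d M α ε) x (Pi.single i 1) (Pi.single j 1) v) (x i) := by
      have := (h1.clm_apply (hasDerivAt_const (x i) (Pi.single j (1 : ℂ) : Fin n → ℂ))).clm_apply
        (hasDerivAt_const (x i) v)
      simpa using this
    have h3 : HasWeakDerivAt (fun y => kzForm d M α ε (Function.update x i y) (Pi.single j 1) v)
        (kzCoeffDeriv d α ε x i j • v) (x i) := by
      simp only [kzForm_single, actL_apply]
      exact (hasWeakDerivAt_kzCoeff h i j).comp_linearMap ((act M).flip v)
    exact (hasWeakDerivAt_iff.mpr h2).unique h3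
  have hab : ∀ a : Fin n → ℂ, a = ∑ i, a i • Pi.single i (1 : ℂ) := fun a => by
    conv_lhs => rw [← Finset.univ_sum_single a]
    refine Finset.sum_congr rfl fun i _ => ?_
    rw [← Pi.single_smul, smul_eq_mul, mul_one]
  rw [hab a, hab b]
  simp only [map_sum, map_smul, sum_apply, smul_apply, key, Finset.smul_sum]
  rw [Finset.sum_comm]
  refine Finset.sum_congr rfl fun i _ => Finset.sum_congr rfl fun j _ => ?_
  rw [smul_comm, kzCoeffDeriv_comm]

variable {d M} in
theorem hasDerivAt_curve_of_hasFDerivAt {ε : Fin n → Bool} {F : (Fin n → ℂ) → M} {c : ℂ → Fin n → ℂ}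
    {c' : Fin n → ℂ} {t : ℂ} (hF : HasFDerivAt F ((kzForm d M α ε (c t)).flip (F (c t))) (c t))
    (hc : HasDerivAt c c' t) :
    HasDerivAt (fun y => F (c y)) (∑ i, c' i • kzCoeff d α ε (c t) i • F (c t)) t := by
  have := hF.comp_hasDerivAt t hc
  rw [ContinuousLinearMap.flip_apply, kzForm_apply] at this
  simp only [sum_apply, smul_apply, actL_apply] at this
  exact this

variable {d M} in
theorem hasDerivAt_update_of_hasFDerivAt {ε : Fin n → Bool} {F : (Fin n → ℂ) → M} {x : Fin n → ℂ}
    (hF : HasFDerivAt F ((kzForm d M α ε x).flip (F x)) x) (i : Fin n) :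
    HasDerivAt (fun y => F (Function.update x i y)) (kzCoeff d α ε x i • F x) (x i) := by
  have e : Function.update x i (x i) = x := Function.update_eq_self i x
  have := hasDerivAt_curve_of_hasFDerivAt (d := d) (M := M) (c := fun y => Function.update x i y)
    (t := x i) (by rw [e]; exact hF) (hasDerivAt_update_coord x i)
  rw [e] at this
  refine this.congr_deriv ?_
  rw [Finset.sum_eq_single i]
  · simp
  · intro j _ hj; simp [hj]
  · simp

theorem exists_chart_fderiv_solution {ε : Fin n → Bool} {x₀ : Fin n → ℂ} (h : x₀ ∈ chartDomain α ε) :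
    ∃ r > 0, Metric.ball x₀ r ⊆ chartDomain α ε ∧ ∀ v : M, ∃ F : (Fin n → ℂ) → M, F x₀ = v ∧
      ∀ x ∈ Metric.ball x₀ r, HasFDerivAt F ((kzForm d M α ε x).flip (F x)) x := by
  have : CompleteSpace M := FiniteDimensional.complete ℂ M
  have hcd : ContDiffOn ℂ 1 (kzForm d M α ε) (chartDomain α ε) := fun x hx =>
    (contDiffAt_kzForm d M hx).contDiffWithinAt
  exact exists_flat_section (isOpen_chartDomain α ε)
    (ω := kzForm d M α ε) (ω' := fderiv ℂ (kzForm d M α ε))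
    (fun x hx => ((contDiffAt_kzForm d M hx).differentiableAt one_ne_zero).hasFDerivAt)
    (hcd.continuousOn_fderiv_of_isOpen (isOpen_chartDomain α ε) le_rfl)
    (fun x hx => fderiv_kzForm_symm d M hx) (fun x hx => kzForm_commute d M hx) h

/-- In a chart the solutions can be chosen on a common ball. -/
theorem exists_chart_solution {ε : Fin n → Bool} {x₀ : Fin n → ℂ} (h : x₀ ∈ chartDomain α ε) :
    ∃ r > 0, Metric.ball x₀ r ⊆ chartDomain α ε ∧ ∀ v : M, ∃ F : (Fin n → ℂ) → M, F x₀ = v ∧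
      ∀ x ∈ Metric.ball x₀ r, ∀ i,
        HasDerivAt (fun y => F (Function.update x i y)) (kzCoeff d α ε x i • F x) (x i) := by
  obtain ⟨r, hr, hsub, hF⟩ := exists_chart_fderiv_solution d M h
  refine ⟨r, hr, hsub, fun v => ?_⟩
  obtain ⟨F, hF0, hF⟩ := hF v
  refine ⟨F, hF0, fun x hx i => ?_⟩
  exact hasDerivAt_update_of_hasFDerivAt (hF x hx) i

variable {d M}

/-- A solution in one chart is a solution in all charts. -/
theorem isKZSolution_of_chart {ε : Fin n → Bool} {W : Set (Fin n → ℂ)} (hW : IsOpen W)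
    (hsub : W ⊆ chartDomain α ε) {G : (Fin n → OnePoint ℂ) → M}
    (hG : ∀ x ∈ W, ∀ i, HasDerivAt (fun y => G (chart ε (Function.update x i y)))
      (kzCoeff d α ε x i • G (chart ε x)) (x i)) :
    IsKZSolution d α (chart ε '' W) G where
  isOpen := isOpenMap_chart ε W hW
  subset := by rintro _ ⟨x, hx, rfl⟩; exact hsub hx
  deriv := by
    rintro ε' x' ⟨x, hx, e⟩ i
    rw [← e]
    obtain ⟨τ, h1, h2, h3⟩ := exists_transition (congrFun e i)
    have h4 : HasWeakDerivAt (fun y => G (chart ε (Function.update x i y)))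
      (kzCoeff d α ε x i • G (chart ε x)) (τ (x' i)) := by
      rw [h1]; exact hasWeakDerivAt_iff.mpr (hG x hx i)
    have h5 := h4.scomp h2
    rw [← smul_assoc, ← kzCoeff_change (d := d) (hsub hx) e i] at h5
    refine h5.congr (h3.mono fun y hy => ?_)
    rw [chart_update, chart_update, ← e, hy]

/-- Two solutions in a ball of a chart that agree at a point are equal. -/
theorem eqOn_of_chart {ε : Fin n → Bool} {x₀ : Fin n → ℂ} {r : ℝ}
    (hsub : Metric.ball x₀ r ⊆ chartDomain α ε) {F : (Fin n → ℂ) → M}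
    (hF : ∀ x ∈ Metric.ball x₀ r, ∀ i,
      HasDerivAt (fun y => F (Function.update x i y)) (kzCoeff d α ε x i • F x) (x i))
    {x : Fin n → ℂ} (hx : x ∈ Metric.ball x₀ r) (h0 : F x = 0) : ∀ x' ∈ Metric.ball x₀ r, F x' = 0 := by
  intro x' hx'
  have hr : 0 < r := Metric.pos_of_mem_ball hx
  have hmem : ∀ z ∈ Metric.ball x₀ r, ∀ i, ∀ y ∈ Metric.ball (x₀ i) r,
      Function.update z i y ∈ Metric.ball x₀ r := by
    intro z hz i y hy
    rw [Metric.mem_ball, dist_pi_lt_iff hr] at hz ⊢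
    intro j
    by_cases hj : j = i
    · subst hj; simpa using hy
    · simpa [hj] using hz j
  have step : ∀ z ∈ Metric.ball x₀ r, F z = 0 → ∀ i, F (Function.update z i (x' i)) = 0 := by
    intro z hz hFz i
    set c : ℝ → ℂ := fun t => z i + t * (x' i - z i) with hc
    have hcm : ∀ t ∈ Icc (0 : ℝ) 1, c t ∈ Metric.ball (x₀ i) r := by
      intro t ht
      have := (convex_ball (x₀ i) r).add_smul_sub_mem (x := z i) (y := x' i)
        ((dist_pi_lt_iff hr).mp hz i) ((dist_pi_lt_iff hr).mp hx' i) ht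
      simpa [hc, Complex.real_smul] using this
    have hcd : ∀ t, HasDerivAt c (x' i - z i) t := by
      intro t
      have := ((hasDerivAt_id t).ofReal_comp.mul_const (x' i - z i)).const_add (z i)
      exact this.congr_deriv (by simp)
    set A : ℝ → M →L[ℂ] M := fun t =>
      (x' i - z i) • actL d M (kzCoeff d α ε (Function.update z i (c t)) i) with hA
    have hAc : ContinuousOn A (Icc 0 1) := by
      intro t ht
      have hcont : ContinuousAt (fun t => Function.update z i (c t)) t :=
        (continuous_const.update i (by rw [hc]; fun_prop)).continuousAt
      have := (contDiffAt_actL_kzCoeff d M (hsub (hmem z hz i _ (hcm t ht))) i).continuousAt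
      have h3 : ContinuousAt (fun t => actL d M (kzCoeff d α ε (Function.update z i (c t)) i)) t :=
        ContinuousAt.comp (f := fun t => Function.update z i (c t)) this hcont
      exact (h3.const_smul (x' i - z i)).continuousWithinAt
    obtain ⟨C, hC⟩ := isCompact_Icc.exists_bound_of_continuousOn hAc
    have hC0 : 0 ≤ C := (norm_nonneg _).trans (hC 0 (left_mem_Icc.mpr zero_le_one))
    have hder : ∀ t ∈ Icc (0 : ℝ) 1, HasDerivAt (fun t => F (Function.update z i (c t)))
        (A t (F (Function.update z i (c t)))) t := by
      intro t ht
      have h1 := hF _ (hmem z hz i _ (hcm t ht)) i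
      simp only [Function.update_idem, Function.update_self] at h1
      exact h1.scomp t (hcd t)
    have := ODE_solution_unique_of_mem_Icc_right (v := fun t y => A t y) (s := fun _ => univ)
      (K := ⟨C, hC0⟩) (f := fun t => F (Function.update z i (c t))) (g := fun _ => 0)
      (a := 0) (b := 1) (fun t ht => ?_) (fun t ht => (hder t ht).continuousAt.continuousWithinAt)
      (fun t ht => (hder t (Ico_subset_Icc_self ht)).hasDerivWithinAt) (fun _ _ => mem_univ _)
      continuousOn_const (fun t ht => by simpa using hasDerivWithinAt_const t (Ici t) (0 : M))
      (fun _ _ => mem_univ _) (by simpa [hc] using hFz)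
    · simpa [hc] using this (right_mem_Icc.mpr zero_le_one)
    · refine LipschitzOnWith.of_dist_le_mul fun y _ y' _ => ?_
      rw [dist_eq_norm, ← map_sub, dist_eq_norm]
      exact ((A t).le_opNorm _).trans (mul_le_mul_of_nonneg_right (hC t (Ico_subset_Icc_self ht))
        (norm_nonneg _))
  have main : ∀ s : Finset (Fin n), F (fun i => if i ∈ s then x' i else x i) = 0 := by
    intro s
    induction s using Finset.induction with
    | empty => simpa using h0
    | insert i s hi ih =>
      have := step _ ?_ ih i
      · convert this using 2
        funext j
        by_cases hj : j = i
        · subst hj; simp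
        · simp [hj]
      · rw [Metric.mem_ball, dist_pi_lt_iff hr] at hx hx' ⊢
        intro j
        split_ifs
        exacts [hx' j, hx j]
  simpa using main Finset.univ

/-- The chain rule for solutions along curves in a chart. -/
theorem IsKZSolution.hasDerivAt_curve_normed {V : Set (Fin n → OnePoint ℂ)}
    {F : (Fin n → OnePoint ℂ) → M} (hF : IsKZSolution d α V F) {ε : Fin n → Bool}
    {c : ℂ → Fin n → ℂ} {c' : Fin n → ℂ} {t : ℂ} (ht : chart ε (c t) ∈ V) (hc : HasDerivAt c c' t) :
    HasDerivAt (fun y => F (chart ε (c y)))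
      (∑ i, c' i • kzCoeff d α ε (c t) i • F (chart ε (c t))) t := by
  obtain ⟨r₁, hr₁, hsub₁, hF₁⟩ := exists_chart_fderiv_solution d M (hF.subset ht)
  obtain ⟨r₂, hr₂, hsub₂⟩ := Metric.mem_nhds_iff.mp
    ((continuous_chart ε).continuousAt.preimage_mem_nhds (hF.isOpen.mem_nhds ht))
  obtain ⟨G, h0, hG⟩ := hF₁ (F (chart ε (c t)))
  have h1 : ∀ x ∈ Metric.ball (c t) (min r₁ r₂), F (chart ε x) - G x = 0 := by
    refine eqOn_of_chart (d := d) (F := fun x => F (chart ε x) - G x)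
      ((Metric.ball_subset_ball (min_le_left _ _)).trans hsub₁) (fun x hx i => ?_)
      (Metric.mem_ball_self (lt_min hr₁ hr₂)) (by rw [h0, sub_self])
    rw [smul_sub]
    exact (hasWeakDerivAt_iff.mp (hF.deriv ε x (hsub₂ (Metric.ball_subset_ball
      (min_le_right _ _) hx)) i)).sub (hasDerivAt_update_of_hasFDerivAt
        (hG x (Metric.ball_subset_ball (min_le_left _ _) hx)) i)
  have h2 := hasDerivAt_curve_of_hasFDerivAt (hG (c t) (Metric.mem_ball_self hr₁)) hc
  rw [h0] at h2
  refine h2.congr_of_eventuallyEq ?_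
  filter_upwards [hc.continuousAt.preimage_mem_nhds (Metric.ball_mem_nhds _ (lt_min hr₁ hr₂))]
    with y hy
  exact sub_eq_zero.mp (h1 _ hy)

end Smooth

section Frame

variable {n m : ℕ} {d : Fin m → ℕ} {α : Fin m → ℂ}

/-- Any configuration has a neighbourhood on which the values of solutions at any point are
arbitrary and determine the solution. -/
theorem exists_frame_normed {M : Type*} [NormedAddCommGroup M] [NormedSpace ℂ M]
    [FiniteDimensional ℂ M] [Module (B n d) M] [IsScalarTower ℂ (B n d) M]
    {ζ : Fin n → OnePoint ℂ} (hζ : ζ ∈ configSet α n) {O : Set (Fin n → OnePoint ℂ)}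
    (hO : O ∈ 𝓝 ζ) :
    ∃ V, ζ ∈ V ∧ V ⊆ O ∧ IsOpen V ∧ V ⊆ configSet α n ∧
      (∀ η ∈ V, ∀ v : M, ∃ F, IsKZSolution d α V F ∧ F η = v) ∧
      ∀ F G : (Fin n → OnePoint ℂ) → M, IsKZSolution d α V F → IsKZSolution d α V G →
        ∀ η ∈ V, F η = G η → EqOn F G V := by
  obtain ⟨ε, x₀, rfl⟩ := exists_chart ζ
  obtain ⟨r₁, hr₁, hsub₁, hF₁⟩ := exists_chart_solution d M (α := α) hζ
  obtain ⟨r₂, hr₂, hsub₂⟩ := Metric.mem_nhds_iff.mp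
    ((continuous_chart ε).continuousAt.preimage_mem_nhds hO)
  obtain ⟨r, hr, hsub, hsubO, hF⟩ : ∃ r > 0, Metric.ball x₀ r ⊆ chartDomain α ε ∧
      Metric.ball x₀ r ⊆ chart ε ⁻¹' O ∧ ∀ v : M, ∃ F : (Fin n → ℂ) → M, F x₀ = v ∧
      ∀ x ∈ Metric.ball x₀ r, ∀ i,
        HasDerivAt (fun y => F (Function.update x i y)) (kzCoeff d α ε x i • F x) (x i) := by
    refine ⟨min r₁ r₂, lt_min hr₁ hr₂, (Metric.ball_subset_ball (min_le_left _ _)).trans hsub₁,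
      (Metric.ball_subset_ball (min_le_right _ _)).trans hsub₂, fun v => ?_⟩
    obtain ⟨F, h0, h1⟩ := hF₁ v
    exact ⟨F, h0, fun x hx => h1 x (Metric.ball_subset_ball (min_le_left _ _) hx)⟩
  have huniq : ∀ F : (Fin n → OnePoint ℂ) → M, IsKZSolution d α (chart ε '' Metric.ball x₀ r) F →
      ∀ η ∈ chart ε '' Metric.ball x₀ r, F η = 0 → ∀ η' ∈ chart ε '' Metric.ball x₀ r, F η' = 0 := by
    rintro F hF _ ⟨x, hx, rfl⟩ h0 _ ⟨x', hx', rfl⟩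
    exact eqOn_of_chart (F := fun y => F (chart ε y)) hsub
      (fun y hy i => hasWeakDerivAt_iff.mp (hF.deriv ε y ⟨y, hy, rfl⟩ i)) hx h0 x' hx'
  have hinv : ∀ x, Function.invFun (chart ε) (chart ε x) = x :=
    Function.leftInverse_invFun (chart_injective ε)
  have hsol : ∀ v : M, ∃ F, IsKZSolution d α (chart ε '' Metric.ball x₀ r) F ∧ F (chart ε x₀) = v := by
    intro v
    obtain ⟨F, h0, h1⟩ := hF v
    refine ⟨fun η => F (Function.invFun (chart ε) η),
      isKZSolution_of_chart Metric.isOpen_ball hsub fun x hx i => ?_, by simp only [hinv, h0]⟩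
    simp only [hinv]
    exact h1 x hx i
  have hadd : ∀ F G : (Fin n → OnePoint ℂ) → M, ∀ c : ℂ,
      IsKZSolution d α (chart ε '' Metric.ball x₀ r) F →
      IsKZSolution d α (chart ε '' Metric.ball x₀ r) G →
      IsKZSolution d α (chart ε '' Metric.ball x₀ r) (fun y => F y + c • G y) := by
    intro F G c hF hG
    refine ⟨hF.isOpen, hF.subset, fun ε' x hx i => ?_⟩
    have := (hF.deriv ε' x hx i).add ((hG.deriv ε' x hx i).const_smul c)
    rw [smul_add, isScalarTower_symm_smul]
    exact this
  refine ⟨chart ε '' Metric.ball x₀ r, ⟨x₀, Metric.mem_ball_self hr, rfl⟩,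
    by rintro _ ⟨x, hx, rfl⟩; exact hsubO hx, isOpenMap_chart ε _ Metric.isOpen_ball, ?_, ?_, ?_⟩
  · rintro _ ⟨x, hx, rfl⟩; exact hsub hx
  · intro η hη
    choose F hF h0 using hsol
    have hlin : ∀ (v w : M) (c : ℂ), F (v + c • w) η = F v η + c • F w η := by
      intro v w c
      have := huniq _ (hadd _ _ (-1) (hF (v + c • w)) (hadd _ _ c (hF v) (hF w))) (chart ε x₀)
        ⟨x₀, Metric.mem_ball_self hr, rfl⟩ (by simp [h0]; abel) η hη
      rwa [neg_one_smul, ← sub_eq_add_neg, sub_eq_zero] at this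
    have h00 : F 0 η = 0 := huniq _ (hF 0) (chart ε x₀) ⟨x₀, Metric.mem_ball_self hr, rfl⟩ (h0 0) η hη
    let L : M →ₗ[ℂ] M :=
      { toFun := fun v => F v η
        map_add' := fun v w => by simpa using hlin v w 1
        map_smul' := fun c w => by simpa [h00] using hlin 0 w c }
    have hinj : Function.Injective L := by
      rw [injective_iff_map_eq_zero]
      intro v hv
      have := huniq _ (hF v) η hη hv (chart ε x₀) ⟨x₀, Metric.mem_ball_self hr, rfl⟩
      rwa [h0] at this
    intro v
    obtain ⟨w, hw⟩ := LinearMap.surjective_of_injective hinj v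
    exact ⟨F w, hF w, hw⟩
  · intro F G hF hG η hη h η' hη'
    have := huniq _ (hadd F G (-1) hF hG) η hη (by simp [h]) η' hη'
    simpa [← sub_eq_add_neg, sub_eq_zero] using this

theorem exists_frame (M : Type*) [AddCommGroup M] [Module ℂ M]
    [FiniteDimensional ℂ M] [Module (B n d) M] [IsScalarTower ℂ (B n d) M]
    {ζ : Fin n → OnePoint ℂ} (hζ : ζ ∈ configSet α n) {O : Set (Fin n → OnePoint ℂ)}
    (hO : O ∈ 𝓝 ζ) :
    ∃ V, ζ ∈ V ∧ V ⊆ O ∧ IsOpen V ∧ V ⊆ configSet α n ∧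
      (∀ η ∈ V, ∀ v : M, ∃ F, IsKZSolution d α V F ∧ F η = v) ∧
      ∀ F G : (Fin n → OnePoint ℂ) → M, IsKZSolution d α V F → IsKZSolution d α V G →
        ∀ η ∈ V, F η = G η → EqOn F G V := by
  let e := (Module.finBasis ℂ M).equivFun
  let _ : NormedAddCommGroup M := NormedAddCommGroup.induced M _ e e.injective
  let _ : NormedSpace ℂ M := NormedSpace.induced ℂ M _ e
  exact exists_frame_normed hζ hO

theorem IsKZSolution.hasWeakDerivAt_curve {M : Type*} [AddCommGroup M] [Module ℂ M]
    [FiniteDimensional ℂ M] [Module (B n d) M] [IsScalarTower ℂ (B n d) M]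
    {V : Set (Fin n → OnePoint ℂ)} {F : (Fin n → OnePoint ℂ) → M} (hF : IsKZSolution d α V F)
    {ε : Fin n → Bool} {c : ℂ → Fin n → ℂ} {c' : Fin n → ℂ} {t : ℂ} (ht : chart ε (c t) ∈ V)
    (hc : HasDerivAt c c' t) :
    HasWeakDerivAt (fun y => F (chart ε (c y)))
      (∑ i, c' i • kzCoeff d α ε (c t) i • F (chart ε (c t))) t := by
  let e := (Module.finBasis ℂ M).equivFun
  let _ : NormedAddCommGroup M := NormedAddCommGroup.induced M _ e e.injective
  let _ : NormedSpace ℂ M := NormedSpace.induced ℂ M _ e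
  exact hasWeakDerivAt_iff.mpr (hF.hasDerivAt_curve_normed ht hc)

end Frame

/-- A sheaf of local solutions, given by the predicate `sol V F` that `F` restricts to a solution
on the open set `V`, such that locally solutions are determined by their value at any point, which
may be prescribed. -/
structure LocalSystem (X M : Type*) [TopologicalSpace X] where
  sol : Set X → (X → M) → Prop
  isOpen : ∀ {V F}, sol V F → IsOpen V
  mono : ∀ {V V' F}, sol V F → IsOpen V' → V' ⊆ V → sol V' F
  exists_frame : ∀ (x : X) (O : Set X), O ∈ 𝓝 x → ∃ V, x ∈ V ∧ V ⊆ O ∧ IsOpen V ∧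
    (∀ y ∈ V, ∀ v, ∃ F, sol V F ∧ F y = v) ∧
    ∀ F G, sol V F → sol V G → ∀ y ∈ V, F y = G y → EqOn F G V

/-- A type endowed with the discrete topology. -/
def Discr (M : Type*) : Type _ := M

instance (M : Type*) : TopologicalSpace (Discr M) := ⊥

instance (M : Type*) : DiscreteTopology (Discr M) := ⟨rfl⟩

namespace LocalSystem

variable {X M : Type*} [TopologicalSpace X] (L : LocalSystem X M)

theorem eventually_eq {V V' : Set X} {F F' : X → M} (h : L.sol V F) (h' : L.sol V' F') {x : X}
    (hx : x ∈ V) (hx' : x ∈ V') (e : F x = F' x) : ∀ᶠ y in 𝓝 x, F y = F' y := by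
  obtain ⟨W, hW, hsub, hWo, -, huniq⟩ := L.exists_frame x (V ∩ V')
    (inter_mem ((L.isOpen h).mem_nhds hx) ((L.isOpen h').mem_nhds hx'))
  filter_upwards [hWo.mem_nhds hW] with y hy
  exact huniq _ _ (L.mono h hWo (hsub.trans inter_subset_left))
    (L.mono h' hWo (hsub.trans inter_subset_right)) x hW e hy

/-- A neighbourhood on which solutions may be prescribed at any point. -/
def frame (x : X) : Set X := (L.exists_frame x univ univ_mem).choose

theorem mem_frame (x : X) : x ∈ L.frame x := (L.exists_frame x univ univ_mem).choose_spec.1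

theorem isOpen_frame (x : X) : IsOpen (L.frame x) :=
  (L.exists_frame x univ univ_mem).choose_spec.2.2.1

theorem exists_sol (x : X) : ∀ y ∈ L.frame x, ∀ v, ∃ F, L.sol (L.frame x) F ∧ F y = v :=
  (L.exists_frame x univ univ_mem).choose_spec.2.2.2.1

theorem eqOn_frame {x : X} {F G : X → M} (hF : L.sol (L.frame x) F) (hG : L.sol (L.frame x) G)
    {y : X} (hy : y ∈ L.frame x) (h : F y = G y) : EqOn F G (L.frame x) :=
  (L.exists_frame x univ univ_mem).choose_spec.2.2.2.2 F G hF hG y hy h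

open Classical in
/-- The solution on `frame x` with value `v` at `y`. -/
def ext (x y : X) (v : M) : X → M := if h : y ∈ L.frame x then (L.exists_sol x y h v).choose else
  fun _ => v

variable {L}

theorem sol_ext {x y : X} (h : y ∈ L.frame x) (v : M) : L.sol (L.frame x) (L.ext x y v) := by
  rw [ext, dif_pos h]; exact (L.exists_sol x y h v).choose_spec.1

theorem ext_apply {x y : X} (h : y ∈ L.frame x) (v : M) : L.ext x y v y = v := by
  rw [ext, dif_pos h]; exact (L.exists_sol x y h v).choose_spec.2

theorem ext_ext {x y z u : X} (hy : y ∈ L.frame x) (hz : z ∈ L.frame x) (hu : u ∈ L.frame x)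
    (v : M) : L.ext x z (L.ext x y v z) u = L.ext x y v u :=
  L.eqOn_frame (sol_ext hz _) (sol_ext hy _) hz (ext_apply hz _) hu

variable (L)

/-- The bundle of values of solutions. -/
def core : FiberBundleCore X X (Discr M) where
  baseSet := L.frame
  isOpen_baseSet := L.isOpen_frame
  indexAt := id
  mem_baseSet_at := L.mem_frame
  coordChange i j y v := L.ext j y (L.ext i i v y) j
  coordChange_self i y hy v :=
    (ext_ext (L.mem_frame i) hy (L.mem_frame i) _).trans (ext_apply (L.mem_frame i) _)
  continuousOn_coordChange i j := by
    rintro ⟨y, v⟩ ⟨⟨hi, hj⟩, -⟩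
    refine ContinuousAt.continuousWithinAt ?_
    have h := L.eventually_eq (sol_ext (L.mem_frame i) v) (sol_ext hj (L.ext i i v y)) hi hj
      (ext_apply hj _).symm
    obtain ⟨c, hc⟩ : ∃ c : Discr M, c = L.ext j y (L.ext i i v y) j := ⟨_, rfl⟩
    refine ContinuousAt.congr (f := fun _ => c) continuousAt_const ?_
    have h' : ∀ᶠ w : Discr M in 𝓝 v, w = v := by rw [nhds_discrete]; exact rfl
    rw [nhds_prod_eq]
    filter_upwards [(h.and ((L.isOpen_frame j).mem_nhds hj)).prod_mk h'] with p hp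
    obtain ⟨⟨h1, h2⟩, h3⟩ := hp
    rw [h3, hc]
    exact ((congrArg (fun w => L.ext j p.1 w j) h1).trans (ext_ext hj h2 (L.mem_frame j) _)).symm
  coordChange_comp i j k y hy v := by
    obtain ⟨⟨hi, hj⟩, hk⟩ := hy
    exact congrArg (fun w => L.ext k y w k)
      ((ext_ext hj (L.mem_frame j) hj _).trans (ext_apply hj _))

/-- The covering space of values of solutions. -/
abbrev Total : Type _ := L.core.TotalSpace

abbrev pt (x : X) (v : M) : L.Total := ⟨x, v⟩

/-- The value of a point of the covering space. -/
def val (p : L.Total) : M := p.2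

theorem val_pt (x : X) (v : M) : L.val (L.pt x v) = v := rfl

theorem isCoveringMap : IsCoveringMap (L.core.proj) :=
  FiberBundle.isCoveringMap (F := Discr M) (E := L.core.Fiber)

theorem continuousAt_pt_iff {A : Type*} [TopologicalSpace A] {γ : A → X} {a : A}
    (hγ : ContinuousAt γ a) (f : A → M) :
    ContinuousAt (fun t => L.pt (γ t) (f t)) a ↔
      ∀ᶠ t in 𝓝 a, f t = L.ext (γ a) (γ a) (f a) (γ t) := by
  rw [FiberBundle.continuousAt_totalSpace]
  obtain ⟨g, hg⟩ : ∃ g : A → Discr M, g = fun t => L.ext (γ a) (γ t) (f t) (γ a) := ⟨_, rfl⟩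
  have e : (fun t => ((trivializationAt (Discr M) L.core.Fiber (γ a)) (L.pt (γ t) (f t))).2) =
      g := by
    funext t
    rw [hg]
    change L.ext (γ a) (γ t) (L.ext (γ t) (γ t) (f t) (γ t)) (γ a) = _
    rw [ext_apply (L.mem_frame _)]
  have hfr : ∀ᶠ t in 𝓝 a, γ t ∈ L.frame (γ a) :=
    hγ.eventually ((L.isOpen_frame _).mem_nhds (L.mem_frame _))
  change ContinuousAt γ a ∧ ContinuousAt
    (fun t => ((trivializationAt (Discr M) L.core.Fiber (γ a)) (L.pt (γ t) (f t))).2) a ↔ _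
  rw [e, and_iff_right hγ, ContinuousAt, nhds_discrete (Discr M), tendsto_pure, hg]
  refine eventually_congr (hfr.mono fun t ht => ?_)
  change L.ext (γ a) (γ t) (f t) (γ a) = L.ext (γ a) (γ a) (f a) (γ a) ↔ _
  rw [ext_apply (L.mem_frame _)]
  constructor
  · intro h
    have := L.eqOn_frame (sol_ext ht (f t)) (sol_ext (L.mem_frame (γ a)) (f a)) (L.mem_frame (γ a))
      (by rw [h, ext_apply (L.mem_frame _)]) ht
    rwa [ext_apply ht] at this
  · intro h
    have := L.eqOn_frame (sol_ext ht (f t)) (sol_ext (L.mem_frame (γ a)) (f a)) ht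
      (by rw [ext_apply ht, h]) (L.mem_frame (γ a))
    rwa [ext_apply (L.mem_frame _)] at this

variable {L}

/-- `f` is a family of values of solutions along the curve `γ`. -/
def IsCont (L : LocalSystem X M) {A : Type*} [TopologicalSpace A] (γ : A → X) (f : A → M) : Prop :=
  ∀ a, ∃ V F, L.sol V F ∧ γ a ∈ V ∧ ∀ᶠ t in 𝓝 a, f t = F (γ t)

theorem isCont_iff {A : Type*} [TopologicalSpace A] {γ : A → X} (hγ : Continuous γ) {f : A → M} :
    L.IsCont γ f ↔ Continuous fun t => L.pt (γ t) (f t) := by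
  rw [continuous_iff_continuousAt]
  refine forall_congr' fun a => ?_
  rw [continuousAt_pt_iff L hγ.continuousAt]
  constructor
  · rintro ⟨V, F, h, ha, hf⟩
    have h1 := hγ.continuousAt.eventually (L.eventually_eq h
      (sol_ext (L.mem_frame (γ a)) (f a)) ha (L.mem_frame _)
      (by rw [ext_apply (L.mem_frame _), hf.self_of_nhds]))
    filter_upwards [h1, hf] with t h2 h3
    rw [h3, h2]
  · exact fun h => ⟨_, _, sol_ext (L.mem_frame (γ a)) (f a), L.mem_frame _, h⟩

theorem isCont_of_sol {A : Type*} [TopologicalSpace A] {γ : A → X} {V : Set X} {F : X → M}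
    (h : L.sol V F) (hγ : ∀ a, γ a ∈ V) : L.IsCont γ (fun t => F (γ t)) :=
  fun a => ⟨V, F, h, hγ a, .of_forall fun _ => rfl⟩

variable (L)

theorem existsUnique_isCont {x y : X} (p : Path x y) (v : M) :
    ∃! f : unitInterval → M, L.IsCont p f ∧ f 0 = v := by
  have cov := L.isCoveringMap
  have h0 : p.toContinuousMap 0 = L.core.proj (L.pt x v) := p.source
  have hlift := fun t => congrFun (cov.liftPath_lifts p.toContinuousMap (L.pt x v) h0) t
  refine ⟨fun t => L.val (cov.liftPath p.toContinuousMap (L.pt x v) h0 t), ⟨?_, ?_⟩, ?_⟩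
  · have hmk : ∀ t, L.pt (p t) (L.val (cov.liftPath p.toContinuousMap (L.pt x v) h0 t)) =
        cov.liftPath p.toContinuousMap (L.pt x v) h0 t := fun t => by
      rw [← show _ = p t from hlift t]; rfl
    rw [isCont_iff p.continuous]
    simp only [hmk]
    exact (cov.liftPath p.toContinuousMap (L.pt x v) h0).continuous
  · simp only [cov.liftPath_zero, val_pt]
  · rintro f ⟨hf, rfl⟩
    rw [isCont_iff p.continuous] at hf
    have := (cov.eq_liftPath_iff (Γ := fun t => L.pt (p t) (f t)) h0).mpr
      ⟨hf, rfl, by rw [p.source]⟩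
    funext t
    rw [← this, val_pt]

/-- Parallel transport along a homotopy class of paths. -/
def transport {x y : X} (γ : Path.Homotopic.Quotient x y) (v : M) : M :=
  L.val (L.isCoveringMap.monodromy γ ⟨L.pt x v, rfl⟩).1

theorem pt_transport {x y : X} (γ : Path.Homotopic.Quotient x y) (v : M) :
    (⟨L.pt y (L.transport γ v), rfl⟩ : L.core.proj ⁻¹' {y}) =
      L.isCoveringMap.monodromy γ ⟨L.pt x v, rfl⟩ := by
  unfold transport
  generalize L.isCoveringMap.monodromy γ ⟨L.pt x v, rfl⟩ = e
  obtain ⟨⟨z, u⟩, h⟩ := e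
  obtain rfl : z = y := h
  rfl

theorem transport_refl (x : X) (v : M) : L.transport (.refl x) v = v := by
  rw [transport, IsCoveringMap.monodromy_refl]; rfl

theorem transport_trans {x y z : X} (γ : Path.Homotopic.Quotient x y)
    (γ' : Path.Homotopic.Quotient y z) (v : M) :
    L.transport (γ.trans γ') v = L.transport γ' (L.transport γ v) := by
  rw [transport, IsCoveringMap.monodromy_trans_apply, ← pt_transport]; rfl

variable {L}

theorem IsCont.transport {x y : X} {p : Path x y} {f : unitInterval → M} (h : L.IsCont p f) :
    L.transport (Path.Homotopic.Quotient.mk p) (f 0) = f 1 := by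
  have h0 : p.toContinuousMap 0 = L.core.proj (L.pt x (f 0)) := p.source
  rw [isCont_iff p.continuous] at h
  have := (L.isCoveringMap.eq_liftPath_iff (Γ := fun t => L.pt (p t) (f t)) h0).mpr
      ⟨h, rfl, by rw [p.source]⟩
  change L.val (L.isCoveringMap.liftPath p.toContinuousMap (L.pt x (f 0)) h0 1) = _
  rw [← this, val_pt]

theorem transport_of_sol {x y : X} (p : Path x y) {V : Set X} {F : X → M} (h : L.sol V F)
    (hp : ∀ t, p t ∈ V) : L.transport (Path.Homotopic.Quotient.mk p) (F x) = F y := by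
  have := (isCont_of_sol h hp).transport
  rwa [p.source, p.target] at this

end LocalSystem

section System

variable {n m : ℕ} (d : Fin m → ℕ) (α : Fin m → ℂ) (M : Type*) [AddCommGroup M] [Module ℂ M]
  [Module (B n d) M]

variable {d α M} in
theorem IsKZSolution.mono {V V' : Set (Fin n → OnePoint ℂ)} {F : (Fin n → OnePoint ℂ) → M}
    (h : IsKZSolution d α V F) (hV : IsOpen V') (hs : V' ⊆ V) : IsKZSolution d α V' F :=
  ⟨hV, hs.trans h.subset, fun ε x hx i => h.deriv ε x (hs hx) i⟩

/-- The local system of solutions on the configuration space. -/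
def kzSystem [FiniteDimensional ℂ M] [IsScalarTower ℂ (B n d) M] : LocalSystem (Config α n) M where
  sol V F := ∃ G, IsKZSolution d α (Subtype.val '' V) G ∧ ∀ y ∈ V, G y.1 = F y
  isOpen := by
    rintro V F ⟨G, hG, -⟩
    rw [← preimage_image_eq V Subtype.val_injective]
    exact hG.isOpen.preimage continuous_subtype_val
  mono := by
    rintro V V' F ⟨G, hG, h⟩ hV hs
    exact ⟨G, hG.mono ((isOpen_configSet α n).isOpenMap_subtype_val V' hV) (image_mono hs),
      fun y hy => h y (hs hy)⟩
  exists_frame x O hO := by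
    obtain ⟨V, h1, h2, h3, h4, h5, h6⟩ := exists_frame (d := d) M x.2
      ((isOpen_configSet α n).isOpenMap_subtype_val.image_mem_nhds hO)
    have hV : Subtype.val '' (Subtype.val ⁻¹' V : Set (Config α n)) = V := by
      rw [Subtype.image_preimage_coe, inter_eq_right.mpr h4]
    refine ⟨Subtype.val ⁻¹' V, h1, fun y hy => ?_, h3.preimage continuous_subtype_val,
      fun y hy v => ?_, ?_⟩
    · obtain ⟨z, hz, e⟩ := h2 hy
      rwa [← Subtype.ext e]
    · obtain ⟨G, hG, e⟩ := h5 y.1 hy v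
      exact ⟨fun y => G y.1, ⟨G, by rwa [hV], fun _ _ => rfl⟩, e⟩
    · rintro F G ⟨F', hF, eF⟩ ⟨G', hG, eG⟩ y hy e z hz
      rw [hV] at hF hG
      rw [← eF z hz, ← eG z hz]
      exact h6 F' G' hF hG y.1 hy (by rw [eF y hy, eG y hy, e]) hz

variable [FiniteDimensional ℂ M] [IsScalarTower ℂ (B n d) M]

variable {d α M}

set_option linter.unusedSectionVars false

theorem kzSystem_sol {V : Set (Fin n → OnePoint ℂ)} {F : (Fin n → OnePoint ℂ) → M}
    (h : IsKZSolution d α V F) : (kzSystem d α M).sol (Subtype.val ⁻¹' V) (fun y => F y.1) :=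
  ⟨F, by rwa [Subtype.image_preimage_coe, inter_eq_right.mpr h.subset], fun _ _ => rfl⟩

theorem isKZContinuation_iff {x y : Config α n} (p : Path x y) (f : unitInterval → M) :
    IsKZContinuation d p f ↔ (kzSystem d α M).IsCont p f := by
  refine forall_congr' fun t => ⟨?_, ?_⟩
  · rintro ⟨V, F, h, ht, hf⟩
    exact ⟨_, _, kzSystem_sol h, ht, hf⟩
  · rintro ⟨V, F, ⟨G, hG, e⟩, ht, hf⟩
    refine ⟨_, G, hG, ⟨p t, ht, rfl⟩, ?_⟩
    have hV : IsOpen V := (kzSystem d α M).isOpen ⟨G, hG, e⟩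
    filter_upwards [hf, p.continuous.continuousAt.preimage_mem_nhds (hV.mem_nhds ht)] with s h1 h2
    rw [h1, e _ h2]

theorem existsUnique_isKZContinuation {x y : Config α n} (p : Path x y) (v : M) :
    ∃! f : unitInterval → M, IsKZContinuation d p f ∧ f 0 = v := by
  simp only [isKZContinuation_iff]
  exact (kzSystem d α M).existsUnique_isCont p v

/-- Continuations are preserved by linear maps that transform solutions into solutions. -/
theorem IsKZContinuation.map {N : Type*} [AddCommGroup N] [Module ℂ N] [Module (B n d) N]
    (g : M →ₗ[ℂ] N) (hg : ∀ (b : B n d) (v : M), g (b • v) = b • g v) {x y : Config α n}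
    {p : Path x y} {f : unitInterval → M} (h : IsKZContinuation d p f) :
    IsKZContinuation d p (fun t => g (f t)) := by
  intro t
  obtain ⟨V, F, hF, ht, e⟩ := h t
  refine ⟨V, fun y => g (F y), ⟨hF.isOpen, hF.subset, fun ε x hx i => ?_⟩, ht,
    e.mono fun s hs => by simp only [hs]⟩
  rw [← hg]
  exact (hF.deriv ε x hx i).comp_linearMap g

theorem IsKZContinuation.add_smul {x y : Config α n} {p : Path x y} {f f' : unitInterval → M}
    (h : IsKZContinuation d p f) (h' : IsKZContinuation d p f') (c : ℂ) :
    IsKZContinuation d p (fun t => f t + c • f' t) := by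
  intro t
  obtain ⟨V, F, hF, ht, e⟩ := h t
  obtain ⟨V', F', hF', ht', e'⟩ := h' t
  refine ⟨V ∩ V', fun y => F y + c • F' y, ⟨hF.isOpen.inter hF'.isOpen,
    inter_subset_left.trans hF.subset, fun ε x hx i => ?_⟩, ⟨ht, ht'⟩, ?_⟩
  · rw [smul_add, isScalarTower_symm_smul]
    exact (hF.deriv ε x hx.1 i).add ((hF'.deriv ε x hx.2 i).const_smul c)
  · filter_upwards [e, e'] with s h1 h2
    rw [h1, h2]

instance : ContinuousConstSMul (Equiv.Perm (Fin n)) (Config α n) where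
  continuous_const_smul σ := by
    have h : Continuous fun x : Config α n => fun i => x.1 (σ⁻¹ i) :=
      continuous_pi fun i => (continuous_apply (σ⁻¹ i)).comp continuous_subtype_val
    exact h.subtype_mk fun x => (σ • x).2

/-- The image of a path under a permutation of the points. -/
def permPath (σ : Equiv.Perm (Fin n)) {x y : Config α n} (p : Path x y) : Path (σ • x) (σ • y) :=
  p.map (continuous_const_smul σ)

theorem IsKZContinuation.perm (σ : Equiv.Perm (Fin n)) {x y : Config α n}
    {p : Path x y} {f : unitInterval → M} (h : IsKZContinuation d p f) :
    IsKZContinuation d (permPath σ p) (fun t => B.perm d σ • f t) := by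
  intro t
  obtain ⟨V, F, hF, ht, e⟩ := h t
  have hcont : Continuous fun (η : Fin n → OnePoint ℂ) i => η (σ i) :=
    continuous_pi fun i => continuous_apply (σ i)
  have hcomp : ∀ ε (x : Fin n → ℂ), (fun i => chart ε x (σ i)) =
      chart (fun i => ε (σ i)) (fun i => x (σ i)) := fun _ _ => rfl
  refine ⟨(fun η i => η (σ i)) ⁻¹' V, fun η => B.perm d σ • F (fun i => η (σ i)),
    ⟨hF.isOpen.preimage hcont, fun η hη => ?_, fun ε x hx i => ?_⟩, ?_, ?_⟩
  · obtain ⟨h1, h2⟩ := hF.subset hη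
    refine ⟨fun a b hab => ?_, fun i k hi => ?_⟩
    · have := @h1 (σ⁻¹ a) (σ⁻¹ b) (by simpa using hab)
      simpa using this
    · exact h2 (σ⁻¹ i) k (by simpa using hi)
  · have h1 := hF.deriv (fun i => ε (σ i)) (fun i => x (σ i)) hx (σ⁻¹ i)
    have h2 := h1.comp_linearMap (act M (B.perm d σ))
    have h3 := perm_mul_kzCoeff (d := d) (α := α) σ (fun i => ε (σ i)) (fun i => x (σ i)) (σ⁻¹ i)
    have hs : σ (σ⁻¹ i) = i := σ.apply_symm_apply i
    have hs' : ∀ p, σ (σ⁻¹ p) = p := σ.apply_symm_apply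
    simp only [hs'] at h3
    simp only [act_apply, ← mul_smul, h3, hs] at h2
    rw [← mul_smul]
    refine h2.congr (.of_forall fun y => ?_)
    rw [hcomp]
    congr 3
    funext j
    by_cases hj : σ j = i
    · subst hj; simp
    · have : j ≠ σ⁻¹ i := fun h => hj (by simp [h])
      rw [Function.update_of_ne hj, Function.update_of_ne this]
  · have : (fun i => (permPath σ p t).1 (σ i)) = (p t).1 := funext fun i => by
      change (p t).1 (σ⁻¹ (σ i)) = _
      simp
    rw [mem_preimage, this]; exact ht
  · refine e.mono fun s hs => ?_
    have : (fun i => (permPath σ p s).1 (σ i)) = (p s).1 := funext fun i => by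
      change (p s).1 (σ⁻¹ (σ i)) = _
      simp
    simp only [this, hs]

variable (d M)

/-- Parallel transport of solutions along a homotopy class of paths. -/
def kzTransport {x y : Config α n} (γ : Path.Homotopic.Quotient x y) : M →ₗ[ℂ] M where
  toFun := (kzSystem d α M).transport γ
  map_add' v w := by
    obtain ⟨p, rfl⟩ := Path.Homotopic.Quotient.mk_surjective γ
    obtain ⟨f, ⟨hf, rfl⟩, -⟩ := existsUnique_isKZContinuation (d := d) p v
    obtain ⟨g, ⟨hg, rfl⟩, -⟩ := existsUnique_isKZContinuation (d := d) p w
    have := ((isKZContinuation_iff _ _).mp (hf.add_smul hg 1)).transport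
    simp only [one_smul] at this
    rw [this, ((isKZContinuation_iff _ _).mp hf).transport,
      ((isKZContinuation_iff _ _).mp hg).transport]
  map_smul' c v := by
    obtain ⟨p, rfl⟩ := Path.Homotopic.Quotient.mk_surjective γ
    obtain ⟨f, ⟨hf, rfl⟩, -⟩ := existsUnique_isKZContinuation (d := d) p v
    have := ((isKZContinuation_iff _ _).mp (hf.add_smul hf (c - 1))).transport
    have e : ∀ v : M, v + (c - 1) • v = c • v := fun v => by rw [sub_smul, one_smul]; abel
    simp only [e] at this
    rw [this, ((isKZContinuation_iff _ _).mp hf).transport, RingHom.id_apply]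

variable {d M}

theorem IsKZContinuation.transport {x y : Config α n} {p : Path x y} {f : unitInterval → M}
    (h : IsKZContinuation d p f) : kzTransport d M (Path.Homotopic.Quotient.mk p) (f 0) = f 1 :=
  ((isKZContinuation_iff _ _).mp h).transport

theorem kzTransport_refl (x : Config α n) : kzTransport d M (.refl x) = LinearMap.id :=
  LinearMap.ext fun v => (kzSystem d α M).transport_refl x v

theorem kzTransport_trans {x y z : Config α n} (γ : Path.Homotopic.Quotient x y)
    (γ' : Path.Homotopic.Quotient y z) :
    kzTransport d M (γ.trans γ') = kzTransport d M γ' ∘ₗ kzTransport d M γ :=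
  LinearMap.ext fun v => (kzSystem d α M).transport_trans γ γ' v

theorem kzTransport_symm_comp {x y : Config α n} (γ : Path.Homotopic.Quotient x y) :
    kzTransport d M γ.symm ∘ₗ kzTransport d M γ = LinearMap.id := by
  rw [← kzTransport_trans, Path.Homotopic.Quotient.trans_symm, kzTransport_refl]

theorem kzTransport_map {N : Type*} [AddCommGroup N] [Module ℂ N] [Module (B n d) N]
    [FiniteDimensional ℂ N] [IsScalarTower ℂ (B n d) N]
    (g : M →ₗ[ℂ] N) (hg : ∀ (b : B n d) (v : M), g (b • v) = b • g v) {x y : Config α n}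
    (γ : Path.Homotopic.Quotient x y) (v : M) :
    g (kzTransport d M γ v) = kzTransport d N γ (g v) := by
  obtain ⟨p, rfl⟩ := Path.Homotopic.Quotient.mk_surjective γ
  obtain ⟨f, ⟨hf, rfl⟩, -⟩ := existsUnique_isKZContinuation (d := d) p v
  rw [hf.transport, (hf.map g hg).transport]

theorem kzTransport_perm (σ : Equiv.Perm (Fin n)) {x y : Config α n} (p : Path x y) (v : M) :
    kzTransport d M (Path.Homotopic.Quotient.mk (permPath σ p)) (B.perm d σ • v) =
      B.perm d σ • kzTransport d M (Path.Homotopic.Quotient.mk p) v := by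
  obtain ⟨f, ⟨hf, rfl⟩, -⟩ := existsUnique_isKZContinuation (d := d) p v
  rw [hf.transport, (hf.perm σ).transport]

end System

section Braid

variable {n m : ℕ} {d : Fin m → ℕ} {α : Fin m → ℂ}

instance : LocallyCompactSpace (Config α n) := (isOpen_configSet α n).locallyCompactSpace

instance : IsCancelSMul (Equiv.Perm (Fin n)) (Config α n) where
  right_cancel' σ τ x h := by
    have h1 : ∀ i, σ⁻¹ i = τ⁻¹ i := fun i => x.2.1 (congrFun (congrArg Subtype.val h) i)
    exact inv_injective (Equiv.ext h1)

variable (n α) in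
theorem isQuotientCoveringMap_toUConfig :
    IsQuotientCoveringMap (toUConfig α n) (Equiv.Perm (Fin n)) :=
  isQuotientCoveringMap_quotientMk_of_properlyDiscontinuousSMul

theorem toUConfig_smul (σ : Equiv.Perm (Fin n)) (x : Config α n) :
    toUConfig α n (σ • x) = toUConfig α n x := (isQuotientCoveringMap_toUConfig n α).map_smul σ

theorem braidClass_eq {x y : Config α n} (p : Path x y) (h : ∃ σ : Equiv.Perm (Fin n), y = σ • x)
    (h' : toUConfig α n x = toUConfig α n y) :
    braidClass p h = ((Path.Homotopic.Quotient.mk p).map (toUConfig α n)).cast rfl h' := rfl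

theorem exists_braidClass {x : Config α n} (g : BraidGroup α x) :
    ∃ (σ : Equiv.Perm (Fin n)) (p : Path x (σ • x)), g = braidClass p ⟨σ, rfl⟩ := by
  have cov := (isQuotientCoveringMap_toUConfig n α).isCoveringMap
  obtain ⟨γ, rfl⟩ := Path.Homotopic.Quotient.mk_surjective g
  have h0 : γ.toContinuousMap 0 = toUConfig α n x := γ.source
  have hl := fun t => congrFun (cov.liftPath_lifts γ.toContinuousMap x h0) t
  have h1 : toUConfig α n (cov.liftPath γ.toContinuousMap x h0 1) = toUConfig α n x :=
    (hl 1).trans γ.target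
  obtain ⟨σ, hσ⟩ := (isQuotientCoveringMap_toUConfig n α).apply_eq_iff_mem_orbit.mp h1
  refine ⟨σ, ⟨cov.liftPath γ.toContinuousMap x h0, cov.liftPath_zero .., hσ.symm⟩, ?_⟩
  refine congrArg Path.Homotopic.Quotient.mk ?_
  ext t
  exact (hl t).symm

theorem braidClass_inj {x : Config α n} {σ τ : Equiv.Perm (Fin n)} {p : Path x (σ • x)}
    {q : Path x (τ • x)} (h : braidClass p ⟨σ, rfl⟩ = braidClass q ⟨τ, rfl⟩) :
    ∃ e : σ = τ, Path.Homotopic.Quotient.mk p = (Path.Homotopic.Quotient.mk q).cast rfl (by rw [e]) := by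
  have cov := (isQuotientCoveringMap_toUConfig n α).isCoveringMap
  have key : ∀ (ρ : Equiv.Perm (Fin n)) (r : Path x (ρ • x)),
      (cov.monodromy (braidClass r ⟨ρ, rfl⟩) ⟨x, rfl⟩).1 = ρ • x := by
    intro ρ r
    have := cov.monodromy_map (Path.Homotopic.Quotient.mk r)
    exact congrArg Subtype.val (cov.monodromy_eq_of_map_eq (ey := ⟨ρ • x, toUConfig_smul ρ x⟩)
      (Path.Homotopic.Quotient.mk r) rfl)
  have e : σ = τ := by
    refine IsCancelSMul.right_cancel' σ τ x ?_
    rw [← key σ p, ← key τ q, h]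
  subst e
  refine ⟨rfl, ?_⟩
  refine cov.injective_path_homotopic_map _ _ ?_
  change (Path.Homotopic.Quotient.mk p).map (toUConfig α n) =
    (Path.Homotopic.Quotient.mk q).map (toUConfig α n)
  have h' := congrArg (fun z : Path.Homotopic.Quotient (toUConfig α n x) (toUConfig α n x) =>
    z.cast rfl (toUConfig_smul σ x)) h
  simpa only [braidClass_eq _ _ (toUConfig_smul σ x).symm, Path.Homotopic.Quotient.cast_cast,
    Path.Homotopic.Quotient.cast_rfl_rfl] using h'

theorem braidClass_mul {x : Config α n} {σ τ : Equiv.Perm (Fin n)} (p : Path x (σ • x))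
    (q : Path x (τ • x)) :
    braidClass p ⟨σ, rfl⟩ * braidClass q ⟨τ, rfl⟩ =
      braidClass (y := (τ * σ) • x) (q.trans (permPath τ p)) ⟨τ * σ, rfl⟩ := by
  rw [FundamentalGroup.mul_def]
  refine congrArg Path.Homotopic.Quotient.mk ?_
  ext t
  have hq : ∀ s, toUConfig α n (permPath τ p s) = toUConfig α n (p s) := fun s =>
    toUConfig_smul τ (p s)
  simp only [Path.cast_coe, Path.map_coe, Function.comp_apply]
  refine Eq.trans ?_ (congrArg (toUConfig α n) (Path.trans_apply q (permPath τ p) t).symm)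
  refine (Path.trans_apply _ _ t).trans ?_
  split_ifs
  · rfl
  · exact (hq _).symm

variable (M : Type*) [AddCommGroup M] [Module ℂ M] [Module (B n d) M] [FiniteDimensional ℂ M]
  [IsScalarTower ℂ (B n d) M]

variable (d) in
/-- The operator of monodromy along a path of configurations that becomes a loop. -/
def kzLoop (σ : Equiv.Perm (Fin n)) {x y : Config α n} (γ : Path.Homotopic.Quotient x y) :
    Module.End ℂ M := act M (B.perm d σ⁻¹) ∘ₗ kzTransport d M γ

theorem kzLoop_eq_of_braidClass_eq {x : Config α n} {σ τ : Equiv.Perm (Fin n)}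
    {p : Path x (σ • x)} {q : Path x (τ • x)}
    (h : braidClass p ⟨σ, rfl⟩ = braidClass q ⟨τ, rfl⟩) :
    kzLoop d M σ (Path.Homotopic.Quotient.mk p) = kzLoop d M τ (Path.Homotopic.Quotient.mk q) := by
  obtain ⟨rfl, e⟩ := braidClass_inj h
  rw [e, Path.Homotopic.Quotient.cast_rfl_rfl]

variable (d) in
theorem exists_kzLoop {x : Config α n} (g : BraidGroup α x) :
    ∃ T : Module.End ℂ M, ∀ (σ : Equiv.Perm (Fin n)) (p : Path x (σ • x)),
      g = braidClass p ⟨σ, rfl⟩ → T = kzLoop d M σ (Path.Homotopic.Quotient.mk p) := by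
  obtain ⟨σ, p, rfl⟩ := exists_braidClass g
  exact ⟨_, fun τ q h => kzLoop_eq_of_braidClass_eq M h⟩

variable (d) in
/-- The operator of monodromy of an element of the braid group. -/
def kzOp {x : Config α n} (g : BraidGroup α x) : Module.End ℂ M := (exists_kzLoop d M g).choose

theorem kzOp_braidClass {x : Config α n} (σ : Equiv.Perm (Fin n)) (p : Path x (σ • x)) :
    kzOp d M (braidClass p ⟨σ, rfl⟩) = kzLoop d M σ (Path.Homotopic.Quotient.mk p) :=
  (exists_kzLoop d M _).choose_spec σ p rfl

theorem kzOp_one (x : Config α n) : kzOp d M (1 : BraidGroup α x) = 1 := by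
  have h := kzOp_braidClass (d := d) M (1 : Equiv.Perm (Fin n)) (Path.refl x : Path x ((1 : Equiv.Perm (Fin n)) • x))
  refine h.trans (LinearMap.ext fun v => ?_)
  have h2 : kzTransport d M (Path.Homotopic.Quotient.mk (Path.refl x)) v = v := by
    rw [Path.Homotopic.Quotient.mk_refl, kzTransport_refl]; rfl
  change (B.perm d 1⁻¹ : B n d) • kzTransport d M (Path.Homotopic.Quotient.mk (Path.refl x)) v = v
  rw [h2, inv_one, B.perm_one, one_smul]

theorem kzOp_mul {x : Config α n} (g h : BraidGroup α x) :
    kzOp d M (g * h) = kzOp d M g * kzOp d M h := by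
  obtain ⟨σ, p, rfl⟩ := exists_braidClass g
  obtain ⟨τ, q, rfl⟩ := exists_braidClass h
  rw [braidClass_mul]
  refine (kzOp_braidClass M (τ * σ) (q.trans (permPath τ p))).trans ?_
  rw [kzOp_braidClass, kzOp_braidClass]
  ext v
  change B.perm d (τ * σ)⁻¹ • kzTransport d M (Path.Homotopic.Quotient.mk (q.trans (permPath τ p))) v =
    B.perm d σ⁻¹ • kzTransport d M (Path.Homotopic.Quotient.mk p)
      (B.perm d τ⁻¹ • kzTransport d M (Path.Homotopic.Quotient.mk q) v)
  rw [Path.Homotopic.Quotient.mk_trans, kzTransport_trans, LinearMap.comp_apply]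
  set u := kzTransport d M (Path.Homotopic.Quotient.mk q) v
  have h1 : u = (B.perm d τ : B n d) • (B.perm d τ⁻¹ : B n d) • u := by
    rw [← mul_smul, B.perm_mul_inv, one_smul]
  conv_lhs => rw [h1, kzTransport_perm]
  rw [mul_inv_rev, B.perm_mul, mul_smul, ← mul_smul (B.perm d τ⁻¹) (B.perm d τ), B.perm_inv_mul,
    one_smul]

variable (d) in
/-- The monodromy representation, with values in the endomorphisms. -/
def kzMonodromyEnd (x : Config α n) : BraidGroup α x →* Module.End ℂ M where
  toFun := kzOp d M
  map_one' := kzOp_one M x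
  map_mul' := kzOp_mul M

variable (d) in
/-- The monodromy representation. -/
def kzMonodromy (x : Config α n) : BraidGroup α x →* (M ≃ₗ[ℂ] M) :=
  (LinearMap.GeneralLinearGroup.generalLinearEquiv ℂ M).toMonoidHom.comp
    (kzMonodromyEnd d M x).toHomUnits

theorem kzMonodromy_apply (x : Config α n) (g : BraidGroup α x) (v : M) :
    kzMonodromy d M x g v = kzOp d M g v := rfl

theorem isKZMonodromy_kzMonodromy (x : Config α n) : IsKZMonodromy d x (kzMonodromy d M x) := by
  intro σ p f hf
  rw [kzMonodromy_apply, kzOp_braidClass, ← hf.transport]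
  rfl

theorem existsUnique_isKZMonodromy (x : Config α n) :
    ∃! ρ : BraidGroup α x →* (M ≃ₗ[ℂ] M), IsKZMonodromy d x ρ := by
  refine ⟨kzMonodromy d M x, isKZMonodromy_kzMonodromy M x, fun ρ hρ => ?_⟩
  ext g v
  obtain ⟨σ, p, rfl⟩ := exists_braidClass g
  obtain ⟨f, ⟨hf, rfl⟩, -⟩ := existsUnique_isKZContinuation (d := d) p v
  rw [hρ σ p f hf, isKZMonodromy_kzMonodromy M x σ p f hf]

end Braid

section Chart

variable {n m : ℕ} {d : Fin m → ℕ} {α : Fin m → ℂ} {ε : Fin n → Bool}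

theorem isEmbedding_chart (ε : Fin n → Bool) : IsEmbedding (chart ε) :=
  (IsOpenEmbedding.of_continuous_injective_isOpenMap (continuous_chart ε) (chart_injective ε)
    (isOpenMap_chart ε)).isEmbedding

/-- Two paths with the same ends in a convex subset of a chart are homotopic. -/
theorem homotopic_of_convex {C : Set (Fin n → ℂ)} (hC : Convex ℝ C) (hsub : C ⊆ chartDomain α ε)
    {x y : Config α n} {p q : Path x y} (hp : ∀ t, ∃ a ∈ C, chart ε a = (p t).1)
    (hq : ∀ t, ∃ a ∈ C, chart ε a = (q t).1) :
    Path.Homotopic.Quotient.mk p = Path.Homotopic.Quotient.mk q := by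
  choose a ha ea using hp
  choose b hb eb using hq
  have lift : ∀ (r : Path x y) (c : unitInterval → Fin n → ℂ), (∀ t, chart ε (c t) = (r t).1) →
      Continuous c := fun r c h => by
    rw [(isEmbedding_chart ε).continuous_iff]
    have : chart ε ∘ c = fun t => (r t).1 := funext h
    rw [this]
    exact continuous_subtype_val.comp r.continuous
  have hac := lift p a ea
  have hbc := lift q b eb
  have h0 : b 0 = a 0 := chart_injective ε (by rw [ea, eb, p.source, q.source])
  have h1 : b 1 = a 1 := chart_injective ε (by rw [ea, eb, p.target, q.target])
  let F : C → Config α n := fun c => ⟨chart ε c.1, hsub c.2⟩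
  have hF : Continuous F := ((continuous_chart ε).comp continuous_subtype_val).subtype_mk _
  let P : Path (⟨a 0, ha 0⟩ : C) ⟨a 1, ha 1⟩ := ⟨⟨fun t => ⟨a t, ha t⟩, hac.subtype_mk _⟩, rfl, rfl⟩
  let Q : Path (⟨a 0, ha 0⟩ : C) ⟨a 1, ha 1⟩ := ⟨⟨fun t => ⟨b t, hb t⟩, hbc.subtype_mk _⟩,
    Subtype.ext h0, Subtype.ext h1⟩
  have : ContractibleSpace C := hC.contractibleSpace ⟨a 0, ha 0⟩
  have hPQ : P.Homotopic Q := SimplyConnectedSpace.paths_homotopic P Q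
  have hx : x = F ⟨a 0, ha 0⟩ := Subtype.ext (by rw [← p.source]; exact (ea 0).symm)
  have hy : y = F ⟨a 1, ha 1⟩ := Subtype.ext (by rw [← p.target]; exact (ea 1).symm)
  have h2 := (hPQ.map ⟨F, hF⟩).pathCast hx hy
  rw [Path.Homotopic.Quotient.eq]
  convert h2 using 1
  · ext1; funext t; exact Subtype.ext (ea t).symm
  · ext1; funext t; exact Subtype.ext (eb t).symm

/-- The straight path between two points of a chart. -/
def segPath {a b : Fin n → ℂ} (h : segment ℝ a b ⊆ chartDomain α ε) :
    Path (⟨chart ε a, h (left_mem_segment ℝ a b)⟩ : Config α n)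
      ⟨chart ε b, h (right_mem_segment ℝ a b)⟩ where
  toFun t := ⟨chart ε (AffineMap.lineMap a b (t : ℝ)), h (by
    rw [segment_eq_image_lineMap]; exact ⟨t, t.2, rfl⟩)⟩
  continuous_toFun := ((continuous_chart ε).comp
    ((AffineMap.lineMap_continuous (R := ℝ)).comp continuous_subtype_val)).subtype_mk _
  source' := Subtype.ext (by simp)
  target' := Subtype.ext (by simp)

theorem segPath_mem {a b : Fin n → ℂ} (h : segment ℝ a b ⊆ chartDomain α ε) (t : unitInterval) :
    ∃ c ∈ segment ℝ a b, chart ε c = (segPath h t).1 :=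
  ⟨AffineMap.lineMap a b (t : ℝ), by rw [segment_eq_image_lineMap]; exact ⟨t, t.2, rfl⟩, rfl⟩

variable (d α) (M : Type*) [AddCommGroup M] [Module ℂ M] [Module (B n d) M]
  [FiniteDimensional ℂ M] [IsScalarTower ℂ (B n d) M]

open Classical in
/-- Parallel transport along the straight path between two points of a chart. -/
def trC (ε : Fin n → Bool) (a b : Fin n → ℂ) : Module.End ℂ M :=
  if h : segment ℝ a b ⊆ chartDomain α ε then
    kzTransport d M (Path.Homotopic.Quotient.mk (segPath h)) else 1

variable {d α M}

theorem kzTransport_eq_trC {C : Set (Fin n → ℂ)} (hC : Convex ℝ C) (hsub : C ⊆ chartDomain α ε)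
    {x y : Config α n} {p : Path x y} {a b : Fin n → ℂ} (ha : a ∈ C) (hb : b ∈ C)
    (hxa : x.1 = chart ε a) (hyb : y.1 = chart ε b) (hp : ∀ t, ∃ c ∈ C, chart ε c = (p t).1) :
    kzTransport d M (Path.Homotopic.Quotient.mk p) = trC d α M ε a b := by
  have hs : segment ℝ a b ⊆ C := hC.segment_subset ha hb
  obtain rfl : x = ⟨chart ε a, hsub ha⟩ := Subtype.ext hxa
  obtain rfl : y = ⟨chart ε b, hsub hb⟩ := Subtype.ext hyb
  rw [trC, dif_pos (hs.trans hsub), homotopic_of_convex hC hsub (q := segPath (hs.trans hsub)) hp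
    fun t => (segPath_mem _ t).imp fun c hc => ⟨hs hc.1, hc.2⟩]

theorem trC_trans {C : Set (Fin n → ℂ)} (hC : Convex ℝ C) (hsub : C ⊆ chartDomain α ε)
    {a b c : Fin n → ℂ} (ha : a ∈ C) (hb : b ∈ C) (hc : c ∈ C) :
    trC d α M ε b c * trC d α M ε a b = trC d α M ε a c := by
  have hab := (hC.segment_subset ha hb).trans hsub
  have hbc := (hC.segment_subset hb hc).trans hsub
  rw [← kzTransport_eq_trC (p := (segPath hab).trans (segPath hbc)) hC hsub ha hc rfl rfl,
    Path.Homotopic.Quotient.mk_trans, kzTransport_trans, trC, trC, dif_pos hab, dif_pos hbc]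
  · rfl
  · intro t
    rw [Path.trans_apply]
    split_ifs
    · exact (segPath_mem hab _).imp fun c h => ⟨hC.segment_subset ha hb h.1, h.2⟩
    · exact (segPath_mem hbc _).imp fun c h => ⟨hC.segment_subset hb hc h.1, h.2⟩

theorem trC_self {a : Fin n → ℂ} (ha : a ∈ chartDomain α ε) : trC d α M ε a a = 1 := by
  have h := kzTransport_eq_trC (d := d) (M := M) (p := Path.refl (⟨chart ε a, ha⟩ : Config α n))
    (convex_singleton a) (singleton_subset_iff.mpr ha) rfl rfl rfl rfl
    (fun t => ⟨a, rfl, rfl⟩)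
  rw [← h, Path.Homotopic.Quotient.mk_refl, kzTransport_refl]; rfl

/-- Splitting a path in two halves each of which is contained in a convex subset of a chart. -/
theorem kzTransport_eq_trC_mul {C C' : Set (Fin n → ℂ)} (hC : Convex ℝ C)
    (hsub : C ⊆ chartDomain α ε) (hC' : Convex ℝ C') (hsub' : C' ⊆ chartDomain α ε)
    {x y : Config α n} {p : Path x y} {a b c : Fin n → ℂ} (ha : a ∈ C) (hb : b ∈ C)
    (hb' : b ∈ C') (hc : c ∈ C') (hxa : x.1 = chart ε a) (hyc : y.1 = chart ε c)
    (hpb : ∀ t : unitInterval, (t : ℝ) = 1 / 2 → (p t).1 = chart ε b)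
    (hp : ∀ t : unitInterval, (t : ℝ) ≤ 1 / 2 → ∃ c ∈ C, chart ε c = (p t).1)
    (hp' : ∀ t : unitInterval, 1 / 2 ≤ (t : ℝ) → ∃ c ∈ C', chart ε c = (p t).1) :
    kzTransport d M (Path.Homotopic.Quotient.mk p) = trC d α M ε b c * trC d α M ε a b := by
  have h1 : ∀ t : unitInterval, (t : ℝ) / 2 ∈ unitInterval := fun t =>
    ⟨by linarith [t.2.1], by linarith [t.2.2]⟩
  have h2 : ∀ t : unitInterval, (1 + (t : ℝ)) / 2 ∈ unitInterval := fun t =>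
    ⟨by linarith [t.2.1], by linarith [t.2.2]⟩
  let p₁ : Path x ⟨chart ε b, hsub hb⟩ :=
    { toFun := fun t => p ⟨t / 2, h1 t⟩
      continuous_toFun := p.continuous.comp (by fun_prop)
      source' := by
        refine Eq.trans (congrArg p (Subtype.ext ?_)) p.source
        simp
      target' := by
        refine Subtype.ext (hpb _ ?_); simp }
  let p₂ : Path (⟨chart ε b, hsub hb⟩ : Config α n) y :=
    { toFun := fun t => p ⟨(1 + t) / 2, h2 t⟩
      continuous_toFun := p.continuous.comp (by fun_prop)
      source' := by
        refine Subtype.ext (hpb _ ?_); simp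
      target' := by
        refine Eq.trans (congrArg p (Subtype.ext ?_)) p.target
        simp }
  have e : p = p₁.trans p₂ := by
    ext1; funext t
    rw [Path.trans_apply]
    split_ifs with h
    · change p t = p ⟨2 * t / 2, _⟩
      congr 1; ext; simp
    · change p t = p ⟨(1 + (2 * t - 1)) / 2, _⟩
      congr 1; ext; simp
  rw [e, Path.Homotopic.Quotient.mk_trans, kzTransport_trans,
    kzTransport_eq_trC (p := p₁) hC hsub ha hb hxa rfl,
    kzTransport_eq_trC (p := p₂) hC' hsub' hb' hc rfl hyc]
  · rfl
  · intro t
    exact hp' ⟨(1 + t) / 2, h2 t⟩ (by simp only; linarith [t.2.1])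
  · intro t
    exact hp ⟨t / 2, h1 t⟩ (by simp only; linarith [t.2.2])

theorem trC_perm (σ : Equiv.Perm (Fin n)) {C : Set (Fin n → ℂ)} (hC : Convex ℝ C)
    (hsub : C ⊆ chartDomain α ε) {a b : Fin n → ℂ} (ha : a ∈ C) (hb : b ∈ C) :
    trC d α M (fun i => ε (σ⁻¹ i)) (fun i => a (σ⁻¹ i)) (fun i => b (σ⁻¹ i)) * act M (B.perm d σ) =
      act M (B.perm d σ) * trC d α M ε a b := by
  have hab := (hC.segment_subset ha hb).trans hsub
  let L : (Fin n → ℂ) →ₗ[ℝ] (Fin n → ℂ) := LinearMap.funLeft ℝ ℂ (⇑(σ⁻¹ : Equiv.Perm (Fin n)))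
  have h := kzTransport_eq_trC (d := d) (M := M) (ε := fun i => ε (σ⁻¹ i)) (C := L '' C)
    (p := permPath σ (segPath hab)) (a := L a) (b := L b) (hC.linear_image L) (by
      rintro _ ⟨c, hc, rfl⟩
      exact (σ • (⟨chart ε c, hsub hc⟩ : Config α n)).2) ⟨a, ha, rfl⟩ ⟨b, hb, rfl⟩ rfl rfl (by
      intro t
      obtain ⟨c, h1, h2⟩ := segPath_mem hab t
      refine ⟨L c, ⟨c, hC.segment_subset ha hb h1, rfl⟩, ?_⟩
      funext i
      exact congrFun h2 (σ⁻¹ i))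
  ext v
  have h2 := kzTransport_perm (d := d) (M := M) σ (segPath hab) v
  rw [h] at h2
  refine h2.trans ?_
  rw [Module.End.mul_apply, act_apply, trC, dif_pos hab]

theorem trC_map {N : Type*} [AddCommGroup N] [Module ℂ N] [Module (B n d) N]
    [FiniteDimensional ℂ N] [IsScalarTower ℂ (B n d) N]
    (g : M →ₗ[ℂ] N) (hg : ∀ (b : B n d) (v : M), g (b • v) = b • g v) (a b : Fin n → ℂ) (v : M) :
    g (trC d α M ε a b v) = trC d α N ε a b (g v) := by
  unfold trC
  split_ifs
  · exact kzTransport_map g hg _ _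
  · rfl

/-- The change of charts for straight paths. -/
theorem trC_eq_trC {ε' : Fin n → Bool} {C' : Set (Fin n → ℂ)} (hC' : Convex ℝ C')
    (hsub' : C' ⊆ chartDomain α ε') {a b a' b' : Fin n → ℂ}
    (hab : segment ℝ a b ⊆ chartDomain α ε) (ha' : a' ∈ C') (hb' : b' ∈ C')
    (ea : chart ε a = chart ε' a') (eb : chart ε b = chart ε' b')
    (h : ∀ c ∈ segment ℝ a b, ∃ c' ∈ C', chart ε' c' = chart ε c) :
    trC d α M ε a b = trC d α M ε' a' b' := by
  rw [← kzTransport_eq_trC (p := segPath hab) hC' hsub' ha' hb' ea eb, trC, dif_pos hab]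
  intro t
  obtain ⟨c, h1, h2⟩ := segPath_mem hab t
  rw [← h2]
  exact h c h1

end Chart

section Separation

variable {n m : ℕ} {d : Fin m → ℕ} {α : Fin m → ℂ}

/-- A real linear form on `ℂ`. -/
def lin (a b : ℝ) (z : ℂ) : ℝ := a * z.re + b * z.im

theorem lin_add (a b : ℝ) (z w : ℂ) : lin a b (z + w) = lin a b z + lin a b w := by
  simp [lin]; ring

theorem lin_sub (a b : ℝ) (z w : ℂ) : lin a b (z - w) = lin a b z - lin a b w := by
  simp [lin]; ring

theorem lin_smul (a b c : ℝ) (z : ℂ) : lin a b (c • z) = c * lin a b z := by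
  simp [lin]; ring

/-- A criterion for the convex hull of a set to be contained in the configuration space: for any
two of the points, linear forms separate their positions. -/
def Sep (α : Fin m → ℂ) (S : Set (Fin n → ℂ)) : Prop :=
  (∀ i j, i < j → ∃ a b, ∀ x ∈ S, 0 < lin a b (x j - x i)) ∧
    ∀ i l, ∃ a b, ∀ x ∈ S, 0 < lin a b (x i - α l)

theorem mem_chartDomain_finite {x : Fin n → ℂ} :
    x ∈ chartDomain α (fun _ => false) ↔ Function.Injective x ∧ ∀ i k, x i ≠ α k := by
  simp [chartDomain, configSet, chart, toSphere, Function.Injective]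

theorem Sep.subset {S : Set (Fin n → ℂ)} (h : Sep α S) :
    convexHull ℝ S ⊆ chartDomain α (fun _ => false) := by
  obtain ⟨h1, h2⟩ := h
  have key : ∀ i j, i < j → ∀ x ∈ convexHull ℝ S, x i ≠ x j := by
    intro i j hij x hx e
    obtain ⟨a, b, h⟩ := h1 i j hij
    have hconv : Convex ℝ {x : Fin n → ℂ | 0 < lin a b (x j - x i)} := by
      intro x hx y hy s t hs ht hst
      simp only [mem_ofPred_eq, lin_sub, Pi.add_apply, Pi.smul_apply, lin_add, lin_smul] at hx hy ⊢
      rcases eq_or_lt_of_le hs with rfl | hs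
      · obtain rfl : t = 1 := by linarith
        linarith
      · nlinarith [mul_pos hs (sub_pos.mpr hx), mul_nonneg ht (sub_nonneg.mpr hy.le), hx, hy]
    have : 0 < lin a b (x j - x i) := convexHull_min h hconv hx
    simp [lin, e] at this
  refine fun x hx => mem_chartDomain_finite.mpr ⟨fun i j e => ?_, fun i l e => ?_⟩
  · rcases lt_trichotomy i j with hij | hij | hij
    · exact absurd e (key i j hij x hx)
    · exact hij
    · exact absurd e.symm (key j i hij x hx)
  · obtain ⟨a, b, h⟩ := h2 i l
    have hconv : Convex ℝ {x : Fin n → ℂ | 0 < lin a b (x i - α l)} := by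
      intro x hx y hy s t hs ht hst
      simp only [mem_ofPred_eq, lin_sub, Pi.add_apply, Pi.smul_apply, lin_add, lin_smul] at hx hy ⊢
      have : lin a b (α l) = (s + t) * lin a b (α l) := by rw [hst, one_mul]
      rw [this]
      rcases eq_or_lt_of_le hs with rfl | hs
      · obtain rfl : t = 1 := by linarith
        linarith
      · nlinarith [mul_pos hs (sub_pos.mpr hx), mul_nonneg ht (sub_nonneg.mpr hy.le), hx, hy]
    have : 0 < lin a b (x i - α l) := convexHull_min h hconv hx
    simp [lin, e] at this

variable (d α) (M : Type*) [AddCommGroup M] [Module ℂ M] [Module (B n d) M]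
  [FiniteDimensional ℂ M] [IsScalarTower ℂ (B n d) M]

/-- Parallel transport along the straight path between two configurations of finite points. -/
abbrev tr (a b : Fin n → ℂ) : Module.End ℂ M := trC d α M (fun _ => false) a b

variable {d α M} {S S' : Set (Fin n → ℂ)}

theorem Sep.mono (hS : Sep α S) (h : S' ⊆ S) : Sep α S' :=
  ⟨fun i j hij => (hS.1 i j hij).imp fun _ => Exists.imp fun _ H x hx => H x (h hx),
    fun i l => (hS.2 i l).imp fun _ => Exists.imp fun _ H x hx => H x (h hx)⟩

theorem Sep.tr_trans (hS : Sep α S) {a b c : Fin n → ℂ} (ha : a ∈ S) (hb : b ∈ S) (hc : c ∈ S) :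
    tr d α M b c * tr d α M a b = tr d α M a c :=
  trC_trans (convex_convexHull ℝ S) hS.subset (subset_convexHull ℝ S ha) (subset_convexHull ℝ S hb)
    (subset_convexHull ℝ S hc)

theorem Sep.tr_self (hS : Sep α S) {a : Fin n → ℂ} (ha : a ∈ S) : tr d α M a a = 1 :=
  trC_self (hS.subset (subset_convexHull ℝ S ha))

theorem Sep.tr_mul_tr (hS : Sep α S) {a b : Fin n → ℂ} (ha : a ∈ S) (hb : b ∈ S) :
    tr d α M b a * tr d α M a b = 1 := by
  rw [hS.tr_trans ha hb ha, hS.tr_self ha]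

theorem Sep.tr_square (hS : Sep α S) {a b b' c : Fin n → ℂ} (ha : a ∈ S) (hb : b ∈ S)
    (hb' : b' ∈ S) (hc : c ∈ S) :
    tr d α M b c * tr d α M a b = tr d α M b' c * tr d α M a b' := by
  rw [hS.tr_trans ha hb hc, hS.tr_trans ha hb' hc]

theorem Sep.tr_perm (hS : Sep α S) (σ : Equiv.Perm (Fin n)) {a b : Fin n → ℂ} (ha : a ∈ S)
    (hb : b ∈ S) :
    tr d α M (fun i => a (σ⁻¹ i)) (fun i => b (σ⁻¹ i)) * act M (B.perm d σ) =
      act M (B.perm d σ) * tr d α M a b :=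
  trC_perm σ (convex_convexHull ℝ S) hS.subset (subset_convexHull ℝ S ha) (subset_convexHull ℝ S hb)

theorem Sep.kzTransport_eq (hS : Sep α S) {x y : Config α n} {p : Path x y} {a b : Fin n → ℂ}
    (ha : a ∈ S) (hb : b ∈ S) (hxa : x.1 = chart (fun _ => false) a)
    (hyb : y.1 = chart (fun _ => false) b) (hp : ∀ t, ∃ c ∈ S, chart (fun _ => false) c = (p t).1) :
    kzTransport d M (Path.Homotopic.Quotient.mk p) = tr d α M a b :=
  kzTransport_eq_trC (convex_convexHull ℝ S) hS.subset (subset_convexHull ℝ S ha)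
    (subset_convexHull ℝ S hb) hxa hyb fun t =>
      (hp t).imp fun _ h => ⟨subset_convexHull ℝ S h.1, h.2⟩

theorem Sep.kzTransport_eq_mul (hS : Sep α S) (hS' : Sep α S') {x y : Config α n} {p : Path x y}
    {a b c : Fin n → ℂ} (ha : a ∈ S) (hb : b ∈ S) (hb' : b ∈ S') (hc : c ∈ S')
    (hxa : x.1 = chart (fun _ => false) a) (hyc : y.1 = chart (fun _ => false) c)
    (hpb : ∀ t : unitInterval, (t : ℝ) = 1 / 2 → (p t).1 = chart (fun _ => false) b)
    (hp : ∀ t : unitInterval, (t : ℝ) ≤ 1 / 2 → ∃ c ∈ S, chart (fun _ => false) c = (p t).1)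
    (hp' : ∀ t : unitInterval, 1 / 2 ≤ (t : ℝ) → ∃ c ∈ S', chart (fun _ => false) c = (p t).1) :
    kzTransport d M (Path.Homotopic.Quotient.mk p) = tr d α M b c * tr d α M a b :=
  kzTransport_eq_trC_mul (convex_convexHull ℝ S) hS.subset (convex_convexHull ℝ S') hS'.subset
    (subset_convexHull ℝ S ha) (subset_convexHull ℝ S hb) (subset_convexHull ℝ S' hb')
    (subset_convexHull ℝ S' hc) hxa hyc hpb
    (fun t ht => (hp t ht).imp fun _ h => ⟨subset_convexHull ℝ S h.1, h.2⟩)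
    (fun t ht => (hp' t ht).imp fun _ h => ⟨subset_convexHull ℝ S' h.1, h.2⟩)

end Separation

namespace RealPosition

variable {n m : ℕ} {d : Fin m → ℕ} (P : RealPosition n m)

/-- Linear forms separate the set `W` from each of the points `α_l`. -/
def SepPoles (W : Set ℂ) : Prop := ∀ l, ∃ a b : ℝ, ∀ w ∈ W, 0 < lin a b (w - P.cα l)

/-- The operator of transport along a polygonal path. -/
def trPoly (d : Fin m → ℕ) {n : ℕ} (α : Fin m → ℂ) (M : Type*) [AddCommGroup M] [Module ℂ M]
    [Module (B n d) M] [FiniteDimensional ℂ M] [IsScalarTower ℂ (B n d) M]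
    (c : ℕ → Fin n → ℂ) : ℕ → Module.End ℂ M
  | 0 => 1
  | r + 1 => tr d α M (c r) (c (r + 1)) * trPoly d α M c r

section

variable {M : Type*} [AddCommGroup M] [Module ℂ M]
  [Module (B n d) M] [FiniteDimensional ℂ M] [IsScalarTower ℂ (B n d) M] {α : Fin m → ℂ}

theorem trPoly_grid (f : ℕ → ℕ → Fin n → ℂ) (r s : ℕ)
    (h : ∀ a < r, ∀ b < s, Sep α {f a b, f (a + 1) b, f a (b + 1), f (a + 1) (b + 1)}) :
    trPoly d α M (fun b => f r b) s * trPoly d α M (fun a => f a 0) r =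
      trPoly d α M (fun a => f a s) r * trPoly d α M (fun b => f 0 b) s := by
  induction r generalizing s with
  | zero => simp [trPoly]
  | succ r ih =>
    have key : ∀ s' ≤ s, trPoly d α M (fun b => f (r + 1) b) s' * tr d α M (f r 0) (f (r + 1) 0) =
        tr d α M (f r s') (f (r + 1) s') * trPoly d α M (fun b => f r b) s' := by
      intro s' hs'
      induction s' with
      | zero => simp [trPoly]
      | succ s' ih' =>
        simp only [trPoly]
        rw [mul_assoc, ih' (by omega), ← mul_assoc, ← mul_assoc,
          (h r (by omega) s' (by omega)).tr_square (a := f r s') (b := f (r + 1) s')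
          (b' := f r (s' + 1)) (c := f (r + 1) (s' + 1)) (by simp) (by simp) (by simp) (by simp)]
    simp only [trPoly]
    rw [← mul_assoc, key s le_rfl, mul_assoc, ih s fun a ha b hb => h a (by omega) b hb, mul_assoc]

end

/-- The configuration in which the points are permuted by `σ`. -/
def flat (σ : Equiv.Perm (Fin (n + 1))) (j : Fin (n + 1)) : ℂ := ⟨P.z (σ⁻¹ j), 0⟩

/-- The configuration in which the points are permuted by `σ` and then moved up to the heights
given by the numbers `h`. -/
def lift (h : Fin (n + 1) → ℕ) (σ : Equiv.Perm (Fin (n + 1))) (j : Fin (n + 1)) : ℂ :=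
  ⟨P.z (σ⁻¹ j), h j⟩

/-- The configurations in which the points are permuted by `σ` and then moved vertically. -/
def vert (σ : Equiv.Perm (Fin (n + 1))) : Set (Fin (n + 1) → ℂ) :=
  {x | ∀ j, (x j).re = P.z (σ⁻¹ j)}

theorem flat_mem_vert (σ : Equiv.Perm (Fin (n + 1))) : P.flat σ ∈ P.vert σ := fun _ => rfl

theorem lift_mem_vert (h : Fin (n + 1) → ℕ) (σ : Equiv.Perm (Fin (n + 1))) :
    P.lift h σ ∈ P.vert σ := fun _ => rfl

theorem sep_vert (σ : Equiv.Perm (Fin (n + 1))) : Sep P.cα (P.vert σ) := by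
  refine ⟨fun i j hij => ?_, fun i l => ⟨1, 0, fun x hx => ?_⟩⟩
  · rcases lt_or_ge (σ⁻¹ i) (σ⁻¹ j) with h | h
    · refine ⟨1, 0, fun x hx => ?_⟩
      have := P.z_mono h
      simp only [lin, Complex.sub_re, Complex.sub_im, hx i, hx j]; linarith
    · have h' : σ⁻¹ j < σ⁻¹ i := lt_of_le_of_ne h fun e => hij.ne' (σ⁻¹.injective e)
      refine ⟨-1, 0, fun x hx => ?_⟩
      have := P.z_mono h'
      simp only [lin, Complex.sub_re, Complex.sub_im, hx i, hx j]; linarith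
  · have := P.lt l (σ⁻¹ i)
    simp only [lin, Complex.sub_re, Complex.sub_im, hx i, cα, Complex.ofReal_re]; linarith

/-- The points stay over the real base points, at increasing heights. -/
def high : Set (Fin (n + 1) → ℂ) :=
  {x | (∀ j l, P.α l < (x j).re) ∧ ∀ i j, i < j → (x i).im < (x j).im}

theorem sep_high : Sep P.cα P.high := by
  refine ⟨fun i j hij => ⟨0, 1, fun x hx => ?_⟩, fun i l => ⟨1, 0, fun x hx => ?_⟩⟩
  · simpa [lin] using hx.2 i j hij
  · simpa [lin, cα] using hx.1 i l

theorem lift_mem_high (σ : Equiv.Perm (Fin (n + 1))) : P.lift (fun j => j.val) σ ∈ P.high :=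
  ⟨fun j l => P.lt l _, fun i j hij => by simpa [lift] using hij⟩

variable (d) (M : Type*) [AddCommGroup M] [Module ℂ M]
  [Module (B (n + 1) d) M] [FiniteDimensional ℂ M] [IsScalarTower ℂ (B (n + 1) d) M]

/-- Transport along the path that permutes the points by `σ`, every point passing below all
points with a larger number. -/
def opQ (σ : Equiv.Perm (Fin (n + 1))) : Module.End ℂ M :=
  tr d P.cα M (P.lift (fun j => j.val) σ) (P.flat σ) *
    tr d P.cα M (P.lift (fun j => j.val) 1) (P.lift (fun j => j.val) σ) *
      tr d P.cα M (P.flat 1) (P.lift (fun j => j.val) 1)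

/-- The monodromy of the positive braid associated with `σ`. -/
def opW (σ : Equiv.Perm (Fin (n + 1))) : Module.End ℂ M :=
  act M (B.perm d σ⁻¹) * opQ d P M σ

variable {M}

theorem act_perm_mul (σ τ : Equiv.Perm (Fin (n + 1))) :
    act M (B.perm d (σ * τ)) = act M (B.perm d σ) * act M (B.perm d τ) := by
  ext v
  rw [Module.End.mul_apply, act_apply, act_apply, act_apply, B.perm_mul, mul_smul]

theorem act_perm_one : act M (B.perm (n := n + 1) d 1) = 1 := by
  ext v
  rw [act_apply, B.perm_one, one_smul]; rfl

theorem act_perm_mul_inv (σ : Equiv.Perm (Fin (n + 1))) :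
    act M (B.perm d σ) * act M (B.perm d σ⁻¹) = 1 := by
  rw [← act_perm_mul, mul_inv_cancel, act_perm_one]

theorem act_perm_inv_mul (σ : Equiv.Perm (Fin (n + 1))) :
    act M (B.perm d σ⁻¹) * act M (B.perm d σ) = 1 := by
  rw [← act_perm_mul, inv_mul_cancel, act_perm_one]

theorem flat_perm (σ τ : Equiv.Perm (Fin (n + 1))) :
    (fun i => P.flat σ (τ⁻¹ i)) = P.flat (τ * σ) := by
  funext i
  simp [flat]

theorem lift_perm (h : Fin (n + 1) → ℕ) (σ τ : Equiv.Perm (Fin (n + 1))) :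
    (fun i => P.lift h σ (τ⁻¹ i)) = P.lift (fun j => h (τ⁻¹ j)) (τ * σ) := by
  funext i
  simp [lift]

theorem act_mul_opQ (σ τ : Equiv.Perm (Fin (n + 1))) :
    act M (B.perm d τ) * opQ d P M σ =
    tr d P.cα M (P.lift (fun j => (τ⁻¹ j).val) (τ * σ)) (P.flat (τ * σ)) *
      tr d P.cα M (P.lift (fun j => (τ⁻¹ j).val) τ) (P.lift (fun j => (τ⁻¹ j).val) (τ * σ)) *
      tr d P.cα M (P.flat τ) (P.lift (fun j => (τ⁻¹ j).val) τ) * act M (B.perm d τ) := by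
  have h1 := (P.sep_vert σ).tr_perm (d := d) (M := M) τ (P.lift_mem_vert (fun j => j.val) σ)
    (P.flat_mem_vert σ)
  have h2 := P.sep_high.tr_perm (d := d) (M := M) τ (P.lift_mem_high 1) (P.lift_mem_high σ)
  have h3 := (P.sep_vert 1).tr_perm (d := d) (M := M) τ (P.flat_mem_vert 1)
    (P.lift_mem_vert (fun j => j.val) 1)
  simp only [flat_perm, lift_perm, mul_one] at h1 h2 h3
  simp only [opQ, mul_assoc, h3]
  rw [← mul_assoc (tr d P.cα M (P.lift (fun j => (τ⁻¹ j).val) τ) _), h2]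
  simp only [mul_assoc]
  rw [← mul_assoc (tr d P.cα M _ _) (act M _), h1]
  simp only [mul_assoc]

theorem opW_mul (τ : Equiv.Perm (Fin (n + 1))) (i : Fin n) (h : τ i.castSucc < τ i.succ) :
    opW d P M (Equiv.swap i.castSucc i.succ) * opW d P M τ =
      opW d P M (τ * Equiv.swap i.castSucc i.succ) := by
  set s := Equiv.swap i.castSucc i.succ with hs
  have hsi : s⁻¹ = s := Equiv.swap_inv _ _
  have hne : i.castSucc ≠ i.succ := (Fin.castSucc_lt_succ).ne
  set b := fun j : Fin (n + 1) => j.val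
  set b' := fun j : Fin (n + 1) => (τ⁻¹ j).val
  let S : Set (Fin (n + 1) → ℂ) := {P.lift b τ, P.lift b' τ, P.lift b' (τ * s), P.lift b (τ * s)}
  have hS : Sep P.cα S := by
    refine ⟨fun p q hpq => ?_, fun p l => ⟨1, 0, ?_⟩⟩
    · by_cases hpq' : τ⁻¹ p = i.castSucc ∧ τ⁻¹ q = i.succ
      · have h3 : b' p < b' q := by simp only [b', hpq'.1, hpq'.2]; exact Fin.castSucc_lt_succ
        have h4 : (b' p : ℝ) < b' q := by exact_mod_cast h3
        have h5 : (b p : ℝ) < b q := by exact_mod_cast hpq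
        refine ⟨0, 1, ?_⟩
        rintro x (rfl | rfl | rfl | rfl) <;>
          simp only [lin, lift, Complex.sub_re, Complex.sub_im] <;> linarith
      · have hlt : (τ⁻¹ p < τ⁻¹ q ∧ s (τ⁻¹ p) < s (τ⁻¹ q)) ∨
            (τ⁻¹ q < τ⁻¹ p ∧ s (τ⁻¹ q) < s (τ⁻¹ p)) := by
          have hne' : τ⁻¹ p ≠ τ⁻¹ q := fun e => hpq.ne (τ⁻¹.injective e)
          have hpq2 : ¬ (τ⁻¹ p = i.succ ∧ τ⁻¹ q = i.castSucc) := by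
            rintro ⟨h1, h2⟩
            have h1' : p = τ i.succ := by rw [← h1]; simp
            have h2' : q = τ i.castSucc := by rw [← h2]; simp
            rw [h1', h2'] at hpq
            exact lt_asymm hpq h
          generalize τ⁻¹ p = u at *
          generalize τ⁻¹ q = v at *
          simp only [hs, Equiv.swap_apply_def]
          simp only [Fin.ext_iff, Fin.lt_def, Fin.val_castSucc, Fin.val_succ] at hne' hpq' hpq2 ⊢
          split_ifs <;> (try simp only [Fin.val_castSucc, Fin.val_succ]) <;> omega
        rcases hlt with ⟨h1, h2⟩ | ⟨h1, h2⟩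
        · have := P.z_mono h1
          have := P.z_mono h2
          refine ⟨1, 0, ?_⟩
          rintro x (rfl | rfl | rfl | rfl) <;>
            simp only [lin, lift, Complex.sub_re, Complex.sub_im, mul_inv_rev, hsi,
              Equiv.Perm.mul_apply] <;> linarith
        · have := P.z_mono h1
          have := P.z_mono h2
          refine ⟨-1, 0, ?_⟩
          rintro x (rfl | rfl | rfl | rfl) <;>
            simp only [lin, lift, Complex.sub_re, Complex.sub_im, mul_inv_rev, hsi,
              Equiv.Perm.mul_apply] <;> linarith
    · have := fun j => P.lt l j
      rintro x (rfl | rfl | rfl | rfl) <;>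
        simp only [lin, lift, cα, Complex.sub_re, Complex.sub_im, Complex.ofReal_re] <;>
        linarith [this (τ⁻¹ p), this ((τ * s)⁻¹ p)]
  have h1 : act M (B.perm d s⁻¹) * opQ d P M s * (act M (B.perm d τ⁻¹) * opQ d P M τ) =
      act M (B.perm d (τ * s)⁻¹) * (act M (B.perm d τ) * opQ d P M s) * act M (B.perm d τ⁻¹) *
        opQ d P M τ := by
    rw [mul_inv_rev, act_perm_mul]
    simp only [mul_assoc]
    rw [← mul_assoc (act M (B.perm d τ⁻¹)) (act M (B.perm d τ)), act_perm_inv_mul, one_mul]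
  rw [opW, opW, opW, h1, act_mul_opQ]
  simp only [mul_assoc]
  congr 1
  rw [← mul_assoc (act M (B.perm d τ)), act_perm_mul_inv, one_mul]
  simp only [opQ]
  have k1 := (P.sep_vert τ).tr_trans (d := d) (M := M) (P.lift_mem_vert b τ) (P.flat_mem_vert τ)
    (P.lift_mem_vert b' τ)
  have k2 := hS.tr_trans (d := d) (M := M) (a := P.lift b τ) (b := P.lift b' τ)
    (c := P.lift b' (τ * s)) (by simp [S]) (by simp [S]) (by simp [S])
  have k3 := hS.tr_trans (d := d) (M := M) (a := P.lift b τ) (b := P.lift b (τ * s))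
    (c := P.lift b' (τ * s)) (by simp [S]) (by simp [S]) (by simp [S])
  have k4 := P.sep_high.tr_trans (d := d) (M := M) (P.lift_mem_high 1) (P.lift_mem_high τ)
    (P.lift_mem_high (τ * s))
  have k5 := (P.sep_vert (τ * s)).tr_trans (d := d) (M := M) (P.lift_mem_vert b (τ * s))
    (P.lift_mem_vert b' (τ * s)) (P.flat_mem_vert (τ * s))
  change _ = tr d P.cα M (P.lift b (τ * s)) (P.flat (τ * s)) *
        tr d P.cα M (P.lift b 1) (P.lift b (τ * s)) * tr d P.cα M (P.flat 1) (P.lift b 1)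
  rw [← k4, ← k5]
  simp only [mul_assoc]
  rw [← mul_assoc (tr d P.cα M (P.lift b (τ * s)) _) (tr d P.cα M (P.lift b τ) _), k3, ← k2, ← k1]
  simp only [mul_assoc, b, b']

end RealPosition

theorem halfTurn_eq (x y t : ℝ) : halfTurn x y t =
    ⟨(x + y) / 2 + (x - y) / 2 * Real.cos (Real.pi * t), (x - y) / 2 * Real.sin (Real.pi * t)⟩ := by
  rw [halfTurn, Complex.exp_mul_I, ← Complex.ofReal_cos, ← Complex.ofReal_sin]
  apply Complex.ext <;>
    simp only [Complex.add_re, Complex.add_im, Complex.mul_re, Complex.mul_im, Complex.ofReal_re,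
      Complex.ofReal_im, Complex.I_re, Complex.I_im] <;> ring

theorem halfTurn_first {t : ℝ} (h0 : 0 ≤ t) (h : t ≤ 1 / 2) :
    ∃ c s : ℝ, (∀ x y, halfTurn x y t = ⟨(x + y) / 2 + (x - y) / 2 * c, (x - y) / 2 * s⟩) ∧
      0 ≤ c ∧ 0 ≤ s ∧ c ≤ 1 ∧ s ≤ 1 ∧ 1 ≤ c + s := by
  have hc : 0 ≤ Real.cos (Real.pi * t) := Real.cos_nonneg_of_mem_Icc
    ⟨by nlinarith [Real.pi_pos], by nlinarith [Real.pi_pos]⟩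
  have hs : 0 ≤ Real.sin (Real.pi * t) := Real.sin_nonneg_of_nonneg_of_le_pi
    (by positivity) (by nlinarith [Real.pi_pos])
  refine ⟨Real.cos (Real.pi * t), Real.sin (Real.pi * t), fun x y => halfTurn_eq x y t, hc, hs,
    Real.cos_le_one _, Real.sin_le_one _, ?_⟩
  nlinarith [Real.sin_sq_add_cos_sq (Real.pi * t), Real.cos_le_one (Real.pi * t),
      Real.sin_le_one (Real.pi * t)]

theorem halfTurn_second {t : ℝ} (h : 1 / 2 ≤ t) (h1 : t ≤ 1) :
    ∃ c s : ℝ, (∀ x y, halfTurn x y t = ⟨(x + y) / 2 - (x - y) / 2 * c, (x - y) / 2 * s⟩) ∧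
      0 ≤ c ∧ 0 ≤ s ∧ c ≤ 1 ∧ s ≤ 1 ∧ 1 ≤ c + s := by
  obtain ⟨c, s, e, h⟩ := halfTurn_first (t := 1 - t) (by linarith) (by linarith)
  refine ⟨c, s, fun x y => ?_, h⟩
  have e1 : halfTurn x y t = halfTurn x y (1 - (1 - t)) := by rw [sub_sub_cancel]
  rw [e1, halfTurn_eq]
  have h1 := congrArg Complex.re (e 1 (-1))
  have h2 := congrArg Complex.im (e 1 (-1))
  rw [halfTurn_eq] at h1 h2
  norm_num at h1 h2
  rw [mul_sub, mul_one, Real.cos_pi_sub, Real.sin_pi_sub, h1, h2, mul_neg, ← sub_eq_add_neg]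

theorem halfTurn_half {t : ℝ} (h : t = 1 / 2) (x y : ℝ) :
    halfTurn x y t = ⟨(x + y) / 2, (x - y) / 2⟩ := by
  rw [halfTurn_eq, h, mul_one_div, Real.cos_pi_div_two, Real.sin_pi_div_two, mul_zero, add_zero,
    mul_one]

namespace RealPosition

variable {n m : ℕ} {d : Fin m → ℕ} (P : RealPosition n m)

/-- Configurations in which the points with the numbers `i` and `i + 1` are on vertical lines
that intersect the interval between their original positions, their difference being in a half
plane, and the other points are fixed. -/
def near (i : Fin n) (a b : ℝ) : Set (Fin (n + 1) → ℂ) :=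
  {x | (∀ j, j ≠ i.castSucc → j ≠ i.succ → (x j).re = P.z j) ∧
    (P.z i.castSucc ≤ (x i.castSucc).re ∧ (x i.castSucc).re ≤ P.z i.succ) ∧
    (P.z i.castSucc ≤ (x i.succ).re ∧ (x i.succ).re ≤ P.z i.succ) ∧
    0 < lin a b (x i.succ - x i.castSucc)}

theorem sep_near (i : Fin n) (a b : ℝ) : Sep P.cα (P.near i a b) := by
  have hlt : ∀ p : Fin (n + 1), p < i.castSucc → P.z p < P.z i.castSucc := fun p h => P.z_mono h
  have hlt' : ∀ p : Fin (n + 1), i.succ < p → P.z i.succ < P.z p := fun p h => P.z_mono h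
  refine ⟨fun p q hpq => ?_, fun p l => ⟨1, 0, fun x hx => ?_⟩⟩
  · by_cases hp : p = i.castSucc ∧ q = i.succ
    · exact ⟨a, b, fun x hx => by rw [hp.1, hp.2]; exact hx.2.2.2⟩
    · refine ⟨1, 0, fun x hx => ?_⟩
      obtain ⟨h1, ⟨h2, h2'⟩, ⟨h3, h3'⟩, -⟩ := hx
      have h4 := P.z_mono hpq
      suffices (x p).re < (x q).re by simpa [lin]
      by_cases h5 : p = i.castSucc
      · have h6 : i.succ < q := by
          have h7 : q ≠ i.succ := fun e => hp ⟨h5, e⟩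
          subst h5; simp only [Fin.lt_def, Ne, Fin.ext_iff, Fin.val_castSucc, Fin.val_succ] at hpq h7 ⊢
          omega
        have := hlt' q h6
        rw [h5, h1 q (fun e => hpq.ne (h5.trans e.symm)) h6.ne']; linarith
      · by_cases h6 : p = i.succ
        · have h7 := hlt' q (h6 ▸ hpq)
          have h8 : q ≠ i.castSucc := fun e => by
            rw [e, h6] at hpq; exact absurd hpq (Fin.castSucc_lt_succ).asymm
          rw [h1 q h8 (h6 ▸ hpq.ne'), h6]; linarith
        · rw [h1 p h5 h6]
          by_cases h7 : q = i.castSucc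
          · have := hlt p (h7 ▸ hpq); rw [h7]; linarith
          · by_cases h8 : q = i.succ
            · have : p < i.castSucc := by
                subst h8; simp only [Fin.lt_def, Fin.ext_iff, Fin.val_castSucc, Fin.val_succ] at hpq h5 ⊢
                omega
              have := hlt p this
              rw [h8]; linarith
            · rw [h1 q h7 h8]; exact h4
  · obtain ⟨h1, ⟨h2, h2'⟩, ⟨h3, h3'⟩, -⟩ := hx
    suffices P.α l < (x p).re by simpa [lin, cα]
    by_cases h5 : p = i.castSucc
    · rw [h5]; linarith [P.lt l i.castSucc]
    · by_cases h6 : p = i.succ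
      · rw [h6]; linarith [P.lt l i.castSucc]
      · rw [h1 p h5 h6]; exact P.lt l p

/-- The points number `i` and `i + 1` are on the vertical line through the middle of the interval
between their original positions. -/
def mid (i : Fin n) (j : Fin (n + 1)) : ℂ :=
  if j = i.castSucc then ⟨(P.z i.castSucc + P.z i.succ) / 2, (P.z i.castSucc - P.z i.succ) / 2⟩
  else if j = i.succ then ⟨(P.z i.succ + P.z i.castSucc) / 2, (P.z i.succ - P.z i.castSucc) / 2⟩
  else ⟨P.z j, 0⟩

section

variable (i : Fin n)

theorem z_castSucc_lt : P.z i.castSucc < P.z i.succ := P.z_mono Fin.castSucc_lt_succ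

theorem succ_ne_castSucc : i.succ ≠ i.castSucc := (Fin.castSucc_lt_succ).ne'

theorem mid_mem_near {a b : ℝ} (h : 0 < b) : P.mid i ∈ P.near i a b := by
  have := P.z_castSucc_lt i
  have hne := succ_ne_castSucc i
  refine ⟨fun j h1 h2 => by simp [mid, h1, h2], ?_, ?_, ?_⟩
  · simp only [mid, if_true]; constructor <;> linarith
  · simp only [mid, if_true, hne, if_false]; constructor <;> linarith
  · simp only [mid, if_true, hne, if_false, lin, Complex.sub_re, Complex.sub_im]
    nlinarith

theorem flat_one_mem_near : P.flat 1 ∈ P.near i 1 1 := by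
  have := P.z_castSucc_lt i
  refine ⟨fun j h1 h2 => rfl, ⟨le_rfl, this.le⟩, ⟨this.le, le_rfl⟩, ?_⟩
  simpa [lin, flat]

theorem lift_one_mem_near {a b : ℝ} (ha : 0 ≤ a) (hb : 0 < b) :
    P.lift (fun j => j.val) 1 ∈ P.near i a b := by
  have := P.z_castSucc_lt i
  refine ⟨fun j h1 h2 => rfl, ⟨le_rfl, this.le⟩, ⟨this.le, le_rfl⟩, ?_⟩
  simp [lin, lift]; nlinarith

theorem flat_swap_mem_near :
    P.flat (Equiv.swap i.castSucc i.succ) ∈ P.near i (-1) 1 := by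
  have := P.z_castSucc_lt i
  refine ⟨fun j h1 h2 => ?_, ?_, ?_, ?_⟩
  · simp only [flat, Equiv.swap_inv, Equiv.swap_apply_of_ne_of_ne h1 h2]
  · simp only [flat, Equiv.swap_inv, Equiv.swap_apply_left]; exact ⟨this.le, le_rfl⟩
  · simp only [flat, Equiv.swap_inv, Equiv.swap_apply_right]; exact ⟨le_rfl, this.le⟩
  · simp only [flat, Equiv.swap_inv, Equiv.swap_apply_right, Equiv.swap_apply_left, lin,
      Complex.sub_re, Complex.sub_im]
    linarith

theorem lift_swap_mem_near {a b : ℝ} (ha : a ≤ 0) (hb : 0 < b) :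
    P.lift (fun j => j.val) (Equiv.swap i.castSucc i.succ) ∈ P.near i a b := by
  have := P.z_castSucc_lt i
  refine ⟨fun j h1 h2 => ?_, ?_, ?_, ?_⟩
  · simp only [lift, Equiv.swap_inv, Equiv.swap_apply_of_ne_of_ne h1 h2]
  · simp only [lift, Equiv.swap_inv, Equiv.swap_apply_left]; exact ⟨this.le, le_rfl⟩
  · simp only [lift, Equiv.swap_inv, Equiv.swap_apply_right]; exact ⟨le_rfl, this.le⟩
  · simp only [lift, Equiv.swap_inv, Equiv.swap_apply_right, Equiv.swap_apply_left, lin,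
      Complex.sub_re, Complex.sub_im, Fin.val_succ, Fin.val_castSucc]
    push_cast
    nlinarith

theorem exchange_mem_near {t : ℝ} (h0 : 0 ≤ t) (h : t ≤ 1 / 2) :
    P.exchange i t ∈ P.near i 1 1 := by
  obtain ⟨c, s, e, h1, h2, h3, h4, h5⟩ := halfTurn_first h0 h
  have := P.z_castSucc_lt i
  have hne := succ_ne_castSucc i
  refine ⟨fun j h1 h2 => by simp [exchange, h1, h2], ?_, ?_, ?_⟩
  · simp only [exchange, if_true, e]; constructor <;> nlinarith
  · simp only [exchange, if_true, hne, if_false, e]; constructor <;> nlinarith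
  · simp only [exchange, if_true, hne, if_false, e, lin, Complex.sub_re, Complex.sub_im]
    nlinarith

theorem exchange_mem_near' {t : ℝ} (h : 1 / 2 ≤ t) (h1 : t ≤ 1) :
    P.exchange i t ∈ P.near i (-1) 1 := by
  obtain ⟨c, s, e, h1, h2, h3, h4, h5⟩ := halfTurn_second h h1
  have := P.z_castSucc_lt i
  have hne := succ_ne_castSucc i
  refine ⟨fun j h1 h2 => by simp [exchange, h1, h2], ?_, ?_, ?_⟩
  · simp only [exchange, if_true, e]; constructor <;> nlinarith
  · simp only [exchange, if_true, hne, if_false, e]; constructor <;> nlinarith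
  · simp only [exchange, if_true, hne, if_false, e, lin, Complex.sub_re, Complex.sub_im]
    nlinarith

theorem exchange_half {t : ℝ} (h : t = 1 / 2) : P.exchange i t = P.mid i := by
  funext j
  simp only [exchange, mid, halfTurn_half h]
  rfl

variable (M : Type*) [AddCommGroup M] [Module ℂ M]
  [Module (B (n + 1) d) M] [FiniteDimensional ℂ M] [IsScalarTower ℂ (B (n + 1) d) M]

theorem kzTransport_pathT :
    kzTransport d M (Path.Homotopic.Quotient.mk (P.pathT i)) =
      tr d P.cα M (P.mid i) (P.flat (Equiv.swap i.castSucc i.succ)) *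
        tr d P.cα M (P.flat 1) (P.mid i) := by
  refine (P.sep_near i 1 1).kzTransport_eq_mul (P.sep_near i (-1) 1) (P.flat_one_mem_near i)
    (P.mid_mem_near i one_pos) (P.mid_mem_near i one_pos) (P.flat_swap_mem_near i) rfl rfl ?_ ?_ ?_
  · intro t ht
    rw [← P.exchange_half i ht]; rfl
  · exact fun t ht => ⟨_, P.exchange_mem_near i t.2.1 ht, rfl⟩
  · exact fun t ht => ⟨_, P.exchange_mem_near' i ht t.2.2, rfl⟩

theorem kzTransport_pathT_eq_opQ :
    kzTransport d M (Path.Homotopic.Quotient.mk (P.pathT i)) =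
      opQ d P M (Equiv.swap i.castSucc i.succ) := by
  have k1 := (P.sep_near i 1 1).tr_trans (d := d) (M := M) (P.flat_one_mem_near i)
    (P.lift_one_mem_near i zero_le_one one_pos) (P.mid_mem_near i one_pos)
  have k2 := (P.sep_near i (-1) 1).tr_trans (d := d) (M := M) (P.mid_mem_near i one_pos)
    (P.lift_swap_mem_near i (by norm_num) one_pos) (P.flat_swap_mem_near i)
  have k3 := (P.sep_near i 0 1).tr_trans (d := d) (M := M)
    (P.lift_one_mem_near i le_rfl one_pos) (P.mid_mem_near i one_pos)
    (P.lift_swap_mem_near i le_rfl one_pos)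
  rw [kzTransport_pathT, ← k1, ← k2, opQ, ← k3]
  simp only [mul_assoc]

variable (d) in
/-- The monodromy operator of `T_i`. -/
def opT : Module.End ℂ M := kzOp d M (P.braidT i)

theorem opT_eq : opT d P i M = act M (B.perm d (Equiv.swap i.castSucc i.succ)⁻¹) *
    (tr d P.cα M (P.mid i) (P.flat (Equiv.swap i.castSucc i.succ)) *
        tr d P.cα M (P.flat 1) (P.mid i)) := by
  rw [opT, braidT, kzOp_braidClass, kzLoop, kzTransport_pathT]
  rfl

theorem opT_eq_opW : opT d P i M = opW d P M (Equiv.swap i.castSucc i.succ) := by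
  rw [opT, braidT, kzOp_braidClass, kzLoop, kzTransport_pathT_eq_opQ]
  rfl

theorem opT_mul_opW (τ : Equiv.Perm (Fin (n + 1))) (h : τ i.castSucc < τ i.succ) :
    opT d P i M * opW d P M τ = opW d P M (τ * Equiv.swap i.castSucc i.succ) := by
  rw [opT_eq_opW, opW_mul d P τ i h]

theorem opW_one : opW d P M 1 = 1 := by
  have h := (P.sep_vert 1).tr_trans (d := d) (M := M) (P.flat_mem_vert 1)
    (P.lift_mem_vert (fun j => j.val) 1) (P.flat_mem_vert 1)
  rw [opW, opQ, P.sep_high.tr_self (P.lift_mem_high 1), mul_one, h,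
    (P.sep_vert 1).tr_self (P.flat_mem_vert 1), mul_one, inv_one, act_perm_one]

theorem val_swap (i : Fin n) (x : Fin (n + 1)) : (Equiv.swap i.castSucc i.succ x).val =
    if x.val = i.val then i.val + 1 else if x.val = i.val + 1 then i.val else x.val := by
  rw [Equiv.swap_apply_def]
  simp only [Fin.ext_iff, Fin.val_castSucc, Fin.val_succ]
  split_ifs <;> simp

theorem swap_mul_swap_mul_swap_succ (i j : Fin n) (hij : i.val + 1 = j.val) :
    Equiv.swap i.castSucc i.succ * Equiv.swap j.castSucc j.succ * Equiv.swap i.castSucc i.succ =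
      Equiv.swap j.castSucc j.succ * Equiv.swap i.castSucc i.succ *
        Equiv.swap j.castSucc j.succ := by
  ext x
  simp only [Equiv.Perm.mul_apply, val_swap, ← hij]
  have e1 : ¬ i.val + 1 + 1 = i.val := by omega
  have e2 : ¬ i.val = i.val + 1 + 1 := by omega
  rcases eq_or_ne x.val i.val with h | h1
  · simp [h, e1, e2]
  rcases eq_or_ne x.val (i.val + 1) with h | h2
  · simp [h, e1, e2]
  rcases eq_or_ne x.val (i.val + 1 + 1) with h | h3
  · simp [h, e1, e2]
  simp [h1, h2, h3]

theorem opT_braid (j : Fin n) (hij : i.val + 1 = j.val) :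
    opT d P i M * opT d P j M * opT d P i M = opT d P j M * opT d P i M * opT d P j M := by
  obtain ⟨i, hi⟩ := i
  obtain ⟨j, hj⟩ := j
  obtain rfl : i + 1 = j := hij
  have e1 := opT_eq_opW (d := d) P ⟨i, hi⟩ M
  have key1 : Equiv.swap (Fin.castSucc ⟨i, hi⟩) (Fin.succ ⟨i, hi⟩) (Fin.castSucc ⟨i + 1, hj⟩) <
      Equiv.swap (Fin.castSucc ⟨i, hi⟩) (Fin.succ ⟨i, hi⟩) (Fin.succ ⟨i + 1, hj⟩) := by
    rw [Fin.lt_def]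
    simp only [val_swap, Fin.val_castSucc, Fin.val_succ]
    split_ifs <;> omega
  have key2 : Equiv.swap (Fin.castSucc ⟨i + 1, hj⟩) (Fin.succ ⟨i + 1, hj⟩) (Fin.castSucc ⟨i, hi⟩) <
      Equiv.swap (Fin.castSucc ⟨i + 1, hj⟩) (Fin.succ ⟨i + 1, hj⟩) (Fin.succ ⟨i, hi⟩) := by
    rw [Fin.lt_def]
    simp only [val_swap, Fin.val_castSucc, Fin.val_succ]
    split_ifs <;> omega
  have e2 := opT_eq_opW (d := d) P ⟨i + 1, hj⟩ M
  have a1 := opT_mul_opW (d := d) P ⟨i + 1, hj⟩ M (Equiv.swap (Fin.castSucc ⟨i, hi⟩) (Fin.succ ⟨i, hi⟩))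
    key1
  have a2 := opT_mul_opW (d := d) P ⟨i, hi⟩ M (Equiv.swap (Fin.castSucc ⟨i + 1, hj⟩)
    (Fin.succ ⟨i + 1, hj⟩)) key2
  have a3 := opT_mul_opW (d := d) P ⟨i, hi⟩ M (Equiv.swap (Fin.castSucc ⟨i, hi⟩) (Fin.succ ⟨i, hi⟩) *
    Equiv.swap (Fin.castSucc ⟨i + 1, hj⟩) (Fin.succ ⟨i + 1, hj⟩))
    (by
      rw [Fin.lt_def]
      simp only [Equiv.Perm.mul_apply, val_swap, Fin.val_castSucc, Fin.val_succ]
      split_ifs <;> omega)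
  have a4 := opT_mul_opW (d := d) P ⟨i + 1, hj⟩ M (Equiv.swap (Fin.castSucc ⟨i + 1, hj⟩)
    (Fin.succ ⟨i + 1, hj⟩) * Equiv.swap (Fin.castSucc ⟨i, hi⟩) (Fin.succ ⟨i, hi⟩))
    (by
      rw [Fin.lt_def]
      simp only [Equiv.Perm.mul_apply, val_swap, Fin.val_castSucc, Fin.val_succ]
      split_ifs <;> omega)
  rw [← e1, ] at a1
  rw [← e2] at a2
  rw [mul_assoc (opT d P ⟨i, hi⟩ M), mul_assoc (opT d P ⟨i + 1, hj⟩ M), a1, a2, a3, a4]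
  rw [swap_mul_swap_mul_swap_succ ⟨i, hi⟩ ⟨i + 1, hj⟩ rfl]

theorem opT_comm (j : Fin n) (hij : i.val + 1 < j.val) :
    opT d P i M * opT d P j M = opT d P j M * opT d P i M := by
  have a1 := opT_mul_opW (d := d) P j M (Equiv.swap i.castSucc i.succ) (by
    rw [Equiv.swap_apply_of_ne_of_ne, Equiv.swap_apply_of_ne_of_ne]
    · exact Fin.castSucc_lt_succ
    all_goals simp [Fin.ext_iff]; omega)
  have a2 := opT_mul_opW (d := d) P i M (Equiv.swap j.castSucc j.succ) (by
    rw [Equiv.swap_apply_of_ne_of_ne, Equiv.swap_apply_of_ne_of_ne]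
    · exact Fin.castSucc_lt_succ
    all_goals simp [Fin.ext_iff]; omega)
  rw [← opT_eq_opW] at a1 a2
  rw [a1, a2]
  congr 1
  ext x
  simp only [Equiv.Perm.mul_apply, val_swap]
  split_ifs <;> omega

end

end RealPosition

namespace RealPosition

variable {n m : ℕ} {d : Fin m → ℕ} (P : RealPosition n m)

theorem left_lt (k : Fin m) : P.left k < P.α k := by
  unfold left
  split_ifs with h
  · have : P.α ⟨k.val - 1, by omega⟩ < P.α k := P.α_mono (by simp [Fin.lt_def]; omega)
    linarith
  · linarith

theorem lt_left {k l : Fin m} (hlk : l < k) : P.α l < P.left k := by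
  have hk : 0 < k.val := lt_of_le_of_lt (Nat.zero_le _) (Fin.lt_def.mp hlk)
  have h1 : P.α l ≤ P.α ⟨k.val - 1, by omega⟩ :=
    P.α_mono.monotone (by rw [Fin.le_def]; have := Fin.lt_def.mp hlk; simp; omega)
  have h2 : P.α ⟨k.val - 1, by omega⟩ < P.α k := P.α_mono (by simp [Fin.lt_def]; omega)
  have h3 : P.left k = (P.α ⟨k.val - 1, by omega⟩ + P.α k) / 2 := by
    unfold left; rw [dif_pos hk]
  linarith

theorem lt_right (k : Fin m) : P.α k < P.right k := by
  unfold right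
  split_ifs with h
  · have h1 : P.α k < P.α ⟨k.val + 1, h⟩ := P.α_mono (by simp [Fin.lt_def])
    linarith
  · linarith [P.lt k 0]

theorem right_lt_z (k : Fin m) : P.right k < P.z 0 := by
  unfold right
  split_ifs with h
  · linarith [P.lt ⟨k.val + 1, h⟩ 0, P.lt k 0]
  · linarith [P.lt k 0]

theorem right_lt {k l : Fin m} (hkl : k < l) : P.right k < P.α l := by
  have hk : k.val + 1 < m := by have := Fin.lt_def.mp hkl; have := l.2; omega
  have h1 : P.α ⟨k.val + 1, hk⟩ ≤ P.α l :=
    P.α_mono.monotone (by rw [Fin.le_def]; have := Fin.lt_def.mp hkl; simp; omega)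
  have h2 : P.α k < P.α ⟨k.val + 1, hk⟩ := P.α_mono (by simp [Fin.lt_def])
  have h3 : P.right k = (P.α k + P.α ⟨k.val + 1, hk⟩) / 2 := by
    unfold right; rw [dif_pos hk]
  linarith

theorem right_eq_left (k l : Fin m) (h : k.val + 1 = l.val) : P.right k = P.left l := by
  have hk : k.val + 1 < m := h ▸ l.2
  have hl : 0 < l.val := by omega
  unfold right left
  rw [dif_pos hk, dif_pos hl]
  congr 3
  · exact Fin.ext (by simp; omega)
  · exact Fin.ext h

/-- The configuration obtained from the base point by moving the first point to `w`. -/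
def pos (w : ℂ) : Fin (n + 1) → ℂ := Function.update (fun j => (P.z j : ℂ)) 0 w

theorem pos_base : P.pos (P.z 0) = P.flat 1 := Function.update_eq_self 0 _

/-- The first point can move in the convex hull of `W` while the others are at the base points. -/
def SepFirst (W : Set ℂ) : Prop :=
  (∀ j, j ≠ 0 → ∃ a b : ℝ, ∀ w ∈ W, 0 < lin a b ((P.z j : ℂ) - w)) ∧ P.SepPoles W

variable {P}

theorem SepFirst.sep {W : Set ℂ} (h : P.SepFirst W) : Sep P.cα (P.pos '' W) := by
  refine ⟨fun i j hij => ?_, fun i l => ?_⟩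
  · have hj : j ≠ 0 := (lt_of_le_of_lt (Fin.zero_le _) hij).ne'
    by_cases hi : i = 0
    · obtain ⟨a, b, h⟩ := h.1 j hj
      refine ⟨a, b, ?_⟩
      rintro _ ⟨w, hw, rfl⟩
      simpa [pos, hi, hj] using h w hw
    · refine ⟨1, 0, ?_⟩
      rintro _ ⟨w, hw, rfl⟩
      simpa [pos, hi, hj, lin] using P.z_mono hij
  · by_cases hi : i = 0
    · obtain ⟨a, b, h⟩ := h.2 l
      refine ⟨a, b, ?_⟩
      rintro _ ⟨w, hw, rfl⟩
      simpa [pos, hi] using h w hw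
    · refine ⟨1, 0, ?_⟩
      rintro _ ⟨w, hw, rfl⟩
      simpa [pos, hi, lin, cα] using P.lt l i

variable (P)

/-- Positions of the first point below `x`, in a suitable sense. -/
def under (x : ℝ) : Set ℂ :=
  {w | (∀ l, P.α l < x → 0 < 2 * (w.re - P.α l) - w.im) ∧
    (∀ l, x < P.α l → 0 < -(w.re - P.α l) - w.im) ∧ ∀ j, j ≠ 0 → w.re + w.im < P.z j}

/-- Positions of the first point above `x`, in a suitable sense. -/
def above (x : ℝ) : Set ℂ :=
  {w | (∀ l, P.α l < x → 0 < (w.re - P.α l) + w.im) ∧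
    (∀ l, x < P.α l → 0 < -(w.re - P.α l) + w.im) ∧ ∀ j, j ≠ 0 → w.re - w.im < P.z j}

/-- Positions of the first point near the base point, in a suitable sense. -/
def home : Set ℂ := {w | (∀ l, P.α l < w.re - w.im) ∧ ∀ j, j ≠ 0 → w.re < P.z j}

variable {P}

theorem sepFirst_under {x : ℝ} (hx : ∀ l, x ≠ P.α l) : P.SepFirst (P.under x) := by
  refine ⟨fun j hj => ⟨1, 1, fun w hw => ?_⟩, fun l => ?_⟩
  · have := hw.2.2 j hj
    simp [lin]; linarith
  · rcases lt_or_gt_of_ne (hx l) with h | h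
    · refine ⟨-1, -1, fun w hw => ?_⟩
      have := hw.2.1 l h
      simp [lin, cα]; linarith
    · refine ⟨2, -1, fun w hw => ?_⟩
      have := hw.1 l h
      simp [lin, cα]; linarith

theorem sepFirst_above {x : ℝ} (hx : ∀ l, x ≠ P.α l) : P.SepFirst (P.above x) := by
  refine ⟨fun j hj => ⟨1, -1, fun w hw => ?_⟩, fun l => ?_⟩
  · have := hw.2.2 j hj
    simp [lin]; linarith
  · rcases lt_or_gt_of_ne (hx l) with h | h
    · refine ⟨-1, 1, fun w hw => ?_⟩
      have := hw.2.1 l h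
      simp [lin, cα]; linarith
    · refine ⟨1, 1, fun w hw => ?_⟩
      have := hw.1 l h
      simp [lin, cα]; linarith

theorem sepFirst_home : P.SepFirst P.home := by
  refine ⟨fun j hj => ⟨1, 0, fun w hw => ?_⟩, fun l => ⟨1, -1, fun w hw => ?_⟩⟩
  · have := hw.2 j hj
    simp [lin]; linarith
  · have := hw.1 l
    simp [lin, cα]; linarith

theorem z_zero_lt {j : Fin (n + 1)} (hj : j ≠ 0) : P.z 0 < P.z j :=
  P.z_mono (Fin.pos_of_ne_zero hj)

variable (d P) (M : Type*) [AddCommGroup M] [Module ℂ M]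
  [Module (B (n + 1) d) M] [FiniteDimensional ℂ M] [IsScalarTower ℂ (B (n + 1) d) M]

/-- Transport along the straight motion of the first point from `v` to `w`. -/
abbrev tr1 (v w : ℂ) : Module.End ℂ M := tr d P.cα M (P.pos v) (P.pos w)

variable {d P M}

theorem SepFirst.tr_trans {W : Set ℂ} (h : P.SepFirst W) {u v w : ℂ} (hu : u ∈ W) (hv : v ∈ W)
    (hw : w ∈ W) : tr1 d P M v w * tr1 d P M u v = tr1 d P M u w :=
  h.sep.tr_trans (mem_image_of_mem _ hu) (mem_image_of_mem _ hv) (mem_image_of_mem _ hw)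

theorem SepFirst.tr_mul_tr {W : Set ℂ} (h : P.SepFirst W) {v w : ℂ} (hv : v ∈ W)
    (hw : w ∈ W) : tr1 d P M w v * tr1 d P M v w = 1 :=
  h.sep.tr_mul_tr (mem_image_of_mem _ hv) (mem_image_of_mem _ hw)

theorem real_mem_under {x : ℝ} (h : x < P.z 0) : (x : ℂ) ∈ P.under x := by
  refine ⟨fun l h => ?_, fun l h => ?_, fun j hj => ?_⟩
  · simp; linarith
  · simp; linarith
  · have := z_zero_lt (P := P) hj; simp; linarith

theorem z_zero_mem_home : (P.z 0 : ℂ) ∈ P.home := by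
  refine ⟨fun l => ?_, fun j hj => ?_⟩
  · simpa using P.lt l 0
  · simpa using z_zero_lt (P := P) hj

theorem kzTransport_under {x : ℝ} (hx : P.Free x) (h : x < P.z 0) {w : ℂ} (hw : w ∈ P.under x)
    (hw' : w ∈ P.home) :
    kzTransport d M (Path.Homotopic.Quotient.mk (P.pathFirst x (P.z 0) hx P.free_base)) =
      tr1 d P M w (P.z 0) * tr1 d P M x w := by
  have key1 : ∀ t : ℝ, 0 ≤ t → t ≤ 1 / 2 → halfTurn x (P.z 0) t ∈ P.under x := by
    intro t h0 ht
    obtain ⟨c, s, e, h1, h2, h3, h4, h5⟩ := halfTurn_first h0 ht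
    rw [e]
    refine ⟨fun l h => ?_, fun l h => ?_, fun j hj => ?_⟩
    · simp only; nlinarith
    · simp only; nlinarith
    · have := z_zero_lt (P := P) hj; simp only; nlinarith
  have key2 : ∀ t : ℝ, 1 / 2 ≤ t → t ≤ 1 → halfTurn x (P.z 0) t ∈ P.home := by
    intro t h0 ht
    obtain ⟨c, s, e, h1, h2, h3, h4, h5⟩ := halfTurn_second h0 ht
    rw [e]
    refine ⟨fun l => ?_, fun j hj => ?_⟩
    · have := P.lt l 0; simp only; nlinarith
    · have := z_zero_lt (P := P) hj; simp only; nlinarith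
  have k := SepFirst.tr_trans (d := d) (M := M) (sepFirst_under hx.1) (real_mem_under h) hw
    (key1 (1 / 2) (by norm_num) le_rfl)
  have k' := SepFirst.tr_trans (d := d) (M := M) (sepFirst_home (P := P)) hw'
    (key2 (1 / 2) le_rfl (by norm_num)) z_zero_mem_home
  rw [← k', mul_assoc, k]
  refine (sepFirst_under hx.1).sep.kzTransport_eq_mul sepFirst_home.sep
    (mem_image_of_mem _ (real_mem_under h)) (mem_image_of_mem _ (key1 (1 / 2) (by norm_num) le_rfl))
    (mem_image_of_mem _ (key2 (1 / 2) le_rfl (by norm_num)))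
    (mem_image_of_mem _ z_zero_mem_home) rfl rfl ?_ ?_ ?_
  · intro t ht
    rw [← ht]; rfl
  · exact fun t ht => ⟨_, mem_image_of_mem _ (key1 t t.2.1 ht), rfl⟩
  · exact fun t ht => ⟨_, mem_image_of_mem _ (key2 t ht t.2.2), rfl⟩

theorem kzTransport_under_symm {x : ℝ} (hx : P.Free x) (h : x < P.z 0) {w : ℂ}
    (hw : w ∈ P.under x) (hw' : w ∈ P.home) :
    kzTransport d M (Path.Homotopic.Quotient.mk (P.pathFirst x (P.z 0) hx P.free_base).symm) =
      tr1 d P M w x * tr1 d P M (P.z 0) w := by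
  have h1 := kzTransport_symm_comp (d := d) (M := M)
    (Path.Homotopic.Quotient.mk (P.pathFirst x (P.z 0) hx P.free_base))
  rw [kzTransport_under hx h hw hw'] at h1
  have h2 : tr1 d P M w (P.z 0) * tr1 d P M x w * (tr1 d P M w x * tr1 d P M (P.z 0) w) = 1 := by
    rw [mul_assoc, ← mul_assoc (tr1 d P M x w), (sepFirst_under hx.1).tr_mul_tr hw
      (real_mem_under h), one_mul, sepFirst_home.tr_mul_tr z_zero_mem_home hw']
  exact left_inv_eq_right_inv h1 h2

theorem real_mem_above {x : ℝ} (h : x < P.z 0) : (x : ℂ) ∈ P.above x := by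
  refine ⟨fun l h => ?_, fun l h => ?_, fun j hj => ?_⟩
  · simp; linarith
  · simp; linarith
  · have := z_zero_lt (P := P) hj; simp; linarith

theorem kzTransport_above {x y : ℝ} (hx : P.Free x) (hy : P.Free y) (hyx : y < x) (h : x < P.z 0)
    {w : ℂ} (hw : w ∈ P.above x) (hw' : w ∈ P.above y) :
    kzTransport d M (Path.Homotopic.Quotient.mk (P.pathFirst x y hx hy)) =
      tr1 d P M w y * tr1 d P M x w := by
  have key1 : ∀ t : ℝ, 0 ≤ t → t ≤ 1 / 2 → halfTurn x y t ∈ P.above x := by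
    intro t h0 ht
    obtain ⟨c, s, e, h1, h2, h3, h4, h5⟩ := halfTurn_first h0 ht
    rw [e]
    refine ⟨fun l h => ?_, fun l h => ?_, fun j hj => ?_⟩
    · simp only; nlinarith
    · simp only; nlinarith
    · have := z_zero_lt (P := P) hj; simp only; nlinarith
  have key2 : ∀ t : ℝ, 1 / 2 ≤ t → t ≤ 1 → halfTurn x y t ∈ P.above y := by
    intro t h0 ht
    obtain ⟨c, s, e, h1, h2, h3, h4, h5⟩ := halfTurn_second h0 ht
    rw [e]
    refine ⟨fun l h => ?_, fun l h => ?_, fun j hj => ?_⟩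
    · simp only; nlinarith
    · simp only; nlinarith
    · have := z_zero_lt (P := P) hj; simp only; nlinarith
  have k := SepFirst.tr_trans (d := d) (M := M) (sepFirst_above hx.1) (real_mem_above h) hw
    (key1 (1 / 2) (by norm_num) le_rfl)
  have k' := SepFirst.tr_trans (d := d) (M := M) (sepFirst_above hy.1) hw'
    (key2 (1 / 2) le_rfl (by norm_num)) (real_mem_above (hyx.trans h))
  rw [← k', mul_assoc, k]
  refine (sepFirst_above hx.1).sep.kzTransport_eq_mul (sepFirst_above hy.1).sep
    (mem_image_of_mem _ (real_mem_above h)) (mem_image_of_mem _ (key1 (1 / 2) (by norm_num) le_rfl))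
    (mem_image_of_mem _ (key2 (1 / 2) le_rfl (by norm_num)))
    (mem_image_of_mem _ (real_mem_above (hyx.trans h))) rfl rfl ?_ ?_ ?_
  · intro t ht
    rw [← ht]; rfl
  · exact fun t ht => ⟨_, mem_image_of_mem _ (key1 t t.2.1 ht), rfl⟩
  · exact fun t ht => ⟨_, mem_image_of_mem _ (key2 t ht t.2.2), rfl⟩

theorem kzTransport_cast {x y x' y' : Config P.cα (n + 1)} (p : Path x y) (hx : x' = x)
    (hy : y' = y) : kzTransport d M (Path.Homotopic.Quotient.mk (p.cast hx hy)) =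
      kzTransport d M (Path.Homotopic.Quotient.mk p) := by
  subst hx hy; rfl

variable (d P M) in
/-- The monodromy operator of `U_k`. -/
def opU (k : Fin m) : Module.End ℂ M := kzOp d M (P.braidU k)

theorem opU_eq (k : Fin m) {w v w' : ℂ} (h1 : w ∈ P.under (P.right k)) (h1' : w ∈ P.home)
    (h2 : v ∈ P.above (P.right k)) (h2' : v ∈ P.above (P.left k)) (h3 : w' ∈ P.under (P.left k))
    (h3' : w' ∈ P.home) :
    opU d P M k = (tr1 d P M w' (P.z 0) * tr1 d P M (P.left k) w') *
      (tr1 d P M v (P.left k) * tr1 d P M (P.right k) v) *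
        (tr1 d P M w (P.right k) * tr1 d P M (P.z 0) w) := by
  have e : opU d P M k = act M (B.perm d 1⁻¹) *
      kzTransport d M (Path.Homotopic.Quotient.mk (P.pathU k)) :=
    kzOp_braidClass (d := d) M (1 : Equiv.Perm (Fin (n + 1)))
      (P.pathU k : Path P.base ((1 : Equiv.Perm (Fin (n + 1))) • P.base))
  rw [e, inv_one, act_perm_one, one_mul, pathU, kzTransport_cast, Path.Homotopic.Quotient.mk_trans,
    kzTransport_trans, Path.Homotopic.Quotient.mk_trans, kzTransport_trans,
    kzTransport_under_symm _ (P.right_lt_z k) h1 h1',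
    kzTransport_under _ ((P.left_lt k).trans (P.lt k 0)) h3 h3',
    kzTransport_above _ _ ((P.left_lt k).trans (P.lt_right k)) (P.right_lt_z k) h2 h2']
  simp only [← Module.End.mul_eq_comp, mul_assoc]

variable (P) in
/-- A rhombus around `α_k`, open at the lower corner. -/
def kite (k : Fin m) (w : ℂ) (η : ℝ) (w' : ℂ) : ℕ → ℂ
  | 0 => w
  | 1 => ⟨P.α k + η, 0⟩
  | 2 => ⟨P.α k, η⟩
  | 3 => ⟨P.α k - η, 0⟩
  | _ => w'

/-- The size `η` is so small that a disk of this radius around `α_k` avoids the other points. -/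
structure Small (P : RealPosition n m) (k : Fin m) (η : ℝ) : Prop where
  pos : 0 < η
  lt : ∀ l, l < k → P.α l + η < P.α k
  gt : ∀ l, k < l → P.α k + η < P.α l
  z : P.α k + η < P.z 0

variable (P) in
/-- Positions of the first point below `α_k` that are directly accessible from the base point. -/
def entry (k : Fin m) : Set ℂ :=
  {w | P.α k ≤ w.re ∧ w.re < P.z 0 ∧ (∀ l, P.α l < w.re - w.im) ∧ w.re + w.im < P.α k}

theorem entry_subset_home (k : Fin m) : P.entry k ⊆ P.home := fun _ hw =>
  ⟨hw.2.2.1, fun _ hj => hw.2.1.trans (z_zero_lt hj)⟩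

theorem not_lt_right {k l : Fin m} (h : P.α l < P.right k) : l ≤ k :=
  not_lt.mp fun h' => lt_asymm h (P.right_lt h')

theorem not_left_lt {k l : Fin m} (h : P.left k < P.α l) : k ≤ l :=
  not_lt.mp fun h' => lt_asymm h (P.lt_left h')

theorem right_lt_imp {k l : Fin m} (h : P.right k < P.α l) : k < l :=
  not_le.mp fun h' => absurd (P.α_mono.monotone h') (by linarith [P.lt_right k])

theorem lt_left_imp {k l : Fin m} (h : P.α l < P.left k) : l < k :=
  not_le.mp fun h' => absurd (P.α_mono.monotone h') (by linarith [P.left_lt k])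

theorem entry_subset_under_right (k : Fin m) : P.entry k ⊆ P.under (P.right k) := by
  rintro w ⟨h1, h2, h3, h4⟩
  refine ⟨fun l h => ?_, fun l h => ?_, fun j hj => ?_⟩
  · linarith [P.α_mono.monotone (not_lt_right h)]
  · linarith [P.α_mono (right_lt_imp h)]
  · linarith [P.lt k j]

theorem entry_subset_under_left (k : Fin m) : P.entry k ⊆ P.under (P.left k) := by
  rintro w ⟨h1, h2, h3, h4⟩
  refine ⟨fun l h => ?_, fun l h => ?_, fun j hj => ?_⟩
  · linarith [P.α_mono (lt_left_imp h)]
  · linarith [P.α_mono.monotone (not_left_lt h)]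
  · linarith [P.lt k j]

theorem Small.right_mem_under {k : Fin m} {η : ℝ} (h : P.Small k η) :
    (⟨P.α k + η, 0⟩ : ℂ) ∈ P.under (P.right k) := by
  refine ⟨fun l h' => ?_, fun l h' => ?_, fun j hj => ?_⟩ <;> simp only
  · linarith [P.α_mono.monotone (not_lt_right h'), h.pos]
  · linarith [h.gt l (right_lt_imp h')]
  · linarith [h.z, z_zero_lt (P := P) hj]

theorem Small.left_mem_under {k : Fin m} {η : ℝ} (h : P.Small k η) :
    (⟨P.α k - η, 0⟩ : ℂ) ∈ P.under (P.left k) := by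
  refine ⟨fun l h' => ?_, fun l h' => ?_, fun j hj => ?_⟩ <;> simp only
  · linarith [h.lt l (lt_left_imp h')]
  · linarith [P.α_mono.monotone (not_left_lt h'), h.pos]
  · linarith [h.z, z_zero_lt (P := P) hj, h.pos]

theorem Small.right_mem_above {k : Fin m} {η : ℝ} (h : P.Small k η) :
    (⟨P.α k + η, 0⟩ : ℂ) ∈ P.above (P.right k) := by
  refine ⟨fun l h' => ?_, fun l h' => ?_, fun j hj => ?_⟩ <;> simp only
  · linarith [P.α_mono.monotone (not_lt_right h'), h.pos]
  · linarith [h.gt l (right_lt_imp h')]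
  · linarith [h.z, z_zero_lt (P := P) hj]

theorem Small.left_mem_above {k : Fin m} {η : ℝ} (h : P.Small k η) :
    (⟨P.α k - η, 0⟩ : ℂ) ∈ P.above (P.left k) := by
  refine ⟨fun l h' => ?_, fun l h' => ?_, fun j hj => ?_⟩ <;> simp only
  · linarith [h.lt l (lt_left_imp h')]
  · linarith [P.α_mono.monotone (not_left_lt h'), h.pos]
  · linarith [h.z, z_zero_lt (P := P) hj, h.pos]

theorem Small.top_mem_above_right {k : Fin m} {η : ℝ} (h : P.Small k η) :
    (⟨P.α k, η⟩ : ℂ) ∈ P.above (P.right k) := by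
  refine ⟨fun l h' => ?_, fun l h' => ?_, fun j hj => ?_⟩ <;> simp only
  · linarith [P.α_mono.monotone (not_lt_right h'), h.pos]
  · linarith [P.α_mono (right_lt_imp h'), h.pos]
  · linarith [h.z, z_zero_lt (P := P) hj, h.pos]

theorem Small.top_mem_above_left {k : Fin m} {η : ℝ} (h : P.Small k η) :
    (⟨P.α k, η⟩ : ℂ) ∈ P.above (P.left k) := by
  refine ⟨fun l h' => ?_, fun l h' => ?_, fun j hj => ?_⟩ <;> simp only
  · linarith [P.α_mono (lt_left_imp h'), h.pos]
  · linarith [P.α_mono.monotone (not_left_lt h'), h.pos]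
  · linarith [h.z, z_zero_lt (P := P) hj, h.pos]

theorem opU_eq_kite {k : Fin m} {η : ℝ} (h : P.Small k η) {w w' : ℂ} (hw : w ∈ P.entry k)
    (hw' : w' ∈ P.entry k) :
    opU d P M k = tr1 d P M w' (P.z 0) * trPoly d P.cα M (fun a => P.pos (kite P k w η w' a)) 4 *
      tr1 d P M (P.z 0) w := by
  have hr : ∀ l, P.right k ≠ P.α l := (P.free_right k).1
  have hl : ∀ l, P.left k ≠ P.α l := (P.free_left k).1
  have rz := P.right_lt_z k
  have lz := (P.left_lt k).trans (P.lt k 0)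
  rw [opU_eq k (entry_subset_under_right k hw) (entry_subset_home k hw) h.top_mem_above_right
    h.top_mem_above_left (entry_subset_under_left k hw') (entry_subset_home k hw')]
  have k1 := SepFirst.tr_trans (d := d) (M := M) (sepFirst_under hr) (entry_subset_under_right k hw)
    h.right_mem_under (real_mem_under rz)
  have k2 := SepFirst.tr_trans (d := d) (M := M) (sepFirst_above hr) h.right_mem_above
    (real_mem_above rz) h.top_mem_above_right
  have k3 := SepFirst.tr_trans (d := d) (M := M) (sepFirst_above hl) h.top_mem_above_left
    h.left_mem_above (real_mem_above lz)
  have k4 := SepFirst.tr_trans (d := d) (M := M) (sepFirst_under hl) h.left_mem_under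
    (real_mem_under lz) (entry_subset_under_left k hw')
  simp only [trPoly, kite, mul_one, tr1, tr] at k1 k2 k3 k4 ⊢
  rw [← k1, ← k2, ← k3, ← k4]
  simp only [mul_assoc]

end RealPosition

theorem trPoly_perm {n m : ℕ} {d : Fin m → ℕ} {α : Fin m → ℂ} {M : Type*} [AddCommGroup M]
    [Module ℂ M] [Module (B n d) M] [FiniteDimensional ℂ M] [IsScalarTower ℂ (B n d) M]
    (σ : Equiv.Perm (Fin n)) {c : ℕ → Fin n → ℂ} {r : ℕ}
    (h : ∀ a < r, Sep α {c a, c (a + 1)}) :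
    RealPosition.trPoly d α M (fun a i => c a (σ⁻¹ i)) r * act M (B.perm d σ) =
      act M (B.perm d σ) * RealPosition.trPoly d α M c r := by
  induction r with
  | zero => simp [RealPosition.trPoly]
  | succ r ih =>
    simp only [RealPosition.trPoly]
    rw [mul_assoc, ih fun a ha => h a (by omega), ← mul_assoc, ← mul_assoc,
      (h r (by omega)).tr_perm σ (by simp) (by simp)]

namespace RealPosition

variable {n m : ℕ} {d : Fin m → ℕ} {P : RealPosition n m}

theorem SepPoles.mono {W W' : Set ℂ} (h : P.SepPoles W) (hs : W' ⊆ W) : P.SepPoles W' :=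
  fun l => (h l).imp fun _ => Exists.imp fun _ H w hw => H w (hs hw)

theorem SepFirst.mono {W W' : Set ℂ} (h : P.SepFirst W) (hs : W' ⊆ W) : P.SepFirst W' :=
  ⟨fun j hj => (h.1 j hj).imp fun _ => Exists.imp fun _ H w hw => H w (hs hw), h.2.mono hs⟩

theorem Small.sepFirst_kite {k : Fin m} {η : ℝ} (h : P.Small k η) {w w' : ℂ} (hw : w ∈ P.entry k)
    (hw' : w' ∈ P.entry k) {a : ℕ} (ha : a < 4) :
    P.SepFirst {kite P k w η w' a, kite P k w η w' (a + 1)} := by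
  have hr : ∀ l, P.right k ≠ P.α l := (P.free_right k).1
  have hl : ∀ l, P.left k ≠ P.α l := (P.free_left k).1
  interval_cases a
  · exact (sepFirst_under hr).mono (insert_subset (entry_subset_under_right k hw)
      (singleton_subset_iff.mpr h.right_mem_under))
  · exact (sepFirst_above hr).mono (insert_subset h.right_mem_above
      (singleton_subset_iff.mpr h.top_mem_above_right))
  · exact (sepFirst_above hl).mono (insert_subset h.top_mem_above_left
      (singleton_subset_iff.mpr h.left_mem_above))
  · exact (sepFirst_under hl).mono (insert_subset h.left_mem_under
      (singleton_subset_iff.mpr (entry_subset_under_left k hw')))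

variable (P) in
/-- The loop of the first point consisting of a rhombus around `α_k` and connecting segments. -/
def loop (k : Fin m) (w : ℂ) (η : ℝ) (w' : ℂ) : ℕ → ℂ
  | 0 => P.z 0
  | 1 => w
  | 2 => ⟨P.α k + η, 0⟩
  | 3 => ⟨P.α k, η⟩
  | 4 => ⟨P.α k - η, 0⟩
  | 5 => w'
  | _ => P.z 0

theorem Small.sepFirst_loop {k : Fin m} {η : ℝ} (h : P.Small k η) {w w' : ℂ} (hw : w ∈ P.entry k)
    (hw' : w' ∈ P.entry k) {a : ℕ} (ha : a < 6) :
    P.SepFirst {loop P k w η w' a, loop P k w η w' (a + 1)} := by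
  interval_cases a
  · exact sepFirst_home.mono (insert_subset z_zero_mem_home
      (singleton_subset_iff.mpr (entry_subset_home k hw)))
  · exact h.sepFirst_kite hw hw' (a := 0) (by norm_num)
  · exact h.sepFirst_kite hw hw' (a := 1) (by norm_num)
  · exact h.sepFirst_kite hw hw' (a := 2) (by norm_num)
  · exact h.sepFirst_kite hw hw' (a := 3) (by norm_num)
  · exact sepFirst_home.mono (insert_subset (entry_subset_home k hw')
      (singleton_subset_iff.mpr z_zero_mem_home))

theorem Small.loop_re_le {k : Fin m} {η : ℝ} (h : P.Small k η) {w w' : ℂ} (hw : w ∈ P.entry k)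
    (hw' : w' ∈ P.entry k) (a : ℕ) : (loop P k w η w' a).re ≤ P.z 0 := by
  have h1 := h.z
  have h2 := h.pos
  unfold loop
  split
  · simp
  · exact hw.2.1.le
  · exact h1.le
  · simp only; linarith
  · simp only; linarith
  · exact hw'.2.1.le
  · simp

theorem exists_small (k : Fin m) {ε : ℝ} (hε : 0 < ε) : ∃ η, P.Small k η ∧ η < ε := by
  have h : ∀ l, ∀ᶠ η in 𝓝[>] (0 : ℝ), (l < k → P.α l + η < P.α k) ∧
      (k < l → P.α k + η < P.α l) := by
    intro l
    have c : ∀ b : ℝ, Tendsto (fun η : ℝ => b + η) (𝓝[>] 0) (𝓝 b) := fun b => by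
      have : Tendsto (fun η : ℝ => b + η) (𝓝 0) (𝓝 (b + 0)) :=
        (continuous_const.add continuous_id).tendsto 0
      rw [add_zero] at this
      exact this.mono_left nhdsWithin_le_nhds
    rcases lt_trichotomy l k with h | h | h
    · filter_upwards [(c (P.α l)).eventually_lt_const (P.α_mono h)] with η h1
      exact ⟨fun _ => h1, fun h' => absurd h h'.asymm⟩
    · exact .of_forall fun η => ⟨fun h' => absurd h h'.ne, fun h' => absurd h h'.ne'⟩
    · filter_upwards [(c (P.α k)).eventually_lt_const (P.α_mono h)] with η h1
      exact ⟨fun h' => absurd h h'.asymm, fun _ => h1⟩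
  have h2 : ∀ᶠ η in 𝓝[>] (0 : ℝ), η < min ε (P.z 0 - P.α k) :=
    (tendsto_id.mono_left nhdsWithin_le_nhds).eventually_lt_const
      (lt_min hε (sub_pos.mpr (P.lt k 0)))
  obtain ⟨η, h1, h2, h3⟩ := ((eventually_all.mpr h).and (h2.and self_mem_nhdsWithin)).exists
  exact ⟨η, ⟨h3, fun l => (h1 l).1, fun l => (h1 l).2, by linarith [h2.trans_le (min_le_right _ _)]⟩,
    h2.trans_le (min_le_left _ _)⟩

theorem mem_entry {k : Fin m} {H : ℝ} (hH : P.z 0 - P.α k ≤ H) :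
    (⟨P.α k, -H⟩ : ℂ) ∈ P.entry k := by
  have := P.lt k 0
  refine ⟨le_rfl, this, fun l => ?_, ?_⟩
  · have := P.lt l 0; simp only; linarith
  · simp only; linarith

variable (M : Type*) [AddCommGroup M] [Module ℂ M]
  [Module (B (n + 1) d) M] [FiniteDimensional ℂ M] [IsScalarTower ℂ (B (n + 1) d) M]

theorem opU_eq_loop {k : Fin m} {η : ℝ} (h : P.Small k η) {w w' : ℂ} (hw : w ∈ P.entry k)
    (hw' : w' ∈ P.entry k) :
    opU d P M k = trPoly d P.cα M (fun a => P.pos (loop P k w η w' a)) 6 := by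
  rw [opU_eq_kite h hw hw']
  simp only [trPoly, kite, loop, mul_one, mul_assoc]

theorem sep_update {W : Set ℂ} (hW : P.SepPoles W) (hre : ∀ w ∈ W, w.re ≤ P.z 0)
    {C : Set (Fin (n + 1) → ℂ)} (hC : Sep P.cα C) (hre' : ∀ c ∈ C, ∀ j, j ≠ 0 → P.z 0 < (c j).re) :
    Sep P.cα (image2 (fun w c => Function.update c 0 w) W C) := by
  refine ⟨fun i j hij => ?_, fun i l => ?_⟩
  · have hj : j ≠ 0 := (lt_of_le_of_lt (Fin.zero_le _) hij).ne'
    by_cases hi : i = 0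
    · refine ⟨1, 0, ?_⟩
      rintro _ ⟨w, hw, c, hc, rfl⟩
      have := hre' c hc j hj
      have := hre w hw
      simp only [hi, Function.update_self, Function.update_of_ne hj, lin, Complex.sub_re]
      linarith
    · obtain ⟨a, b, h⟩ := hC.1 i j hij
      refine ⟨a, b, ?_⟩
      rintro _ ⟨w, hw, c, hc, rfl⟩
      simpa only [Function.update_of_ne hi, Function.update_of_ne hj] using h c hc
  · by_cases hi : i = 0
    · obtain ⟨a, b, h⟩ := hW l
      refine ⟨a, b, ?_⟩
      rintro _ ⟨w, hw, c, hc, rfl⟩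
      simpa only [hi, Function.update_self] using h w hw
    · obtain ⟨a, b, h⟩ := hC.2 i l
      refine ⟨a, b, ?_⟩
      rintro _ ⟨w, hw, c, hc, rfl⟩
      simpa only [Function.update_of_ne hi] using h c hc

theorem z_lt_re_of_mem_near {i : Fin n} (hi : 1 ≤ i.val) {a b : ℝ} {x : Fin (n + 1) → ℂ}
    (hx : x ∈ P.near i a b) {j : Fin (n + 1)} (hj : j ≠ 0) : P.z 0 < (x j).re := by
  have h0 : P.z 0 < P.z i.castSucc := P.z_mono (by rw [Fin.lt_def]; simp; omega)
  by_cases h1 : j = i.castSucc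
  · rw [h1]; exact h0.trans_le hx.2.1.1
  · by_cases h2 : j = i.succ
    · rw [h2]; exact h0.trans_le hx.2.2.1.1
    · rw [hx.1 j h1 h2]; exact z_zero_lt hj

theorem opU_comm_opT (k : Fin m) (i : Fin n) (hi : 1 ≤ i.val) :
    opU d P M k * opT d P i M = opT d P i M * opU d P M k := by
  obtain ⟨η, hη, -⟩ := exists_small (P := P) k one_pos
  have hw := mem_entry (P := P) (k := k) le_rfl
  set w : ℂ := ⟨P.α k, -(P.z 0 - P.α k)⟩
  set s := Equiv.swap i.castSucc i.succ
  have hs0 : s 0 = 0 := Equiv.swap_apply_of_ne_of_ne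
    (by rw [Ne, Fin.ext_iff]; simp; omega) (by rw [Ne, Fin.ext_iff]; simp)
  have hs0' : s⁻¹ 0 = 0 := by rw [Equiv.swap_inv]; exact hs0
  let c : ℕ → Fin (n + 1) → ℂ
    | 0 => P.flat 1
    | 1 => P.mid i
    | _ => P.flat s
  have hc0 : ∀ b, c b 0 = P.z 0 := by
    have e1 : (0 : Fin (n + 1)) ≠ i.castSucc := by rw [Ne, Fin.ext_iff]; simp; omega
    have e2 : (0 : Fin (n + 1)) ≠ i.succ := by rw [Ne, Fin.ext_iff]; simp
    intro b
    simp only [c]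
    split
    · rfl
    · simp only [mid, e1, e2, if_false]; rfl
    · simp only [flat, hs0']; rfl
  let u := loop P k w η w
  have hc : ∀ b < 2, ∃ C, Sep P.cα C ∧ (∀ x ∈ C, ∀ j, j ≠ 0 → P.z 0 < (x j).re) ∧ c b ∈ C ∧
      c (b + 1) ∈ C := by
    intro b hb
    interval_cases b
    · exact ⟨_, P.sep_near i 1 1, fun x hx j => z_lt_re_of_mem_near hi hx, P.flat_one_mem_near i,
        P.mid_mem_near i one_pos⟩
    · exact ⟨_, P.sep_near i (-1) 1, fun x hx j => z_lt_re_of_mem_near hi hx,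
        P.mid_mem_near i one_pos, P.flat_swap_mem_near i⟩
  have grid := trPoly_grid (d := d) (M := M) (α := P.cα) (fun a b => Function.update (c b) 0 (u a))
    6 2 (by
      intro a ha b hb
      obtain ⟨C, h1, h2, h3, h4⟩ := hc b hb
      refine (sep_update (hη.sepFirst_loop hw hw ha).2 ?_ h1 h2).mono ?_
      · rintro _ (rfl | rfl)
        · exact hη.loop_re_le hw hw a
        · exact hη.loop_re_le hw hw (a + 1)
      · rintro _ (rfl | rfl | rfl | rfl)
        · exact mem_image2_of_mem (by simp [u]) h3
        · exact mem_image2_of_mem (by simp [u]) h3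
        · exact mem_image2_of_mem (by simp [u]) h4
        · exact mem_image2_of_mem (by simp [u]) h4)
  have f0 : ∀ b, Function.update (c b) 0 (u 0) = c b := fun b => by
    have : u 0 = c b 0 := (hc0 b).symm
    rw [this, Function.update_eq_self]
  have f6 : ∀ b, Function.update (c b) 0 (u 6) = c b := f0
  have g0 : ∀ a, Function.update (c 0) 0 (u a) = P.pos (u a) := fun a => rfl
  have g2 : ∀ a, Function.update (c 2) 0 (u a) = fun j => P.pos (u a) (s⁻¹ j) := by
    intro a
    funext j
    by_cases hj : j = 0
    · rw [hj, hs0']; simp [pos]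
    · have : s⁻¹ j ≠ 0 := fun e => hj (by rw [← hs0'] at e; exact s⁻¹.injective e)
      rw [Function.update_of_ne hj, pos, Function.update_of_ne this]
      rfl
  simp only [f0, f6, g0, g2] at grid
  have hp := trPoly_perm (d := d) (M := M) s (c := fun a => P.pos (u a)) (r := 6)
    (fun a ha => by
      have := (hη.sepFirst_loop hw hw ha).sep
      rwa [image_pair] at this)
  rw [← opU_eq_loop M hη hw hw] at grid hp
  have hc2 : trPoly d P.cα M (fun b => c b) 2 = tr d P.cα M (P.mid i) (P.flat s) *
      tr d P.cα M (P.flat 1) (P.mid i) := by simp only [trPoly, mul_one]; rfl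
  rw [opT_eq, ← hc2]
  have e1 := act_perm_mul_inv (d := d) (M := M) s
  have e2 := act_perm_inv_mul (d := d) (M := M) s
  set A := act M (B.perm d s)
  set A' := act M (B.perm d s⁻¹)
  have key : A' * trPoly d P.cα M (fun a j => P.pos (u a) (s⁻¹ j)) 6 = opU d P M k * A' := by
    have := congrArg (fun x => A' * (x * A')) hp
    simp only [mul_assoc, e1, mul_one] at this
    rw [this, ← mul_assoc, e2, one_mul]
  rw [← mul_assoc, ← key, mul_assoc, ← grid, mul_assoc]

end RealPosition

theorem mul_mul_eq_of_mul_eq {G : Type*} [Semigroup G] {a b c : G} (h : a * b = c) (x : G) :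
    a * (b * x) = c * x := by rw [← mul_assoc, h]

namespace RealPosition

variable {n m : ℕ} {d : Fin m → ℕ} (P : RealPosition n m)

/-- The configuration obtained from the base point by moving the first point to `q.1` and the
point number `i + 1` to `q.2`. -/
def pos2 (i : Fin n) (q : ℂ × ℂ) : Fin (n + 1) → ℂ := Function.update (P.pos q.1) i.succ q.2

/-- Positions that are joined to real points on the right of the `α_l` by segments directed
to the upper right. -/
def homePoles : Set ℂ := {w | ∀ l, P.α l < w.re - w.im}

variable {P}

theorem sepPoles_homePoles : P.SepPoles P.homePoles := fun l => ⟨1, -1, fun w hw => by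
  have := hw l
  simp [lin, cα]; linarith⟩

theorem sep_pos2 {i : Fin n} (hi : i.val = 0) {W : Set (ℂ × ℂ)} {W₀ W₁ : Set ℂ}
    (h0 : P.SepPoles W₀) (h1 : P.SepPoles W₁) (a b : ℝ)
    (h : ∀ q ∈ W, 0 < a * (q.2.re - q.1.re) + b * (q.2.im - q.1.im) ∧ q.1.re ≤ P.z i.succ ∧
      q.2.re ≤ P.z i.succ ∧ q.1 ∈ W₀ ∧ q.2 ∈ W₁) : Sep P.cα (P.pos2 i '' W) := by
  have hne : (0 : Fin (n + 1)) ≠ i.succ := (Fin.succ_ne_zero i).symm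
  refine ⟨fun p q hpq => ?_, fun p l => ?_⟩
  · have hq : q ≠ 0 := (lt_of_le_of_lt (Fin.zero_le _) hpq).ne'
    by_cases hp : p = 0
    · by_cases hq' : q = i.succ
      · refine ⟨a, b, ?_⟩
        rintro _ ⟨x, hx, rfl⟩
        simpa only [pos2, pos, hp, hq', Function.update_self, Function.update_of_ne hne, lin,
          Complex.sub_re, Complex.sub_im] using (h x hx).1
      · refine ⟨1, 0, ?_⟩
        rintro _ ⟨x, hx, rfl⟩
        have : P.z i.succ < P.z q := P.z_mono (by
          have e1 : q.val ≠ 0 := fun e => hq (Fin.ext e)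
          have e2 : q.val ≠ i.val + 1 := fun e => hq' (Fin.ext (by simpa using e))
          rw [Fin.lt_def, Fin.val_succ]; omega)
        have := (h x hx).2.1
        simp only [pos2, pos, hp, Function.update_self, Function.update_of_ne hne,
          Function.update_of_ne hq', Function.update_of_ne hq, lin, Complex.sub_re,
          Complex.ofReal_re]
        linarith
    · by_cases hp' : p = i.succ
      · refine ⟨1, 0, ?_⟩
        rintro _ ⟨x, hx, rfl⟩
        have hq' : q ≠ i.succ := fun e => hpq.ne (hp'.trans e.symm)
        have : P.z i.succ < P.z q := P.z_mono (hp' ▸ hpq)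
        have := (h x hx).2.2.1
        simp only [pos2, pos, hp', Function.update_self,
          Function.update_of_ne hq', Function.update_of_ne hq, lin, Complex.sub_re,
          Complex.ofReal_re]
        linarith
      · refine ⟨1, 0, ?_⟩
        rintro _ ⟨x, hx, rfl⟩
        have hq' : q ≠ i.succ := fun e => by
          have e1 : p.val ≠ 0 := fun e => hp (Fin.ext e)
          rw [e, Fin.lt_def, Fin.val_succ] at hpq; omega
        have := P.z_mono hpq
        simp only [pos2, pos, Function.update_of_ne hp, Function.update_of_ne hp',
          Function.update_of_ne hq', Function.update_of_ne hq, lin, Complex.sub_re,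
          Complex.ofReal_re]
        linarith
  · by_cases hp : p = 0
    · obtain ⟨a, b, h0⟩ := h0 l
      refine ⟨a, b, ?_⟩
      rintro _ ⟨x, hx, rfl⟩
      simpa only [pos2, pos, hp, Function.update_self, Function.update_of_ne hne] using
        h0 _ (h x hx).2.2.2.1
    · by_cases hp' : p = i.succ
      · obtain ⟨a, b, h1⟩ := h1 l
        refine ⟨a, b, ?_⟩
        rintro _ ⟨x, hx, rfl⟩
        simpa only [pos2, hp', Function.update_self] using h1 _ (h x hx).2.2.2.2
      · refine ⟨1, 0, ?_⟩
        rintro _ ⟨x, hx, rfl⟩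
        have := P.lt l p
        simp only [pos2, pos, Function.update_of_ne hp, Function.update_of_ne hp', lin, cα,
          Complex.sub_re, Complex.ofReal_re]
        linarith

theorem pos2_z (i : Fin n) (w : ℂ) : P.pos2 i (w, ⟨P.z i.succ, 0⟩) = P.pos w := by
  have : (⟨P.z i.succ, 0⟩ : ℂ) = P.pos w i.succ := by
    rw [pos, Function.update_of_ne (Fin.succ_ne_zero i)]; rfl
  rw [pos2, this, Function.update_eq_self]

theorem castSucc_eq_zero {i : Fin n} (hi : i.val = 0) : i.castSucc = 0 := Fin.ext (by simpa)

theorem pos_swap {i : Fin n} (hi : i.val = 0) (w : ℂ) :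
    (fun j => P.pos w ((Equiv.swap i.castSucc i.succ)⁻¹ j)) =
      P.pos2 i (⟨P.z i.succ, 0⟩, w) := by
  have hne : (0 : Fin (n + 1)) ≠ i.succ := (Fin.succ_ne_zero i).symm
  funext j
  rw [Equiv.swap_inv, castSucc_eq_zero hi, pos2]
  by_cases h0 : j = 0
  · rw [h0, Equiv.swap_apply_left, Function.update_of_ne hne, pos, Function.update_of_ne hne.symm,
      pos, Function.update_self]; rfl
  · by_cases h1 : j = i.succ
    · rw [h1, Equiv.swap_apply_right, Function.update_self, pos, Function.update_self]
    · rw [Equiv.swap_apply_of_ne_of_ne h0 h1, Function.update_of_ne h1, pos, pos,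
        Function.update_of_ne h0, Function.update_of_ne h0]

theorem mid_eq {i : Fin n} (hi : i.val = 0) : P.mid i = P.pos2 i
    (⟨(P.z 0 + P.z i.succ) / 2, (P.z 0 - P.z i.succ) / 2⟩,
      ⟨(P.z i.succ + P.z 0) / 2, (P.z i.succ - P.z 0) / 2⟩) := by
  have hne : (0 : Fin (n + 1)) ≠ i.succ := (Fin.succ_ne_zero i).symm
  funext j
  rw [mid, castSucc_eq_zero hi, pos2]
  by_cases h1 : j = i.succ
  · simp [h1]
  · by_cases h0 : j = 0
    · simp [h0, hne, pos]
    · simp [h0, h1, pos]; rfl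

theorem mid_swap {i : Fin n} (hi : i.val = 0) :
    (fun j => P.mid i ((Equiv.swap i.castSucc i.succ)⁻¹ j)) = P.pos2 i
    (⟨(P.z i.succ + P.z 0) / 2, (P.z i.succ - P.z 0) / 2⟩,
      ⟨(P.z 0 + P.z i.succ) / 2, (P.z 0 - P.z i.succ) / 2⟩) := by
  have hne : (0 : Fin (n + 1)) ≠ i.succ := (Fin.succ_ne_zero i).symm
  rw [mid_eq hi]
  funext j
  rw [Equiv.swap_inv, castSucc_eq_zero hi, pos2, pos2]
  by_cases h0 : j = 0
  · rw [h0, Equiv.swap_apply_left, Function.update_of_ne hne, Function.update_self, pos,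
      Function.update_self]
  · by_cases h1 : j = i.succ
    · rw [h1, Equiv.swap_apply_right, Function.update_self, Function.update_of_ne hne, pos,
        Function.update_self]
    · rw [Equiv.swap_apply_of_ne_of_ne h0 h1, Function.update_of_ne h1, Function.update_of_ne h1,
        pos, pos, Function.update_of_ne h0, Function.update_of_ne h0]

variable (d P) (M : Type*) [AddCommGroup M] [Module ℂ M]
  [Module (B (n + 1) d) M] [FiniteDimensional ℂ M] [IsScalarTower ℂ (B (n + 1) d) M]

/-- Transport along the straight motion of the first and of another point. -/
abbrev tr2 (i : Fin n) (q r : ℂ × ℂ) : Module.End ℂ M := tr d P.cα M (P.pos2 i q) (P.pos2 i r)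

variable {d P M}

theorem flat_one_eq (i : Fin n) : P.flat 1 = P.pos2 i (⟨P.z 0, 0⟩, ⟨P.z i.succ, 0⟩) := by
  rw [pos2_z, ← pos_base]; rfl

theorem flat_swap_eq {i : Fin n} (hi : i.val = 0) : P.flat (Equiv.swap i.castSucc i.succ) =
    P.pos2 i (⟨P.z i.succ, 0⟩, ⟨P.z 0, 0⟩) := by
  rw [← pos_swap hi]
  have : (⟨P.z 0, 0⟩ : ℂ) = P.z 0 := rfl
  rw [this, pos_base, flat_perm, mul_one]

theorem act_swap_mul_act_swap (i : Fin n) :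
    act M (B.perm d (Equiv.swap i.castSucc i.succ)) *
      act M (B.perm d (Equiv.swap i.castSucc i.succ)) = 1 := by
  rw [← act_perm_mul, Equiv.swap_mul_self, act_perm_one]

/-- The operator of `U_k` conjugated by a transposition. -/
theorem act_swap_mul_opU {i : Fin n} (hi : i.val = 0) {k : Fin m} {η : ℝ} (h : P.Small k η)
    {w w' : ℂ} (hw : w ∈ P.entry k) (hw' : w' ∈ P.entry k) :
    act M (B.perm d (Equiv.swap i.castSucc i.succ)) * opU d P M k =
      (tr2 d P M i (⟨P.z i.succ, 0⟩, w') (⟨P.z i.succ, 0⟩, ⟨P.z 0, 0⟩) *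
        trPoly d P.cα M (fun b => P.pos2 i (⟨P.z i.succ, 0⟩, P.kite k w η w' b)) 4 *
        tr2 d P M i (⟨P.z i.succ, 0⟩, ⟨P.z 0, 0⟩) (⟨P.z i.succ, 0⟩, w)) *
      act M (B.perm d (Equiv.swap i.castSucc i.succ)) := by
  have hp := trPoly_perm (d := d) (M := M) (Equiv.swap i.castSucc i.succ)
    (c := fun a => P.pos (loop P k w η w' a)) (r := 6)
    (fun a ha => by
      have := (h.sepFirst_loop hw hw' ha).sep
      rwa [image_pair] at this)
  rw [← opU_eq_loop M h hw hw'] at hp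
  have e : (fun a j => P.pos (loop P k w η w' a) ((Equiv.swap i.castSucc i.succ)⁻¹ j)) =
      fun a => P.pos2 i (⟨P.z i.succ, 0⟩, loop P k w η w' a) := funext fun a => pos_swap hi _
  rw [e] at hp
  rw [← hp]
  simp only [trPoly, loop, kite, mul_one, mul_assoc]
  rfl

theorem opT_eq_pos2 {i : Fin n} (hi : i.val = 0) : opT d P i M =
    act M (B.perm d (Equiv.swap i.castSucc i.succ)) *
      (tr2 d P M i (⟨(P.z 0 + P.z i.succ) / 2, (P.z 0 - P.z i.succ) / 2⟩,
        ⟨(P.z i.succ + P.z 0) / 2, (P.z i.succ - P.z 0) / 2⟩)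
        (⟨P.z i.succ, 0⟩, ⟨P.z 0, 0⟩) *
      tr2 d P M i (⟨P.z 0, 0⟩, ⟨P.z i.succ, 0⟩)
        (⟨(P.z 0 + P.z i.succ) / 2, (P.z 0 - P.z i.succ) / 2⟩,
        ⟨(P.z i.succ + P.z 0) / 2, (P.z i.succ - P.z 0) / 2⟩)) := by
  rw [opT_eq, Equiv.swap_inv, flat_swap_eq hi, flat_one_eq i, mid_eq hi]

theorem act_swap_mul_tr2 {i : Fin n} (hi : i.val = 0) :
    act M (B.perm d (Equiv.swap i.castSucc i.succ)) *
      (tr2 d P M i (⟨(P.z 0 + P.z i.succ) / 2, (P.z 0 - P.z i.succ) / 2⟩,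
        ⟨(P.z i.succ + P.z 0) / 2, (P.z i.succ - P.z 0) / 2⟩)
        (⟨P.z i.succ, 0⟩, ⟨P.z 0, 0⟩) *
      tr2 d P M i (⟨P.z 0, 0⟩, ⟨P.z i.succ, 0⟩)
        (⟨(P.z 0 + P.z i.succ) / 2, (P.z 0 - P.z i.succ) / 2⟩,
        ⟨(P.z i.succ + P.z 0) / 2, (P.z i.succ - P.z 0) / 2⟩)) =
      (tr2 d P M i (⟨(P.z i.succ + P.z 0) / 2, (P.z i.succ - P.z 0) / 2⟩,
        ⟨(P.z 0 + P.z i.succ) / 2, (P.z 0 - P.z i.succ) / 2⟩)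
        (⟨P.z 0, 0⟩, ⟨P.z i.succ, 0⟩) *
      tr2 d P M i (⟨P.z i.succ, 0⟩, ⟨P.z 0, 0⟩)
        (⟨(P.z i.succ + P.z 0) / 2, (P.z i.succ - P.z 0) / 2⟩,
        ⟨(P.z 0 + P.z i.succ) / 2, (P.z 0 - P.z i.succ) / 2⟩)) *
      act M (B.perm d (Equiv.swap i.castSucc i.succ)) := by
  set s := Equiv.swap i.castSucc i.succ with hs
  have h1 := (P.sep_near i (-1) 1).tr_perm (d := d) (M := M) s (P.mid_mem_near i one_pos)
    (P.flat_swap_mem_near i)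
  have h2 := (P.sep_near i 1 1).tr_perm (d := d) (M := M) s (P.flat_one_mem_near i)
    (P.mid_mem_near i one_pos)
  rw [flat_perm, mid_swap hi] at h1 h2
  have e : s * Equiv.swap i.castSucc i.succ = 1 := Equiv.swap_mul_self _ _
  rw [e, mid_eq hi, ← hs, flat_one_eq i, flat_swap_eq hi] at h1
  rw [mul_one, flat_one_eq i, flat_swap_eq hi, mid_eq hi] at h2
  rw [← mul_assoc, ← h1, mul_assoc, ← h2, mul_assoc]

end RealPosition

namespace RealPosition

variable {n m : ℕ} {d : Fin m → ℕ} {P : RealPosition n m}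

theorem Small.mono {k : Fin m} {η η' : ℝ} (h : P.Small k η) (h0 : 0 < η') (hle : η' ≤ η) :
    P.Small k η' :=
  ⟨h0, fun l hl => by linarith [h.lt l hl], fun l hl => by linarith [h.gt l hl],
    by linarith [h.z]⟩

/-- The path in `ℂ` with two vertices. -/
def edge (u v : ℂ) : ℕ → ℂ
  | 0 => u
  | _ => v

variable {M : Type*} [AddCommGroup M] [Module ℂ M]
  [Module (B (n + 1) d) M] [FiniteDimensional ℂ M] [IsScalarTower ℂ (B (n + 1) d) M]

theorem trPoly_edge_left (i : Fin n) (u v x : ℂ) :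
    trPoly d P.cα M (fun a => P.pos2 i (edge u v a, x)) 1 = tr2 d P M i (u, x) (v, x) := by
  simp only [trPoly, edge, mul_one]

theorem trPoly_edge_right (i : Fin n) (u v x : ℂ) :
    trPoly d P.cα M (fun a => P.pos2 i (x, edge u v a)) 1 = tr2 d P M i (x, u) (x, v) := by
  simp only [trPoly, edge, mul_one]

/-- Two points that move along polygonal paths kept apart by linear forms can move in any order. -/
theorem pos2_grid {i : Fin n} (hi : i.val = 0) (f g : ℕ → ℂ) (r s : ℕ)
    (hf : ∀ a < r, P.SepPoles {f a, f (a + 1)}) (hg : ∀ b < s, P.SepPoles {g b, g (b + 1)})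
    (hf' : ∀ a ≤ r, (f a).re ≤ P.z i.succ) (hg' : ∀ b ≤ s, (g b).re ≤ P.z i.succ)
    (h : ∀ b < s, ∃ p q : ℝ, ∀ a ≤ r,
      0 < p * ((g b).re - (f a).re) + q * ((g b).im - (f a).im) ∧
      0 < p * ((g (b + 1)).re - (f a).re) + q * ((g (b + 1)).im - (f a).im)) :
    trPoly d P.cα M (fun b => P.pos2 i (f r, g b)) s *
        trPoly d P.cα M (fun a => P.pos2 i (f a, g 0)) r =
      trPoly d P.cα M (fun a => P.pos2 i (f a, g s)) r *
        trPoly d P.cα M (fun b => P.pos2 i (f 0, g b)) s := by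
  refine trPoly_grid (fun a b => P.pos2 i (f a, g b)) r s fun a ha b hb => ?_
  obtain ⟨p, q, hpq⟩ := h b hb
  have k := sep_pos2 hi (W := {(f a, g b), (f (a + 1), g b), (f a, g (b + 1)),
    (f (a + 1), g (b + 1))}) (hf a ha) (hg b hb) p q (by
      rintro x (rfl | rfl | rfl | rfl)
      · exact ⟨(hpq a ha.le).1, hf' a ha.le, hg' b hb.le, by simp, by simp⟩
      · exact ⟨(hpq (a + 1) ha).1, hf' (a + 1) ha, hg' b hb.le, by simp, by simp⟩
      · exact ⟨(hpq a ha.le).2, hf' a ha.le, hg' (b + 1) hb, by simp, by simp⟩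
      · exact ⟨(hpq (a + 1) ha).2, hf' (a + 1) ha, hg' (b + 1) hb, by simp, by simp⟩)
  simpa only [image_insert_eq, image_singleton] using k

theorem opU_eq_kite_pos2 (i : Fin n) {k : Fin m} {η : ℝ} (h : P.Small k η) {w w' : ℂ}
    (hw : w ∈ P.entry k) (hw' : w' ∈ P.entry k) :
    opU d P M k = tr2 d P M i (w', ⟨P.z i.succ, 0⟩) (⟨P.z 0, 0⟩, ⟨P.z i.succ, 0⟩) *
      trPoly d P.cα M (fun a => P.pos2 i (kite P k w η w' a, ⟨P.z i.succ, 0⟩)) 4 *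
      tr2 d P M i (⟨P.z 0, 0⟩, ⟨P.z i.succ, 0⟩) (w, ⟨P.z i.succ, 0⟩) := by
  rw [opU_eq_kite h hw hw']
  simp only [pos2_z, tr2]
  rfl

theorem opU_comm_conj {i : Fin n} (hi : i.val = 0) {k j : Fin m} (hkj : k < j) :
    ∃ X : Module.End ℂ M, opT d P i M * X = opU d P M j * opT d P i M ∧
      opU d P M k * X = X * opU d P M k := by
  have hA : P.α k < P.α j := P.α_mono hkj
  have hJ := P.lt j 0
  have hz : P.z 0 < P.z i.succ := P.z_mono (Fin.succ_pos i)
  obtain ⟨η₁, hη₁, hη₁'⟩ := exists_small (P := P) k (half_pos (sub_pos.mpr hA))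
  obtain ⟨η₂, hη₂, -⟩ := exists_small (P := P) j one_pos
  have hk := hη₁.mono (lt_min hη₁.pos hη₂.pos) (min_le_left _ _)
  have hj := hη₂.mono (lt_min hη₁.pos hη₂.pos) (min_le_right _ _)
  have hη' : 2 * min η₁ η₂ < P.α j - P.α k := by linarith [min_le_left η₁ η₂]
  generalize min η₁ η₂ = η at hk hj hη'
  have hη := hk.pos
  have hkz := hk.z
  have hjz := hj.z
  have hw₀ := mem_entry (P := P) (k := k) (H := P.z i.succ - P.α k) (by linarith)
  have hw₁ := mem_entry (P := P) (k := j) le_rfl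
  set w₀ : ℂ := ⟨P.α k, -(P.z i.succ - P.α k)⟩ with ew₀
  set w₁ : ℂ := ⟨P.α j, -(P.z 0 - P.α j)⟩ with ew₁
  have G1 := pos2_grid (d := d) (M := M) (P := P) hi (edge w₀ ⟨P.z i.succ, 0⟩) (kite P j w₁ η w₁)
    1 4 (by
      intro a ha
      refine sepPoles_homePoles.mono ?_
      interval_cases a
      rintro w (rfl | rfl) l
      · have := P.lt l 0; simp only [edge, ew₀]; linarith
      · have := P.lt l 0; simp only [edge]; linarith)
    (fun b hb => (hj.sepFirst_kite hw₁ hw₁ hb).2)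
    (by intro a ha; interval_cases a <;> simp only [edge, ew₀] <;> linarith)
    (by intro b hb; interval_cases b <;> simp only [kite, ew₁] <;> linarith)
    (by
      intro b hb
      refine ⟨-1, 1, fun a ha => ?_⟩
      interval_cases b <;> interval_cases a <;> simp only [kite, edge, ew₀, ew₁] <;>
        constructor <;> linarith)
  have G2 := pos2_grid (d := d) (M := M) (P := P) hi (kite P k w₀ η w₀) (edge ⟨P.z i.succ, 0⟩ w₁)
    4 1 (fun b hb => (hk.sepFirst_kite hw₀ hw₀ hb).2)
    (by
      intro a ha
      refine sepPoles_homePoles.mono ?_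
      interval_cases a
      rintro w (rfl | rfl) l
      · have := P.lt l 0; simp only [edge]; linarith
      · have := P.lt l 0; simp only [edge, ew₁]; linarith)
    (by intro b hb; interval_cases b <;> simp only [kite, ew₀] <;> linarith)
    (by intro a ha; interval_cases a <;> simp only [edge, ew₁] <;> linarith)
    (by
      intro b hb
      refine ⟨1, 0, fun a ha => ?_⟩
      interval_cases b; interval_cases a <;> simp only [kite, edge, ew₀, ew₁] <;>
        constructor <;> linarith)
  have G3 := pos2_grid (d := d) (M := M) (P := P) hi (kite P k w₀ η w₀) (kite P j w₁ η w₁)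
    4 4 (fun b hb => (hk.sepFirst_kite hw₀ hw₀ hb).2) (fun b hb => (hj.sepFirst_kite hw₁ hw₁ hb).2)
    (by intro b hb; interval_cases b <;> simp only [kite, ew₀] <;> linarith)
    (by intro b hb; interval_cases b <;> simp only [kite, ew₁] <;> linarith)
    (by
      intro b hb
      refine ⟨1, 0, fun a ha => ?_⟩
      interval_cases b <;> interval_cases a <;> simp only [kite, ew₀, ew₁] <;>
        constructor <;> linarith)
  have hs1 := sep_pos2 (P := P) hi (W := {(⟨P.z 0, 0⟩, ⟨P.z i.succ, 0⟩), (w₀, ⟨P.z i.succ, 0⟩),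
    (w₀, w₁), (⟨(P.z 0 + P.z i.succ) / 2, (P.z 0 - P.z i.succ) / 2⟩,
        ⟨(P.z i.succ + P.z 0) / 2, (P.z i.succ - P.z 0) / 2⟩)}) sepPoles_homePoles
    sepPoles_homePoles 1 1 (by
      rintro q (rfl | rfl | rfl | rfl) <;> refine ⟨?_, ?_, ?_, fun l => ?_, fun l => ?_⟩ <;>
        simp only [ew₀, ew₁] <;> first | linarith | linarith [P.lt l 0])
  have hs2 := sep_pos2 (P := P) hi (W := {(w₀, w₁), (⟨P.z i.succ, 0⟩, w₁),
    (⟨P.z i.succ, 0⟩, ⟨P.z 0, 0⟩), (⟨(P.z 0 + P.z i.succ) / 2, (P.z 0 - P.z i.succ) / 2⟩,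
        ⟨(P.z i.succ + P.z 0) / 2, (P.z i.succ - P.z 0) / 2⟩)}) sepPoles_homePoles
    sepPoles_homePoles (-1) 1 (by
      rintro q (rfl | rfl | rfl | rfl) <;> refine ⟨?_, ?_, ?_, fun l => ?_, fun l => ?_⟩ <;>
        simp only [ew₀, ew₁] <;> first | linarith | linarith [P.lt l 0])
  have hU := opU_eq_kite_pos2 (d := d) (M := M) i hk hw₀ hw₀
  have hU' := act_swap_mul_opU (d := d) (M := M) hi hj hw₁ hw₁
  have hAA := act_swap_mul_act_swap (d := d) (M := M) i
  rw [trPoly_edge_left, trPoly_edge_left] at G1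
  rw [trPoly_edge_right, trPoly_edge_right] at G2
  rw [opT_eq_pos2 hi]
  set A := act M (B.perm d (Equiv.swap i.castSucc i.succ))
  change trPoly d P.cα M (fun b => P.pos2 i (⟨P.z i.succ, 0⟩, kite P j w₁ η w₁ b)) 4 *
    tr2 d P M i (w₀, w₁) (⟨P.z i.succ, 0⟩, w₁) = tr2 d P M i (w₀, w₁) (⟨P.z i.succ, 0⟩, w₁) *
    trPoly d P.cα M (fun b => P.pos2 i (w₀, kite P j w₁ η w₁ b)) 4 at G1
  change tr2 d P M i (w₀, ⟨P.z i.succ, 0⟩) (w₀, w₁) *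
    trPoly d P.cα M (fun a => P.pos2 i (kite P k w₀ η w₀ a, ⟨P.z i.succ, 0⟩)) 4 =
    trPoly d P.cα M (fun a => P.pos2 i (kite P k w₀ η w₀ a, w₁)) 4 *
    tr2 d P M i (w₀, ⟨P.z i.succ, 0⟩) (w₀, w₁) at G2
  change trPoly d P.cα M (fun b => P.pos2 i (w₀, kite P j w₁ η w₁ b)) 4 *
    trPoly d P.cα M (fun a => P.pos2 i (kite P k w₀ η w₀ a, w₁)) 4 =
    trPoly d P.cα M (fun a => P.pos2 i (kite P k w₀ η w₀ a, w₁)) 4 *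
    trPoly d P.cα M (fun b => P.pos2 i (w₀, kite P j w₁ η w₁ b)) 4 at G3
  generalize hb : ((⟨P.z 0, 0⟩, ⟨P.z i.succ, 0⟩) : ℂ × ℂ) = b at *
  generalize hS : ((⟨P.z i.succ, 0⟩, ⟨P.z 0, 0⟩) : ℂ × ℂ) = S at *
  generalize hX : ((w₀, ⟨P.z i.succ, 0⟩) : ℂ × ℂ) = X at *
  generalize hY : ((w₀, w₁) : ℂ × ℂ) = Y at *
  generalize hV : ((⟨P.z i.succ, 0⟩, w₁) : ℂ × ℂ) = V at *
  generalize hμ : ((⟨(P.z 0 + P.z i.succ) / 2, (P.z 0 - P.z i.succ) / 2⟩,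
        ⟨(P.z i.succ + P.z 0) / 2, (P.z i.succ - P.z 0) / 2⟩) : ℂ × ℂ) = μ at *
  have c1 : tr2 d P M i Y V * tr2 d P M i μ Y = tr2 d P M i μ V :=
    hs2.tr_trans ⟨_, by simp, rfl⟩ ⟨_, by simp, rfl⟩ ⟨_, by simp, rfl⟩
  have c2 : tr2 d P M i S V * tr2 d P M i μ S = tr2 d P M i μ V :=
    hs2.tr_trans ⟨_, by simp, rfl⟩ ⟨_, by simp, rfl⟩ ⟨_, by simp, rfl⟩
  have c3 : tr2 d P M i μ Y * tr2 d P M i b μ = tr2 d P M i b Y :=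
    hs1.tr_trans ⟨_, by simp, rfl⟩ ⟨_, by simp, rfl⟩ ⟨_, by simp, rfl⟩
  have c4 : tr2 d P M i X Y * tr2 d P M i b X = tr2 d P M i b Y :=
    hs1.tr_trans ⟨_, by simp, rfl⟩ ⟨_, by simp, rfl⟩ ⟨_, by simp, rfl⟩
  have c5 : tr2 d P M i b X * tr2 d P M i X b = 1 :=
    hs1.tr_mul_tr ⟨_, by simp, rfl⟩ ⟨_, by simp, rfl⟩
  have c6 : tr2 d P M i X Y * tr2 d P M i Y X = 1 :=
    hs1.tr_mul_tr ⟨_, by simp, rfl⟩ ⟨_, by simp, rfl⟩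
  have c6' : tr2 d P M i Y X * tr2 d P M i X Y = 1 :=
    hs1.tr_mul_tr ⟨_, by simp, rfl⟩ ⟨_, by simp, rfl⟩
  have c7 : tr2 d P M i V S * tr2 d P M i S V = 1 :=
    hs2.tr_mul_tr ⟨_, by simp, rfl⟩ ⟨_, by simp, rfl⟩
  generalize trPoly d P.cα M (fun b => P.pos2 i (w₀, kite P j w₁ η w₁ b)) 4 = K at *
  generalize trPoly d P.cα M (fun b => P.pos2 i (⟨P.z i.succ, 0⟩, kite P j w₁ η w₁ b)) 4 = K' at *
  generalize trPoly d P.cα M (fun a => P.pos2 i (kite P k w₀ η w₀ a, w₁)) 4 = L at *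
  generalize trPoly d P.cα M (fun a => P.pos2 i (kite P k w₀ η w₀ a, ⟨P.z i.succ, 0⟩)) 4 = L' at *
  have hU2 : opU d P M k = tr2 d P M i X b * (tr2 d P M i Y X * (L * (tr2 d P M i X Y *
      tr2 d P M i b X))) := by
    rw [hU, ← mul_assoc L, ← G2, mul_assoc, mul_assoc, mul_mul_eq_of_mul_eq c6', one_mul]
  have hQ : tr2 d P M i S V * (tr2 d P M i μ S * tr2 d P M i b μ) =
      tr2 d P M i Y V * (tr2 d P M i X Y * tr2 d P M i b X) := by
    rw [mul_mul_eq_of_mul_eq c2, c4, ← c1, mul_assoc, c3]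
  have hQ' : tr2 d P M i μ S * tr2 d P M i b μ =
      tr2 d P M i V S * (tr2 d P M i Y V * (tr2 d P M i X Y * tr2 d P M i b X)) := by
    rw [← hQ, mul_mul_eq_of_mul_eq c7, one_mul]
  refine ⟨tr2 d P M i X b * (tr2 d P M i Y X * (K * (tr2 d P M i X Y * tr2 d P M i b X))), ?_, ?_⟩
  · have e1 : opU d P M j * A = A * (tr2 d P M i V S * K' * tr2 d P M i S V) := by
      have := congrArg (fun x => A * x * A) hU'
      simp only [mul_assoc, hAA, mul_one, mul_mul_eq_of_mul_eq hAA, one_mul] at this ⊢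
      exact this
    rw [mul_mul_eq_of_mul_eq e1]
    simp only [mul_assoc]
    congr 1
    rw [hQ, mul_mul_eq_of_mul_eq G1, mul_mul_eq_of_mul_eq hQ']
    simp only [mul_assoc]
    rw [mul_mul_eq_of_mul_eq c5, one_mul, mul_mul_eq_of_mul_eq c6, one_mul]
  · rw [hU2]
    simp only [mul_assoc]
    rw [mul_mul_eq_of_mul_eq c5, one_mul, mul_mul_eq_of_mul_eq c6, one_mul,
      mul_mul_eq_of_mul_eq c5, one_mul, mul_mul_eq_of_mul_eq c6, one_mul,
      mul_mul_eq_of_mul_eq G3, mul_assoc]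

end RealPosition

theorem nested_loop_identity {G : Type*} [Monoid G]
    {A U bμ μS SW WR RT TL LV VS Sμ' μ'b μW' W'W W'R' R'R R'T' T'L' L'L L'Y YV YS Yμ' Xb YX XW' bX
      XY YW' YR' : G} (hAA : A * A = 1) (hAQ : A * (μS * bμ) = μ'b * Sμ' * A)
    (hU' : A * U = VS * (LV * (TL * (RT * WR))) * SW * A)
    (c1 : SW * μS = W'W * μW') (c2 : WR * W'W = R'R * W'R') (c3 : μW' * bμ = XW' * bX)
    (c4 : YW' * XY = XW') (c5 : W'R' * YW' = YR') (G4 : TL * RT * R'R = L'L * (T'L' * R'T'))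
    (c6 : LV * L'L = YV * L'Y) (c7 : VS * YV = YS) (c8 : Sμ' * YS = Yμ')
    (c9 : μ'b * Yμ' = Xb * YX) :
    A * (μS * bμ) * U * (A * (μS * bμ)) =
      Xb * (YX * (L'Y * (T'L' * (R'T' * YR')) * (XY * bX))) := by
  have e0 : A * (μS * bμ) * A = μ'b * Sμ' := by rw [hAQ, mul_assoc, hAA, mul_one]
  have e1 : A * U * A = VS * (LV * (TL * (RT * WR))) * SW := by rw [hU', mul_assoc, hAA, mul_one]
  calc _ = (A * (μS * bμ) * A) * (A * U * A) * (μS * bμ) := by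
        simp only [mul_assoc, mul_mul_eq_of_mul_eq hAA, one_mul]
    _ = _ := by
      rw [e0, e1]
      simp only [mul_assoc]
      rw [mul_mul_eq_of_mul_eq c1, mul_assoc, c3, mul_mul_eq_of_mul_eq c2, mul_assoc, ← c4,
        mul_assoc, mul_mul_eq_of_mul_eq c5, ← mul_assoc TL RT, mul_mul_eq_of_mul_eq G4]
      simp only [mul_assoc]
      rw [mul_mul_eq_of_mul_eq c6, mul_assoc, mul_mul_eq_of_mul_eq c7, mul_mul_eq_of_mul_eq c8,
        mul_mul_eq_of_mul_eq c9, mul_assoc]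

namespace RealPosition

variable {n m : ℕ} {d : Fin m → ℕ} {P : RealPosition n m}
  {M : Type*} [AddCommGroup M] [Module ℂ M]
  [Module (B (n + 1) d) M] [FiniteDimensional ℂ M] [IsScalarTower ℂ (B (n + 1) d) M]

variable (P) in
theorem exists_between_poles (k : Fin m) : ∃ c : ℝ, (∀ l, P.α l < c) ∧ c < P.z 0 ∧ P.α k < c := by
  obtain ⟨m, rfl⟩ : ∃ m', m = m' + 1 := ⟨m - 1, by have := k.2; omega⟩
  refine ⟨(P.α (Fin.last m) + P.z 0) / 2, fun l => ?_, ?_, ?_⟩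
  · linarith [P.α_mono.monotone (Fin.le_last l), P.lt (Fin.last m) 0]
  · linarith [P.lt (Fin.last m) 0]
  · linarith [P.α_mono.monotone (Fin.le_last k), P.lt (Fin.last m) 0]

set_option maxHeartbeats 2000000 in
theorem opU_comm_opT_opU_opT {i : Fin n} (hi : i.val = 0) (k : Fin m) :
    opU d P M k * (opT d P i M * opU d P M k * opT d P i M) =
      (opT d P i M * opU d P M k * opT d P i M) * opU d P M k := by
  have hA := P.lt k 0
  have hz : P.z 0 < P.z i.succ := P.z_mono (Fin.succ_pos i)
  obtain ⟨c, hc, hcz, hkc⟩ := P.exists_between_poles k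
  obtain ⟨η', hη', hη'c⟩ := exists_small (P := P) k (ε := (c - P.α k) / 3) (by linarith)
  have hη0 := hη'.pos
  have hη := hη'.mono (half_pos hη0) (by linarith)
  have hηz := hη'.z
  have hw₀ := mem_entry (P := P) (k := k) le_rfl
  have hw₁ := mem_entry (P := P) (k := k) (H := P.z i.succ - P.α k) (by linarith)
  set w₀ : ℂ := ⟨P.α k, -(P.z 0 - P.α k)⟩ with ew₀
  set w₁ : ℂ := ⟨P.α k, -(P.z i.succ - P.α k)⟩ with ew₁
  obtain ⟨w', ew'⟩ : ∃ w' : ℂ, w' = ⟨P.α k + η', -(c - P.α k - η')⟩ := ⟨_, rfl⟩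
  have hw' : w' ∈ P.entry k := by
    rw [ew']
    exact ⟨by simp only; linarith, by simp only; linarith, fun l => by
      have := hc l; simp only; linarith, by simp only; linarith⟩
  have q1 : 0 < (P.z 0 - P.α k) * (P.z i.succ - P.α k) - η' * (P.z 0 - P.α k) := by nlinarith
  have q2 : 0 < (P.z i.succ - P.z 0) * η' := mul_pos (by linarith) hη0
  have q3 : 0 < (P.z 0 - P.α k) * η' := mul_pos (by linarith) hη0
  have q4 : 0 < (P.z i.succ - P.α k) * η' := mul_pos (by linarith) hη0
  have q5 : 0 < (P.z 0 - P.α k) * (P.z i.succ - P.α k) := mul_pos (by linarith) (by linarith)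
  have q6 : 0 < (c - P.α k - η') * η' := mul_pos (by linarith) hη0
  have q7 : 0 < η' * η' := mul_pos hη0 hη0
  have q8 : 0 < (P.z 0 - c) * η' := mul_pos (by linarith) hη0
  -- the two rhombi
  have hk := fun {a : ℕ} (ha : a < 4) => hη'.sepFirst_kite hw₁ hw₁ ha
  have hk' := fun {a : ℕ} (ha : a < 4) => hη'.sepFirst_kite hw' hw₁ ha
  have G2 := pos2_grid (d := d) (M := M) (P := P) hi (kite P k w₀ (η' / 2) w₀)
    (edge ⟨P.z i.succ, 0⟩ w₁)
    4 1 (fun b hb => (hη.sepFirst_kite hw₀ hw₀ hb).2)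
    (by
      intro a ha
      refine sepPoles_homePoles.mono ?_
      interval_cases a
      rintro w (rfl | rfl) l
      · have := P.lt l 0; simp only [edge]; linarith
      · have := P.lt l 0; simp only [edge, ew₁]; linarith)
    (by intro b hb; interval_cases b <;> simp only [kite, ew₀] <;> linarith)
    (by intro a ha; interval_cases a <;> simp only [edge, ew₁] <;> linarith)
    (by
      intro b hb
      refine ⟨1, -1, fun a ha => ?_⟩
      interval_cases b; interval_cases a <;> simp only [kite, edge, ew₀, ew₁] <;>
        constructor <;> linarith)
  have G3 := pos2_grid (d := d) (M := M) (P := P) hi (kite P k w₀ (η' / 2) w₀) (kite P k w₁ η' w₁)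
    4 4 (fun b hb => (hη.sepFirst_kite hw₀ hw₀ hb).2) (fun b hb => (hk hb).2)
    (by intro b hb; interval_cases b <;> simp only [kite, ew₀] <;> linarith)
    (by intro b hb; interval_cases b <;> simp only [kite, ew₁] <;> linarith)
    (by
      intro b hb
      interval_cases b
      · refine ⟨P.z i.succ - P.α k, -η', fun a ha => ?_⟩
        interval_cases a <;> simp only [kite, ew₀, ew₁] <;> constructor <;> nlinarith
      · refine ⟨1, 1, fun a ha => ?_⟩
        interval_cases a <;> simp only [kite, ew₀, ew₁] <;> constructor <;> linarith
      · refine ⟨-1, 1, fun a ha => ?_⟩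
        interval_cases a <;> simp only [kite, ew₀, ew₁] <;> constructor <;> linarith
      · refine ⟨-(P.z i.succ - P.α k), -η', fun a ha => ?_⟩
        interval_cases a <;> simp only [kite, ew₀, ew₁] <;> constructor <;> nlinarith)
  have G4 := pos2_grid (d := d) (M := M) (P := P) hi (edge w₀ ⟨P.z i.succ, 0⟩)
    (fun b => kite P k w' η' w₁ (b + 1)) 1 2 (by
      intro a ha
      refine sepPoles_homePoles.mono ?_
      interval_cases a
      rintro w (rfl | rfl) l
      · have := P.lt l 0; simp only [edge, ew₀]; linarith
      · have := P.lt l 0; simp only [edge]; linarith)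
    (fun b hb => (hk' (a := b + 1) (by omega)).2)
    (by intro a ha; interval_cases a <;> simp only [edge, ew₀] <;> linarith)
    (by intro b hb; interval_cases b <;> simp only [kite] <;> linarith)
    (by
      intro b hb
      refine ⟨-1, 1, fun a ha => ?_⟩
      interval_cases b <;> interval_cases a <;> simp only [kite, edge, ew₀] <;>
        constructor <;> linarith)
  have hU := opU_eq_kite_pos2 (d := d) (M := M) i hη hw₀ hw₀
  have hU' := act_swap_mul_opU (d := d) (M := M) hi hη' hw' hw₁
  have hAA := act_swap_mul_act_swap (d := d) (M := M) i
  have hAQ := act_swap_mul_tr2 (d := d) (M := M) (P := P) hi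
  obtain ⟨b, eb⟩ : ∃ b : ℂ × ℂ, b = (⟨P.z 0, 0⟩, ⟨P.z i.succ, 0⟩) := ⟨_, rfl⟩
  obtain ⟨S, eS⟩ : ∃ b : ℂ × ℂ, b = (⟨P.z i.succ, 0⟩, ⟨P.z 0, 0⟩) := ⟨_, rfl⟩
  obtain ⟨X, eX⟩ : ∃ b : ℂ × ℂ, b = (w₀, ⟨P.z i.succ, 0⟩) := ⟨_, rfl⟩
  obtain ⟨Y, eY⟩ : ∃ b : ℂ × ℂ, b = (w₀, w₁) := ⟨_, rfl⟩
  obtain ⟨V, eV⟩ : ∃ b : ℂ × ℂ, b = (⟨P.z i.succ, 0⟩, w₁) := ⟨_, rfl⟩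
  obtain ⟨W, eW⟩ : ∃ b : ℂ × ℂ, b = (⟨P.z i.succ, 0⟩, w') := ⟨_, rfl⟩
  obtain ⟨W', eW'⟩ : ∃ b : ℂ × ℂ, b = (w₀, w') := ⟨_, rfl⟩
  obtain ⟨R, eR⟩ : ∃ b : ℂ × ℂ, b = (⟨P.z i.succ, 0⟩, ⟨P.α k + η', 0⟩) := ⟨_, rfl⟩
  obtain ⟨R', eR'⟩ : ∃ b : ℂ × ℂ, b = (w₀, ⟨P.α k + η', 0⟩) := ⟨_, rfl⟩
  obtain ⟨L, eL⟩ : ∃ b : ℂ × ℂ, b = (⟨P.z i.succ, 0⟩, ⟨P.α k - η', 0⟩) := ⟨_, rfl⟩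
  obtain ⟨L', eL'⟩ : ∃ b : ℂ × ℂ, b = (w₀, ⟨P.α k - η', 0⟩) := ⟨_, rfl⟩
  obtain ⟨T, eT⟩ : ∃ b : ℂ × ℂ, b = (⟨P.z i.succ, 0⟩, ⟨P.α k, η'⟩) := ⟨_, rfl⟩
  obtain ⟨T', eT'⟩ : ∃ b : ℂ × ℂ, b = (w₀, ⟨P.α k, η'⟩) := ⟨_, rfl⟩
  obtain ⟨μ, eμ⟩ : ∃ b : ℂ × ℂ, b = (⟨(P.z 0 + P.z i.succ) / 2, (P.z 0 - P.z i.succ) / 2⟩,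
        ⟨(P.z i.succ + P.z 0) / 2, (P.z i.succ - P.z 0) / 2⟩) := ⟨_, rfl⟩
  obtain ⟨μ', eμ'⟩ : ∃ b : ℂ × ℂ, b = (⟨(P.z i.succ + P.z 0) / 2, (P.z i.succ - P.z 0) / 2⟩,
        ⟨(P.z 0 + P.z i.succ) / 2, (P.z 0 - P.z i.succ) / 2⟩) := ⟨_, rfl⟩
  have hO1 := sep_pos2 (P := P) hi (W := {μ, S, W, W'}) sepPoles_homePoles
    sepPoles_homePoles (-1) 1 (by
      rintro q (rfl | rfl | rfl | rfl) <;> refine ⟨?_, ?_, ?_, fun l => ?_, fun l => ?_⟩ <;>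
        simp only [eμ, eS, eW, eW', ew₀, ew'] <;> first | linarith | linarith [P.lt l 0] | linarith [hc l])
  have hO2 := sep_pos2 (P := P) hi (W := {W, R, W', R'}) sepPoles_homePoles
    (hk' (a := 0) (by norm_num)).2 (-1) 1 (by
      rintro q (rfl | rfl | rfl | rfl) <;> refine ⟨?_, ?_, ?_, fun l => ?_, ?_⟩ <;>
        simp only [eR, eR', eW, eW', ew₀, ew', kite] <;>
        first | linarith | linarith [P.lt l 0] | simp)
  have hO3 := sep_pos2 (P := P) hi (W := {b, μ, X, W'}) sepPoles_homePoles
    sepPoles_homePoles 1 1 (by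
      rintro q (rfl | rfl | rfl | rfl) <;> refine ⟨?_, ?_, ?_, fun l => ?_, fun l => ?_⟩ <;>
        simp only [eμ, eb, eX, eW', ew₀, ew'] <;> first | linarith | linarith [P.lt l 0] | linarith [hc l])
  have hO4 := sep_pos2 (P := P) hi (W := {X, W', Y}) sepPoles_homePoles
    sepPoles_homePoles (2 * (P.z 0 - P.α k)) (-η') (by
      rintro q (rfl | rfl | rfl) <;> refine ⟨?_, ?_, ?_, fun l => ?_, fun l => ?_⟩ <;>
        simp only [eX, eY, eW', ew₀, ew₁, ew'] <;>
        first | linarith | linarith [P.lt l 0] | linarith [hc l] | nlinarith)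
  have hO5 := sep_pos2 (P := P) hi (W := {W', Y, R'}) sepPoles_homePoles
    (sepFirst_under (P.free_right k).1).2 (2 * (P.z 0 - P.α k)) (-η') (by
      rintro q (rfl | rfl | rfl) <;> refine ⟨?_, ?_, ?_, fun l => ?_, ?_⟩ <;>
        simp only [eR', eY, eW']
      · simp only [ew₀, ew']; nlinarith
      · simp only [ew₀]; linarith
      · simp only [ew']; linarith
      · simp only [ew₀]; linarith [P.lt l 0]
      · exact entry_subset_under_right k hw'
      · simp only [ew₀, ew₁]; nlinarith
      · simp only [ew₀]; linarith
      · simp only [ew₁]; linarith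
      · simp only [ew₀]; linarith [P.lt l 0]
      · exact entry_subset_under_right k hw₁
      · simp only [ew₀]; nlinarith
      · simp only [ew₀]; linarith
      · linarith
      · simp only [ew₀]; linarith [P.lt l 0]
      · exact hη'.right_mem_under)
  have hR1 := sep_pos2 (P := P) hi (W := {L, L', Y, V}) sepPoles_homePoles
    (hk (a := 3) (by norm_num)).2 (-(2 * (P.z 0 - P.α k))) (-η') (by
      rintro q (rfl | rfl | rfl | rfl) <;> refine ⟨?_, ?_, ?_, fun l => ?_, ?_⟩ <;>
        simp only [eL, eL', eY, eV, ew₀, ew₁, kite] <;>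
        first | linarith | linarith [P.lt l 0] | nlinarith | simp)
  have hR2 := sep_pos2 (P := P) hi (W := {V, S, μ', Y}) sepPoles_homePoles
    sepPoles_homePoles (-1) (-1) (by
      rintro q (rfl | rfl | rfl | rfl) <;> refine ⟨?_, ?_, ?_, fun l => ?_, fun l => ?_⟩ <;>
        simp only [eμ', eS, eV, eY, ew₀, ew₁] <;> first | linarith | linarith [P.lt l 0])
  have hR3 := sep_pos2 (P := P) hi (W := {μ', Y, b, X}) sepPoles_homePoles
    sepPoles_homePoles 1 (-1) (by
      rintro q (rfl | rfl | rfl | rfl) <;> refine ⟨?_, ?_, ?_, fun l => ?_, fun l => ?_⟩ <;>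
        simp only [eμ', eb, eX, eY, ew₀, ew₁] <;> first | linarith | linarith [P.lt l 0])
  rw [trPoly_edge_right, trPoly_edge_right] at G2
  rw [trPoly_edge_left, trPoly_edge_left] at G4
  simp only [trPoly, kite, edge, mul_one] at G4 hU'
  rw [← eR, ← eR', ← eL, ← eL', ← eT, ← eT'] at G4
  rw [← eR, ← eL, ← eT, ← eV, ← eS, ← eW] at hU'
  rw [← eμ, ← eμ', ← eb, ← eS] at hAQ
  rw [← eX, ← eb] at hU
  rw [opT_eq_pos2 hi, ← eμ, ← eS, ← eb]
  set A := act M (B.perm d (Equiv.swap i.castSucc i.succ))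
  set K := trPoly d P.cα M (fun b => P.pos2 i (w₀, kite P k w₁ η' w₁ b)) 4 with eK
  set N := trPoly d P.cα M (fun a => P.pos2 i (kite P k w₀ (η' / 2) w₀ a, w₁)) 4
  set N' := trPoly d P.cα M (fun a => P.pos2 i (kite P k w₀ (η' / 2) w₀ a, ⟨P.z i.succ, 0⟩)) 4
  change K * N = N * K at G3
  change tr2 d P M i (w₀, ⟨P.z i.succ, 0⟩) (w₀, w₁) * N' =
    N * tr2 d P M i (w₀, ⟨P.z i.succ, 0⟩) (w₀, w₁) at G2
  rw [← eX, ← eY] at G2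
  simp only [trPoly, kite, mul_one] at eK
  rw [← eR', ← eL', ← eT', ← eY] at eK
  have c1 : tr2 d P M i S W * tr2 d P M i μ S = tr2 d P M i W' W * tr2 d P M i μ W' :=
    hO1.tr_square ⟨_, by simp, rfl⟩ ⟨_, by simp, rfl⟩ ⟨_, by simp, rfl⟩ ⟨_, by simp, rfl⟩
  have c2 : tr2 d P M i W R * tr2 d P M i W' W = tr2 d P M i R' R * tr2 d P M i W' R' :=
    hO2.tr_square ⟨_, by simp, rfl⟩ ⟨_, by simp, rfl⟩ ⟨_, by simp, rfl⟩ ⟨_, by simp, rfl⟩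
  have c3 : tr2 d P M i μ W' * tr2 d P M i b μ = tr2 d P M i X W' * tr2 d P M i b X :=
    hO3.tr_square ⟨_, by simp, rfl⟩ ⟨_, by simp, rfl⟩ ⟨_, by simp, rfl⟩ ⟨_, by simp, rfl⟩
  have c4 : tr2 d P M i Y W' * tr2 d P M i X Y = tr2 d P M i X W' :=
    hO4.tr_trans ⟨_, by simp, rfl⟩ ⟨_, by simp, rfl⟩ ⟨_, by simp, rfl⟩
  have c5 : tr2 d P M i W' R' * tr2 d P M i Y W' = tr2 d P M i Y R' :=
    hO5.tr_trans ⟨_, by simp, rfl⟩ ⟨_, by simp, rfl⟩ ⟨_, by simp, rfl⟩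
  have c6 : tr2 d P M i L V * tr2 d P M i L' L = tr2 d P M i Y V * tr2 d P M i L' Y :=
    hR1.tr_square ⟨_, by simp, rfl⟩ ⟨_, by simp, rfl⟩ ⟨_, by simp, rfl⟩ ⟨_, by simp, rfl⟩
  have c7 : tr2 d P M i V S * tr2 d P M i Y V = tr2 d P M i Y S :=
    hR2.tr_trans ⟨_, by simp, rfl⟩ ⟨_, by simp, rfl⟩ ⟨_, by simp, rfl⟩
  have c8 : tr2 d P M i S μ' * tr2 d P M i Y S = tr2 d P M i Y μ' :=
    hR2.tr_trans ⟨_, by simp, rfl⟩ ⟨_, by simp, rfl⟩ ⟨_, by simp, rfl⟩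
  have c9 : tr2 d P M i μ' b * tr2 d P M i Y μ' = tr2 d P M i X b * tr2 d P M i Y X :=
    hR3.tr_square ⟨_, by simp, rfl⟩ ⟨_, by simp, rfl⟩ ⟨_, by simp, rfl⟩ ⟨_, by simp, rfl⟩
  have c10 : tr2 d P M i b X * tr2 d P M i X b = 1 :=
    hR3.tr_mul_tr ⟨_, by simp, rfl⟩ ⟨_, by simp, rfl⟩
  have c11 : tr2 d P M i X Y * tr2 d P M i Y X = 1 :=
    hR3.tr_mul_tr ⟨_, by simp, rfl⟩ ⟨_, by simp, rfl⟩
  have c12 : tr2 d P M i Y X * tr2 d P M i X Y = 1 :=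
    hR3.tr_mul_tr ⟨_, by simp, rfl⟩ ⟨_, by simp, rfl⟩
  simp only [tr2] at *
  have hU2 : opU d P M k = tr2 d P M i X b * (tr2 d P M i Y X * (N * (tr2 d P M i X Y *
      tr2 d P M i b X))) := by
    simp only [tr2]
    rw [hU, ← mul_assoc N, ← G2, mul_assoc, mul_assoc, mul_mul_eq_of_mul_eq c12, one_mul]
  have hT : A * (tr2 d P M i μ S * tr2 d P M i b μ) * opU d P M k *
      (A * (tr2 d P M i μ S * tr2 d P M i b μ)) =
      tr2 d P M i X b * (tr2 d P M i Y X * (K * (tr2 d P M i X Y * tr2 d P M i b X))) := by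
    simp only [tr2]
    rw [eK]
    exact nested_loop_identity hAA hAQ hU' c1 c2 c3 c4 c5 G4 c6 c7 c8 c9
  rw [hT, hU2]
  simp only [tr2, mul_assoc]
  rw [mul_mul_eq_of_mul_eq c10, one_mul, mul_mul_eq_of_mul_eq c11, one_mul,
      mul_mul_eq_of_mul_eq c10, one_mul, mul_mul_eq_of_mul_eq c11, one_mul,
      mul_mul_eq_of_mul_eq G3, mul_assoc]

end RealPosition

namespace RealPosition

variable {n m : ℕ} {d : Fin m → ℕ} {P : RealPosition n m}

theorem sep_of_first {S : Set (Fin (n + 1) → ℂ)} (a b a' b' : ℝ)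
    (h : ∀ x ∈ S, (∀ i : Fin n, 0 < a * ((x i.succ).re - (x 0).re) +
        b * ((x i.succ).im - (x 0).im)) ∧
      (∀ i j : Fin n, i < j → (x i.succ).re < (x j.succ).re) ∧
      (∀ (i : Fin n) l, P.α l < (x i.succ).re) ∧
      ∀ l, 0 < a' * ((x 0).re - P.α l) + b' * (x 0).im) : Sep P.cα S := by
  refine ⟨fun p q hpq => ?_, fun p l => ?_⟩
  · obtain ⟨q, rfl⟩ := Fin.exists_succ_eq.mpr (lt_of_le_of_lt (Fin.zero_le _) hpq).ne'
    rcases Fin.eq_zero_or_eq_succ p with rfl | ⟨p, rfl⟩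
    · exact ⟨a, b, fun x hx => by simpa [lin] using (h x hx).1 q⟩
    · exact ⟨1, 0, fun x hx => by simpa [lin] using (h x hx).2.1 p q (Fin.succ_lt_succ_iff.mp hpq)⟩
  · rcases Fin.eq_zero_or_eq_succ p with rfl | ⟨p, rfl⟩
    · exact ⟨a', b', fun x hx => by simpa [lin, cα] using (h x hx).2.2.2 l⟩
    · exact ⟨1, 0, fun x hx => by simpa [lin, cα] using (h x hx).2.2.1 p l⟩

variable (M : Type*) [AddCommGroup M] [Module ℂ M]
  [Module (B (n + 1) d) M] [FiniteDimensional ℂ M] [IsScalarTower ℂ (B (n + 1) d) M]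

theorem cycleRange_succ_eq (i : Fin n) : Fin.cycleRange i.succ =
    Fin.cycleRange i.castSucc * Equiv.swap i.castSucc i.succ := by
  ext x
  rw [Equiv.Perm.mul_apply]
  rcases lt_trichotomy x.val i.val with h | h | h
  · have h1 : x < i.succ := by rw [Fin.lt_def, Fin.val_succ]; omega
    have h2 : x < i.castSucc := by rw [Fin.lt_def, Fin.val_castSucc]; omega
    rw [Equiv.swap_apply_of_ne_of_ne h2.ne h1.ne, Fin.coe_cycleRange_of_lt h1,
      Fin.coe_cycleRange_of_lt h2]
  · obtain rfl : x = i.castSucc := Fin.ext h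
    rw [Equiv.swap_apply_left, Fin.coe_cycleRange_of_lt Fin.castSucc_lt_succ,
      Fin.cycleRange_of_gt Fin.castSucc_lt_succ]
    simp
  · rcases eq_or_ne x i.succ with rfl | h'
    · rw [Equiv.swap_apply_right, Fin.cycleRange_self, Fin.cycleRange_self]
    · have h1 : i.succ < x := by
        rw [Ne, Fin.ext_iff, Fin.val_succ] at h'; rw [Fin.lt_def, Fin.val_succ]; omega
      have h2 : i.castSucc < x := Fin.castSucc_lt_succ.trans h1
      rw [Equiv.swap_apply_of_ne_of_ne h2.ne' h1.ne', Fin.cycleRange_of_gt h1,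
        Fin.cycleRange_of_gt h2]

theorem prod_reverse_opT : (List.ofFn fun i : Fin n => opT d P i M).reverse.prod =
    opW d P M (Fin.cycleRange (Fin.last n)) := by
  have key : ∀ k (hk : k ≤ n), ((List.ofFn fun i : Fin n => opT d P i M).take k).reverse.prod =
      opW d P M (Fin.cycleRange ⟨k, Nat.lt_succ_of_le hk⟩) := by
    intro k
    induction k with
    | zero =>
      intro hk
      have : (⟨0, Nat.lt_succ_of_le hk⟩ : Fin (n + 1)) = 0 := rfl
      rw [this, Fin.cycleRange_zero, opW_one]; simp
    | succ k ih =>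
      intro hk
      rw [List.take_succ_eq_append_getElem (by simpa), List.reverse_append, List.prod_append,
        ih (by omega)]
      have := opT_mul_opW (d := d) P ⟨k, hk⟩ M (Fin.cycleRange (Fin.castSucc ⟨k, hk⟩)) (by
        rw [Fin.cycleRange_self, Fin.cycleRange_of_gt Fin.castSucc_lt_succ]
        exact Fin.succ_pos _)
      rw [← cycleRange_succ_eq] at this
      simpa using this
  have := key n le_rfl
  rwa [List.take_of_length_le (by simp)] at this

theorem prod_opT : (List.ofFn fun i : Fin n => opT d P i M).prod =
    opW d P M (Fin.cycleRange (Fin.last n))⁻¹ := by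
  set c := Fin.cycleRange (Fin.last n) with hc
  have key : ∀ r (hr : r ≤ n), ((List.ofFn fun i : Fin n => opT d P i M).drop (n - r)).prod =
      opW d P M (c⁻¹ * Fin.cycleRange ⟨n - r, by omega⟩) := by
    intro r
    induction r with
    | zero =>
      intro hk
      have : (⟨n - 0, by omega⟩ : Fin (n + 1)) = Fin.last n := rfl
      rw [this, ← hc, inv_mul_cancel, opW_one, List.drop_of_length_le (by simp), List.prod_nil]
    | succ r ih =>
      intro hr
      rw [List.drop_eq_getElem_cons (by simp; omega), List.prod_cons]
      have e : n - (r + 1) + 1 = n - r := by omega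
      simp only [e]
      rw [ih (by omega)]
      have hlt : n - (r + 1) < n := by omega
      have e' : (⟨n - r, by omega⟩ : Fin (n + 1)) = Fin.succ ⟨n - (r + 1), hlt⟩ :=
        Fin.ext (by simp; omega)
      have e'' : (⟨n - (r + 1), by omega⟩ : Fin (n + 1)) = Fin.castSucc ⟨n - (r + 1), hlt⟩ := rfl
      rw [e', e'']
      have h0 : c (Fin.castSucc ⟨n - (r + 1), hlt⟩) = Fin.succ ⟨n - (r + 1), hlt⟩ := by
        apply Fin.ext
        rw [hc, Fin.coe_cycleRange_of_lt (Fin.castSucc_lt_last _)]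
        simp
      have := opT_mul_opW (d := d) P ⟨n - (r + 1), hlt⟩ M
        (c⁻¹ * Fin.cycleRange (Fin.succ ⟨n - (r + 1), hlt⟩)) (by
        rw [Equiv.Perm.mul_apply, Equiv.Perm.mul_apply, Fin.cycleRange_self]
        have h1 : Fin.cycleRange (Fin.succ ⟨n - (r + 1), hlt⟩) (Fin.castSucc ⟨n - (r + 1), hlt⟩) =
            c (Fin.castSucc ⟨n - (r + 1), hlt⟩) := by
          rw [h0]
          apply Fin.ext
          rw [Fin.coe_cycleRange_of_lt Fin.castSucc_lt_succ]
          simp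
        have h2 : (0 : Fin (n + 1)) = c (Fin.last n) := by rw [hc, Fin.cycleRange_self]
        rw [h1, h2, ← Equiv.Perm.mul_apply, ← Equiv.Perm.mul_apply, inv_mul_cancel]
        exact Fin.castSucc_lt_last _)
      rw [mul_assoc, cycleRange_succ_eq, mul_assoc, Equiv.swap_mul_self, mul_one,
        ← cycleRange_succ_eq] at this
      simpa using this
  have := key n le_rfl
  have e : (⟨n - n, by omega⟩ : Fin (n + 1)) = 0 := Fin.ext (by simp)
  rw [e, Fin.cycleRange_zero, mul_one] at this
  simpa using this

variable (P) in
/-- A bound for the distances of the base points and the poles to the origin. -/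
structure Bound (P : RealPosition n m) (ρ : ℝ) : Prop where
  pos : 0 < ρ
  z : ∀ j, |P.z j| < ρ
  α : ∀ l, |P.α l| < ρ

theorem exists_bound : ∃ ρ, P.Bound ρ := by
  have h1 : ∀ᶠ ρ : ℝ in atTop, ∀ j, |P.z j| < ρ := eventually_all.mpr fun j => eventually_gt_atTop _
  have h2 : ∀ᶠ ρ : ℝ in atTop, ∀ j, |P.α j| < ρ := eventually_all.mpr fun j => eventually_gt_atTop _
  obtain ⟨ρ, h1, h2, h3⟩ := (h1.and (h2.and (eventually_gt_atTop 0))).exists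
  exact ⟨ρ, h3, h1, h2⟩

variable {M}

theorem cycle_inv_zero : (Fin.cycleRange (Fin.last n))⁻¹ 0 = Fin.last n := by
  rw [Equiv.Perm.inv_eq_iff_eq, Fin.cycleRange_self]

theorem cycle_inv_succ (i : Fin n) : (Fin.cycleRange (Fin.last n))⁻¹ i.succ = i.castSucc := by
  rw [Equiv.Perm.inv_eq_iff_eq]
  apply Fin.ext
  rw [Fin.coe_cycleRange_of_lt (Fin.castSucc_lt_last _)]
  simp

theorem prod_opT_mul_prod_opT {ρ : ℝ} (hρ : P.Bound ρ) :
    (List.ofFn fun i : Fin n => opT d P i M).prod *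
      (List.ofFn fun i : Fin n => opT d P i M).reverse.prod =
    tr1 d P M ⟨0, 2 * ρ⟩ (P.z 0) * (tr1 d P M ⟨2 * ρ, 0⟩ ⟨0, 2 * ρ⟩ *
      (tr1 d P M ⟨0, -(2 * ρ)⟩ ⟨2 * ρ, 0⟩ * tr1 d P M (P.z 0) ⟨0, -(2 * ρ)⟩)) := by
  rw [prod_opT, prod_reverse_opT]
  have h0 := cycle_inv_zero (n := n)
  have hs := cycle_inv_succ (n := n)
  set c := Fin.cycleRange (Fin.last n)
  have e1 : opW d P M c⁻¹ = act M (B.perm d c) * opQ d P M c⁻¹ := by rw [opW, inv_inv]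
  rw [e1, act_mul_opQ, opW, mul_assoc, ← mul_assoc (act M (B.perm d c)), act_perm_mul_inv, one_mul,
    mul_inv_cancel, opQ]
  set b := fun j : Fin (n + 1) => j.val
  set b' := fun j : Fin (n + 1) => (c⁻¹ j).val
  have ρ0 := hρ.pos
  have hz := fun j => abs_lt.mp (hρ.z j)
  have hα := fun l => abs_lt.mp (hρ.α l)
  have z1 : ∀ i j : Fin n, i < j → P.z i.succ < P.z j.succ := fun i j h =>
    P.z_mono (Fin.succ_lt_succ_iff.mpr h)
  have z2 : ∀ i j : Fin n, i < j → P.z i.castSucc < P.z j.castSucc := fun i j h =>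
    P.z_mono (Fin.castSucc_lt_castSucc_iff.mpr h)
  have z3 : ∀ i : Fin n, P.z i.castSucc < P.z (Fin.last n) := fun i =>
    P.z_mono (Fin.castSucc_lt_last i)
  have z4 : ∀ i : Fin n, P.z 0 < P.z i.succ := fun i => P.z_mono (Fin.succ_pos i)
  have z5 : ∀ i : Fin n, (i.val : ℝ) < n := fun i => by exact_mod_cast i.2
  have z6 : ∀ i : Fin n, (0 : ℝ) ≤ i.val := fun i => by positivity
  have f1 : ∀ i : Fin n, P.flat 1 i.succ = ⟨P.z i.succ, 0⟩ := fun i => rfl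
  have f1' : P.flat 1 0 = ⟨P.z 0, 0⟩ := rfl
  have f2 : ∀ i : Fin n, P.flat c i.succ = ⟨P.z i.castSucc, 0⟩ := fun i => by rw [flat, hs]
  have f2' : P.flat c 0 = ⟨P.z (Fin.last n), 0⟩ := by rw [flat, h0]
  have f3 : ∀ i : Fin n, P.lift b 1 i.succ = ⟨P.z i.succ, i.val + 1⟩ := fun i => by
    simp [lift, b]
  have f3' : P.lift b 1 0 = ⟨P.z 0, 0⟩ := by simp [lift, b]
  have f4 : ∀ i : Fin n, P.lift b c i.succ = ⟨P.z i.castSucc, i.val + 1⟩ := fun i => by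
    rw [lift, hs]; simp [b]
  have f4' : P.lift b c 0 = ⟨P.z (Fin.last n), 0⟩ := by rw [lift, h0]; simp [b]
  have f5 : ∀ i : Fin n, P.lift b' c i.succ = ⟨P.z i.castSucc, i.val⟩ := fun i => by
    simp only [lift, b', hs]; rfl
  have f5' : P.lift b' c 0 = ⟨P.z (Fin.last n), n⟩ := by simp only [lift, b', h0]; rfl
  have f6 : ∀ i : Fin n, P.lift b' 1 i.succ = ⟨P.z i.succ, i.val⟩ := fun i => by
    simp only [lift, b', hs]; rfl
  have f6' : P.lift b' 1 0 = ⟨P.z 0, n⟩ := by simp only [lift, b', h0]; rfl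
  have f7 : ∀ (w : ℂ) (i : Fin n), P.pos w i.succ = ⟨P.z i.succ, 0⟩ := fun w i => by
    rw [pos, Function.update_of_ne (Fin.succ_ne_zero i)]; rfl
  have f7' : ∀ w : ℂ, P.pos w 0 = w := fun w => by rw [pos, Function.update_self]
  simp only [tr1, pos_base]
  set N := P.pos ⟨0, 2 * ρ⟩ with hN
  set S := P.pos ⟨0, -(2 * ρ)⟩ with hS
  set E := P.pos ⟨2 * ρ, 0⟩ with hE
  have sA : Sep P.cα {P.flat 1, P.lift b 1, S} := sep_of_first 1 1 1 (-1) (by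
    rintro x (rfl | rfl | rfl) <;> refine ⟨fun i => ?_, fun i j h => ?_, fun i l => ?_, fun l => ?_⟩ <;>
      simp only [f1, f1', f3, f3', hS, f7, f7'] <;>
      first | linarith [z1 i j h] | linarith [P.lt l i.succ] | linarith [P.lt l 0] |
        linarith [z4 i, z6 i, hz i.succ] | linarith [hα l])
  have sB : Sep P.cα {P.lift b 1, P.lift b c, S} := sep_of_first 0 1 1 (-1) (by
    rintro x (rfl | rfl | rfl) <;> refine ⟨fun i => ?_, fun i j h => ?_, fun i l => ?_, fun l => ?_⟩ <;>
      simp only [f4, f4', f3, f3', hS, f7, f7'] <;>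
      first | linarith [z1 i j h] | linarith [z2 i j h] | linarith [P.lt l i.succ] |
        linarith [P.lt l i.castSucc] | linarith [P.lt l 0] | linarith [P.lt l (Fin.last n)] |
        linarith [z4 i, z6 i, hz i.succ] | linarith [hα l])
  have sC : Sep P.cα {P.lift b c, S, E, P.flat c} := sep_of_first (-1) 1 1 (-1) (by
    rintro x (rfl | rfl | rfl | rfl) <;>
      refine ⟨fun i => ?_, fun i j h => ?_, fun i l => ?_, fun l => ?_⟩ <;>
      simp only [f4, f4', f2, f2', hS, hE, f7, f7'] <;>
      first | linarith [z1 i j h] | linarith [z2 i j h] | linarith [P.lt l i.succ] |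
        linarith [P.lt l i.castSucc] | linarith [P.lt l 0] | linarith [P.lt l (Fin.last n)] |
        linarith [z3 i, z6 i, hz i.succ] | linarith [(hz i.succ).2] | linarith [(hα l).2])
  have sD : Sep P.cα {P.flat c, P.lift b' c, E, N} := sep_of_first (-1) (-1) 1 1 (by
    rintro x (rfl | rfl | rfl | rfl) <;>
      refine ⟨fun i => ?_, fun i j h => ?_, fun i l => ?_, fun l => ?_⟩ <;>
      simp only [f5, f5', f2, f2', hN, hE, f7, f7'] <;>
      first | linarith [z1 i j h] | linarith [z2 i j h] | linarith [P.lt l i.succ] |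
        linarith [P.lt l i.castSucc] | linarith [P.lt l 0] |
        linarith [P.lt l (Fin.last n), (Nat.cast_nonneg n : (0 : ℝ) ≤ n)] |
        linarith [z3 i, z5 i, hz i.succ] | linarith [(hz i.succ).2] | linarith [(hα l).2])
  have sE : Sep P.cα {P.lift b' c, P.lift b' 1, N} := sep_of_first 0 (-1) 1 1 (by
    rintro x (rfl | rfl | rfl) <;>
      refine ⟨fun i => ?_, fun i j h => ?_, fun i l => ?_, fun l => ?_⟩ <;>
      simp only [f5, f5', f6, f6', hN, f7, f7'] <;>
      first | linarith [z1 i j h] | linarith [z2 i j h] | linarith [P.lt l i.succ] |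
        linarith [P.lt l i.castSucc] | linarith [P.lt l 0, (Nat.cast_nonneg n : (0 : ℝ) ≤ n)] |
        linarith [P.lt l (Fin.last n), (Nat.cast_nonneg n : (0 : ℝ) ≤ n)] |
        linarith [z5 i] | linarith [(hz i.succ).2] | linarith [(hα l).2])
  have sF : Sep P.cα {P.lift b' 1, N, P.flat 1} := sep_of_first 1 (-1) 1 1 (by
    rintro x (rfl | rfl | rfl) <;>
      refine ⟨fun i => ?_, fun i j h => ?_, fun i l => ?_, fun l => ?_⟩ <;>
      simp only [f1, f1', f6, f6', hN, f7, f7'] <;>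
      first | linarith [z1 i j h] | linarith [P.lt l i.succ] |
        linarith [P.lt l 0, (Nat.cast_nonneg n : (0 : ℝ) ≤ n)] |
        linarith [z4 i, z5 i] | linarith [(hz i.succ).1] | linarith [(hα l).2])
  have c1 : tr d P.cα M (P.lift b 1) S * tr d P.cα M (P.flat 1) (P.lift b 1) =
    tr d P.cα M (P.flat 1) S := sA.tr_trans (by simp) (by simp) (by simp)
  have c2 : tr d P.cα M S (P.lift b c) * tr d P.cα M (P.lift b 1) S =
    tr d P.cα M (P.lift b 1) (P.lift b c) := sB.tr_trans (by simp) (by simp) (by simp)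
  have c3 : tr d P.cα M (P.lift b c) (P.flat c) * tr d P.cα M S (P.lift b c) =
    tr d P.cα M E (P.flat c) * tr d P.cα M S E :=
      sC.tr_square (by simp) (by simp) (by simp) (by simp)
  have c4 : tr d P.cα M (P.flat c) (P.lift b' c) * tr d P.cα M E (P.flat c) =
    tr d P.cα M N (P.lift b' c) * tr d P.cα M E N :=
      sD.tr_square (by simp) (by simp) (by simp) (by simp)
  have c5 : tr d P.cα M (P.lift b' c) (P.lift b' 1) * tr d P.cα M N (P.lift b' c) =
    tr d P.cα M N (P.lift b' 1) := sE.tr_trans (by simp) (by simp) (by simp)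
  have c6 : tr d P.cα M (P.lift b' 1) (P.flat 1) * tr d P.cα M N (P.lift b' 1) =
    tr d P.cα M N (P.flat 1) := sF.tr_trans (by simp) (by simp) (by simp)
  change tr d P.cα M (P.lift b' 1) (P.flat 1) * tr d P.cα M (P.lift b' c) (P.lift b' 1) *
    tr d P.cα M (P.flat c) (P.lift b' c) * (tr d P.cα M (P.lift b c) (P.flat c) *
      tr d P.cα M (P.lift b 1) (P.lift b c) * tr d P.cα M (P.flat 1) (P.lift b 1)) = _
  rw [← c2]
  simp only [mul_assoc]
  rw [c1, mul_mul_eq_of_mul_eq c3, mul_assoc, mul_mul_eq_of_mul_eq c4, mul_assoc,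
    mul_mul_eq_of_mul_eq c5, mul_mul_eq_of_mul_eq c6]

end RealPosition

namespace RealPosition

variable {n m : ℕ} {d : Fin m → ℕ} {P : RealPosition n m}
variable {M : Type*} [AddCommGroup M] [Module ℂ M]
  [Module (B (n + 1) d) M] [FiniteDimensional ℂ M] [IsScalarTower ℂ (B (n + 1) d) M]

variable (P) in
/-- Positions of the first point far from the origin, in the chart at infinity. -/
def farChart (ρ : ℝ) : Set (Fin (n + 1) → ℂ) := {x | ‖x 0‖ < ρ⁻¹ ∧ ∀ j : Fin n, x j.succ = P.z j.succ}

/-- The chart in which the first point may be at infinity. -/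
def firstInf (n : ℕ) : Fin (n + 1) → Bool := Fin.cons true fun _ => false

theorem convex_farChart (ρ : ℝ) : Convex ℝ (P.farChart ρ) := by
  intro x hx y hy s t hs ht hst
  refine ⟨?_, fun j => ?_⟩
  · have h : Convex ℝ (Metric.ball (0 : ℂ) ρ⁻¹) := convex_ball _ _
    have := h (x := x 0) (by simpa using hx.1) (y := y 0) (by simpa using hy.1) hs ht hst
    simpa using this
  · simp only [Pi.add_apply, Pi.smul_apply, hx.2 j, hy.2 j, ← add_smul, hst, one_smul]

theorem farChart_subset {ρ : ℝ} (hρ : P.Bound ρ) :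
    P.farChart ρ ⊆ chartDomain P.cα (firstInf n) := by
  rintro x ⟨h0, hs⟩
  have hs' : ∀ j : Fin n, chart (firstInf n) x j.succ = ((P.z j.succ : ℂ) : OnePoint ℂ) := fun j => by
    simp [chart, firstInf, toSphere, hs j]
  have h0' : ∀ r : ℝ, |r| < ρ → chart (firstInf n) x 0 ≠ ((r : ℂ) : OnePoint ℂ) := by
    intro r hr h
    simp only [chart, firstInf, Fin.cons_zero, toSphere, if_true] at h
    split_ifs at h with hx
    · exact OnePoint.infty_ne_coe _ h
    · have := OnePoint.coe_injective h
      rw [← inv_inv (x 0), this, norm_inv, Complex.norm_real, Real.norm_eq_abs] at h0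
      have hr0 : 0 < |r| := abs_pos.mpr fun e => hx (by rw [← inv_inv (x 0), this, e]; simp)
      exact absurd ((inv_lt_inv₀ hr0 hρ.pos).mp h0) (not_lt.mpr hr.le)
  refine ⟨fun i j e => ?_, fun i l => ?_⟩
  · rcases Fin.eq_zero_or_eq_succ i with rfl | ⟨i, rfl⟩ <;>
      rcases Fin.eq_zero_or_eq_succ j with rfl | ⟨j, rfl⟩
    · rfl
    · rw [hs'] at e; exact absurd e (h0' _ (hρ.z _))
    · rw [hs'] at e; exact absurd e.symm (h0' _ (hρ.z _))
    · rw [hs', hs'] at e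
      exact P.z_mono.injective (Complex.ofReal_injective (OnePoint.coe_injective e))
  · rcases Fin.eq_zero_or_eq_succ i with rfl | ⟨i, rfl⟩
    · exact h0' _ (hρ.α _)
    · rw [hs']
      exact fun e => (P.lt l _).ne' (Complex.ofReal_injective (OnePoint.coe_injective e))

variable (P) in
/-- The position `w` of the first point in the chart at infinity. -/
def posInf (w : ℂ) : Fin (n + 1) → ℂ := Function.update (fun j => (P.z j : ℂ)) 0 w⁻¹

theorem chart_posInf {w : ℂ} (hw : w ≠ 0) :
    chart (firstInf n) (P.posInf w) = chart (fun _ => false) (P.pos w) := by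
  funext j
  rcases Fin.eq_zero_or_eq_succ j with rfl | ⟨j, rfl⟩
  · simp [chart, firstInf, toSphere, posInf, pos, hw]
  · simp [chart, firstInf, toSphere, posInf, pos]

theorem posInf_mem {ρ : ℝ} (hρ : P.Bound ρ) {w : ℂ} (hw : ρ < ‖w‖) : P.posInf w ∈ P.farChart ρ := by
  refine ⟨?_, fun j => by simp [posInf]⟩
  simp only [posInf, Function.update_self, norm_inv]
  exact (inv_lt_inv₀ (hρ.pos.trans hw) hρ.pos).mpr hw

theorem tr1_eq_trC {ρ : ℝ} (hρ : P.Bound ρ) {v w : ℂ} (h : ∀ c ∈ segment ℝ v w, ρ < ‖c‖) :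
    tr1 d P M v w = trC d P.cα M (firstInf n) (P.posInf v) (P.posInf w) := by
  have ne : ∀ c ∈ segment ℝ v w, c ≠ 0 := fun c hc e => by
    have := h c hc; rw [e, norm_zero] at this; exact absurd hρ.pos this.not_gt
  have hseg : ∀ c ∈ segment ℝ (P.pos v) (P.pos w), ∃ e ∈ segment ℝ v w, c = P.pos e := by
    rintro c ⟨s, t, hs, ht, hst, rfl⟩
    refine ⟨s • v + t • w, ⟨s, t, hs, ht, hst, rfl⟩, ?_⟩
    funext j
    rcases Fin.eq_zero_or_eq_succ j with rfl | ⟨j, rfl⟩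
    · simp [pos]
    · simp only [pos, Pi.add_apply, Pi.smul_apply, ne_eq, Fin.succ_ne_zero, not_false_eq_true,
        Function.update_of_ne, ← add_smul, hst, one_smul]
  have hv := left_mem_segment ℝ v w
  have hw := right_mem_segment ℝ v w
  refine trC_eq_trC (convex_farChart ρ) (farChart_subset hρ) ?_ (posInf_mem hρ (h v hv))
    (posInf_mem hρ (h w hw)) (chart_posInf (ne v hv)).symm (chart_posInf (ne w hw)).symm ?_
  · intro c hc
    obtain ⟨e, he, rfl⟩ := hseg c hc
    have := farChart_subset hρ (posInf_mem hρ (h e he))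
    rwa [chartDomain, mem_ofPred_eq, chart_posInf (ne e he)] at this
  · intro c hc
    obtain ⟨e, he, rfl⟩ := hseg c hc
    exact ⟨_, posInf_mem hρ (h e he), chart_posInf (ne e he)⟩

theorem lt_norm_of_mem_segment {ρ : ℝ} (hρ : 0 < ρ) {a b : ℝ} (ha : a ^ 2 = 1) (hb : b ^ 2 = 1)
    {v w : ℂ} (hv : lin a b v = 2 * ρ) (hw : lin a b w = 2 * ρ) : ∀ c ∈ segment ℝ v w, ρ < ‖c‖ := by
  rintro c ⟨s, t, hs, ht, hst, rfl⟩
  have h : lin a b (s • v + t • w) = 2 * ρ := by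
    rw [lin_add, lin_smul, lin_smul, hv, hw, ← add_mul, hst, one_mul]
  set c := s • v + t • w
  refine lt_of_pow_lt_pow_left₀ 2 (norm_nonneg _) ?_
  rw [← Complex.normSq_eq_norm_sq, Complex.normSq_apply]
  simp only [lin] at h
  have h2 : (2 * ρ) ^ 2 + (a * c.im - b * c.re) ^ 2 = 2 * (c.re * c.re + c.im * c.im) := by
    rw [← h]; linear_combination (c.re ^ 2 + c.im ^ 2) * (ha + hb)
  nlinarith [sq_nonneg (a * c.im - b * c.re), pow_pos hρ 2]

theorem tr1_diamond {ρ : ℝ} (hρ : P.Bound ρ) :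
    tr1 d P M ⟨-(2 * ρ), 0⟩ ⟨0, -(2 * ρ)⟩ * (tr1 d P M ⟨0, 2 * ρ⟩ ⟨-(2 * ρ), 0⟩ *
      (tr1 d P M ⟨2 * ρ, 0⟩ ⟨0, 2 * ρ⟩ * tr1 d P M ⟨0, -(2 * ρ)⟩ ⟨2 * ρ, 0⟩)) = 1 := by
  have h0 := hρ.pos
  have e1 := tr1_eq_trC (d := d) (M := M) hρ (lt_norm_of_mem_segment (v := ⟨-(2 * ρ), 0⟩)
    (w := ⟨0, -(2 * ρ)⟩) h0 (a := -1) (b := -1) (by norm_num) (by norm_num) (by simp [lin])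
    (by simp [lin]))
  have e2 := tr1_eq_trC (d := d) (M := M) hρ (lt_norm_of_mem_segment (v := ⟨0, 2 * ρ⟩)
    (w := ⟨-(2 * ρ), 0⟩) h0 (a := -1) (b := 1) (by norm_num) (by norm_num) (by simp [lin])
    (by simp [lin]))
  have e3 := tr1_eq_trC (d := d) (M := M) hρ (lt_norm_of_mem_segment (v := ⟨2 * ρ, 0⟩)
    (w := ⟨0, 2 * ρ⟩) h0 (a := 1) (b := 1) (by norm_num) (by norm_num) (by simp [lin])
    (by simp [lin]))
  have e4 := tr1_eq_trC (d := d) (M := M) hρ (lt_norm_of_mem_segment (v := ⟨0, -(2 * ρ)⟩)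
    (w := ⟨2 * ρ, 0⟩) h0 (a := 1) (b := -1) (by norm_num) (by norm_num) (by simp [lin])
    (by simp [lin]))
  have m1 : P.posInf ⟨-(2 * ρ), 0⟩ ∈ P.farChart ρ := posInf_mem hρ
    (lt_norm_of_mem_segment (v := ⟨-(2 * ρ), 0⟩)
    (w := ⟨0, -(2 * ρ)⟩) h0 (a := -1) (b := -1) (by norm_num) (by norm_num) (by simp [lin])
    (by simp [lin]) _ (left_mem_segment _ _ _))
  have m2 : P.posInf ⟨0, 2 * ρ⟩ ∈ P.farChart ρ := posInf_mem hρ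
    (lt_norm_of_mem_segment (v := ⟨0, 2 * ρ⟩)
    (w := ⟨-(2 * ρ), 0⟩) h0 (a := -1) (b := 1) (by norm_num) (by norm_num) (by simp [lin])
    (by simp [lin]) _ (left_mem_segment _ _ _))
  have m3 : P.posInf ⟨2 * ρ, 0⟩ ∈ P.farChart ρ := posInf_mem hρ
    (lt_norm_of_mem_segment (v := ⟨2 * ρ, 0⟩)
    (w := ⟨0, 2 * ρ⟩) h0 (a := 1) (b := 1) (by norm_num) (by norm_num) (by simp [lin])
    (by simp [lin]) _ (left_mem_segment _ _ _))
  have m4 : P.posInf ⟨0, -(2 * ρ)⟩ ∈ P.farChart ρ := posInf_mem hρ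
    (lt_norm_of_mem_segment (v := ⟨0, -(2 * ρ)⟩)
    (w := ⟨2 * ρ, 0⟩) h0 (a := 1) (b := -1) (by norm_num) (by norm_num) (by simp [lin])
    (by simp [lin]) _ (left_mem_segment _ _ _))
  rw [e1, e2, e3, e4, trC_trans (convex_farChart ρ) (farChart_subset hρ) m4 m3 m2,
    trC_trans (convex_farChart ρ) (farChart_subset hρ) m4 m2 m1,
    trC_trans (convex_farChart ρ) (farChart_subset hρ) m4 m1 m4,
    trC_self (farChart_subset hρ m4)]

theorem prod_opU {ρ : ℝ} (hρ : P.Bound ρ) :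
    (List.ofFn fun k : Fin m => opU d P M k).prod =
      tr1 d P M ⟨0, -(2 * ρ)⟩ (P.z 0) * (tr1 d P M ⟨-(2 * ρ), 0⟩ ⟨0, -(2 * ρ)⟩ *
        (tr1 d P M ⟨0, 2 * ρ⟩ ⟨-(2 * ρ), 0⟩ * tr1 d P M (P.z 0) ⟨0, 2 * ρ⟩)) := by
  have ρ0 := hρ.pos
  have hz := fun j => abs_lt.mp (hρ.z j)
  have hα := fun l => abs_lt.mp (hρ.α l)
  have hz0 : ∀ j : Fin (n + 1), j ≠ 0 → P.z 0 < P.z j := fun j hj => z_zero_lt hj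
  rcases Nat.eq_zero_or_pos m with rfl | hm
  · have s1 : P.SepFirst {(P.z 0 : ℂ), (⟨0, 2 * ρ⟩ : ℂ), (⟨-(2 * ρ), 0⟩ : ℂ)} := by
      refine ⟨fun j hj => ⟨1, -1, ?_⟩, fun l => l.elim0⟩
      rintro w (rfl | rfl | rfl) <;>
        simp only [lin, Complex.sub_re, Complex.sub_im, Complex.ofReal_re, Complex.ofReal_im] <;>
        linarith [hz0 j hj, hz j]
    have s2 : P.SepFirst {(P.z 0 : ℂ), (⟨0, -(2 * ρ)⟩ : ℂ), (⟨-(2 * ρ), 0⟩ : ℂ)} := by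
      refine ⟨fun j hj => ⟨1, 1, ?_⟩, fun l => l.elim0⟩
      rintro w (rfl | rfl | rfl) <;>
        simp only [lin, Complex.sub_re, Complex.sub_im, Complex.ofReal_re, Complex.ofReal_im] <;>
        linarith [hz0 j hj, hz j]
    rw [s1.tr_trans (by simp) (by simp) (by simp), s2.tr_trans (by simp) (by simp) (by simp),
      s2.tr_mul_tr (by simp) (by simp)]
    simp
  set w : ℂ := ⟨-ρ, -(5 * ρ)⟩ with hw
  set N : ℂ := ⟨0, 2 * ρ⟩ with hN
  set S : ℂ := ⟨0, -(2 * ρ)⟩ with hS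
  set W : ℂ := ⟨-(2 * ρ), 0⟩ with hW
  have w_home : w ∈ P.home := ⟨fun l => by simp only [hw]; linarith [hα l],
    fun j _ => by simp only [hw]; linarith [hz j]⟩
  have w_under : ∀ x, w ∈ P.under x := fun x =>
    ⟨fun l _ => by simp only [hw]; linarith [hα l], fun l _ => by simp only [hw]; linarith [hα l],
      fun j _ => by simp only [hw]; linarith [hz j]⟩
  have N_above : ∀ x, N ∈ P.above x := fun x =>
    ⟨fun l _ => by simp only [hN]; linarith [hα l], fun l _ => by simp only [hN]; linarith [hα l],
      fun j _ => by simp only [hN]; linarith [hz j]⟩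
  have left_ne : ∀ k l, P.left k ≠ P.α l := fun k => (P.free_left k).1
  have right_ne : ∀ k l, P.right k ≠ P.α l := fun k => (P.free_right k).1
  have left_lt_z : ∀ k, P.left k < P.z 0 := fun k => (P.left_lt k).trans (P.lt k 0)
  have hU : ∀ k, opU d P M k = (tr1 d P M w (P.z 0) * (tr1 d P M (P.left k) w *
      tr1 d P M N (P.left k))) * (tr1 d P M (P.right k) N * (tr1 d P M w (P.right k) *
        tr1 d P M (P.z 0) w)) := fun k => by
    rw [opU_eq k (w_under _) w_home (N_above _) (N_above _) (w_under _) w_home]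
    simp only [mul_assoc]
  have hFF : ∀ k, (tr1 d P M (P.left k) N * (tr1 d P M w (P.left k) * tr1 d P M (P.z 0) w)) *
      (tr1 d P M w (P.z 0) * (tr1 d P M (P.left k) w * tr1 d P M N (P.left k))) = 1 := fun k => by
    have h1 := sepFirst_home.tr_mul_tr (d := d) (M := M) (w_home) (z_zero_mem_home (P := P))
    have h2 := (sepFirst_under (left_ne k)).tr_mul_tr (d := d) (M := M)
      (real_mem_under (left_lt_z k)) (w_under _)
    have h3 := (sepFirst_above (left_ne k)).tr_mul_tr (d := d) (M := M) (N_above _)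
      (real_mem_above (left_lt_z k))
    simp only [mul_assoc]
    rw [mul_mul_eq_of_mul_eq h1, one_mul, mul_mul_eq_of_mul_eq h2, one_mul, h3]
  have key : ∀ k (hk : k < m), ((List.ofFn fun k : Fin m => opU d P M k).take (k + 1)).prod =
      (tr1 d P M w (P.z 0) * (tr1 d P M (P.left ⟨0, hm⟩) w * tr1 d P M N (P.left ⟨0, hm⟩))) *
        (tr1 d P M (P.right ⟨k, hk⟩) N * (tr1 d P M w (P.right ⟨k, hk⟩) *
          tr1 d P M (P.z 0) w)) := by
    intro k
    induction k with
    | zero =>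
      intro hk
      rw [List.prod_take_succ _ _ (by simpa)]
      simp [hU]
    | succ k ih =>
      intro hk
      rw [List.prod_take_succ _ _ (by simpa), ih (by omega), List.getElem_ofFn, hU,
        P.right_eq_left ⟨k, by omega⟩ ⟨k + 1, hk⟩ rfl, ← mul_assoc _ _ (_ * (_ * _)),
        mul_assoc _ _ (tr1 d P M w _ * (_ * _)), hFF, mul_one]
  have h := key (m - 1) (by omega)
  rw [Nat.sub_add_cancel hm, List.take_of_length_le (by simp)] at h
  rw [h]
  have e1 : tr1 d P M (P.right ⟨m - 1, by omega⟩) N * (tr1 d P M w (P.right ⟨m - 1, by omega⟩) *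
      tr1 d P M (P.z 0) w) = tr1 d P M (P.z 0) N := by
    have hr : ∀ l, P.α l < P.right ⟨m - 1, by omega⟩ := fun l =>
      lt_of_le_of_lt (P.α_mono.monotone (by rw [Fin.le_def]; simp; omega)) (P.lt_right _)
    have h1 : ((P.right ⟨m - 1, by omega⟩ : ℝ) : ℂ) ∈ P.home :=
      ⟨fun l => by simpa using hr l, fun j hj => by
        simpa using (P.right_lt_z _).trans (hz0 j hj)⟩
    rw [sepFirst_home.tr_trans z_zero_mem_home w_home h1,
      (sepFirst_above (right_ne _)).tr_trans ⟨fun l _ => by simpa using P.lt l 0,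
        fun l hl => absurd hl (hr l).not_gt, fun j hj => by simpa using hz0 j hj⟩
        (real_mem_above (P.right_lt_z _)) (N_above _)]
  have hl : ∀ l, P.left ⟨0, hm⟩ < P.α l := fun l =>
    lt_of_lt_of_le (P.left_lt _) (P.α_mono.monotone (by rw [Fin.le_def]; simp))
  have W_above : W ∈ P.above (P.left ⟨0, hm⟩) := ⟨fun l h => absurd h (hl l).not_gt,
    fun l _ => by simp only [hW]; linarith [hα l], fun j _ => by simp only [hW]; linarith [hz j]⟩
  have W_under : W ∈ P.under (P.left ⟨0, hm⟩) := ⟨fun l h => absurd h (hl l).not_gt,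
    fun l _ => by simp only [hW]; linarith [hα l], fun j _ => by simp only [hW]; linarith [hz j]⟩
  have S_under : S ∈ P.under (P.left ⟨0, hm⟩) := ⟨fun l h => absurd h (hl l).not_gt,
    fun l _ => by simp only [hS]; linarith [hα l], fun j _ => by simp only [hS]; linarith [hz j]⟩
  have s3 : P.SepFirst {S, w, (P.z 0 : ℂ)} := by
    refine ⟨fun j hj => ⟨1, 1, ?_⟩, fun l => ⟨1, -1, ?_⟩⟩
    · rintro v (rfl | rfl | rfl) <;>
        simp only [lin, Complex.sub_re, Complex.sub_im, Complex.ofReal_re, Complex.ofReal_im, hS,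
          hw] <;> linarith [hz0 j hj, hz j]
    · rintro v (rfl | rfl | rfl) <;>
        simp only [lin, Complex.sub_re, Complex.sub_im, Complex.ofReal_re, Complex.ofReal_im, hS,
          hw, cα] <;> linarith [P.lt l 0, hα l]
  have e2 : tr1 d P M w (P.z 0) * (tr1 d P M (P.left ⟨0, hm⟩) w * tr1 d P M N (P.left ⟨0, hm⟩)) =
      tr1 d P M S (P.z 0) * (tr1 d P M W S * tr1 d P M N W) := by
    rw [← (sepFirst_above (left_ne _)).tr_trans (N_above _) W_above
      (real_mem_above (left_lt_z _)), ← mul_assoc (tr1 d P M _ w),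
      (sepFirst_under (left_ne _)).tr_trans W_under (real_mem_under (left_lt_z _)) (w_under _),
      ← (sepFirst_under (left_ne _)).tr_trans W_under S_under (w_under _), ← mul_assoc,
      ← mul_assoc, s3.tr_trans (by simp) (by simp) (by simp), mul_assoc]
  rw [e1, e2]
  simp only [mul_assoc]

theorem prod_opU_mul_prod_opT :
    (List.ofFn fun k : Fin m => opU d P M k).prod *
      ((List.ofFn fun i : Fin n => opT d P i M).prod *
        (List.ofFn fun i : Fin n => opT d P i M).reverse.prod) = 1 := by
  obtain ⟨ρ, hρ⟩ := exists_bound (P := P)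
  have ρ0 := hρ.pos
  have hz := fun j => abs_lt.mp (hρ.z j)
  have hα := fun l => abs_lt.mp (hρ.α l)
  have hz0 : ∀ j : Fin (n + 1), j ≠ 0 → P.z 0 < P.z j := fun j hj => z_zero_lt hj
  have s1 : P.SepFirst {(P.z 0 : ℂ), (⟨0, 2 * ρ⟩ : ℂ)} := by
    refine ⟨fun j hj => ⟨1, -1, ?_⟩, fun l => ⟨1, 1, ?_⟩⟩ <;>
    rintro v (rfl | rfl) <;>
    simp only [lin, Complex.sub_re, Complex.sub_im, Complex.ofReal_re, Complex.ofReal_im, cα] <;>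
    first | linarith [hz0 j hj, hz j] | linarith [P.lt l 0, hα l]
  have s2 : P.SepFirst {(P.z 0 : ℂ), (⟨0, -(2 * ρ)⟩ : ℂ)} := by
    refine ⟨fun j hj => ⟨1, 1, ?_⟩, fun l => ⟨1, -1, ?_⟩⟩ <;>
    rintro v (rfl | rfl) <;>
    simp only [lin, Complex.sub_re, Complex.sub_im, Complex.ofReal_re, Complex.ofReal_im, cα] <;>
    first | linarith [hz0 j hj, hz j] | linarith [P.lt l 0, hα l]
  rw [prod_opU hρ, prod_opT_mul_prod_opT hρ]
  simp only [mul_assoc]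
  rw [mul_mul_eq_of_mul_eq (s1.tr_mul_tr (d := d) (M := M) (v := ⟨0, 2 * ρ⟩) (w := P.z 0)
    (by simp) (by simp)), one_mul]
  have h := tr1_diamond (d := d) (M := M) hρ
  calc _ = tr1 d P M ⟨0, -(2 * ρ)⟩ (P.z 0) * ((tr1 d P M ⟨-(2 * ρ), 0⟩ ⟨0, -(2 * ρ)⟩ *
      (tr1 d P M ⟨0, 2 * ρ⟩ ⟨-(2 * ρ), 0⟩ * (tr1 d P M ⟨2 * ρ, 0⟩ ⟨0, 2 * ρ⟩ *
        tr1 d P M ⟨0, -(2 * ρ)⟩ ⟨2 * ρ, 0⟩))) * tr1 d P M (P.z 0) ⟨0, -(2 * ρ)⟩) := by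
        simp only [mul_assoc]
    _ = 1 := by rw [h, one_mul, s2.tr_mul_tr (by simp) (by simp)]

end RealPosition

section Growth

variable {V : Type*} [NormedAddCommGroup V] [NormedSpace ℂ V]

theorem norm_le_mul_exp {f f' : ℝ → V} {K a b : ℝ} (hab : a ≤ b)
    (hf : ∀ x ∈ Icc a b, HasDerivAt f (f' x) x) (bound : ∀ x ∈ Icc a b, ‖f' x‖ ≤ K * ‖f x‖) :
    ‖f b‖ ≤ ‖f a‖ * Real.exp (K * (b - a)) ∧ ‖f a‖ ≤ ‖f b‖ * Real.exp (K * (b - a)) := by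
  constructor
  · have h := norm_le_gronwallBound_of_norm_deriv_right_le (ε := 0)
      (fun x hx => (hf x hx).continuousAt.continuousWithinAt)
      (fun x hx => (hf x (Ico_subset_Icc_self hx)).hasDerivWithinAt) le_rfl
      (fun x hx => by simpa using bound x (Ico_subset_Icc_self hx)) b (right_mem_Icc.mpr hab)
    rwa [gronwallBound_ε0] at h
  · have hm : ∀ x ∈ Icc (-b) (-a), -x ∈ Icc a b := fun x hx =>
      ⟨by linarith [hx.2], by linarith [hx.1]⟩
    have hd : ∀ x ∈ Icc (-b) (-a), HasDerivAt (fun x => f (-x)) (-f' (-x)) x := fun x hx => by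
      simpa [Function.comp_def] using (hf _ (hm x hx)).scomp x (hasDerivAt_neg x)
    have h := norm_le_gronwallBound_of_norm_deriv_right_le (ε := 0) (K := K)
      (fun x hx => (hd x hx).continuousAt.continuousWithinAt)
      (fun x hx => (hd x (Ico_subset_Icc_self hx)).hasDerivWithinAt) le_rfl
      (fun x hx => by simpa using bound _ (hm x (Ico_subset_Icc_self hx))) (-a)
      (right_mem_Icc.mpr (by linarith))
    rw [gronwallBound_ε0] at h
    simpa [neg_add_eq_sub] using h

theorem isBigO_exp_of_le {a b : ℝ} (hab : a ≤ b) :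
    (fun σ => Real.exp (b * σ)) =O[atBot] fun σ => Real.exp (a * σ) := by
  refine IsBigO.of_bound 1 ?_
  filter_upwards [eventually_le_atBot 0] with σ hσ
  rw [one_mul, Real.norm_eq_abs, Real.norm_eq_abs, Real.abs_exp, Real.abs_exp, Real.exp_le_exp]
  nlinarith

/-- A growth estimate for a perturbation of a scalar equation. -/
theorem isBigO_of_scalar {H H' : ℝ → V} {a b : ℝ} {l : ℂ}
    (hH : ∀ᶠ σ in atBot, HasDerivAt H (H' σ) σ)
    (h1 : (fun σ => H' σ - l • H σ) =O[atBot] fun σ => Real.exp (b * σ))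
    (h2 : H =O[atBot] fun σ => Real.exp (a * σ)) (hab : a ≤ b) (hl : b < l.re ∨ l.re < a) :
    H =O[atBot] fun σ => Real.exp (b * σ) := by
  obtain ⟨C, hC⟩ := h1.bound
  obtain ⟨N, hN⟩ := eventually_atBot.mp (hH.and hC)
  have hne : b - l.re ≠ 0 := by rcases hl with h | h <;> intro e <;> linarith
  have hn : ∀ s : ℝ, ‖Complex.exp (-l * s)‖ = Real.exp (-l.re * s) := fun s => by
    rw [Complex.norm_exp]; simp
  set y : ℝ → V := fun σ => Complex.exp (-l * σ) • H σ with hy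
  have hHy : ∀ σ, ‖H σ‖ = Real.exp (l.re * σ) * ‖y σ‖ := fun σ => by
    rw [hy, norm_smul, hn, ← mul_assoc, ← Real.exp_add]; simp
  have hdy : ∀ σ ≤ N, HasDerivAt y (Complex.exp (-l * σ) • (H' σ - l • H σ)) σ := fun σ hσ => by
    have h : HasDerivAt (fun s : ℝ => Complex.exp (-l * s)) (Complex.exp (-l * σ) * (-l)) σ := by
      have : HasDerivAt (fun s : ℂ => -l * s) (-l) (σ : ℂ) := by
        simpa using (hasDerivAt_id (σ : ℂ)).const_mul (-l)
      exact this.cexp.comp_ofReal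
    refine (h.smul (hN σ hσ).1).congr_deriv ?_
    rw [smul_sub, smul_smul, mul_neg, neg_smul, sub_eq_add_neg]
  set Bd : ℝ → ℝ := fun σ => C / (b - l.re) * Real.exp ((b - l.re) * σ) with hBd
  have hB : ∀ σ, HasDerivAt Bd (C * Real.exp ((b - l.re) * σ)) σ := fun σ => by
    have := (((hasDerivAt_id σ).const_mul (b - l.re)).exp).const_mul (C / (b - l.re))
    refine this.congr_deriv ?_
    simp only [id]
    field_simp
  have key : ∀ s t, s ≤ t → t ≤ N → ‖y t - y s‖ ≤ Bd t - Bd s := fun s t hst ht => by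
    refine image_norm_le_of_norm_deriv_right_le_deriv_boundary (f := fun x => y x - y s)
      (f' := fun x => Complex.exp (-l * x) • (H' x - l • H x)) (B := fun x => Bd x - Bd s)
      (a := s) (b := t) (fun x hx => ?_) (fun x hx => ?_) (by simp)
      (fun x => (hB x).sub_const _) (fun x hx => ?_) (right_mem_Icc.mpr hst)
    · exact ((hdy x (hx.2.trans ht)).sub_const _).continuousAt.continuousWithinAt
    · exact ((hdy x (hx.2.le.trans ht)).sub_const _).hasDerivWithinAt
    · rw [norm_smul, hn]
      have := (hN x (hx.2.le.trans ht)).2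
      rw [Real.norm_eq_abs, Real.abs_exp] at this
      calc _ ≤ Real.exp (-l.re * x) * (C * Real.exp (b * x)) := by gcongr
        _ = C * (Real.exp (-l.re * x) * Real.exp (b * x)) := by ring
        _ = _ := by rw [← Real.exp_add]; ring_nf
  rcases hl with hl | hl
  · refine IsBigO.of_bound ((‖y N‖ + |Bd N|) * Real.exp ((l.re - b) * N) + |C / (b - l.re)|) ?_
    filter_upwards [eventually_le_atBot N] with σ hσ
    have h := key σ N hσ le_rfl
    have h' : ‖y σ‖ ≤ (‖y N‖ + |Bd N|) + |C / (b - l.re)| * Real.exp ((b - l.re) * σ) := by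
      have h3 := norm_sub_norm_le (y σ) (y N)
      rw [norm_sub_rev] at h3
      have h4 : -Bd σ ≤ |C / (b - l.re)| * Real.exp ((b - l.re) * σ) := by
        rw [hBd]
        nlinarith [neg_abs_le (C / (b - l.re)), Real.exp_pos ((b - l.re) * σ)]
      linarith [le_abs_self (Bd N)]
    rw [hHy, Real.norm_eq_abs, Real.abs_exp]
    have e1 : Real.exp (l.re * σ) * Real.exp ((b - l.re) * σ) = Real.exp (b * σ) := by
      rw [← Real.exp_add]; ring_nf
    have e2 : Real.exp (l.re * σ) ≤ Real.exp ((l.re - b) * N) * Real.exp (b * σ) := by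
      rw [← Real.exp_add, Real.exp_le_exp]; nlinarith
    calc _ ≤ Real.exp (l.re * σ) * ((‖y N‖ + |Bd N|) +
          |C / (b - l.re)| * Real.exp ((b - l.re) * σ)) := by gcongr
      _ = (‖y N‖ + |Bd N|) * Real.exp (l.re * σ) + |C / (b - l.re)| * Real.exp (b * σ) := by
        rw [← e1]; ring
      _ ≤ (‖y N‖ + |Bd N|) * (Real.exp ((l.re - b) * N) * Real.exp (b * σ)) +
          |C / (b - l.re)| * Real.exp (b * σ) := by gcongr
      _ = _ := by ring
  · obtain ⟨C2, hC2⟩ := h2.bound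
    have hpos : 0 < b - l.re := by linarith
    have hCB : ∀ s ≤ N, 0 ≤ C := fun s hs => by
      have := (norm_nonneg _).trans (hN s hs).2
      rw [Real.norm_eq_abs, Real.abs_exp] at this
      exact nonneg_of_mul_nonneg_left this (Real.exp_pos _)
    have hlim : Tendsto (fun s => ‖y s‖) atBot (𝓝 0) := by
      have hz : Tendsto (fun s => C2 * Real.exp ((a - l.re) * s)) atBot (𝓝 0) := by
        rw [← mul_zero C2]
        exact (Real.tendsto_exp_atBot.comp
          (tendsto_id.const_mul_atBot (by linarith))).const_mul C2
      refine squeeze_zero' (.of_forall fun _ => norm_nonneg _) ?_ hz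
      filter_upwards [hC2] with s hs
      rw [Real.norm_eq_abs, Real.abs_exp] at hs
      rw [hy, norm_smul, hn]
      calc _ ≤ Real.exp (-l.re * s) * (C2 * Real.exp (a * s)) := by gcongr
        _ = C2 * (Real.exp (-l.re * s) * Real.exp (a * s)) := by ring
        _ = _ := by rw [← Real.exp_add]; ring_nf
    refine IsBigO.of_bound (C / (b - l.re)) ?_
    filter_upwards [eventually_le_atBot N] with σ hσ
    have h' : ‖y σ‖ ≤ Bd σ := by
      have h3 : Tendsto (fun s => ‖y s‖ + Bd σ) atBot (𝓝 (0 + Bd σ)) := hlim.add_const _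
      rw [zero_add] at h3
      refine ge_of_tendsto h3 ?_
      filter_upwards [eventually_le_atBot σ] with s hs
      have h4 := key s σ hs hσ
      have h5 := norm_sub_norm_le (y σ) (y s)
      have h6 : 0 ≤ Bd s := by
        have := hCB s (hs.trans hσ)
        rw [hBd]; positivity
      linarith
    rw [hHy, Real.norm_eq_abs, Real.abs_exp]
    calc _ ≤ Real.exp (l.re * σ) * Bd σ := by gcongr
      _ = C / (b - l.re) * (Real.exp (l.re * σ) * Real.exp ((b - l.re) * σ)) := by rw [hBd]; ring
      _ = _ := by rw [← Real.exp_add]; ring_nf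

theorem isBigO_of_unipotent {r : V →L[ℂ] V} {a b : ℝ} {l : ℂ} (hab : a ≤ b)
    (hl : b < l.re ∨ l.re < a) (p : ℕ) {Z Z' : ℝ → V}
    (hZ : ∀ᶠ σ in atBot, HasDerivAt Z (Z' σ) σ)
    (h1 : (fun σ => Z' σ - r (Z σ)) =O[atBot] fun σ => Real.exp (b * σ))
    (h2 : Z =O[atBot] fun σ => Real.exp (a * σ))
    (hp : ∀ᶠ σ in atBot, ((r - l • 1) ^ p) (Z σ) = 0) :
    Z =O[atBot] fun σ => Real.exp (b * σ) := by
  induction p generalizing Z Z' with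
  | zero =>
    refine (isBigO_zero _ _).congr' ?_ EventuallyEq.rfl
    filter_upwards [hp] with σ hσ
    simpa using hσ.symm
  | succ p ih =>
    set s : V →L[ℂ] V := r - l • 1
    have hs : ∀ v, s v = r v - l • v := fun v => rfl
    have hc : ∀ v, s (r v) = r (s v) := fun v => by simp only [hs, map_sub, map_smul]
    have key := ih (Z := fun σ => s (Z σ)) (Z' := fun σ => s (Z' σ))
      (hZ.mono fun σ hσ => (s.restrictScalars ℝ).hasFDerivAt.comp_hasDerivAt σ hσ)
      (((s.isBigO_comp _ _).trans h1).congr_left fun σ => by rw [map_sub, hc])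
      ((s.isBigO_comp _ _).trans h2)
      (hp.mono fun σ hσ => by rwa [pow_succ] at hσ)
    refine isBigO_of_scalar hZ ((h1.add key).congr_left fun σ => ?_) h2 hab hl
    rw [hs]; abel

end Growth

section Exp

variable {𝔸 : Type*} [NormedRing 𝔸] [NormedAlgebra ℂ 𝔸] [CompleteSpace 𝔸]

theorem exists_exp_sub_one (X : 𝔸) : ∃ h, NormedSpace.exp X - 1 = h * X ∧
    ∀ Z, Commute Z X → Commute Z h := by
  set g : ℕ → 𝔸 := fun k => (((k + 1).factorial : ℂ)⁻¹) • X ^ k with hg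
  have hs : Summable g := by
    refine Summable.of_norm_bounded (NormedSpace.norm_expSeries_summable' (𝕂 := ℂ) X) fun k => ?_
    rw [hg, norm_smul, norm_smul, norm_inv, norm_inv, Complex.norm_natCast, Complex.norm_natCast]
    have : k.factorial ≤ (k + 1).factorial := Nat.factorial_le (Nat.le_succ k)
    have : (k.factorial : ℝ) ≤ (k + 1).factorial := by exact_mod_cast this
    gcongr
  refine ⟨∑' k, g k, ?_, fun Z hZ => Commute.tsum_right _ fun k => (hZ.pow_right k).smul_right _⟩
  have h1 := (hasSum_nat_add_iff' 1).mpr (NormedSpace.exp_series_hasSum_exp' (𝕂 := ℂ) X)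
  have h2 := hs.hasSum.mul_right X
  have h3 : (fun k => g k * X) = fun k => (((k + 1).factorial : ℂ)⁻¹) • X ^ (k + 1) := by
    funext k; rw [hg, smul_mul_assoc, pow_succ]
  rw [h3] at h2
  simpa using h1.unique h2

theorem exists_exp_sub_exp {X Y : 𝔸} (hXY : Commute X Y) : ∃ h,
    NormedSpace.exp X - NormedSpace.exp Y = h * (X - Y) ∧
      ∀ Z, Commute Z X → Commute Z Y → Commute Z h := by
  let _ : NormedAlgebra ℚ 𝔸 := NormedAlgebra.restrictScalars ℚ ℂ 𝔸
  obtain ⟨h, h1, h2⟩ := exists_exp_sub_one (X - Y)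
  refine ⟨NormedSpace.exp Y * h, ?_, fun Z hX hY => hY.exp_right.mul_right (h2 Z (hX.sub_right hY))⟩
  have e : NormedSpace.exp X = NormedSpace.exp Y * NormedSpace.exp (X - Y) := by
    rw [← NormedSpace.exp_add_of_commute (hXY.symm.sub_right (Commute.refl Y)), add_sub_cancel]
  rw [mul_assoc, ← h1, e, mul_sub, mul_one]

end Exp

/-- A fundamental solution `Φ` of the equation `Φ' = A Φ` on a half plane, where `A τ` approaches
`R` exponentially, its monodromy `U` under translation by `ω i`, and a factorization of an
annihilating polynomial of `R` with central roots. -/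
structure LocalMonodromy (V : Type*) [NormedAddCommGroup V] [NormedSpace ℂ V] (ι : Type*) where
  (R Θ U : V →L[ℂ] V)
  (A Φ : ℂ → V →L[ℂ] V)
  (r q h g E : ι → V →L[ℂ] V)
  (σ₀ ω C : ℝ)
  ω_nonneg : 0 ≤ ω
  norm_sub_le : ∀ τ : ℂ, τ.re < σ₀ → ‖A τ - R‖ ≤ C * Real.exp τ.re
  deriv : ∀ τ : ℂ, τ.re < σ₀ → ∀ x, HasDerivAt (fun s => Φ s x) (A τ (Φ τ x)) τ
  monodromy : ∀ σ : ℝ, σ < σ₀ → Θ * Φ (σ + ω * Complex.I) = Φ σ * U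
  inj : ∀ x, (∀ σ : ℝ, σ < σ₀ → Φ σ x = 0) → x = 0
  R_sub_r : ∀ k, R - r k = g k * E k
  exp_sub_q : ∀ k, Θ * NormedSpace.exp ((ω * Complex.I) • R) - q k = h k * E k
  E_E : ∀ k l, Commute (E k) (E l)
  E_h : ∀ k l, Commute (E k) (h l)
  R_E : ∀ k, Commute R (E k)
  r_E : ∀ k l, Commute (r k) (E l)
  r_Φ : ∀ k (σ : ℝ), σ < σ₀ → Commute (r k) (Φ σ)
  r_r : ∀ k l, Commute (r k) (r l)
  r_q : ∀ k l, Commute (r k) (q l)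
  r_U : ∀ k, Commute (r k) U
  q_q : ∀ k l, Commute (q k) (q l)
  q_U : ∀ k, Commute (q k) U
  q_Φ : ∀ k (σ : ℝ), σ < σ₀ → Commute (q k) (Φ σ)

namespace LocalMonodromy

variable {V : Type*} [NormedAddCommGroup V] [NormedSpace ℂ V] {ι : Type*}
  (D : LocalMonodromy V ι)

/-- Growth of the solution with parameter `x`. -/
def Growth (b : ℝ) (x : V) : Prop := (fun σ : ℝ => D.Φ σ x) =O[atBot] fun σ => Real.exp (b * σ)

variable {D}

theorem Growth.mono {a b : ℝ} {x : V} (h : D.Growth b x) (hab : a ≤ b) : D.Growth a x :=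
  IsBigO.trans h (isBigO_exp_of_le hab)

variable (D)

theorem hasDerivAt_real {σ : ℝ} (hσ : σ < D.σ₀) (x : V) :
    HasDerivAt (fun s : ℝ => D.Φ s x) (D.A σ (D.Φ σ x)) σ := by
  have := (D.deriv σ (by simpa) x).scomp σ (Complex.ofRealCLM.hasDerivAt (x := σ))
  simpa [Function.comp_def] using this

theorem hasDerivAt_imag {σ : ℝ} (hσ : σ < D.σ₀) (x : V) (s : ℂ) (hs : s.im = 0) :
    HasDerivAt (fun s : ℂ => D.Φ (σ + s * Complex.I) x)
      (Complex.I • D.A (σ + s * Complex.I) (D.Φ (σ + s * Complex.I) x)) s := by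
  have h1 : HasDerivAt (fun s : ℂ => (σ : ℂ) + s * Complex.I) Complex.I s := by
    simpa using ((hasDerivAt_id s).mul_const Complex.I).const_add (σ : ℂ)
  have := (D.deriv (σ + s * Complex.I) (by simpa [hs]) x).scomp s h1
  simpa [Function.comp_def] using this

theorem C_nonneg : 0 ≤ D.C := by
  have h := (norm_nonneg _).trans (D.norm_sub_le ((D.σ₀ - 1 : ℝ) : ℂ) (by simp))
  exact nonneg_of_mul_nonneg_left h (Real.exp_pos _)

/-- A bound for the coefficients of the equation. -/
def K : ℝ := D.C * Real.exp D.σ₀ + ‖D.R‖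

theorem K_nonneg : 0 ≤ D.K := by
  have := D.C_nonneg; rw [K]; positivity

theorem norm_A_le {τ : ℂ} (h : τ.re < D.σ₀) : ‖D.A τ‖ ≤ D.K := by
  have h1 := D.norm_sub_le τ h
  have h2 := norm_le_norm_add_norm_sub' (D.A τ) D.R
  have h3 := D.C_nonneg
  have h4 : D.C * Real.exp τ.re ≤ D.C * Real.exp D.σ₀ := by gcongr
  rw [K]
  rw [norm_sub_rev] at h2
  linarith [norm_sub_rev (D.A τ) D.R]

theorem growth_of_lt {b : ℝ} (hb : b < -D.K) (x : V) : D.Growth b x := by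
  refine IsBigO.of_bound (‖D.Φ ((D.σ₀ - 1 : ℝ) : ℂ) x‖ * Real.exp (D.K * (D.σ₀ - 1))) ?_
  filter_upwards [eventually_le_atBot (D.σ₀ - 1), eventually_le_atBot 0] with σ hσ hσ0
  have hlt : ∀ y ∈ Icc σ (D.σ₀ - 1), y < D.σ₀ := fun y hy => by linarith [hy.2]
  have h := (norm_le_mul_exp (K := D.K) hσ (fun y hy => D.hasDerivAt_real (hlt y hy) x)
    (fun y hy => (D.A y).le_of_opNorm_le (D.norm_A_le (by simpa using hlt y hy)) _)).2
  refine h.trans ?_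
  rw [Real.norm_eq_abs, Real.abs_exp, mul_assoc, ← Real.exp_add]
  gcongr
  nlinarith

theorem eq_zero_of_growth {b : ℝ} (hb : D.K < b) {x : V} (h : D.Growth b x) : x = 0 := by
  refine D.inj x fun σ hσ => norm_le_zero_iff.mp ?_
  obtain ⟨c, hc⟩ := h.bound
  have hlim : Tendsto (fun s => c * Real.exp (D.K * σ) * Real.exp ((b - D.K) * s)) atBot (𝓝 0) := by
    rw [← mul_zero (c * Real.exp (D.K * σ))]
    exact (Real.tendsto_exp_atBot.comp (tendsto_id.const_mul_atBot (by linarith))).const_mul _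
  refine ge_of_tendsto hlim ?_
  filter_upwards [hc, eventually_le_atBot σ] with s hs hsσ
  have hlt : ∀ y ∈ Icc s σ, y < D.σ₀ := fun y hy => by linarith [hy.2]
  have h := (norm_le_mul_exp (K := D.K) hsσ (fun y hy => D.hasDerivAt_real (hlt y hy) x)
    (fun y hy => (D.A y).le_of_opNorm_le (D.norm_A_le (by simpa using hlt y hy)) _)).1
  rw [Real.norm_eq_abs, Real.abs_exp] at hs
  calc _ ≤ c * Real.exp (b * s) * Real.exp (D.K * (σ - s)) := h.trans (by gcongr)
    _ = c * (Real.exp (b * s) * Real.exp (D.K * (σ - s))) := by ring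
    _ = c * (Real.exp (D.K * σ) * Real.exp ((b - D.K) * s)) := by
      rw [← Real.exp_add, ← Real.exp_add]; ring_nf
    _ = _ := by ring

variable [CompleteSpace V]

theorem isBigO_translate {a : ℝ} {x : V} (h : D.Growth a x) :
    (fun σ : ℝ => D.Φ (σ + D.ω * Complex.I) x -
      NormedSpace.exp ((D.ω * Complex.I) • D.R) (D.Φ σ x)) =O[atBot]
        fun σ => Real.exp ((a + 1) * σ) := by
  let _ : NormedAlgebra ℚ (V →L[ℂ] V) := NormedAlgebra.restrictScalars ℚ ℂ _
  obtain ⟨N, hN⟩ : ∃ N, ∀ s ∈ Icc 0 D.ω, ‖NormedSpace.exp ((s : ℂ) • (-(Complex.I • D.R)))‖ ≤ N := by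
    have hc : Continuous fun s : ℝ => NormedSpace.exp ((s : ℂ) • (-(Complex.I • D.R))) :=
      NormedSpace.exp_continuous.comp (by fun_prop)
    obtain ⟨N, hN⟩ := (isCompact_Icc (a := 0) (b := D.ω)).exists_bound_of_continuousOn hc.continuousOn
    exact ⟨N, hN⟩
  have N0 : 0 ≤ N := (norm_nonneg _).trans (hN 0 ⟨le_rfl, D.ω_nonneg⟩)
  set T := NormedSpace.exp ((D.ω * Complex.I) • D.R) with hT
  set N' := N * (D.C * Real.exp (D.K * D.ω)) * D.ω
  have C0 := D.C_nonneg
  have key : ∀ σ < D.σ₀, ‖D.Φ (σ + D.ω * Complex.I) x - T (D.Φ σ x)‖ ≤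
      ‖T‖ * N' * (Real.exp σ * ‖D.Φ σ x‖) := by
    intro σ hσ
    have hre : ∀ s : ℝ, ((σ : ℂ) + s * Complex.I).re < D.σ₀ := fun s => by simpa
    have hd : ∀ s : ℝ, HasDerivAt (fun s : ℝ => D.Φ (σ + s * Complex.I) x)
        (Complex.I • D.A (σ + s * Complex.I) (D.Φ (σ + s * Complex.I) x)) s := fun s => by
      have := (D.hasDerivAt_imag hσ x s (by simp)).scomp s (Complex.ofRealCLM.hasDerivAt (x := s))
      simpa [Function.comp_def] using this
    have hg : ∀ s ∈ Icc 0 D.ω, ‖D.Φ (σ + s * Complex.I) x‖ ≤ ‖D.Φ σ x‖ * Real.exp (D.K * D.ω) := by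
      intro s hs
      have h := (norm_le_mul_exp (K := D.K) hs.1 (fun y _ => hd y) (fun y _ => by
        rw [norm_smul, Complex.norm_I, one_mul]
        exact (D.A _).le_of_opNorm_le (D.norm_A_le (hre y)) _)).1
      simp only [Complex.ofReal_zero, zero_mul, add_zero, sub_zero] at h
      have K0 := D.K_nonneg
      exact h.trans (by gcongr; exact hs.2)
    set X : V →L[ℂ] V := -(Complex.I • D.R) with hX
    set y : ℝ → V := fun s => NormedSpace.exp ((s : ℂ) • X) (D.Φ (σ + s * Complex.I) x) with hy
    have hdy : ∀ s : ℝ, HasDerivAt y (NormedSpace.exp ((s : ℂ) • X)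
        (Complex.I • (D.A (σ + s * Complex.I) - D.R) (D.Φ (σ + s * Complex.I) x))) s := fun s => by
      have h1 := (hasDerivAt_exp_smul_const X (s : ℂ)).clm_apply (D.hasDerivAt_imag hσ x s (by simp))
      have h2 := h1.scomp s (Complex.ofRealCLM.hasDerivAt (x := s))
      simp only [Function.comp_def, Complex.ofRealCLM_apply, Complex.ofReal_one, one_smul] at h2
      refine h2.congr_deriv ?_
      rw [mul_apply_eq_comp, ← map_add]
      congr 1
      simp only [hX, neg_apply, smul_apply, sub_apply, smul_sub]
      abel
    have hmv := norm_image_sub_le_of_norm_deriv_le_segment' (a := 0) (b := D.ω)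
      (C := N * (D.C * Real.exp σ * (‖D.Φ σ x‖ * Real.exp (D.K * D.ω))))
      (fun s _ => (hdy s).hasDerivWithinAt) (fun s hs => by
        refine (ContinuousLinearMap.le_of_opNorm_le _ (hN s (Ico_subset_Icc_self hs)) _).trans ?_
        gcongr
        rw [norm_smul, Complex.norm_I, one_mul]
        refine (ContinuousLinearMap.le_opNorm _ _).trans ?_
        have := D.norm_sub_le _ (hre s)
        simp only [Complex.add_re, Complex.ofReal_re, Complex.mul_re, Complex.I_re, mul_zero,
          Complex.ofReal_im, Complex.I_im, mul_one, sub_self, add_zero] at this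
        have h3 := hg s (Ico_subset_Icc_self hs)
        gcongr) D.ω (right_mem_Icc.mpr D.ω_nonneg)
    have e0 : y 0 = D.Φ σ x := by simp [hy]
    have e1 : T (y D.ω) = D.Φ (σ + D.ω * Complex.I) x := by
      rw [hy, ← mul_apply_eq_comp, hT, ← NormedSpace.exp_add_of_commute]
      · rw [hX, smul_neg, smul_smul, add_neg_cancel, NormedSpace.exp_zero]; rfl
      · exact ((Commute.refl D.R).smul_right _).neg_right.smul_right _ |>.smul_left _
    rw [← e1, ← map_sub, ← e0]
    refine (T.le_opNorm _).trans ?_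
    rw [mul_assoc]
    gcongr
    refine hmv.trans (le_of_eq ?_)
    rw [e0]; ring
  have h1 : (fun σ : ℝ => Real.exp σ * ‖D.Φ σ x‖) =O[atBot] fun σ => Real.exp ((a + 1) * σ) := by
    refine ((isBigO_refl (fun σ : ℝ => Real.exp σ) atBot).mul h.norm_left).congr_right fun σ => ?_
    rw [← Real.exp_add]; ring_nf
  refine IsBigO.trans (IsBigO.of_bound (‖T‖ * N') ?_) h1
  filter_upwards [eventually_lt_atBot D.σ₀] with σ hσ
  refine (key σ hσ).trans (le_of_eq ?_)
  rw [Real.norm_of_nonneg (by positivity)]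

end LocalMonodromy

theorem commute_list_prod_map {𝔸 ι : Type*} [Monoid 𝔸] {f : ι → 𝔸} {x : 𝔸}
    (h : ∀ k, Commute x (f k)) (L : List ι) : Commute x (L.map f).prod :=
  Commute.list_prod_right _ _ fun y hy => by
    obtain ⟨k, -, rfl⟩ := List.mem_map.mp hy
    exact h k

theorem list_prod_map_mul {𝔸 ι : Type*} [Monoid 𝔸] {f g : ι → 𝔸}
    (h : ∀ k l, Commute (f k) (g l)) (L : List ι) :
    (L.map fun k => g k * f k).prod = (L.map g).prod * (L.map f).prod := by
  induction L with
  | nil => simp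
  | cons k L ih =>
    simp only [List.map_cons, List.prod_cons, ih]
    rw [mul_assoc, ← mul_assoc (f k), (commute_list_prod_map (h k) L).eq, mul_assoc, mul_assoc]

theorem list_prod_map_perm {𝔸 ι : Type*} [Monoid 𝔸] {f : ι → 𝔸} (h : ∀ k l, Commute (f k) (f l))
    {L L' : List ι} (hL : L.Perm L') : (L.map f).prod = (L'.map f).prod := by
  refine (hL.map f).prod_eq' ?_
  rw [List.pairwise_map]
  exact List.Pairwise.imp (R := fun _ _ => True) (fun _ => h _ _) (List.pairwise_of_forall fun _ _ => trivial)

namespace LocalMonodromy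

variable {V : Type*} [NormedAddCommGroup V] [NormedSpace ℂ V] {ι : Type*}
  (D : LocalMonodromy V ι)

/-- Joint generalized eigenvectors of the operators `r k`. -/
def Joint (χ : ι → ℂ) (x : V) : Prop := ∀ k, ∃ p : ℕ, ((D.r k - χ k • 1) ^ p) x = 0

theorem commute_r_sub_smul {k : ι} {c : ℂ} {X : V →L[ℂ] V} (h : Commute (D.r k) X) (p : ℕ) :
    Commute ((D.r k - c • 1) ^ p) X :=
  (h.sub_left ((Commute.one_left X).smul_left c)).pow_left p

variable {D}

theorem Joint.apply {χ : ι → ℂ} {x : V} (hx : D.Joint χ x) {X : V →L[ℂ] V}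
    (hX : ∀ k, Commute (D.r k) X) : D.Joint χ (X x) := fun k => by
  obtain ⟨p, hp⟩ := hx k
  refine ⟨p, ?_⟩
  have := congrArg (fun Y : V →L[ℂ] V => Y x) (D.commute_r_sub_smul (c := χ k) (hX k) p).eq
  simp only [mul_apply_eq_comp] at this
  rw [this, hp, map_zero]

theorem Joint.prod {χ : ι → ℂ} {x : V} (hx : D.Joint χ x) (L : List ι) :
    D.Joint χ ((L.map fun k => D.U - D.q k).prod x) :=
  hx.apply fun k => commute_list_prod_map (fun l => (D.r_U k).sub_right (D.r_q k l)) L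

theorem growth_descend {χ : ι → ℂ} {x : V} (hx : D.Joint χ x) {a b : ℝ} (ha : D.Growth a x)
    (hab : a ≤ b) (hb : b ≤ a + 1) (L : List ι) (hL : ∀ k ∈ L, b < (χ k).re ∨ (χ k).re < a)
    (h : (fun σ : ℝ => (L.map D.E).prod (D.Φ σ x)) =O[atBot] fun σ => Real.exp (b * σ)) :
    D.Growth b x := by
  induction L with
  | nil => exact h
  | cons k L ih =>
    refine ih (fun l hl => hL l (List.mem_cons_of_mem k hl)) ?_
    set W := (L.map D.E).prod with hW
    obtain ⟨p, hp⟩ := hx k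
    have hWr : Commute (D.r k) W := commute_list_prod_map (D.r_E k) L
    have hWR : Commute D.R W := commute_list_prod_map D.R_E L
    have hWR' : ∀ v, W (D.R v) = D.R (W v) := fun v =>
      (congrArg (fun Y : V →L[ℂ] V => Y v) hWR.eq).symm
    refine isBigO_of_unipotent (r := D.r k) (Z' := fun σ => W (D.A σ (D.Φ σ x))) hab
      (hL k List.mem_cons_self) p ?_ ?_ ((W.isBigO_comp _ _).trans ha) ?_
    · filter_upwards [eventually_lt_atBot D.σ₀] with σ hσ
      exact (W.restrictScalars ℝ).hasFDerivAt.comp_hasDerivAt σ (D.hasDerivAt_real hσ x)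
    · have h1 : (fun σ : ℝ => W ((D.A σ - D.R) (D.Φ σ x))) =O[atBot]
          fun σ => Real.exp (b * σ) := by
        refine (W.isBigO_comp _ _).trans (IsBigO.trans ?_ (isBigO_exp_of_le hb))
        have h2 : (fun σ : ℝ => (D.A σ - D.R) (D.Φ σ x)) =O[atBot]
            fun σ => Real.exp σ * ‖D.Φ σ x‖ := by
          refine IsBigO.of_bound D.C ?_
          filter_upwards [eventually_lt_atBot D.σ₀] with σ hσ
          rw [Real.norm_of_nonneg (by positivity), ← mul_assoc]
          exact ContinuousLinearMap.le_of_opNorm_le _ (D.norm_sub_le σ (by simpa)) _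
        refine h2.trans ?_
        refine ((isBigO_refl (fun σ : ℝ => Real.exp σ) atBot).mul
          (IsBigO.norm_left ha)).congr_right fun σ => ?_
        rw [← Real.exp_add]; ring_nf
      have h2 : (fun σ : ℝ => D.g k ((D.E k * W) (D.Φ σ x))) =O[atBot]
          fun σ => Real.exp (b * σ) := ((D.g k).isBigO_comp _ _).trans h
      refine (h1.add h2).congr_left fun σ => ?_
      have h3 : D.g k (D.E k (W (D.Φ σ x))) = D.R (W (D.Φ σ x)) - D.r k (W (D.Φ σ x)) := by
        rw [← sub_apply, D.R_sub_r]; rfl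
      rw [mul_apply_eq_comp, h3, sub_apply, map_sub, hWR']
      abel
    · filter_upwards [eventually_lt_atBot D.σ₀] with σ hσ
      have := congrArg (fun Y : V →L[ℂ] V => Y x)
        (D.commute_r_sub_smul (c := χ k) (hWr.mul_right (D.r_Φ k σ hσ)) p).eq
      simp only [mul_apply_eq_comp] at this
      rw [this, hp, map_zero, map_zero]

variable [CompleteSpace V]

theorem isBigO_apply_sub {a : ℝ} {x : V} (h : D.Growth a x) (k : ι) :
    (fun σ : ℝ => D.Φ σ ((D.U - D.q k) x) - (D.h k * D.E k) (D.Φ σ x)) =O[atBot]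
      fun σ => Real.exp ((a + 1) * σ) := by
  refine ((D.Θ.isBigO_comp _ _).trans (D.isBigO_translate h)).congr' ?_ EventuallyEq.rfl
  filter_upwards [eventually_lt_atBot D.σ₀] with σ hσ
  have h1 := congrArg (fun Y : V →L[ℂ] V => Y x) (D.monodromy σ hσ)
  have h2 := congrArg (fun Y : V →L[ℂ] V => Y x) (D.q_Φ k σ hσ).eq
  simp only [mul_apply_eq_comp] at h1 h2
  rw [← D.exp_sub_q, map_sub, h1, sub_apply, sub_apply, map_sub, mul_apply_eq_comp, h2]
  abel

theorem Growth.apply_sub {a : ℝ} {x : V} (h : D.Growth a x) (k : ι) :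
    D.Growth a ((D.U - D.q k) x) := by
  have h1 := (isBigO_apply_sub h k).trans (isBigO_exp_of_le (a := a) (by linarith))
  have h2 := ((D.h k * D.E k).isBigO_comp (fun σ : ℝ => D.Φ σ x) atBot).trans h
  exact (h1.add h2).congr_left fun σ => by abel

theorem Growth.prod {a : ℝ} {x : V} (h : D.Growth a x) (L : List ι) :
    D.Growth a ((L.map fun k => D.U - D.q k).prod x) := by
  induction L with
  | nil => exact h
  | cons k L ih => exact ih.apply_sub k

theorem isBigO_prod {a : ℝ} {x : V} (h : D.Growth a x) (L : List ι) :
    (fun σ : ℝ => D.Φ σ ((L.map fun k => D.U - D.q k).prod x) -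
      (L.map fun k => D.h k * D.E k).prod (D.Φ σ x)) =O[atBot]
        fun σ => Real.exp ((a + 1) * σ) := by
  induction L with
  | nil => simpa using isBigO_zero _ _
  | cons k L ih =>
    have h1 := isBigO_apply_sub (h.prod L) k
    have h2 := ((D.h k * D.E k).isBigO_comp _ _).trans ih
    refine (h1.add h2).congr_left fun σ => ?_
    simp only [List.map_cons, List.prod_cons, mul_apply_eq_comp, map_sub]
    abel

theorem growth_window [Finite ι] {χ : ι → ℂ} {x : V} (hx : D.Joint χ x) {L : List ι}
    (hL : (L.map D.E).prod = 0) {c : ℝ} (hc : ∀ b < c, D.Growth b x) (p : ι → Bool)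
    (hp : ∀ k, p k = false → (χ k).re < c ∨ c + 1 / 2 ≤ (χ k).re) {b : ℝ} (hb : b < c + 1 / 2) :
    D.Growth b (((L.filter p).map fun k => D.U - D.q k).prod x) := by
  obtain ⟨a, hac, ha, hχ⟩ : ∃ a < c, c - 1 / 2 < a ∧ ∀ k, (χ k).re < c → (χ k).re < a := by
    have h1 : ∀ᶠ a in 𝓝[<] c, a < c := eventually_mem_nhdsWithin
    have h2 : ∀ᶠ a in 𝓝[<] c, c - 1 / 2 < a :=
      (eventually_gt_nhds (by linarith)).filter_mono nhdsWithin_le_nhds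
    have h3 : ∀ᶠ a in 𝓝[<] c, ∀ k, (χ k).re < c → (χ k).re < a := eventually_all.mpr fun k => by
      by_cases h : (χ k).re < c
      · exact ((eventually_gt_nhds h).filter_mono nhdsWithin_le_nhds).mono fun _ h _ => h
      · exact .of_forall fun _ h' => absurd h' h
    exact (h1.and (h2.and h3)).exists
  have hcomm : ∀ k l, Commute (D.E k) (D.h l * D.E l) := fun k l =>
    (D.E_h k l).mul_right (D.E_E k l)
  set P := L.filter p
  set P' := L.filter fun k => !p k
  have hprod : (P'.map D.E).prod * (P.map fun k => D.h k * D.E k).prod = 0 := by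
    rw [list_prod_map_mul D.E_h, ← mul_assoc,
      ← (Commute.list_prod_right _ _ fun y hy => ?_ : Commute (P.map D.h).prod (P'.map D.E).prod).eq,
      mul_assoc, ← List.prod_append, ← List.map_append,
      list_prod_map_perm D.E_E (List.perm_append_comm.trans (List.filter_append_perm p L)), hL,
      mul_zero]
    obtain ⟨k, -, rfl⟩ := List.mem_map.mp hy
    exact (commute_list_prod_map (D.E_h k) P).symm
  have hg := hc a hac
  refine (growth_descend (b := max a b) (hx.prod P) (hg.prod P) (le_max_left _ _)
    (max_le (by linarith) (by linarith)) P' (fun k hk => ?_) ?_).mono (le_max_right _ _)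
  · have : p k = false := by simpa using (List.mem_filter.mp hk).2
    rcases hp k this with h | h
    · exact Or.inr (hχ k h)
    · exact Or.inl (lt_of_lt_of_le (max_lt (by linarith) hb) h)
  · have h1 := ((P'.map D.E).prod.isBigO_comp _ _).trans (isBigO_prod hg P)
    refine (h1.trans (isBigO_exp_of_le (max_le (by linarith) (by linarith)))).congr_left fun σ => ?_
    rw [map_sub, ← mul_apply_eq_comp (P'.map D.E).prod (P.map fun k => D.h k * D.E k).prod, hprod]
    simp

theorem prod_apply_eq_zero [Finite ι] {χ : ι → ℂ} {x : V} (hx : D.Joint χ x) {L : List ι}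
    (hL : (L.map D.E).prod = 0) : (L.map fun k => D.U - D.q k).prod x = 0 := by
  classical
  set c : ℕ → ℝ := fun j => -D.K + j / 2 with hc
  have key : ∀ j, ∀ b < c j, D.Growth b
      (((L.filter fun k => decide ((χ k).re < c j)).map fun k => D.U - D.q k).prod x) := by
    intro j
    induction j with
    | zero => exact fun b hb => D.growth_of_lt (by simpa [hc] using hb) _
    | succ j ih =>
      intro b hb
      have hcs : c (j + 1) = c j + 1 / 2 := by simp only [hc]; push_cast; ring
      have h := growth_window (hx.prod _) hL ih
        (fun k => decide (c j ≤ (χ k).re ∧ (χ k).re < c (j + 1))) (fun k hk => by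
          rw [decide_eq_false_iff_not, not_and_or, not_le, not_lt, hcs] at hk
          exact hk) (hcs ▸ hb)
      rw [← mul_apply_eq_comp, ← List.prod_append, ← List.map_append] at h
      rwa [list_prod_map_perm (L' := L.filter fun k => decide ((χ k).re < c (j + 1)))
        (fun k l => ((Commute.refl D.U).sub_right (D.q_U l).symm).sub_left
          ((D.q_U k).sub_right (D.q_q k l)))] at h
      have hperm := List.filter_append_perm (fun k => decide (c j ≤ (χ k).re))
        (L.filter fun k => decide ((χ k).re < c (j + 1)))
      refine List.Perm.trans (List.Perm.of_eq ?_) hperm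
      rw [List.filter_filter, List.filter_filter]
      congr 1
      · refine List.filter_congr fun k _ => ?_
        simp
      · refine List.filter_congr fun k _ => ?_
        by_cases h : c j ≤ (χ k).re
        · simp [h]
        · have : (χ k).re < c (j + 1) := by rw [hcs]; linarith [not_le.mp h]
          simp [h, this, not_le.mp h]
  obtain ⟨j, hj1, hj2⟩ : ∃ j, D.K < c j ∧ ∀ k, (χ k).re < c j := by
    have hlim : Tendsto c atTop atTop := tendsto_atTop_add_const_left _ _
      (tendsto_natCast_atTop_atTop.atTop_div_const (by norm_num))
    exact ((hlim.eventually_gt_atTop D.K).and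
      (eventually_all.mpr fun k => hlim.eventually_gt_atTop _)).exists
  obtain ⟨b, hb1, hb2⟩ := exists_between hj1
  have h := D.eq_zero_of_growth hb1 (key j b hb2)
  rwa [List.filter_eq_self.mpr fun k _ => by simpa using hj2 k] at h

/-- The annihilating polynomial of the residue exponentiates to one of the monodromy. -/
theorem prod_eq_zero [Finite ι] [FiniteDimensional ℂ V] (D : LocalMonodromy V ι) {L : List ι}
    (hL : (L.map D.E).prod = 0) : (L.map fun k => D.U - D.q k).prod = 0 := by
  set Q := (L.map fun k => D.U - D.q k).prod
  have h := Module.End.iSup_iInf_maxGenEigenspace_eq_top_of_iSup_maxGenEigenspace_eq_top_of_commute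
    (fun k => (D.r k : Module.End ℂ V)) (fun k l _ => by
      have := congrArg (fun Y : V →L[ℂ] V => (Y : V →ₗ[ℂ] V)) (D.r_r k l).eq
      exact this) (fun k => Module.End.iSup_maxGenEigenspace_eq_top _)
  have hle : (⊤ : Submodule ℂ V) ≤ LinearMap.ker (Q : V →ₗ[ℂ] V) := by
    rw [← h, iSup_le_iff]
    intro χ x hx
    rw [Submodule.mem_iInf] at hx
    refine LinearMap.mem_ker.mpr (prod_apply_eq_zero (χ := χ) (fun k => ?_) hL)
    obtain ⟨p, hp⟩ := Module.End.mem_maxGenEigenspace _ _ _ |>.mp (hx k)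
    refine ⟨p, ?_⟩
    have e : ∀ (Y : V →L[ℂ] V) (p : ℕ) (v : V), ((Y : V →ₗ[ℂ] V) ^ p) v = (Y ^ p) v := by
      intro Y p v
      induction p generalizing v with
      | zero => rfl
      | succ p ih => rw [pow_succ, pow_succ, Module.End.mul_apply, mul_apply_eq_comp, ← ih]; rfl
    rw [← e]
    exact hp
  ext x
  exact LinearMap.mem_ker.mp (hle Submodule.mem_top)

end LocalMonodromy

/-- The half plane of complex numbers with real part less than `σ₀`. -/
abbrev halfPlane (σ₀ : ℝ) : Set ℂ := {τ | τ.re < σ₀}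

theorem convex_halfPlane (σ₀ : ℝ) : Convex ℝ (halfPlane σ₀) :=
  convex_halfSpace_lt Complex.reLm.isLinear σ₀

theorem isOpen_halfPlane (σ₀ : ℝ) : IsOpen (halfPlane σ₀) :=
  isOpen_lt Complex.continuous_re continuous_const

instance (σ₀ : ℝ) : ContractibleSpace (halfPlane σ₀) :=
  (convex_halfPlane σ₀).contractibleSpace ⟨((σ₀ - 1 : ℝ) : ℂ), by simp⟩

/-- The number `c + s e^τ` does not vanish for `Re τ < σ₀`, by a margin if `c ≠ 0`. -/
def Apart (σ₀ : ℝ) (c s : ℂ) : Prop := (c = 0 ∧ s ≠ 0) ∨ ‖s‖ * Real.exp σ₀ < ‖c‖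

theorem sub_le_norm_add_exp {σ₀ : ℝ} (c s : ℂ) {τ : ℂ} (hτ : τ.re < σ₀) :
    ‖c‖ - ‖s‖ * Real.exp σ₀ ≤ ‖c + s * Complex.exp τ‖ := by
  have h1 := norm_sub_norm_le c (-(s * Complex.exp τ))
  rw [norm_neg, sub_neg_eq_add, norm_mul, Complex.norm_exp] at h1
  have : ‖s‖ * Real.exp τ.re ≤ ‖s‖ * Real.exp σ₀ := by gcongr
  linarith

theorem Apart.ne {σ₀ : ℝ} {c s : ℂ} (h : Apart σ₀ c s) {τ : ℂ} (hτ : τ.re < σ₀) :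
    c + s * Complex.exp τ ≠ 0 := by
  rcases h with ⟨rfl, h⟩ | h
  · simp [h]
  · have := sub_le_norm_add_exp c s hτ
    exact norm_pos_iff.mp (by linarith)

/-- The limit of `e^τ / (c + s e^τ)` as `Re τ → -∞`. -/
def limCoeff (c s : ℂ) : ℂ := if c = 0 then s⁻¹ else 0

theorem Apart.isBigO {σ₀ : ℝ} {c s : ℂ} (h : Apart σ₀ c s) :
    (fun τ : ℂ => Complex.exp τ * (c + s * Complex.exp τ)⁻¹ - limCoeff c s)
      =O[𝓟 (halfPlane σ₀)] fun τ => Real.exp τ.re := by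
  rcases h with ⟨rfl, h⟩ | h
  · refine (isBigO_zero _ _).congr_left fun τ => ?_
    rw [limCoeff, if_pos rfl, zero_add, mul_inv]
    field_simp
    simp
  · have hc : c ≠ 0 := norm_pos_iff.mp (lt_of_le_of_lt (by positivity) h)
    rw [limCoeff, if_neg hc, isBigO_principal]
    refine ⟨(‖c‖ - ‖s‖ * Real.exp σ₀)⁻¹, fun τ hτ => ?_⟩
    have h1 := sub_le_norm_add_exp c s hτ
    have h2 : 0 < ‖c‖ - ‖s‖ * Real.exp σ₀ := by linarith
    rw [sub_zero, norm_mul, Complex.norm_exp, norm_inv, Real.norm_eq_abs, Real.abs_exp, mul_comm]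
    gcongr

/-- A family of configurations `a j + s j e^τ`, for `Re τ < σ₀`. -/
structure Star {m : ℕ} (α : Fin m → ℂ) (n : ℕ) where
  a : Fin n → ℂ
  s : Fin n → ℂ
  σ₀ : ℝ
  pair : ∀ i j, i ≠ j → Apart σ₀ (a i - a j) (s i - s j)
  pole : ∀ i l, Apart σ₀ (a i - α l) (s i)

namespace Star

variable {n m : ℕ} {d : Fin m → ℕ} {α : Fin m → ℂ} (G : Star α n)

/-- The configuration with parameter `τ`. -/
def cfg (τ : ℂ) (j : Fin n) : ℂ := G.a j + G.s j * Complex.exp τ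

theorem hasDerivAt_cfg (τ : ℂ) : HasDerivAt G.cfg (fun j => G.s j * Complex.exp τ) τ :=
  hasDerivAt_pi.mpr fun j => ((Complex.hasDerivAt_exp τ).const_mul (G.s j)).const_add (G.a j)

theorem cfg_mem {τ : ℂ} (hτ : τ.re < G.σ₀) : G.cfg τ ∈ chartDomain α fun _ => false := by
  refine mem_chartDomain_finite.mpr ⟨fun i j e => ?_, fun i l e => ?_⟩
  · by_contra hij
    refine (G.pair i j hij).ne hτ ?_
    rw [← sub_eq_zero.mpr e]; simp only [cfg]; ring
  · refine (G.pole i l).ne hτ ?_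
    rw [← sub_eq_zero.mpr e]; simp only [cfg]; ring

/-- The family of configurations as a continuous map. -/
def map : C(halfPlane G.σ₀, Config α n) :=
  ⟨fun τ => ⟨chart (fun _ => false) (G.cfg τ), G.cfg_mem τ.2⟩, by
    refine Continuous.subtype_mk ((continuous_chart _).comp ?_) _
    unfold cfg
    fun_prop⟩

variable (d) in
/-- The coefficient of the equation along the family. -/
def coeff (τ : ℂ) : B n d :=
  ∑ i, (G.s i * Complex.exp τ) • kzCoeff d α (fun _ => false) (G.cfg τ) i

variable (d) in
/-- The residue of the equation along the family. -/
def res : B n d := ∑ i, G.s i • (B.data n d).comb i (fun l => limCoeff (G.a i - α l) (G.s i))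
  fun p => limCoeff (G.a i - G.a p) (G.s i - G.s p)

theorem isBigO_coeff_sub (M : Type*) [NormedAddCommGroup M] [NormedSpace ℂ M]
    [FiniteDimensional ℂ M] [Module (B n d) M] [IsScalarTower ℂ (B n d) M] :
    (fun τ => actL d M (G.coeff d τ) - actL d M (G.res d)) =O[𝓟 (halfPlane G.σ₀)]
      fun τ => Real.exp τ.re := by
  have hsmul : ∀ {f : ℂ → ℂ} (x : M →L[ℂ] M), f =O[𝓟 (halfPlane G.σ₀)] (fun τ => Real.exp τ.re) →
      (fun τ => f τ • x) =O[𝓟 (halfPlane G.σ₀)] fun τ => Real.exp τ.re := fun {f} x h =>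
    ((ContinuousLinearMap.toSpanSingleton ℂ x).isBigO_comp f _).trans h
  have h : (fun τ => ∑ i, G.s i • (∑ l, (Complex.exp τ * (G.a i - α l + G.s i * Complex.exp τ)⁻¹ -
        limCoeff (G.a i - α l) (G.s i)) • actL d M (B.Y d i l) -
      ∑ p ∈ Finset.univ.erase i, (Complex.exp τ *
        (G.a i - G.a p + (G.s i - G.s p) * Complex.exp τ)⁻¹ -
          limCoeff (G.a i - G.a p) (G.s i - G.s p)) • actL d M (B.nu n d * B.s d i p)))
      =O[𝓟 (halfPlane G.σ₀)] fun τ => Real.exp τ.re :=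
    IsBigO.fun_sum fun i _ => (((G.s i • ContinuousLinearMap.id ℂ (M →L[ℂ] M))).isBigO_comp _ _).trans ((IsBigO.fun_sum fun l _ =>
      hsmul _ (G.pole i l).isBigO).sub (IsBigO.fun_sum fun p hp =>
        hsmul _ (G.pair i p (Finset.ne_of_mem_erase hp).symm).isBigO))
  refine h.congr_left fun τ => ?_
  rw [coeff, res, map_sum, map_sum, ← Finset.sum_sub_distrib]
  refine Finset.sum_congr rfl fun i _ => ?_
  have e3 : ∀ a c, actL d M ((B.data n d).comb i a c) = ∑ k, a k • actL d M (B.Y d i k) -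
      ∑ p ∈ Finset.univ.erase i, c p • actL d M (B.nu n d * B.s d i p) := fun a c =>
    KZData.map_comb (B.data n d) (actL d M) i a c
  rw [map_smul, map_smul, mul_smul, ← smul_sub, kzCoeff_eq, e3, e3,
    smul_sub (Complex.exp τ), Finset.smul_sum, Finset.smul_sum]
  have e1 : ∀ l, dlogCoeff false (G.cfg τ i) (α l, 1) =
      (G.a i - α l + G.s i * Complex.exp τ)⁻¹ := fun l => by
    simp only [dlogCoeff, cfg, if_neg Bool.false_ne_true, mul_one, one_div]
    congr 1; ring
  have e2 : ∀ p, dlogCoeff false (G.cfg τ i) (homog false (G.cfg τ p)) =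
      (G.a i - G.a p + (G.s i - G.s p) * Complex.exp τ)⁻¹ := fun p => by
    simp only [dlogCoeff, cfg, homog, if_neg Bool.false_ne_true, mul_one, one_div]
    congr 1; ring
  simp only [e1, e2, sub_smul, Finset.sum_sub_distrib, smul_smul]
  congr 1
  abel

variable (d) (M : Type*) [AddCommGroup M] [Module ℂ M] [Module (B n d) M] [FiniteDimensional ℂ M]
  [IsScalarTower ℂ (B n d) M]

/-- Parallel transport along the family. -/
def trans (a b : halfPlane G.σ₀) : Module.End ℂ M := kzTransport d M
  ((Path.Homotopic.Quotient.mk (PathConnectedSpace.somePath a b)).map G.map)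

variable {d M}

theorem kzTransport_eq_trans {a b : halfPlane G.σ₀} (p : Path a b) {x y : Config α n}
    (q : Path x y) (h : ∀ t, q t = G.map (p t)) :
    kzTransport d M (Path.Homotopic.Quotient.mk q) = G.trans d M a b := by
  obtain rfl : x = G.map a := by simpa using h 0
  obtain rfl : y = G.map b := by simpa using h 1
  obtain rfl : q = p.map G.map.continuous := Path.ext (funext h)
  have e : Path.Homotopic.Quotient.mk p = Path.Homotopic.Quotient.mk
      (PathConnectedSpace.somePath a b) :=
    Path.Homotopic.Quotient.eq.mpr (SimplyConnectedSpace.paths_homotopic _ _)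
  rw [trans, ← e]
  rfl

theorem trans_trans (a b c : halfPlane G.σ₀) :
    G.trans d M b c * G.trans d M a b = G.trans d M a c := by
  rw [← G.kzTransport_eq_trans (d := d) (M := M) ((PathConnectedSpace.somePath a b).trans
    (PathConnectedSpace.somePath b c))
    (((PathConnectedSpace.somePath a b).map G.map.continuous).trans
      ((PathConnectedSpace.somePath b c).map G.map.continuous)) fun t => ?_,
    Path.Homotopic.Quotient.mk_trans, kzTransport_trans]
  · rfl
  · rw [← Path.map_trans]; rfl

theorem trans_self (a : halfPlane G.σ₀) : G.trans d M a a = 1 := by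
  rw [← G.kzTransport_eq_trans (d := d) (M := M) (Path.refl a) (Path.refl (G.map a)) fun t => rfl,
    Path.Homotopic.Quotient.mk_refl, kzTransport_refl]
  rfl

theorem trans_map {N : Type*} [AddCommGroup N] [Module ℂ N] [Module (B n d) N]
    [FiniteDimensional ℂ N] [IsScalarTower ℂ (B n d) N]
    (g : M →ₗ[ℂ] N) (hg : ∀ (b : B n d) (v : M), g (b • v) = b • g v) (a b : halfPlane G.σ₀) (v : M) :
    g (G.trans d M a b v) = G.trans d N a b (g v) := kzTransport_map g hg _ _

theorem add_mem {θ : ℂ} (hθ : θ.re = 0) (a : halfPlane G.σ₀) : (a + θ : ℂ) ∈ halfPlane G.σ₀ := by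
  rw [mem_ofPred_eq, Complex.add_re, hθ, add_zero]; exact a.2

theorem trans_add {σ : Equiv.Perm (Fin n)} {θ : ℂ} (hθ : θ.re = 0)
    (ha : ∀ j, G.a (σ⁻¹ j) = G.a j) (hs : ∀ j, G.s (σ⁻¹ j) = Complex.exp θ * G.s j)
    (a b : halfPlane G.σ₀) :
    G.trans d M ⟨a + θ, G.add_mem hθ a⟩ ⟨b + θ, G.add_mem hθ b⟩ *
      act M (B.perm d σ) = act M (B.perm d σ) * G.trans d M a b := by
  set p := PathConnectedSpace.somePath a b
  let sh : C(halfPlane G.σ₀, halfPlane G.σ₀) :=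
    ⟨fun τ => ⟨τ + θ, G.add_mem hθ τ⟩, by fun_prop⟩
  have h := G.kzTransport_eq_trans (d := d) (M := M) (p.map sh.continuous)
    (permPath σ (p.map G.map.continuous)) fun t => by
      apply Subtype.ext
      funext j
      change toSphere false (G.cfg (p t) (σ⁻¹ j)) = toSphere false (G.cfg (p t + θ) j)
      rw [cfg, cfg, ha, hs, Complex.exp_add]
      congr 1; ring
  ext v
  have h2 := kzTransport_perm (d := d) (M := M) σ (p.map G.map.continuous) v
  rw [h] at h2
  exact h2

theorem hasWeakDerivAt_trans (a τ : halfPlane G.σ₀) (v : M) {Φ : ℂ → M}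
    (hΦ : ∀ s (hs : s ∈ halfPlane G.σ₀), Φ s = G.trans d M a ⟨s, hs⟩ v) :
    HasWeakDerivAt Φ (G.coeff d τ • Φ τ) τ := by
  obtain ⟨V, F, ⟨F', hF', hFF⟩, hτ, hv⟩ : ∃ V F, (kzSystem d α M).sol V F ∧ G.map τ ∈ V ∧
      F (G.map τ) = Φ τ := by
    obtain ⟨F, hF, h⟩ := (kzSystem d α M).exists_sol (G.map τ) _ ((kzSystem d α M).mem_frame _) (Φ τ)
    exact ⟨_, F, hF, (kzSystem d α M).mem_frame _, h⟩
  have hVo : IsOpen V := (kzSystem d α M).isOpen ⟨F', hF', hFF⟩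
  have h1 := hF'.hasWeakDerivAt_curve (ε := fun _ => false) (c := G.cfg) (t := τ) ⟨_, hτ, rfl⟩ (G.hasDerivAt_cfg τ)
  have e0 : F' (chart (fun _ => false) (G.cfg τ)) = Φ τ := (hFF _ hτ).trans hv
  rw [e0] at h1
  have e1 : (∑ i, (G.s i * Complex.exp τ) • kzCoeff d α (fun _ => false) (G.cfg τ) i • Φ τ) =
      G.coeff d τ • Φ τ := by
    rw [coeff, Finset.sum_smul]
    exact Finset.sum_congr rfl fun i _ => (smul_assoc _ _ _).symm
  rw [e1] at h1
  refine h1.congr ?_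
  have hnear : ∃ r > 0, ∀ s : halfPlane G.σ₀, (s : ℂ) ∈ Metric.ball (τ : ℂ) r → G.map s ∈ V := by
    obtain ⟨r, hr, h⟩ := Metric.mem_nhds_iff.mp (G.map.continuous.continuousAt.preimage_mem_nhds
      (hVo.mem_nhds hτ))
    exact ⟨r, hr, fun s hs => h hs⟩
  obtain ⟨r, hr, hball⟩ := hnear
  filter_upwards [Metric.ball_mem_nhds (τ : ℂ) hr, (isOpen_halfPlane G.σ₀).mem_nhds τ.2] with s hs hsD
  have hseg : ∀ t : unitInterval, AffineMap.lineMap (τ : ℂ) s (t : ℝ) ∈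
      segment ℝ (τ : ℂ) s := fun t => by
    rw [segment_eq_image_lineMap]; exact ⟨t, t.2, rfl⟩
  let p : Path τ (⟨s, hsD⟩ : halfPlane G.σ₀) :=
    { toFun := fun t => ⟨AffineMap.lineMap (τ : ℂ) s (t : ℝ),
        (convex_halfPlane _).segment_subset τ.2 hsD (hseg t)⟩
      continuous_toFun := by
        refine Continuous.subtype_mk ?_ _
        simp only [AffineMap.lineMap_apply]
        fun_prop
      source' := by apply Subtype.ext; simp
      target' := by apply Subtype.ext; simp }
  have h2 := G.kzTransport_eq_trans (d := d) (M := M) p (p.map G.map.continuous) fun t => rfl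
  have h3 := (kzSystem d α M).transport_of_sol (p.map G.map.continuous) ⟨F', hF', hFF⟩ fun t =>
    hball _ ((convex_ball _ _).segment_subset (Metric.mem_ball_self hr) hs (hseg t))
  have h4 : F (G.map ⟨s, hsD⟩) = G.trans d M τ ⟨s, hsD⟩ (Φ τ) := by
    rw [← h2, ← hv]; exact h3.symm
  have h5 : F' (chart (fun _ => false) (G.cfg s)) = F (G.map ⟨s, hsD⟩) :=
    hFF (G.map ⟨s, hsD⟩) (hball ⟨s, hsD⟩ hs)
  change Φ s = _
  rw [h5, h4, hΦ s hsD, hΦ τ τ.2, ← Module.End.mul_apply, trans_trans]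

end Star

section ExpEnd

variable (M : Type*) [AddCommGroup M] [Module ℂ M] [FiniteDimensional ℂ M]

/-- A norm on a finite dimensional space. -/
abbrev finNorm : NormedAddCommGroup M :=
  NormedAddCommGroup.induced M _ (Module.finBasis ℂ M).equivFun (Module.finBasis ℂ M).equivFun.injective

/-- A norm on a finite dimensional space is compatible with the scalar multiplication. -/
abbrev finNormedSpace : @NormedSpace ℂ M _ (finNorm M).toSeminormedAddCommGroup :=
  letI := finNorm M
  NormedSpace.induced ℂ M _ (Module.finBasis ℂ M).equivFun

variable {M}

/-- The exponential of an endomorphism of a finite dimensional space. -/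
def expEnd (X : Module.End ℂ M) : Module.End ℂ M :=
  letI := finNorm M
  letI := finNormedSpace M
  (Module.End.toContinuousLinearMap M).symm (NormedSpace.exp (Module.End.toContinuousLinearMap M X))

theorem hasSum_expEnd (X : Module.End ℂ M) (φ : Module.Dual ℂ M) (v : M) :
    HasSum (fun r : ℕ => (r.factorial : ℂ)⁻¹ * φ ((X ^ r) v)) (φ (expEnd X v)) := by
  let _ := finNorm M
  let _ := finNormedSpace M
  have : CompleteSpace M := FiniteDimensional.complete ℂ M
  let κ := Module.End.toContinuousLinearMap (𝕜 := ℂ) M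
  have h := NormedSpace.exp_series_hasSum_exp' (𝕂 := ℂ) (κ X)
  let L : (M →L[ℂ] M) →L[ℂ] ℂ := (LinearMap.toContinuousLinearMap φ).comp
    (ContinuousLinearMap.apply ℂ M v)
  have h2 := L.hasSum h
  have e : ∀ r : ℕ, L ((r.factorial : ℂ)⁻¹ • κ X ^ r) = (r.factorial : ℂ)⁻¹ * φ ((X ^ r) v) :=
    fun r => by rw [map_smul, ← map_pow, smul_eq_mul]; rfl
  simp only [e] at h2
  exact h2

theorem expEnd_add {X Y : Module.End ℂ M} (h : Commute X Y) :
    expEnd (X + Y) = expEnd X * expEnd Y := by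
  let _ := finNorm M
  let _ := finNormedSpace M
  have : CompleteSpace M := FiniteDimensional.complete ℂ M
  let _ : NormedAlgebra ℚ (M →L[ℂ] M) := NormedAlgebra.restrictScalars ℚ ℂ _
  unfold expEnd
  rw [map_add, NormedSpace.exp_add_of_commute (h.map _), map_mul]

theorem expEnd_zero : expEnd (0 : Module.End ℂ M) = 1 := by
  let _ := finNorm M
  let _ := finNormedSpace M
  unfold expEnd
  rw [map_zero, NormedSpace.exp_zero, map_one]

theorem Commute.expEnd {Z X : Module.End ℂ M} (h : Commute Z X) : Commute Z (GDAHA.expEnd X) := by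
  let _ := finNorm M
  let _ := finNormedSpace M
  have := (h.map (Module.End.toContinuousLinearMap (𝕜 := ℂ) M)).exp_right.map
    (Module.End.toContinuousLinearMap (𝕜 := ℂ) M).symm
  rw [AlgEquiv.symm_apply_apply] at this
  exact this

theorem exists_expEnd_sub_expEnd {X Y : Module.End ℂ M} (hXY : Commute X Y) : ∃ h,
    expEnd X - expEnd Y = h * (X - Y) ∧ ∀ Z, Commute Z X → Commute Z Y → Commute Z h := by
  let _ := finNorm M
  let _ := finNormedSpace M
  have : CompleteSpace M := FiniteDimensional.complete ℂ M
  let κ := Module.End.toContinuousLinearMap (𝕜 := ℂ) M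
  obtain ⟨h, h1, h2⟩ := exists_exp_sub_exp (hXY.map κ)
  refine ⟨κ.symm h, ?_, fun Z hX hY => ?_⟩
  · have := congrArg κ.symm h1
    rw [map_sub, map_mul, map_sub, AlgEquiv.symm_apply_apply, AlgEquiv.symm_apply_apply] at this
    exact this
  · have := (h2 _ (hX.map κ) (hY.map κ)).map κ.symm
    rwa [AlgEquiv.symm_apply_apply] at this

end ExpEnd

namespace Star

variable {n m : ℕ} {d : Fin m → ℕ} {α : Fin m → ℂ} (G : Star α n)
  {M : Type*} [AddCommGroup M] [Module ℂ M] [Module (B n d) M] [FiniteDimensional ℂ M]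
  [IsScalarTower ℂ (B n d) M]

theorem commute_trans {g : Module.End ℂ M} (hg : ∀ b : B n d, Commute g (act M b))
    (a b : halfPlane G.σ₀) : Commute g (G.trans d M a b) :=
  LinearMap.ext fun v => G.trans_map g (fun b v => LinearMap.congr_fun (hg b).eq v) a b v

/-- The polynomial relation for the monodromy of a family of configurations. -/
theorem prod_monodromy_eq_zero {σ : Equiv.Perm (Fin n)} {ω : ℝ} (hω : 0 ≤ ω)
    (ha : ∀ j, G.a (σ⁻¹ j) = G.a j)
    (hs : ∀ j, G.s (σ⁻¹ j) = Complex.exp (ω * Complex.I) * G.s j)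
    {a b : halfPlane G.σ₀} (hab : (b : ℂ) = a + ω * Complex.I) {ι : Type*} [Finite ι] {L : List ι}
    (r q h g E : ι → Module.End ℂ M) (hr : ∀ k x, Commute (r k) (act M (x : B n d)))
    (hq : ∀ k x, Commute (q k) (act M (x : B n d))) (r_r : ∀ k l, Commute (r k) (r l))
    (r_q : ∀ k l, Commute (r k) (q l)) (q_q : ∀ k l, Commute (q k) (q l))
    (res_sub : ∀ k, act M (G.res d) - r k = g k * E k)
    (exp_sub : ∀ k, act M (B.perm d σ⁻¹) * expEnd ((ω * Complex.I) • act M (G.res d)) - q k =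
      h k * E k)
    (E_E : ∀ k l, Commute (E k) (E l)) (E_h : ∀ k l, Commute (E k) (h l))
    (res_E : ∀ k, Commute (act M (G.res d)) (E k)) (r_E : ∀ k l, Commute (r k) (E l))
    (hL : (L.map E).prod = 0) :
    (L.map fun k => act M (B.perm d σ⁻¹) * G.trans d M a b - q k).prod = 0 := by
  let _ := finNorm M
  let _ := finNormedSpace M
  have : CompleteSpace M := FiniteDimensional.complete ℂ M
  let κ := Module.End.toContinuousLinearMap (𝕜 := ℂ) M
  obtain ⟨C, hC⟩ := isBigO_principal.mp (G.isBigO_coeff_sub (d := d) M)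
  set U : Module.End ℂ M := act M (B.perm d σ⁻¹) * G.trans d M a b with hU
  classical
  let Φ : ℂ → Module.End ℂ M := fun τ =>
    if h : τ ∈ halfPlane G.σ₀ then G.trans d M a ⟨τ, h⟩ else 0
  have hΦ : ∀ τ (h : τ ∈ halfPlane G.σ₀), Φ τ = G.trans d M a ⟨τ, h⟩ := fun τ h => dif_pos h
  have comm : ∀ {f : Module.End ℂ M}, (∀ x : B n d, Commute f (act M x)) →
      Commute f U ∧ ∀ τ ∈ halfPlane G.σ₀, Commute f (Φ τ) := fun hf =>
    ⟨(hf _).mul_right (G.commute_trans hf a b), fun τ hτ => hΦ τ hτ ▸ G.commute_trans hf _ _⟩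
  have hre : ∀ τ : ℝ, τ < G.σ₀ → (τ : ℂ) ∈ halfPlane G.σ₀ := fun τ hτ => by simpa using hτ
  let D : LocalMonodromy M ι :=
    { R := κ (act M (G.res d))
      Θ := κ (act M (B.perm d σ⁻¹))
      U := κ U
      A := fun τ => κ (act M (G.coeff d τ))
      Φ := fun τ => κ (Φ τ)
      r := fun k => κ (r k)
      q := fun k => κ (q k)
      h := fun k => κ (h k)
      g := fun k => κ (g k)
      E := fun k => κ (E k)
      σ₀ := G.σ₀
      ω := ω
      C := C
      ω_nonneg := hω
      norm_sub_le := fun τ hτ => by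
        have := hC τ hτ
        rwa [Real.norm_eq_abs, Real.abs_exp] at this
      deriv := fun τ hτ x => by
        refine hasWeakDerivAt_iff.mp ?_
        exact G.hasWeakDerivAt_trans a ⟨τ, hτ⟩ x (Φ := fun s => Φ s x)
          fun s hs => by rw [hΦ s hs]
      monodromy := fun τ hτ => by
        rw [← map_mul, ← map_mul]
        congr 1
        have hI : (ω * Complex.I).re = 0 := by simp
        rw [hΦ _ (hre τ hτ), hΦ _ (G.add_mem hI ⟨τ, hre τ hτ⟩), hU]
        have hb : b = ⟨a + ω * Complex.I, G.add_mem hI a⟩ := Subtype.ext hab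
        have h1 := G.trans_add (d := d) (M := M) hI ha hs a ⟨τ, hre τ hτ⟩
        have h2 : act M (B.perm d σ⁻¹) * act M (B.perm d σ) = 1 := LinearMap.ext fun v => by
          rw [Module.End.mul_apply, act_apply, act_apply, ← mul_smul, B.perm_inv_mul, one_smul]; rfl
        have h3 : act M (B.perm d σ) * act M (B.perm d σ⁻¹) = 1 := LinearMap.ext fun v => by
          rw [Module.End.mul_apply, act_apply, act_apply, ← mul_smul, B.perm_mul_inv, one_smul]; rfl
        rw [← hb] at h1
        rw [← G.trans_trans a b, ← mul_assoc, ← mul_assoc]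
        congr 1
        calc _ = act M (B.perm d σ⁻¹) * (G.trans d M b _ * act M (B.perm d σ)) *
              act M (B.perm d σ⁻¹) := by rw [mul_assoc, mul_assoc (G.trans d M b _), h3, mul_one]
          _ = _ := by rw [h1, ← mul_assoc, h2, one_mul]
      inj := fun x hx => by
        have hlt : G.σ₀ - 1 < G.σ₀ := by linarith
        have h := hx _ hlt
        change Φ ((G.σ₀ - 1 : ℝ) : ℂ) x = 0 at h
        rw [hΦ _ (hre _ hlt)] at h
        have h2 := LinearMap.congr_fun ((G.trans_trans (d := d) (M := M) a
          ⟨((G.σ₀ - 1 : ℝ) : ℂ), hre _ hlt⟩ a).trans (G.trans_self a)) x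
        rw [Module.End.mul_apply, h, map_zero] at h2
        exact h2.symm
      R_sub_r := fun k => by rw [← map_sub, res_sub, map_mul]
      exp_sub_q := fun k => by
        rw [← map_mul, ← exp_sub, map_sub, map_mul, ← map_smul]
        congr 2
      E_E := fun k l => (E_E k l).map κ
      E_h := fun k l => (E_h k l).map κ
      R_E := fun k => (res_E k).map κ
      r_E := fun k l => (r_E k l).map κ
      r_Φ := fun k τ hτ => ((comm (hr k)).2 τ (hre τ hτ)).map κ
      r_r := fun k l => (r_r k l).map κ
      r_q := fun k l => (r_q k l).map κ
      r_U := fun k => (comm (hr k)).1.map κ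
      q_q := fun k l => (q_q k l).map κ
      q_U := fun k => (comm (hq k)).1.map κ
      q_Φ := fun k τ hτ => ((comm (hq k)).2 τ (hre τ hτ)).map κ }
  have hprod : ∀ f : ι → Module.End ℂ M, κ (L.map f).prod = (L.map fun k => κ (f k)).prod := fun f => by
    rw [map_list_prod, List.map_map]; rfl
  refine κ.injective ?_
  rw [hprod, map_zero]
  have := D.prod_eq_zero (L := L) (by rw [← map_zero κ, ← hL, hprod])
  simpa only [map_sub] using this

end Star

theorem two_smul_mul_expEnd {M : Type*} [AddCommGroup M] [Module ℂ M] [FiniteDimensional ℂ M]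
    {X S : Module.End ℂ M} (hS : S * S = 1) (h : Commute X S) :
    S * (2 • expEnd (-(X * S))) = expEnd (-X) * (1 + S) - expEnd X * (1 - S) := by
  have hc : Commute S (expEnd X) := Commute.expEnd h.symm
  have hc' : Commute S (expEnd (-X)) := Commute.expEnd h.symm.neg_right
  have h1 : Commute (-(X * S)) X := ((Commute.refl X).mul_left h.symm).neg_left
  obtain ⟨f, hf, -⟩ := exists_expEnd_sub_expEnd h1.neg_right
  obtain ⟨g, hg, -⟩ := exists_expEnd_sub_expEnd h1
  have e1 : (expEnd (-(X * S)) - expEnd (-X)) * (1 + S) = 0 := by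
    rw [hf]
    have : (-(X * S) - -X) * (1 + S) = 0 := by
      have : (-(X * S) - -X) * (1 + S) = X * (1 - S * S) := by noncomm_ring
      rw [this, hS, sub_self, mul_zero]
    rw [mul_assoc, this, mul_zero]
  have e2 : (expEnd (-(X * S)) - expEnd X) * (1 - S) = 0 := by
    rw [hg]
    have : (-(X * S) - X) * (1 - S) = 0 := by
      have : (-(X * S) - X) * (1 - S) = X * (S * S - 1) := by noncomm_ring
      rw [this, hS, sub_self, mul_zero]
    rw [mul_assoc, this, mul_zero]
  have e3 : 2 • expEnd (-(X * S)) = expEnd (-X) * (1 + S) + expEnd X * (1 - S) := by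
    have : 2 • expEnd (-(X * S)) = (expEnd (-(X * S)) - expEnd (-X)) * (1 + S) +
        (expEnd (-(X * S)) - expEnd X) * (1 - S) +
        (expEnd (-X) * (1 + S) + expEnd X * (1 - S)) := by noncomm_ring
    rw [this, e1, e2, add_zero, zero_add]
  have a1 : S * (1 + S) = 1 + S := by rw [mul_add, hS, mul_one, add_comm]
  have a2 : S * (1 - S) = -(1 - S) := by rw [mul_sub, hS, mul_one, neg_sub]
  rw [e3, mul_add, ← mul_assoc, ← mul_assoc, hc.eq, hc'.eq, mul_assoc, mul_assoc, a1, a2, mul_neg,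
    ← sub_eq_add_neg]

section

variable {n m : ℕ} {d : Fin m → ℕ} {M : Type*} [AddCommGroup M] [Module ℂ M]
  [Module (B n d) M] [IsScalarTower ℂ (B n d) M]

theorem act_mul (a b : B n d) : act M (a * b) = act M a * act M b :=
  LinearMap.ext fun v => mul_smul a b v

theorem act_neg (a : B n d) : act M (-a) = -act M a := LinearMap.ext fun v => neg_smul a v

theorem act_one : act M (1 : B n d) = 1 := LinearMap.ext fun v => one_smul _ v

theorem commute_act {a : B n d} (h : ∀ b, a * b = b * a) (b : B n d) :
    Commute (act M a) (act M b) := by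
  rw [Commute, SemiconjBy, ← act_mul, ← act_mul, h]

end

/-- A family of configurations with a prescribed configuration in the interior of its domain. -/
theorem exists_star {n m : ℕ} {α : Fin m → ℂ} (a s : Fin n → ℂ) {r : ℝ} (hr : 0 < r)
    (h : ∀ i j, i ≠ j → (a i = a j ∧ s i ≠ s j) ∨ ‖s i - s j‖ * r < ‖a i - a j‖)
    (h' : ∀ i l, (a i = α l ∧ s i ≠ 0) ∨ ‖s i‖ * r < ‖a i - α l‖) :
    ∃ G : Star α n, G.a = a ∧ G.s = s ∧ Real.log r < G.σ₀ := by
  have key : ∀ c s : ℂ, (c = 0 ∧ s ≠ 0) ∨ ‖s‖ * r < ‖c‖ →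
      ∀ᶠ σ in 𝓝[>] Real.log r, Apart σ c s := fun c s h => by
    rcases h with h | h
    · exact .of_forall fun _ => .inl h
    · have : Tendsto (fun σ => ‖s‖ * Real.exp σ) (𝓝 (Real.log r)) (𝓝 (‖s‖ * r)) := by
        have h2 : Continuous fun σ => ‖s‖ * Real.exp σ := by fun_prop
        simpa [Real.exp_log hr] using h2.tendsto (Real.log r)
      filter_upwards [(this.mono_left nhdsWithin_le_nhds).eventually_lt_const h] with σ hσ
      exact .inr hσ
  have h1 : ∀ᶠ σ in 𝓝[>] Real.log r, ∀ i j, i ≠ j → Apart σ (a i - a j) (s i - s j) := by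
    refine eventually_all.mpr fun i => eventually_all.mpr fun j => ?_
    by_cases hij : i = j
    · exact .of_forall fun _ h => absurd hij h
    · filter_upwards [key (a i - a j) (s i - s j)
        (by rw [sub_eq_zero, sub_ne_zero]; exact h i j hij)] with σ hσ _ using hσ
  have h2 : ∀ᶠ σ in 𝓝[>] Real.log r, ∀ i l, Apart σ (a i - α l) (s i) :=
    eventually_all.mpr fun i => eventually_all.mpr fun l =>
      key _ _ (by rw [sub_eq_zero]; exact h' i l)
  obtain ⟨σ, ⟨h1, h2⟩, h3⟩ := ((h1.and h2).and self_mem_nhdsWithin).exists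
  exact ⟨⟨a, s, σ, h1, h2⟩, rfl, rfl, h3⟩

namespace KZData

variable {R : Type*} [Ring R] [Algebra ℂ R] {n m : ℕ} (D : KZData R n m) (t : Fin n → ℂ)
  (a : Fin n → Fin m → ℂ) (c : Fin n → Fin n → ℂ)

theorem sum_smul_comb : ∑ i, t i • D.comb i (a i) (c i) =
    ∑ i, ∑ k, (t i * a i k) • D.Y i k -
      ∑ i, ∑ p ∈ Finset.univ.erase i, (t i * c i p) • (D.nu * D.s i p) := by
  simp only [comb, smul_sub, Finset.smul_sum, smul_smul, Finset.sum_sub_distrib]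

theorem sum_smul_comb_swap {i j : Fin n} (hij : i ≠ j) (hY : ∀ p k, t p * a p k = 0)
    (hc : ∀ p q, p ≠ q → t p * c p q = if (p = i ∧ q = j) ∨ (p = j ∧ q = i) then 1 / 2 else 0) :
    ∑ i, t i • D.comb i (a i) (c i) = -(D.nu * D.s i j) := by
  rw [sum_smul_comb]
  simp only [hY, zero_smul, Finset.sum_const_zero, zero_sub, neg_inj]
  have e : ∀ p, ∑ q ∈ Finset.univ.erase p, (t p * c p q) • (D.nu * D.s p q) =
      (if p = i then (1 / 2 : ℂ) • (D.nu * D.s i j) else 0) +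
        if p = j then (1 / 2 : ℂ) • (D.nu * D.s i j) else 0 := fun p => by
    rw [Finset.sum_congr rfl fun q hq => by rw [hc p q (Finset.ne_of_mem_erase hq).symm]]
    by_cases hi : p = i
    · subst hi
      rw [if_pos rfl, if_neg hij, add_zero, Finset.sum_eq_single_of_mem j (by simp [hij.symm])]
      · rw [if_pos (by simp)]
      · intro q _ hq
        rw [if_neg (by simp [hq, hij]), zero_smul]
    · by_cases hj : p = j
      · subst hj
        rw [if_neg hi, if_pos rfl, zero_add, Finset.sum_eq_single_of_mem i (by simp [hij]), s_comm]
        · rw [if_pos (by simp)]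
        · intro q _ hq
          rw [if_neg (by simp [hq, hi]), zero_smul]
      · rw [if_neg hi, if_neg hj, add_zero]
        exact Finset.sum_eq_zero fun q _ => by rw [if_neg (by simp [hi, hj]), zero_smul]
  simp only [e, Finset.sum_add_distrib, Finset.sum_ite_eq', Finset.mem_univ, if_true]
  rw [← add_smul]
  norm_num

theorem sum_smul_comb_single {i : Fin n} {l : Fin m}
    (hY : ∀ p k, t p * a p k = if p = i ∧ k = l then 1 else 0)
    (hc : ∀ p q, p ≠ q → t p * c p q = 0) : ∑ i, t i • D.comb i (a i) (c i) = D.Y i l := by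
  rw [sum_smul_comb, Finset.sum_eq_zero (f := fun i => ∑ p ∈ Finset.univ.erase i, _) fun p _ =>
    Finset.sum_eq_zero fun q hq => by rw [hc p q (Finset.ne_of_mem_erase hq).symm, zero_smul],
    sub_zero, Finset.sum_eq_single_of_mem i (Finset.mem_univ _),
    Finset.sum_eq_single_of_mem l (Finset.mem_univ _), hY, if_pos ⟨rfl, rfl⟩, one_smul]
  · intro k _ hk
    rw [hY, if_neg (by simp [hk]), zero_smul]
  · intro p _ hp
    exact Finset.sum_eq_zero fun k _ => by rw [hY, if_neg (by simp [hp]), zero_smul]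

end KZData

namespace RealPosition

variable {n m : ℕ} {d : Fin m → ℕ} (P : RealPosition n m) (i : Fin n)

/-- The centres of the half circles described by the points number `i` and `i + 1`. -/
def midpoint (j : Fin (n + 1)) : ℂ :=
  if j = i.castSucc ∨ j = i.succ then ((P.z i.castSucc + P.z i.succ) / 2 : ℝ) else P.z j

/-- The directions of the points number `i` and `i + 1`, seen from the midpoint. -/
def direction (i : Fin n) (j : Fin (n + 1)) : ℂ :=
  if j = i.castSucc then -1 else if j = i.succ then 1 else 0

theorem exchange_eq (t : ℝ) (j : Fin (n + 1)) :
    P.exchange i t j = P.midpoint i j + direction i j *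
      (((P.z i.succ - P.z i.castSucc) / 2 : ℝ) * Complex.exp ((Real.pi * t : ℝ) * Complex.I)) := by
  have hne := succ_ne_castSucc i
  simp only [exchange, midpoint, direction, halfTurn]
  split_ifs with h1 h2 h3 h3 h3
  all_goals first | tauto | (push_cast; ring)

theorem lt_abs_midpoint_sub {j : Fin (n + 1)} (h1 : j ≠ i.castSucc) (h2 : j ≠ i.succ) :
    (P.z i.succ - P.z i.castSucc) / 2 < |(P.z i.castSucc + P.z i.succ) / 2 - P.z j| := by
  rcases lt_or_gt_of_ne h1 with h | h
  · have := P.z_mono h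
    exact lt_of_lt_of_le (by linarith) (le_abs_self _)
  · have h3 : i.succ < j := by
      simp only [Fin.lt_def, Ne, Fin.ext_iff, Fin.val_castSucc, Fin.val_succ] at h h2 ⊢; omega
    have := P.z_mono h3
    exact lt_of_lt_of_le (by linarith) (neg_le_abs _)

theorem midpoint_ne {j : Fin (n + 1)} (h1 : j ≠ i.castSucc) (h2 : j ≠ i.succ) :
    (P.z i.castSucc + P.z i.succ) / 2 - P.z j ≠ 0 := fun e => by
  have := P.lt_abs_midpoint_sub i h1 h2
  rw [e, abs_zero] at this
  linarith [P.z_castSucc_lt i]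

theorem exists_star_swap : ∃ G : Star P.cα (n + 1), G.a = P.midpoint i ∧ G.s = direction i ∧
    Real.log ((P.z i.succ - P.z i.castSucc) / 2) < G.σ₀ := by
  have hlt := P.z_castSucc_lt i
  have hne := succ_ne_castSucc i
  have sep := fun j => P.lt_abs_midpoint_sub i (j := j)
  have nrm : ∀ x y : ℝ, ‖(x : ℂ) - y‖ = |x - y| := fun x y => by
    rw [← Complex.ofReal_sub, Complex.norm_real, Real.norm_eq_abs]
  refine exists_star _ _ (by linarith) (fun p q hpq => ?_) fun p l => .inr ?_
  · by_cases hp : p = i.castSucc ∨ p = i.succ <;> by_cases hq : q = i.castSucc ∨ q = i.succ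
    · refine .inl ⟨by rw [midpoint, midpoint, if_pos hp, if_pos hq], ?_⟩
      rcases hp with rfl | rfl <;> rcases hq with rfl | rfl
      · exact absurd rfl hpq
      · simp [direction, hne]; norm_num
      · simp [direction, hne]; norm_num
      · exact absurd rfl hpq
    · right
      rw [midpoint, midpoint, if_pos hp, if_neg hq, nrm]
      obtain ⟨h1, h2⟩ := not_or.mp hq
      have : ‖direction i p - direction i q‖ = 1 := by
        rcases hp with rfl | rfl <;> simp [direction, h1, h2, hne]
      rw [this, one_mul]
      exact sep q h1 h2
    · right
      rw [midpoint, midpoint, if_neg hp, if_pos hq, nrm, abs_sub_comm]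
      obtain ⟨h1, h2⟩ := not_or.mp hp
      have : ‖direction i p - direction i q‖ = 1 := by
        rcases hq with rfl | rfl <;> simp [direction, h1, h2, hne]
      rw [this, one_mul]
      exact sep p h1 h2
    · right
      obtain ⟨h1, h2⟩ := not_or.mp hp
      obtain ⟨h3, h4⟩ := not_or.mp hq
      rw [midpoint, midpoint, if_neg hp, if_neg hq, nrm]
      simpa [direction, h1, h2, h3, h4, sub_eq_zero] using fun e => hpq (P.z_mono.injective e)
  · by_cases hp : p = i.castSucc ∨ p = i.succ
    · have : ‖direction i p‖ = 1 := by rcases hp with rfl | rfl <;> simp [direction, hne]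
      rw [midpoint, if_pos hp, this, one_mul, cα, nrm]
      have := P.lt l i.castSucc
      exact lt_of_lt_of_le (by linarith) (le_abs_self _)
    · obtain ⟨h1, h2⟩ := not_or.mp hp
      rw [midpoint, if_neg hp, cα, nrm]
      simpa [direction, h1, h2, sub_eq_zero] using (P.lt l p).ne'

theorem res_swap {G : Star P.cα (n + 1)} (ha : G.a = P.midpoint i) (hs : G.s = direction i) :
    G.res d = -(B.nu (n + 1) d * B.s d i.castSucc i.succ) := by
  have hlt := P.z_castSucc_lt i
  have hne := succ_ne_castSucc i
  have hY : ∀ p l, G.s p * limCoeff (G.a p - P.cα l) (G.s p) = 0 := fun p l => by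
    by_cases hp : G.s p = 0
    · rw [hp, zero_mul]
    · have hp' : p = i.castSucc ∨ p = i.succ := by
        by_contra h
        obtain ⟨h1, h2⟩ := not_or.mp h
        rw [hs] at hp
        simp [direction, h1, h2] at hp
      rw [limCoeff, if_neg, mul_zero]
      rw [ha, midpoint, if_pos hp', cα, ← Complex.ofReal_sub]
      have := P.lt l i.castSucc
      have h : (P.z i.castSucc + P.z i.succ) / 2 - P.α l ≠ 0 := by linarith
      exact Complex.ofReal_ne_zero.mpr h
  refine KZData.sum_smul_comb_swap (B.data (n + 1) d) _ _ _ hne.symm hY fun p q hpq => ?_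
  by_cases hp : p = i.castSucc ∨ p = i.succ <;> by_cases hq : q = i.castSucc ∨ q = i.succ
  · have e : G.a p - G.a q = 0 := by rw [ha, midpoint, midpoint, if_pos hp, if_pos hq, sub_self]
    rw [e, limCoeff, if_pos rfl, hs]
    rcases hp with rfl | rfl <;> rcases hq with rfl | rfl
    · exact absurd rfl hpq
    · simp [direction, hne]; norm_num
    · simp [direction, hne]; norm_num
    · exact absurd rfl hpq
  · obtain ⟨h1, h2⟩ := not_or.mp hq
    have e : G.a p - G.a q ≠ 0 := by
      rw [ha, midpoint, midpoint, if_pos hp, if_neg hq, ← Complex.ofReal_sub, Complex.ofReal_ne_zero]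
      exact P.midpoint_ne i h1 h2
    rw [limCoeff, if_neg e, mul_zero, if_neg (by tauto)]
  · obtain ⟨h1, h2⟩ := not_or.mp hp
    have e : G.s p = 0 := by simp [hs, direction, h1, h2]
    rw [e, zero_mul, if_neg (by tauto)]
  · obtain ⟨h1, h2⟩ := not_or.mp hp
    have e : G.s p = 0 := by simp [hs, direction, h1, h2]
    rw [e, zero_mul, if_neg (by tauto)]

variable (M : Type*) [AddCommGroup M] [Module ℂ M]
  [Module (B (n + 1) d) M] [FiniteDimensional ℂ M] [IsScalarTower ℂ (B (n + 1) d) M]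

theorem kzTransport_pathT_eq_trans {G : Star P.cα (n + 1)} (ha : G.a = P.midpoint i)
    (hs : G.s = direction i) {a b : halfPlane G.σ₀}
    (hra : (a : ℂ) = (Real.log ((P.z i.succ - P.z i.castSucc) / 2) : ℝ))
    (hab : (b : ℂ) = a + Real.pi * Complex.I) :
    kzTransport d M (Path.Homotopic.Quotient.mk (P.pathT i)) = G.trans d M a b := by
  have hlt := P.z_castSucc_lt i
  let p : Path a b :=
    { toFun := fun t => ⟨a + (Real.pi * t : ℝ) * Complex.I, G.add_mem (by simp) a⟩
      continuous_toFun := by fun_prop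
      source' := by apply Subtype.ext; simp
      target' := by apply Subtype.ext; simp [hab] }
  refine G.kzTransport_eq_trans p _ fun t => Subtype.ext (funext fun j => ?_)
  change ((P.exchange i t j : ℂ) : OnePoint ℂ) = ((G.cfg (a + (Real.pi * t : ℝ) * Complex.I) j : ℂ) :
    OnePoint ℂ)
  rw [exchange_eq, Star.cfg, ha, hs, Complex.exp_add, hra, ← Complex.ofReal_exp,
    Real.exp_log (by linarith)]

/-- The Hecke relation. -/
theorem opT_hecke : (opT d P i M - expEnd (-(Real.pi * Complex.I) • act M (B.nu (n + 1) d))) *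
    (opT d P i M + expEnd ((Real.pi * Complex.I) • act M (B.nu (n + 1) d))) = 0 := by
  obtain ⟨G, ha, hs, hσ⟩ := P.exists_star_swap i
  have hne := succ_ne_castSucc i
  set τ : halfPlane G.σ₀ := ⟨(Real.log ((P.z i.succ - P.z i.castSucc) / 2) : ℝ), by simpa using hσ⟩
  set τ' : halfPlane G.σ₀ := ⟨τ + Real.pi * Complex.I, G.add_mem (by simp) τ⟩
  set σ := Equiv.swap i.castSucc i.succ with hσ'
  have hT : opT d P i M = act M (B.perm d σ⁻¹) * G.trans d M τ τ' := by
    rw [← P.kzTransport_pathT_eq_trans i M ha hs rfl rfl, opT, braidT, kzOp_braidClass, kzLoop]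
    rfl
  set N := act M (B.nu (n + 1) d) with hN
  set S := act M (B.s d i.castSucc i.succ) with hS
  set X := (Real.pi * Complex.I) • N with hX
  have hSσ : act M (B.perm d σ⁻¹) = S := by rw [hσ', Equiv.swap_inv]; rfl
  have hSS : S * S = 1 := by rw [hS, ← act_mul, B.s_mul_s, act_one]
  have hNc : ∀ x, Commute N (act M x) := commute_act B.nu_comm
  have hXc : ∀ x, Commute X (act M x) := fun x => (hNc x).smul_left _
  have hres : act M (G.res d) = -(N * S) := by rw [P.res_swap i ha hs, act_neg, act_mul]
  have hE := two_smul_mul_expEnd hSS (hXc _)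
  have hsm : (Real.pi * Complex.I) • act M (G.res d) = -(X * S) := by
    rw [hres, smul_neg, hX, smul_mul_assoc]
  have comm : ∀ {Z}, Commute Z X → Commute Z (expEnd (-X)) ∧ Commute Z (expEnd X) := fun h =>
    ⟨Commute.expEnd h.neg_right, Commute.expEnd h⟩
  have hNX : Commute N X := (Commute.refl N).smul_right _
  have hXS : Commute X S := hXc _
  set r : Bool → Module.End ℂ M := fun k => if k then -N else N with hr
  set q : Bool → Module.End ℂ M := fun k => if k then expEnd (-X) else -expEnd X with hq
  set A := (2 : ℂ)⁻¹ • (expEnd (-X) + expEnd X) with hA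
  set h : Bool → Module.End ℂ M := fun k => if k then -A else A with hh
  set E : Bool → Module.End ℂ M := fun k => if k then 1 - S else 1 + S with hE'
  have cr : ∀ {Z}, Commute Z N → ∀ k, Commute Z (r k) := fun hZ k => by
    cases k
    exacts [hZ, hZ.neg_right]
  have cq : ∀ {Z}, Commute Z X → ∀ k, Commute Z (q k) := fun hZ k => by
    cases k
    exacts [(comm hZ).2.neg_right, (comm hZ).1]
  have ch : ∀ {Z}, Commute Z X → ∀ k, Commute Z (h k) := fun hZ k => by
    have := ((comm hZ).1.add_right (comm hZ).2).smul_right (2 : ℂ)⁻¹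
    cases k
    exacts [this, this.neg_right]
  have cE : ∀ {Z}, Commute Z S → ∀ k, Commute Z (E k) := fun hZ k => by
    cases k
    exacts [(Commute.one_right _).add_right hZ, (Commute.one_right _).sub_right hZ]
  have hsj : ∀ j, direction i (σ⁻¹ j) = -direction i j := fun j => by
    rw [hσ', Equiv.swap_inv]
    by_cases h1 : j = i.castSucc
    · subst h1; simp [direction, hne]
    · by_cases h2 : j = i.succ
      · subst h2; simp [direction, hne]
      · simp [direction, h1, h2, Equiv.swap_apply_of_ne_of_ne h1 h2]
  have haj : ∀ j, P.midpoint i (σ⁻¹ j) = P.midpoint i j := fun j => by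
    rw [hσ', Equiv.swap_inv]
    by_cases h1 : j = i.castSucc
    · subst h1; simp [midpoint]
    · by_cases h2 : j = i.succ
      · subst h2; simp [midpoint]
      · rw [Equiv.swap_apply_of_ne_of_ne h1 h2]
  have key := G.prod_monodromy_eq_zero (d := d) (M := M) (σ := σ) Real.pi_pos.le
    (fun j => by rw [ha, haj]) (fun j => by rw [hs, hsj, Complex.exp_pi_mul_I, neg_one_mul])
    (a := τ) (b := τ') rfl (ι := Bool) (L := [true, false]) r q h (fun k => if k then N else -N) E
    (fun k x => (cr (hNc x).symm k).symm) (fun k x => (cq (hXc x).symm k).symm)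
    (fun k => cr (cr (Commute.refl N) k).symm) (fun k => cq (cr hNX.symm k).symm)
    (fun k => cq (cq (Commute.refl X) k).symm) (fun k => ?_) (fun k => ?_)
    (fun k => cE (cE (Commute.refl S) k).symm) (fun k => ch (cE hXS k).symm)
    (cE (hres ▸ ((hNc _).mul_left (Commute.refl S)).neg_left)) (fun k => cE (cr (hNc _).symm k).symm) ?_
  · rw [neg_smul, ← hX, hT]
    simpa [hq] using key
  · rw [hres]
    cases k
    · simp [hr, hE']; noncomm_ring
    · simp [hr, hE']; noncomm_ring
  · have hE2 : S * expEnd (-(X * S)) = (2 : ℂ)⁻¹ • (expEnd (-X) * (1 + S) - expEnd X * (1 - S)) := by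
      rw [← hE, mul_smul_comm, ← Nat.cast_smul_eq_nsmul ℂ, smul_smul]; norm_num
    rw [hSσ, hsm, hE2]
    cases k
    all_goals
      simp only [hq, hh, hE', hA, Bool.false_eq_true, if_false, if_true, smul_mul_assoc, neg_mul, mul_add,
        mul_sub, add_mul, mul_one]
      module
  · simp only [List.map_cons, List.map_nil, List.prod_cons, List.prod_nil, mul_one, hE',
      Bool.false_eq_true, if_false, if_true]
    rw [sub_mul, one_mul, mul_add, mul_one, hSS]
    abel

end RealPosition

theorem list_prod_conj {A ι : Type*} [Monoid A] {c c' : A} (h : c * c' = 1) (h' : c' * c = 1)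
    (L : List ι) (f : ι → A) : (L.map fun k => c * f k * c').prod = c * (L.map f).prod * c' := by
  induction L with
  | nil => simp [h]
  | cons k L ih =>
    rw [List.map_cons, List.prod_cons, ih, List.map_cons, List.prod_cons]
    calc _ = c * f k * (c' * c) * (L.map f).prod * c' := by simp only [mul_assoc]
      _ = _ := by rw [h', mul_one]; simp only [mul_assoc]

namespace RealPosition

variable {n m : ℕ} {d : Fin m → ℕ} {P : RealPosition n m} {k : Fin m} {η : ℝ}

theorem Small.sepFirst_sector (h : P.Small k η) (a b : ℝ) :
    P.SepFirst {w | (P.α k - η ≤ w.re ∧ w.re ≤ P.α k + η) ∧ 0 < lin a b (w - P.cα k)} := by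
  refine ⟨fun j hj => ⟨1, 0, fun w hw => ?_⟩, fun l => ?_⟩
  · have := z_zero_lt (P := P) hj
    have := h.z
    simp only [lin, Complex.sub_re, Complex.ofReal_re]
    linarith [hw.1.2]
  · rcases lt_trichotomy l k with hl | rfl | hl
    · refine ⟨1, 0, fun w hw => ?_⟩
      simp only [lin, Complex.sub_re, cα, Complex.ofReal_re]
      linarith [hw.1.1, h.lt l hl]
    · exact ⟨a, b, fun w hw => hw.2⟩
    · refine ⟨-1, 0, fun w hw => ?_⟩
      simp only [lin, Complex.sub_re, cα, Complex.ofReal_re]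
      linarith [hw.1.2, h.gt l hl]

theorem Small.bottom_mem_under_right (h : P.Small k η) :
    (⟨P.α k, -η⟩ : ℂ) ∈ P.under (P.right k) := by
  refine ⟨fun l h' => ?_, fun l h' => ?_, fun j hj => ?_⟩ <;> simp only
  · linarith [P.α_mono.monotone (not_lt_right h'), h.pos]
  · linarith [P.α_mono (right_lt_imp h'), h.pos]
  · linarith [h.z, z_zero_lt (P := P) hj, h.pos]

theorem Small.bottom_mem_under_left (h : P.Small k η) :
    (⟨P.α k, -η⟩ : ℂ) ∈ P.under (P.left k) := by
  refine ⟨fun l h' => ?_, fun l h' => ?_, fun j hj => ?_⟩ <;> simp only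
  · linarith [P.α_mono (lt_left_imp h'), h.pos]
  · linarith [P.α_mono.monotone (not_left_lt h'), h.pos]
  · linarith [h.z, z_zero_lt (P := P) hj, h.pos]

theorem Small.exists_star (h : P.Small k η) : ∃ G : Star P.cα (n + 1), G.a = P.pos (P.α k) ∧
    G.s = Pi.single 0 1 ∧ Real.log η < G.σ₀ := by
  have nrm : ∀ x y : ℝ, ‖(x : ℂ) - y‖ = |x - y| := fun x y => by
    rw [← Complex.ofReal_sub, Complex.norm_real, Real.norm_eq_abs]
  have hz : ∀ j, j ≠ 0 → η < |P.α k - P.z j| := fun j hj =>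
    lt_of_lt_of_le (by linarith [h.z, z_zero_lt (P := P) hj]) (neg_le_abs _)
  refine GDAHA.exists_star _ _ h.pos (fun i j hij => .inr ?_) fun i l => ?_
  · by_cases hi : i = 0
    · subst hi
      simpa [RealPosition.pos, hij.symm, nrm] using hz j hij.symm
    · by_cases hj : j = 0
      · subst hj
        simpa [RealPosition.pos, hij, nrm, abs_sub_comm] using hz i hij
      · simpa [RealPosition.pos, hi, hj, sub_eq_zero] using fun e => hij (P.z_mono.injective e)
  · by_cases hi : i = 0
    · subst hi
      rcases lt_trichotomy l k with hl | rfl | hl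
      · right
        simp only [RealPosition.pos, Function.update_self, Pi.single_eq_same, norm_one, one_mul, cα, nrm]
        exact lt_of_lt_of_le (by linarith [h.lt l hl]) (le_abs_self _)
      · left; simp [RealPosition.pos, cα]
      · right
        simp only [RealPosition.pos, Function.update_self, Pi.single_eq_same, norm_one, one_mul, cα, nrm]
        exact lt_of_lt_of_le (by linarith [h.gt l hl]) (neg_le_abs _)
    · right
      simpa [RealPosition.pos, hi, cα, sub_eq_zero] using (P.lt l i).ne'

theorem res_single {G : Star P.cα (n + 1)} (ha : G.a = P.pos (P.α k)) (hs : G.s = Pi.single 0 1) :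
    G.res d = B.Y d 0 k := by
  refine KZData.sum_smul_comb_single (B.data (n + 1) d) _ _ _ (fun p l => ?_) fun p q hpq => ?_
  · by_cases hp : p = 0
    · subst hp
      have : limCoeff (P.α k - P.cα l : ℂ) 1 = if l = k then 1 else 0 := by
        simp only [limCoeff, cα, sub_eq_zero, Complex.ofReal_inj, P.α_mono.injective.eq_iff, inv_one,
          eq_comm (a := l)]
      simp [ha, hs, pos, this]
    · simp [hs, hp]
  · by_cases hp : p = 0
    · subst hp
      have : (P.α k - P.z q : ℂ) ≠ 0 := by
        rw [← Complex.ofReal_sub, Complex.ofReal_ne_zero]; linarith [P.lt k q]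
      simp [ha, hs, pos, hpq.symm, limCoeff, this]
    · simp [hs, hp]

variable (M : Type*) [AddCommGroup M] [Module ℂ M]
  [Module (B (n + 1) d) M] [FiniteDimensional ℂ M] [IsScalarTower ℂ (B (n + 1) d) M]

/-- The point of the circle of radius `η` around `α_k` in the direction `θ`. -/
def onCircle (P : RealPosition n m) (k : Fin m) (η θ : ℝ) : ℂ :=
  ⟨P.α k + η * Real.cos θ, η * Real.sin θ⟩

theorem cfg_single {G : Star P.cα (n + 1)} (ha : G.a = P.pos (P.α k)) (hs : G.s = Pi.single 0 1)
    (hη : 0 < η) (θ : ℝ) : G.cfg ((Real.log η : ℝ) + θ * Complex.I) = P.pos (onCircle P k η θ) := by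
  funext j
  rw [Star.cfg, ha, hs, Complex.exp_add, ← Complex.ofReal_exp, Real.exp_log hη]
  by_cases hj : j = 0
  · subst hj
    have : (onCircle P k η θ) = P.α k + η * Complex.exp (θ * Complex.I) := by
      rw [Complex.exp_mul_I]
      apply Complex.ext <;> simp [onCircle, Complex.cos_ofReal_re, Complex.sin_ofReal_re]
    simp [pos, this]
  · simp [pos, hj]

theorem Small.trans_eq (h : P.Small k η) {G : Star P.cα (n + 1)} (ha : G.a = P.pos (P.α k))
    (hs : G.s = Pi.single 0 1) {θ θ' : ℝ} (hθ : θ ≤ θ') (hθ' : θ' ≤ θ + Real.pi / 2)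
    {a b : halfPlane G.σ₀} (hra : (a : ℂ) = (Real.log η : ℝ) + θ * Complex.I)
    (hrb : (b : ℂ) = (Real.log η : ℝ) + θ' * Complex.I) :
    G.trans d M a b = tr1 d P M (onCircle P k η θ) (onCircle P k η θ') := by
  have hη := h.pos
  have hre : ∀ x : ℝ, ((Real.log η : ℝ) + x * Complex.I : ℂ) ∈ halfPlane G.σ₀ := fun x => by
    have : (a : ℂ).re < G.σ₀ := a.2
    rw [hra] at this
    simpa using this
  let p : Path a b :=
    { toFun := fun t => ⟨(Real.log η : ℝ) + ((θ + t * (θ' - θ) : ℝ) : ℂ) * Complex.I, hre _⟩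
      continuous_toFun := by fun_prop
      source' := by apply Subtype.ext; simp [hra]
      target' := by apply Subtype.ext; simp [hrb] }
  rw [← G.kzTransport_eq_trans p (p.map G.map.continuous) fun t => rfl]
  have key : ∀ x, θ ≤ x → x ≤ θ' → onCircle P k η x ∈ {w : ℂ | (P.α k - η ≤ w.re ∧ w.re ≤ P.α k + η) ∧
      0 < lin (Real.cos ((θ + θ') / 2)) (Real.sin ((θ + θ') / 2)) (w - P.cα k)} := fun x h1 h2 => by
    have hc : 0 < Real.cos ((θ + θ') / 2 - x) := by
      have := Real.pi_pos
      exact Real.cos_pos_of_mem_Ioo ⟨by linarith, by linarith⟩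
    rw [Real.cos_sub] at hc
    refine ⟨⟨?_, ?_⟩, ?_⟩
    · simp only [onCircle]; nlinarith [Real.neg_one_le_cos x]
    · simp only [onCircle]; nlinarith [Real.cos_le_one x]
    · simp only [onCircle, lin, cα, Complex.sub_re, Complex.sub_im, Complex.ofReal_re,
        Complex.ofReal_im]
      nlinarith [mul_pos hη hc]
  refine (h.sepFirst_sector (Real.cos ((θ + θ') / 2)) (Real.sin ((θ + θ') / 2))).sep.kzTransport_eq
    (mem_image_of_mem _ (key _ le_rfl hθ)) (mem_image_of_mem _ (key _ hθ le_rfl)) ?_ ?_ fun t => ?_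
  · rw [← cfg_single ha hs hη, ← hra]; rfl
  · rw [← cfg_single ha hs hη, ← hrb]; rfl
  · refine ⟨_, mem_image_of_mem _ (key (θ + t * (θ' - θ)) ?_ ?_), ?_⟩
    · nlinarith [t.2.1]
    · nlinarith [t.2.2]
    · rw [← cfg_single ha hs hη]; rfl

theorem Small.exists_opU_eq (h : P.Small k η) {G : Star P.cα (n + 1)} (ha : G.a = P.pos (P.α k))
    (hs : G.s = Pi.single 0 1) (hσ : Real.log η < G.σ₀) :
    ∃ (a b : halfPlane G.σ₀) (C C' : Module.End ℂ M), (b : ℂ) = a + (2 * Real.pi : ℝ) * Complex.I ∧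
      C * C' = 1 ∧ C' * C = 1 ∧ opU d P M k = C * G.trans d M a b * C' ∧
      ∀ g : Module.End ℂ M, (∀ x : B (n + 1) d, Commute g (act M x)) → Commute g C := by
  have hre : ∀ x : ℝ, ((Real.log η : ℝ) + x * Complex.I : ℂ) ∈ halfPlane G.σ₀ := fun x => by
    simpa using hσ
  have hw := mem_entry (P := P) (k := k) le_rfl
  set w : ℂ := ⟨P.α k, -(P.z 0 - P.α k)⟩
  have hr : ∀ l, P.right k ≠ P.α l := (P.free_right k).1
  have hl : ∀ l, P.left k ≠ P.α l := (P.free_left k).1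
  have hπ := Real.pi_pos
  let τ : ℝ → halfPlane G.σ₀ := fun x => ⟨_, hre x⟩
  have e0 : onCircle P k η (-(Real.pi / 2)) = ⟨P.α k, -η⟩ := by simp [onCircle]
  have e1 : onCircle P k η 0 = ⟨P.α k + η, 0⟩ := by simp [onCircle]
  have e2 : onCircle P k η (Real.pi / 2) = ⟨P.α k, η⟩ := by simp [onCircle]
  have e3 : onCircle P k η Real.pi = ⟨P.α k - η, 0⟩ := by simp [onCircle, sub_eq_add_neg]
  have e4 : onCircle P k η (Real.pi + Real.pi / 2) = ⟨P.α k, -η⟩ := by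
    simp [onCircle, Real.cos_add, Real.sin_add]
  have q1 := h.trans_eq (d := d) M ha hs (θ := -(Real.pi / 2)) (θ' := 0) (by linarith) (by linarith)
    (a := τ _) (b := τ _) rfl rfl
  have q2 := h.trans_eq (d := d) M ha hs (θ := 0) (θ' := Real.pi / 2) (by linarith) (by linarith)
    (a := τ _) (b := τ _) rfl rfl
  have q3 := h.trans_eq (d := d) M ha hs (θ := Real.pi / 2) (θ' := Real.pi) (by linarith)
    (by linarith) (a := τ _) (b := τ _) rfl rfl
  have q4 := h.trans_eq (d := d) M ha hs (θ := Real.pi) (θ' := Real.pi + Real.pi / 2) (by linarith)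
    (by linarith) (a := τ _) (b := τ _) rfl rfl
  rw [e0, e1] at q1
  rw [e1, e2] at q2
  rw [e2, e3] at q3
  rw [e3, e4] at q4
  have k1 := SepFirst.tr_trans (d := d) (M := M) (sepFirst_under hr) (entry_subset_under_right k hw)
    h.bottom_mem_under_right h.right_mem_under
  have k2 := SepFirst.tr_trans (d := d) (M := M) (sepFirst_under hl) h.left_mem_under
    h.bottom_mem_under_left (entry_subset_under_left k hw)
  have c1 := SepFirst.tr_mul_tr (d := d) (M := M) (sepFirst_under hl) h.bottom_mem_under_left
    (entry_subset_under_left k hw)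
  have c1' := SepFirst.tr_mul_tr (d := d) (M := M) (sepFirst_under hl)
    (entry_subset_under_left k hw) h.bottom_mem_under_left
  have c2 := SepFirst.tr_mul_tr (d := d) (M := M) sepFirst_home z_zero_mem_home
    (entry_subset_home k hw)
  have c2' := SepFirst.tr_mul_tr (d := d) (M := M) sepFirst_home
    (entry_subset_home k hw) z_zero_mem_home
  refine ⟨τ (-(Real.pi / 2)), τ (Real.pi + Real.pi / 2), tr1 d P M w (P.z 0) * tr1 d P M ⟨P.α k, -η⟩ w,
    tr1 d P M w ⟨P.α k, -η⟩ * tr1 d P M (P.z 0) w, ?_, ?_, ?_, ?_, fun g hg => ?_⟩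
  · simp only [τ]; push_cast; ring
  · rw [mul_assoc, ← mul_assoc (tr1 d P M ⟨P.α k, -η⟩ w), c1', one_mul, c2]
  · rw [mul_assoc, ← mul_assoc (tr1 d P M (P.z 0) w), c2', one_mul, c1]
  · rw [opU_eq_kite h hw hw, ← G.trans_trans _ (τ Real.pi), ← G.trans_trans _ (τ (Real.pi / 2)) (τ Real.pi),
      ← G.trans_trans _ (τ 0) (τ (Real.pi / 2)), q1, q2, q3, q4]
    simp only [trPoly, kite, mul_one, tr1, tr] at k1 k2 ⊢
    rw [← k1, ← k2]
    simp only [mul_assoc]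
  · have ht : ∀ a b, Commute g (tr1 d P M a b) := fun a b =>
      LinearMap.ext fun v => trC_map g (fun b v => LinearMap.congr_fun (hg b).eq v) _ _ v
    exact (ht _ _).mul_right (ht _ _)

/-- The polynomial relation for `U_k`. -/
theorem prod_opU_sub (k : Fin m) : (List.ofFn fun j : Fin (d k) => opU d P M k -
    expEnd ((2 * Real.pi * Complex.I) • act M (B.gam (n + 1) d k j))).prod = 0 := by
  obtain ⟨η, h, -⟩ := exists_small (P := P) k one_pos
  obtain ⟨G, ha, hs, hσ⟩ := h.exists_star
  obtain ⟨a, b, C, C', hab, hC, hC', hU, hcomm⟩ := h.exists_opU_eq (d := d) M ha hs hσ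
  set R := act M (B.Y d (0 : Fin (n + 1)) k) with hR
  have hres : G.res d = B.Y d 0 k := res_single ha hs
  let r : Fin (d k) → Module.End ℂ M := fun j => act M (B.gam (n + 1) d k j)
  let z : ℂ := 2 * Real.pi * Complex.I
  let q : Fin (d k) → Module.End ℂ M := fun j => expEnd (z • r j)
  have hr : ∀ j x, Commute (r j) (act M x) := fun j => commute_act (B.gam_comm k j)
  have hq' : ∀ {Z}, (∀ j, Commute Z (r j)) → ∀ j, Commute Z (q j) := fun hZ j =>
    Commute.expEnd ((hZ j).smul_right z)
  have hq : ∀ j x, Commute (q j) (act M x) := fun j x => (hq' (fun j => (hr j x).symm) j).symm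
  choose f hf hf' using fun j => exists_expEnd_sub_expEnd (((hr j _).symm.smul_left z).smul_right z :
    Commute (z • R) (z • r j))
  have hRr : ∀ {Z}, Commute Z R → (∀ j, Commute Z (r j)) → ∀ j, Commute Z (R - r j) := fun h1 h2 j =>
    h1.sub_right (h2 j)
  have hE : ∀ j, Commute (R - r j) R ∧ ∀ l, Commute (R - r j) (r l) := fun j =>
    ⟨(hRr (.refl R) (fun j => (hr j _).symm) j).symm, fun l =>
      (hRr (hr l _) (fun j => hr l _) j).symm⟩
  have hz : (z : ℂ) = ((2 * Real.pi : ℝ) : ℂ) * Complex.I := by simp [z]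
  have key := G.prod_monodromy_eq_zero (d := d) (M := M) (σ := 1) Real.two_pi_pos.le
    (fun j => rfl) (fun j => by rw [← hz, Complex.exp_two_pi_mul_I, one_mul]; rfl) hab
    (L := List.finRange (d k)) r q (fun j => z • f j) 1 (fun j => R - r j) hr hq
    (fun j l => hr j _) (fun j l => (hq l _).symm) (fun j => hq' (fun l => hq j _)) (fun j => ?_) (fun j => ?_)
    (fun j => hRr (hE j).1 (hE j).2) (fun j l => (hf' l _ ((hE j).1.smul_right z)
      (((hE j).2 l).smul_right z)).smul_right z) (fun j => ?_) (fun j => hRr (hr j _) fun l => hr j _) ?_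
  · rw [List.ofFn_eq_map, hU]
    have e : ∀ j, C * G.trans d M a b * C' - q j = C * (G.trans d M a b - q j) * C' := fun j => by
      rw [mul_sub, sub_mul, ← (hcomm _ (hq j)).eq, mul_assoc (q j), hC, mul_one]
    simp only [inv_one, act_perm_one, one_mul] at key
    change ((List.finRange (d k)).map fun j => C * G.trans d M a b * C' - q j).prod = 0
    simp only [e]
    rw [list_prod_conj hC hC', key, mul_zero, zero_mul]
  · rw [hres, Pi.one_apply, one_mul]
  · rw [inv_one, act_perm_one, one_mul, hres, ← hz, hf, ← smul_sub, mul_smul_comm, smul_mul_assoc]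
  · rw [hres]; exact hRr (.refl R) (fun j => (hr j _).symm) j
  · let φ : B (n + 1) d →* Module.End ℂ M := ⟨⟨act M, act_one⟩, act_mul⟩
    have := congrArg φ (B.poly (d := d) (0 : Fin (n + 1)) k)
    rw [map_list_prod, List.map_ofFn, List.ofFn_eq_map] at this
    have e : φ 0 = 0 := LinearMap.ext fun v => zero_smul _ v
    rw [← e, ← this]
    congr 2
    funext j
    exact LinearMap.ext fun v => (sub_smul (B.Y d 0 k) (B.gam (n + 1) d k j) v).symm

end RealPosition

/-- A ring homomorphism from a free algebra, for a homomorphism of the base ring whose image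
commutes with the images of the generators. -/
theorem exists_freeAlgebra_lift {R A X : Type*} [CommRing R] [Ring A] (f : R →+* A) (g : X → A)
    (h : ∀ r x, Commute (f r) (g x)) : ∃ φ : FreeAlgebra R X →+* A,
      (∀ x, φ (FreeAlgebra.ι R x) = g x) ∧ ∀ r, φ (algebraMap R _ r) = f r := by
  let Z := Subring.centralizer (Set.range f)
  have hf : ∀ r, f r ∈ Z := fun r => Subring.mem_centralizer_iff.mpr (by
    rintro _ ⟨s, rfl⟩; rw [← map_mul, mul_comm, map_mul])
  let f' : R →+* Z := f.codRestrict Z hf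
  let _ : Algebra R Z := f'.toAlgebra' fun r z => Subtype.ext
    (Subring.mem_centralizer_iff.mp z.2 _ ⟨r, rfl⟩)
  let φ : FreeAlgebra R X →ₐ[R] Z := FreeAlgebra.lift R fun x =>
    ⟨g x, Subring.mem_centralizer_iff.mpr (by rintro _ ⟨r, rfl⟩; exact h r x)⟩
  refine ⟨Z.subtype.comp φ.toRingHom, fun x => ?_, fun r => ?_⟩
  · change ((φ (FreeAlgebra.ι R x) : Z) : A) = g x
    rw [FreeAlgebra.lift_ι_apply]
  · change ((φ (algebraMap R _ r) : Z) : A) = f r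
    rw [AlgHom.commutes]; rfl

section

variable {n m : ℕ} {d : Fin m → ℕ} (M : Type*) [AddCommGroup M] [Module ℂ M]
  [Module (B n d) M] [FiniteDimensional ℂ M] [IsScalarTower ℂ (B n d) M]
  {N : Type*} [AddCommGroup N] [Module ℂ N] [Module (B n d) N] [FiniteDimensional ℂ N]
  [IsScalarTower ℂ (B n d) N]

theorem expEnd_map {M N : Type*} [AddCommGroup M] [Module ℂ M] [FiniteDimensional ℂ M]
    [AddCommGroup N] [Module ℂ N] [FiniteDimensional ℂ N] {X : Module.End ℂ M}
    {Y : Module.End ℂ N} (g : M →ₗ[ℂ] N) (h : ∀ v, g (X v) = Y (g v)) (v : M) :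
    g (expEnd X v) = expEnd Y (g v) := by
  have hr : ∀ r : ℕ, ∀ v, g ((X ^ r) v) = (Y ^ r) (g v) := fun r => by
    induction r with
    | zero => simp
    | succ r ih => intro v; rw [pow_succ', pow_succ', Module.End.mul_apply, h, ih]; rfl
  rw [← sub_eq_zero, ← Module.forall_dual_apply_eq_zero_iff ℂ]
  intro φ
  rw [map_sub, sub_eq_zero]
  refine (hasSum_expEnd X (φ ∘ₗ g) v).unique ?_
  have := hasSum_expEnd Y φ (g v)
  simp only [← hr] at this
  exact this

theorem kzOp_map {α : Fin m → ℂ} {x : Config α n} (b : BraidGroup α x) (g : M →ₗ[ℂ] N)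
    (hg : ∀ (b : B n d) (v : M), g (b • v) = b • g v) (v : M) :
    g (kzOp d M b v) = kzOp d N b (g v) := by
  obtain ⟨σ, p, rfl⟩ := exists_braidClass b
  rw [kzOp_braidClass, kzOp_braidClass]
  change g ((B.perm d σ⁻¹ : B n d) • kzTransport d M _ v) = (B.perm d σ⁻¹ : B n d) • kzTransport d N _ (g v)
  rw [hg, kzTransport_map g hg]

/-- The constants in the exponents of the parameters of the monodromy representation. -/
def parConst : Param d → ℂ
  | none => -(Real.pi * Complex.I)
  | some _ => 2 * Real.pi * Complex.I

/-- The logarithm of the operator of a Laurent monomial in the parameters. -/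
def logPar (e : Param d →₀ ℤ) : Module.End ℂ M :=
  ∑ p, ((e p : ℂ) * parConst p) • act M (algebraMap (PolyParam d) (B n d) (MvPolynomial.X p))

theorem logPar_add (e f : Param d →₀ ℤ) :
    logPar (n := n) M (e + f) = logPar (n := n) M e + logPar (n := n) M f := by
  simp only [logPar, ← Finset.sum_add_distrib, ← add_smul, Finsupp.add_apply, Int.cast_add, add_mul]

theorem logPar_zero : logPar (n := n) M (0 : Param d →₀ ℤ) = 0 := by
  simp [logPar]

theorem logPar_single (p : Param d) (k : ℤ) : logPar (n := n) M (Finsupp.single p k) =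
    ((k : ℂ) * parConst p) • act M (algebraMap (PolyParam d) (B n d) (MvPolynomial.X p)) := by
  classical
  rw [logPar, Finset.sum_eq_single p]
  · rw [Finsupp.single_eq_same]
  · intro q _ hq
    rw [Finsupp.single_eq_of_ne hq, Int.cast_zero, zero_mul, zero_smul]
  · exact fun h => absurd (Finset.mem_univ p) h

theorem logPar_map (e : Param d →₀ ℤ) (g : M →ₗ[ℂ] N)
    (hg : ∀ (b : B n d) (v : M), g (b • v) = b • g v) (v : M) :
    g (logPar (n := n) M e v) = logPar (n := n) N e (g v) := by
  simp only [logPar, LinearMap.sum_apply, LinearMap.smul_apply, map_sum, map_smul, act_apply, hg]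

theorem logPar_commute (e f : Param d →₀ ℤ) :
    Commute (logPar (n := n) M e) (logPar (n := n) M f) :=
  Commute.sum_left _ _ _ fun _ _ => Commute.sum_right _ _ _ fun _ _ =>
    ((commute_act (Algebra.commutes _) _).smul_left _).smul_right _

variable (n d) in
/-- The action of the Laurent polynomials in the parameters of the monodromy representation. -/
def laurentRep : LaurentParam d →ₐ[ℂ] Module.End ℂ M :=
  AddMonoidAlgebra.lift ℂ (Module.End ℂ M) (Param d →₀ ℤ)
    { toFun := fun e => expEnd (logPar (n := n) M e.toAdd)
      map_one' := by rw [toAdd_one, logPar_zero, expEnd_zero]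
      map_mul' := fun e f => by
        rw [toAdd_mul, logPar_add, expEnd_add (logPar_commute M _ _)] }

theorem laurentRep_single (e : Param d →₀ ℤ) (c : ℂ) :
    laurentRep n d M (AddMonoidAlgebra.single e c) = c • expEnd (logPar (n := n) M e) :=
  AddMonoidAlgebra.lift_single _ _ _

variable {M} in
theorem laurentRep_map (x : LaurentParam d) (g : M →ₗ[ℂ] N)
    (hg : ∀ (b : B n d) (v : M), g (b • v) = b • g v) (v : M) :
    g (laurentRep n d M x v) = laurentRep n d N x (g v) := by
  induction x using AddMonoidAlgebra.induction_linear with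
  | zero => simp
  | add x y hx hy => rw [map_add, map_add, LinearMap.add_apply, map_add, hx, hy]; rfl
  | single e c =>
    rw [laurentRep_single, laurentRep_single, LinearMap.smul_apply, map_smul,
      expEnd_map g (logPar_map M e g hg)]
    rfl

theorem laurentRep_commute_act (x : LaurentParam d) (b : B n d) :
    Commute (laurentRep n d M x) (act M b) := by
  induction x using AddMonoidAlgebra.induction_linear with
  | zero => rw [map_zero]; exact Commute.zero_left _
  | add x y hx hy => rw [map_add]; exact hx.add_left hy
  | single e c =>
    rw [laurentRep_single]
    have h : ∀ p, Commute (act M b) (((e p : ℂ) * parConst p) •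
        act M (algebraMap (PolyParam d) (B n d) (MvPolynomial.X p))) := fun p =>
      (commute_act (Algebra.commutes (MvPolynomial.X p)) b).symm.smul_right _
    exact (Commute.expEnd (Commute.sum_right _ _ _ fun p _ => h p)).symm.smul_left c

theorem laurentRep_commute_kzOp {α : Fin m → ℂ} {x : Config α n} (r : LaurentParam d)
    (b : BraidGroup α x) : Commute (laurentRep n d M r) (kzOp d M b) :=
  LinearMap.ext fun v => kzOp_map M b (laurentRep n d M r)
    (fun b v => LinearMap.congr_fun (laurentRep_commute_act M r b).eq v) v

end

namespace RealPosition

variable {n m : ℕ} (d : Fin m → ℕ) (P : RealPosition n m) (M : Type*) [AddCommGroup M] [Module ℂ M]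
  [Module (B (n + 1) d) M] [FiniteDimensional ℂ M] [IsScalarTower ℂ (B (n + 1) d) M]

/-- The element of the braid group corresponding to a generator of the algebra `H_n`. -/
def braidGen : HGen n m → BraidGroup P.cα P.base
  | .U k => P.braidU k
  | .Uinv k => (P.braidU k)⁻¹
  | .T i => P.braidT i
  | .Tinv i => (P.braidT i)⁻¹

/-- The homomorphism from the free algebra given by the monodromy representation. -/
def freeRep : HFree n d →+* Module.End ℂ M :=
  (exists_freeAlgebra_lift (laurentRep (n + 1) d M : LaurentParam d →+* Module.End ℂ M)
    (fun x => kzOp d M (P.braidGen x)) fun r _ => laurentRep_commute_kzOp M r _).choose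

theorem freeRep_ι (x : HGen n m) :
    freeRep d P M (FreeAlgebra.ι _ x) = kzOp d M (P.braidGen x) :=
  (exists_freeAlgebra_lift (laurentRep (n + 1) d M : LaurentParam d →+* Module.End ℂ M)
    (fun x => kzOp d M (P.braidGen x)) fun r _ => laurentRep_commute_kzOp M r _).choose_spec.1 x

theorem freeRep_algebraMap (r : LaurentParam d) :
    freeRep d P M (algebraMap _ _ r) = laurentRep (n + 1) d M r :=
  (exists_freeAlgebra_lift (laurentRep (n + 1) d M : LaurentParam d →+* Module.End ℂ M)
    (fun x => kzOp d M (P.braidGen x)) fun r _ => laurentRep_commute_kzOp M r _).choose_spec.2 r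

theorem freeRep_U (k : Fin m) : freeRep d P M (HFree.U n d k) = opU d P M k := freeRep_ι d P M _

theorem freeRep_T (i : Fin n) : freeRep d P M (HFree.T d i) = opT d P i M := freeRep_ι d P M _

theorem freeRep_par (p : Param d) (k : ℤ) : freeRep d P M (HFree.par n d p k) =
    expEnd (((k : ℂ) * parConst p) • act M (algebraMap (PolyParam d) (B (n + 1) d) (MvPolynomial.X p))) := by
  rw [HFree.par, freeRep_algebraMap, laurentRep_single, one_smul, logPar_single]

theorem kzOp_mul_inv (b : BraidGroup P.cα P.base) : kzOp d M b * kzOp d M b⁻¹ = 1 := by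
  rw [← kzOp_mul, mul_inv_cancel, kzOp_one]

theorem kzOp_inv_mul (b : BraidGroup P.cα P.base) : kzOp d M b⁻¹ * kzOp d M b = 1 := by
  rw [← kzOp_mul, inv_mul_cancel, kzOp_one]

theorem freeRep_Tinv (i : Fin n) :
    freeRep d P M (HFree.T d i) * freeRep d P M (HFree.Tinv d i) = 1 ∧
    freeRep d P M (HFree.Tinv d i) * freeRep d P M (HFree.T d i) = 1 := by
  have h : freeRep d P M (HFree.Tinv d i) = kzOp d M (P.braidT i)⁻¹ := freeRep_ι d P M _
  rw [freeRep_T, h]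
  exact ⟨kzOp_mul_inv d P M _, kzOp_inv_mul d P M _⟩

theorem freeRep_rel ⦃x y : HFree n d⦄ (h : HRel n d x y) : freeRep d P M x = freeRep d P M y := by
  induction h with
  | U_mul_inv k =>
    rw [map_mul, map_one]
    exact (congrArg₂ _ (freeRep_ι d P M _) (freeRep_ι d P M _)).trans (kzOp_mul_inv d P M _)
  | U_inv_mul k =>
    rw [map_mul, map_one]
    exact (congrArg₂ _ (freeRep_ι d P M _) (freeRep_ι d P M _)).trans (kzOp_inv_mul d P M _)
  | T_mul_inv i => rw [map_mul, map_one]; exact (freeRep_Tinv d P M i).1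
  | T_inv_mul i => rw [map_mul, map_one]; exact (freeRep_Tinv d P M i).2
  | total =>
    have e1 : (freeRep d P M ∘ fun k => HFree.U n d k) = fun k => opU d P M k := funext (freeRep_U d P M)
    have e2 : (freeRep d P M ∘ fun i => HFree.T d i) = fun i => opT d P i M := funext (freeRep_T d P M)
    simp only [map_mul, map_one, map_list_prod, List.map_reverse, List.map_ofFn]
    rw [e1, e2]
    exact prod_opU_mul_prod_opT
  | braid i j hij => simp only [map_mul, freeRep_T]; exact opT_braid P i M j hij
  | comm_T i j hij => simp only [map_mul, freeRep_T]; exact opT_comm P i M j hij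
  | comm_U_T k i hi => simp only [map_mul, freeRep_T, freeRep_U]; exact opU_comm_opT (d := d) (P := P) M k i hi
  | comm_U_TUT k i hi =>
    simp only [map_mul, freeRep_T, freeRep_U]; exact opU_comm_opT_opU_opT (d := d) (P := P) (M := M) hi k
  | comm_U_TinvUT k j i hi hkj =>
    obtain ⟨X, h1, h2⟩ := opU_comm_conj (d := d) (P := P) (M := M) hi hkj
    obtain ⟨-, h4⟩ := freeRep_Tinv d P M i
    have : freeRep d P M (HFree.Tinv d i * HFree.U n d j * HFree.T d i) = X := by
      rw [map_mul, map_mul, mul_assoc, freeRep_U, freeRep_T, ← h1, ← mul_assoc, ← freeRep_T, h4, one_mul]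
    rw [map_mul, map_mul _ _ (HFree.U n d k), this, freeRep_U, h2]
  | poly k =>
    rw [map_list_prod, List.map_ofFn, map_zero, ← prod_opU_sub (d := d) (P := P) M k]
    congr 2
    funext j
    rw [Function.comp_apply, map_sub, freeRep_U, freeRep_par, Int.cast_one, one_mul]
    rfl
  | hecke i =>
    obtain ⟨h1, h2⟩ := freeRep_Tinv d P M i
    have h := P.opT_hecke (d := d) i M
    rw [← freeRep_T] at h
    set T := freeRep d P M (HFree.T d i)
    set T' := freeRep d P M (HFree.Tinv d i)
    set N := act (n := n + 1) (d := d) M (B.nu (n + 1) d) with hN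
    have e1 : freeRep d P M (HFree.par n d none 1) = expEnd (-(Real.pi * Complex.I) • N) := by
      rw [freeRep_par, Int.cast_one, one_mul]; rfl
    have e2 : freeRep d P M (HFree.par n d none (-1)) = expEnd ((Real.pi * Complex.I) • N) := by
      rw [freeRep_par, Int.cast_neg, Int.cast_one, neg_one_mul, parConst, neg_neg]; rfl
    have hc : Commute ((-(Real.pi * Complex.I)) • N) ((Real.pi * Complex.I) • N) :=
      ((Commute.refl N).smul_left _).smul_right _
    have e3 : expEnd (-(Real.pi * Complex.I) • N) * expEnd ((Real.pi * Complex.I) • N) = 1 := by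
      rw [← expEnd_add hc, neg_smul, neg_add_cancel, expEnd_zero]
    rw [map_sub, map_sub, e1, e2]
    have hTc : T * expEnd ((Real.pi * Complex.I) • N) = expEnd ((Real.pi * Complex.I) • N) * T := by
      rw [← e2]
      simp only [T]
      rw [← map_mul, ← map_mul, HFree.par, Algebra.commutes]
    set t := expEnd (-(Real.pi * Complex.I) • N)
    set t' := expEnd ((Real.pi * Complex.I) • N)
    have h3 : (T - t) * (T + t') * T' = (T * (T * T')) + t' * (T * T') - t * (T * T') - (t * t') * T' +
        (T * t' - t' * T) * T' := by noncomm_ring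
    rw [h, zero_mul, h1, e3, hTc, sub_self, zero_mul, add_zero, mul_one, mul_one, mul_one, one_mul] at h3
    rw [← sub_eq_zero, h3]
    abel

/-- The homomorphism from the algebra `H_n` given by the monodromy representation. -/
def heckeRep : H n d →+* Module.End ℂ M := RingQuot.lift ⟨freeRep d P M, freeRep_rel d P M⟩

theorem heckeRep_proj (x : HFree n d) : heckeRep d P M (H.proj n d x) = freeRep d P M x := by
  rw [heckeRep, H.proj, ← RingQuot.lift_mkRingHom_apply (freeRep d P M) (freeRep_rel d P M) x,
    ← RingQuot.mkAlgHom_coe (LaurentParam d)]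
  rfl

theorem heckeRep_algebraMap (c : ℂ) : heckeRep d P M (algebraMap ℂ (H n d) c) = c • 1 := by
  have e : algebraMap ℂ (H n d) c = H.proj n d (algebraMap (LaurentParam d) _ (algebraMap ℂ _ c)) := by
    rw [AlgHom.commutes]; rfl
  rw [e, heckeRep_proj, freeRep_algebraMap, AlgHom.commutes, Algebra.algebraMap_eq_smul_one]

variable {M} in
theorem heckeRep_map {N : Type*} [AddCommGroup N] [Module ℂ N] [Module (B (n + 1) d) N]
    [FiniteDimensional ℂ N] [IsScalarTower ℂ (B (n + 1) d) N] (h : H n d) (g : M →ₗ[ℂ] N)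
    (hg : ∀ (b : B (n + 1) d) (v : M), g (b • v) = b • g v) (v : M) :
    g (heckeRep d P M h v) = heckeRep d P N h (g v) := by
  obtain ⟨x, rfl⟩ : ∃ x, H.proj n d x = h := RingQuot.mkAlgHom_surjective _ _ h
  rw [heckeRep_proj, heckeRep_proj]
  induction x using FreeAlgebra.induction generalizing v with
  | grade0 r => rw [freeRep_algebraMap, freeRep_algebraMap, laurentRep_map r g hg]
  | grade1 x => rw [freeRep_ι, freeRep_ι, kzOp_map M _ g hg]
  | mul x y hx hy => rw [map_mul, map_mul, Module.End.mul_apply, hx, hy]; rfl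
  | add x y hx hy => rw [map_add, map_add, LinearMap.add_apply, map_add, hx, hy]; rfl

end RealPosition

theorem isExpSMul_expEnd {n m : ℕ} {d : Fin m → ℕ} {M : Type*} [AddCommGroup M] [Module ℂ M]
    [Module (B n d) M] [FiniteDimensional ℂ M] [IsScalarTower ℂ (B n d) M] (c : ℂ) (b : B n d) (v : M) :
    IsExpSMul c b v (expEnd (c • act M b) v) := fun φ => by
  have e : ∀ r : ℕ, ((c • act M b) ^ r) v = c ^ r • b ^ r • v := fun r => by
    let ψ : B n d →* Module.End ℂ M := ⟨⟨act M, act_one⟩, act_mul⟩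
    have : act M b ^ r = act M (b ^ r) := (map_pow ψ b r).symm
    rw [smul_pow, this]; rfl
  have := hasSum_expEnd (c • act M b) φ v
  simp only [e, map_smul, smul_eq_mul, ← mul_assoc] at this
  exact this

namespace RealPosition

open CategoryTheory

variable {n m : ℕ} (d : Fin m → ℕ) (P : RealPosition n m)

instance (M : RepF.{w} (B (n + 1) d)) : FiniteDimensional ℂ M.obj := M.property

/-- The module over the algebra `H_n` given by the monodromy representation. -/
def monodromyModule (M : RepF.{w} (B (n + 1) d)) : ModuleCat.{w} (H n d) :=
  @ModuleCat.of (H n d) _ M.obj _ (Module.compHom M.obj (heckeRep d P M.obj))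

/-- The underlying vector space of the monodromy representation. -/
def monodromyEquiv (M : RepF.{w} (B (n + 1) d)) : M.obj ≃ₗ[ℂ] monodromyModule d P M where
  toFun v := v
  invFun v := v
  left_inv _ := rfl
  right_inv _ := rfl
  map_add' _ _ := rfl
  map_smul' c v := by
    change c • v = heckeRep d P M.obj (algebraMap ℂ (H n d) c) v
    rw [heckeRep_algebraMap]
    rfl

theorem smul_monodromyEquiv (M : RepF.{w} (B (n + 1) d)) (h : H n d) (v : M.obj) :
    h • monodromyEquiv d P M v = monodromyEquiv d P M (heckeRep d P M.obj h v) := rfl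

/-- The map between monodromy representations given by a homomorphism of modules. -/
def monodromyMap {M N : RepF.{w} (B (n + 1) d)} (g : M ⟶ N) :
    monodromyModule d P M ⟶ monodromyModule d P N := @ModuleCat.ofHom (H n d) _ (monodromyModule d P M)
    (monodromyModule d P N) _ (monodromyModule d P M).isModule _ (monodromyModule d P N).isModule
  { toFun := fun v => monodromyEquiv d P N (g.hom ((monodromyEquiv d P M).symm v))
    map_add' := fun v w => by rw [map_add, map_add, map_add]
    map_smul' := fun h v => by
      let g' : M.obj →ₗ[ℂ] N.obj :=
        { toFun := g.hom
          map_add' := map_add g.hom.hom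
          map_smul' := fun c v => (g.hom.hom.map_smul (algebraMap ℂ (B (n + 1) d) c) v :) }
      exact heckeRep_map d P h g' (fun b v => g.hom.hom.map_smul b v) v }

/-- The functor given by the monodromy representations. -/
def monodromyFunctor : RepF.{w} (B (n + 1) d) ⥤ RepF.{w} (H n d) where
  obj M := ⟨monodromyModule d P M, Module.Finite.equiv (monodromyEquiv d P M)⟩
  map g := ObjectProperty.homMk (monodromyMap d P g)
  map_id _ := rfl
  map_comp _ _ := rfl

theorem exists_monodromyFunctor : ∃ (F : Functor (RepF.{w} (B (n + 1) d)) (RepF.{w} (H n d)))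
    (e : ∀ M : RepF.{w} (B (n + 1) d), M.obj ≃ₗ[ℂ] (F.obj M).obj),
    (∀ (M N : RepF.{w} (B (n + 1) d)) (g : M ⟶ N) (v : M.obj),
      (F.map g).hom (e M v) = e N (g.hom v)) ∧
    ∀ M : RepF.{w} (B (n + 1) d),
      (∀ (k : Fin m) (j : Fin (d k)) (v : M.obj),
        IsExpSMul (2 * Real.pi * Complex.I) (B.gam (n + 1) d k j) v
          ((e M).symm (H.u n d k j • e M v))) ∧
      (∀ v : M.obj, IsExpSMul (-(Real.pi * Complex.I)) (B.nu (n + 1) d) v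
        ((e M).symm (H.t n d • e M v))) ∧
      ∃ ρ : BraidGroup P.cα P.base →* (M.obj ≃ₗ[ℂ] M.obj), IsKZMonodromy d P.base ρ ∧
        (∀ (i : Fin n) (v : M.obj), H.T d i • e M v = e M (ρ (P.braidT i) v)) ∧
        (∀ (k : Fin m) (v : M.obj), H.U n d k • e M v = e M (ρ (P.braidU k) v)) := by
  have hpar : ∀ (M : RepF.{w} (B (n + 1) d)) (p : Param d) (v : M.obj),
      IsExpSMul (parConst p) (algebraMap (PolyParam d) (B (n + 1) d) (MvPolynomial.X p)) v
        (heckeRep d P M.obj (H.proj n d (HFree.par n d p 1)) v) := fun M p v => by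
    rw [heckeRep_proj, freeRep_par, Int.cast_one, one_mul]
    exact isExpSMul_expEnd _ _ v
  refine ⟨monodromyFunctor d P, monodromyEquiv d P, fun M N g v => rfl, fun M =>
    ⟨fun k j v => hpar M (some ⟨k, j⟩) v, fun v => hpar M none v, kzMonodromy d M.obj P.base,
      isKZMonodromy_kzMonodromy _ _, fun i v => ?_, fun k v => ?_⟩⟩
  · refine (smul_monodromyEquiv d P M _ v).trans ?_
    rw [H.T, heckeRep_proj, freeRep_T]
    rfl
  · refine (smul_monodromyEquiv d P M _ v).trans ?_
    rw [H.U, heckeRep_proj, freeRep_U]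
    rfl

end RealPosition

end GDAHA

end

theorem mainTheorem6 (n m : ℕ) (d : Fin m → ℕ) :
    -- the connection extends to the configurations on the sphere and is flat
    (∀ α : Fin m → ℂ, Function.Injective α →
      GDAHA.KZExtends d α (n + 1) ∧ GDAHA.KZFlat d α (n + 1)) ∧
    -- the monodromy representation of the braid group on a finite dimensional module
    (∀ α : Fin m → ℂ, Function.Injective α → ∀ (x : GDAHA.Config α (n + 1))
      (M : Type w) [AddCommGroup M] [Module ℂ M] [Module (GDAHA.B (n + 1) d) M]
      [IsScalarTower ℂ (GDAHA.B (n + 1) d) M] [FiniteDimensional ℂ M],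
      (∀ (y : GDAHA.Config α (n + 1)) (p : Path x y) (v : M),
        ∃! f : unitInterval → M, GDAHA.IsKZContinuation d p f ∧ f 0 = v) ∧
      ∃! ρ : GDAHA.BraidGroup α x →* (M ≃ₗ[ℂ] M), GDAHA.IsKZMonodromy d x ρ) ∧
    -- the monodromy functor
    (∀ P : GDAHA.RealPosition n m,
      ∃ (F : CategoryTheory.Functor (GDAHA.RepF.{w} (GDAHA.B (n + 1) d))
          (GDAHA.RepF.{w} (GDAHA.H n d)))
        (e : ∀ M : GDAHA.RepF.{w} (GDAHA.B (n + 1) d), M.obj ≃ₗ[ℂ] (F.obj M).obj),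
        (∀ (M N : GDAHA.RepF.{w} (GDAHA.B (n + 1) d)) (g : M ⟶ N) (v : M.obj),
          (F.map g).hom (e M v) = e N (g.hom v)) ∧
        ∀ M : GDAHA.RepF.{w} (GDAHA.B (n + 1) d),
          (∀ (k : Fin m) (j : Fin (d k)) (v : M.obj),
            GDAHA.IsExpSMul (2 * Real.pi * Complex.I) (GDAHA.B.gam (n + 1) d k j) v
              ((e M).symm (GDAHA.H.u n d k j • e M v))) ∧
          (∀ v : M.obj,
            GDAHA.IsExpSMul (-(Real.pi * Complex.I)) (GDAHA.B.nu (n + 1) d) v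
              ((e M).symm (GDAHA.H.t n d • e M v))) ∧
          ∃ ρ : GDAHA.BraidGroup P.cα P.base →* (M.obj ≃ₗ[ℂ] M.obj),
            GDAHA.IsKZMonodromy d P.base ρ ∧
            (∀ (i : Fin n) (v : M.obj), GDAHA.H.T d i • e M v = e M (ρ (P.braidT i) v)) ∧
            (∀ (k : Fin m) (v : M.obj),
              GDAHA.H.U n d k • e M v = e M (ρ (P.braidU k) v))) := by
  exact ⟨fun α _ => ⟨GDAHA.kzExtends d α (n + 1), GDAHA.kzFlat d α (n + 1)⟩,
    fun α _ x M _ _ _ _ _ => ⟨fun y p v => GDAHA.existsUnique_isKZContinuation p v,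
      GDAHA.existsUnique_isKZMonodromy M x⟩,
    fun P => GDAHA.RealPosition.exists_monodromyFunctor d P⟩
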